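/- **Setting.** A *maximal common subsequence* (MCS) of two strings $X, Y$ is a common subsequence of $X$ and $Y$ in which inserting any character at any position no longer yields a common subsequence. Computations are on a unit-cost RAM with finitely many registers and arrays of natural numbers. An algorithm is an $(f_p(n), f_s(n), f_d(n))$-*algorithm for MCS enumeration* if, for all $n \ge 2$, $\sigma$ and all strings $X, Y$ of length $O(n)$ over $\{1,\dots,\sigma\}$, it performs an $O(f_p(n))$-time preprocessing, uses $O(f_s(n))$ space in total (numbers occurring being of size $O(n+\sigma)$), and then outputs all MCSs of $X$ and $Y$, each exactly once, such that the time before the first output, between consecutive outputs, and from the last output to termination is $O(f_d(n))$. The implied constants depend only on the constant in the length bound. **Algorithm Enum211.** The input is first put into normal form: a new least character $1$ is prepended to both strings, a new greatest character is appended to both, and the other characters are renumbered by numbers in between, all of them at most $|X|+|Y|-2$ for the resulting strings $X,Y$. A *match* is a pair $(i,j)$ with $X[i]=Y[j]$; write $u<v$ (resp. $u\le v$) if this holds in both coordinates, $u \lneq v$ if $u\le v$ and $u\ne v$, and $u\prec v$ if $u<v$ and no match $w$ has $u<w<v$. For a common subsequence $Z$, $\mathrm{pref}(Z)$ (resp.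 $\mathrm{suff}(Z)$) is the match $(i,j)$ such that $X[1:i]$ and $Y[1:j]$ are the shortest prefixes (resp. $X[i:|X|]$ and $Y[j:|Y|]$ the shortest suffixes) containing $Z$; a match of the form $\mathrm{suff}(Z)$ is a *suff-match*. For a prefix $Z'$ of an MCS, $\mathrm{safe}(Z')=(i,j)$, where $i$ (resp. $j$) is the least index such that $\mathrm{pref}(Z^*)=(i,j_{\mathrm{pref}(Z')})$ (resp. $(i_{\mathrm{pref}(Z')},j)$) for some common subsequence $Z^*$ obtained by inserting one character into $Z'$, and is $|X|+1$ (resp. $|Y|+1$) if there is none. A *witness* is a suff-match $v$ with $\mathrm{pref}(Z')\prec v\le \mathrm{safe}(Z')$; it is *prominent* if no witness $v'$ has $v'\lneq v$; $\mathrm{ext}(Z')$ is the sequence of all prominent witnesses. - *Preprocessing.* For each character $c$ and each string store the ascending list of its occurrences. Give each match $w$ of $c$ the coordinates $(\hat\imath_w,\hat\jmath_w)$, the numbers of occurrences of $c$ up to $w$ in $X$ and in $Y$. For each $c$ and each diagonal $\hat d=\hat\jmath-\hat\imath$ store both coordinates of the last suff-match of $c$ on that diagonal, i.e. the one with the greatest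 $\hat\imath+\hat\jmath$ ($(\max(0,-\hat d),\max(0,\hat d))$ if there is none); these are computed by enumerating all suff-matches row by row, keeping only the current row. Build range maximum query structures (linear space, constant query time) for these two threshold arrays. - *Enumeration.* Start with the string $Z'=1$ and repeat until $Z'$ is empty: if $Z'$ does not end with the greatest character, compute $\mathrm{ext}(Z')$ and append the least character of its elements; otherwise output $Z'$ (without its first and last characters, in the original characters), delete its last character as long as no greater alternative to it is left, and, if $Z'$ is not yet empty, replace its last character by the least greater alternative, where the alternatives are the characters of the matches in $\mathrm{ext}$ of $Z'$ without its last character; these are kept on a stack. For each nonempty prefix of $Z'$, $\mathrm{pref}$ and $\mathrm{safe}$ are maintained, using binary search in the occurrence lists. To compute $\mathrm{ext}(Z')$, list the matches $(i,j)=\mathrm{pref}(Z'c)$ with $\mathrm{pref}(Z')\prec (i,j)$, generating the list from both ends until they meet; for each of them, look for the suff-match of $c$ with the same $i$ and least $j'\ge j$, and for the one with the same $j$ and least $i'\ge i$, in the range allowed by $\mathrm{safe}(Z')$, by a range maximum query on the thresholds followed by a binary search; keep it if it is $\le\mathrm{safe}(Z')$ and neither neighbour of $(i,j)$ in the list is smaller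 than it in both coordinates. **Theorem.** Algorithm Enum211 is an $(n^2, n, n\log n)$-algorithm for MCS enumeration: it enumerates all MCSs of $X$ and $Y$, each exactly once, with $O(n^2)$-time preprocessing, $O(n)$ space and $O(n\log n)$ delay. -/

import Mathlib

/-! ### Maximal common subsequences -/

/-- `Z` is a common subsequence of `X` and `Y`. -/
def IsCommonSubseq {α : Type*} (X Y Z : List α) : Prop :=
  Z.Sublist X ∧ Z.Sublist Y

/-- `Z` is a maximal common subsequence of `X` and `Y`: a common subsequence such that inserting
any character at any position no longer yields a common subsequence. -/
def IsMCS {α : Type*} (X Y Z : List α) : Prop :=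
  IsCommonSubseq X Y Z ∧
    ∀ (Z₁ Z₂ : List α) (c : α), Z = Z₁ ++ Z₂ → ¬ IsCommonSubseq X Y (Z₁ ++ c :: Z₂)

/-! ### A unit-cost random access machine

Programs are structured programs over finitely many registers (type `R`) and finitely many
one-dimensional arrays (type `A`) of natural numbers. Every operation, memory access and test
costs one time unit. The state records the time used so far, for every array the extent of the
part of it written so far, the largest number that ever occurred (so that the word length can be
bounded), and the write-only output. -/

/-- Arithmetic expressions; `sub` is truncated subtraction, `div` is integer division. -/
inductive Exp (R A : Type) : Type
  | lit (k : ℕ)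
  | var (x : R)
  | get (a : A) (e : Exp R A)
  | add (e f : Exp R A)
  | sub (e f : Exp R A)
  | mul (e f : Exp R A)
  | div (e f : Exp R A)

/-- Tests. -/
inductive Cond (R A : Type) : Type
  | le (e f : Exp R A)
  | lt (e f : Exp R A)
  | eq (e f : Exp R A)
  | ne (e f : Exp R A)
  | and (b c : Cond R A)

/-- Statements. `emit e` appends the value of `e` to the string that is currently being output;
`finish` completes the output of this string. -/
inductive Stmt (R A : Type) : Type
  | skip
  | assign (x : R) (e : Exp R A)
  | store (a : A) (i e : Exp R A)
  | seq (p q : Stmt R A)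
  | ite (c : Cond R A) (p q : Stmt R A)
  | loop (c : Cond R A) (p : Stmt R A)
  | emit (e : Exp R A)
  | finish

/-- Machine states. -/
structure MState (R A : Type) : Type where
  /-- the contents of the registers -/
  reg : R → ℕ
  /-- the contents of the arrays -/
  mem : A → ℕ → ℕ
  /-- one plus the greatest index of a cell that holds input or has been written to, for each
  array (cells beyond it are still zero) -/
  extent : A → ℕ
  /-- the number of time units used so far -/
  time : ℕ
  /-- the largest number that has occurred in the computation so far -/
  word : ℕ
  /-- the string currently being output -/
  cur : List ℕ
  /-- the strings output so far, in this order, each with the time of its completion -/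
  out : List (List ℕ × ℕ)

namespace Exp

variable {R A : Type}

/-- The value of an expression. -/
def val (s : MState R A) : Exp R A → ℕ
  | lit k => k
  | var x => s.reg x
  | get a e => s.mem a (e.val s)
  | add e f => e.val s + f.val s
  | sub e f => e.val s - f.val s
  | mul e f => e.val s * f.val s
  | div e f => e.val s / f.val s

/-- The time to evaluate an expression: one unit for each of its nodes. -/
def cost : Exp R A → ℕ
  | lit _ => 1
  | var _ => 1
  | get _ e => e.cost + 1
  | add e f => e.cost + f.cost + 1
  | sub e f => e.cost + f.cost + 1
  | mul e f => e.cost + f.cost + 1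
  | div e f => e.cost + f.cost + 1

/-- The largest number that occurs in the evaluation of an expression. -/
def peak (s : MState R A) : Exp R A → ℕ
  | lit k => k
  | var x => s.reg x
  | get a e => max (e.peak s) (s.mem a (e.val s))
  | add e f => max (max (e.peak s) (f.peak s)) (e.val s + f.val s)
  | sub e f => max (e.peak s) (f.peak s)
  | mul e f => max (max (e.peak s) (f.peak s)) (e.val s * f.val s)
  | div e f => max (e.peak s) (f.peak s)

end Exp

namespace Cond

variable {R A : Type}

/-- The truth value of a test. -/
def holds (s : MState R A) : Cond R A → Prop
  | le e f => e.val s ≤ f.val s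
  | lt e f => e.val s < f.val s
  | eq e f => e.val s = f.val s
  | ne e f => e.val s ≠ f.val s
  | and b c => b.holds s ∧ c.holds s

/-- The time to evaluate a test. -/
def cost : Cond R A → ℕ
  | le e f => e.cost + f.cost + 1
  | lt e f => e.cost + f.cost + 1
  | eq e f => e.cost + f.cost + 1
  | ne e f => e.cost + f.cost + 1
  | and b c => b.cost + c.cost + 1

/-- The largest number that occurs in the evaluation of a test. -/
def peak (s : MState R A) : Cond R A → ℕ
  | le e f => max (e.peak s) (f.peak s)
  | lt e f => max (e.peak s) (f.peak s)
  | eq e f => max (e.peak s) (f.peak s)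
  | ne e f => max (e.peak s) (f.peak s)
  | and b c => max (b.peak s) (c.peak s)

end Cond

/-- Account for `t` time units spent on numbers up to `p`. -/
def MState.charge {R A : Type} (s : MState R A) (t p : ℕ) : MState R A :=
  { s with time := s.time + t, word := max s.word p }

/-- `Exec p s s'`: the statement `p`, started in state `s`, terminates in state `s'`. -/
inductive Exec {R A : Type} [DecidableEq R] [DecidableEq A] :
    Stmt R A → MState R A → MState R A → Prop
  | skip (s : MState R A) : Exec .skip s s
  | assign (x : R) (e : Exp R A) (s : MState R A) :
      Exec (.assign x e) s
        { s.charge (e.cost + 1) (e.peak s) with reg := Function.update s.reg x (e.val s) }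
  | store (a : A) (i e : Exp R A) (s : MState R A) :
      Exec (.store a i e) s
        { s.charge (i.cost + e.cost + 1) (max (i.peak s) (e.peak s)) with
          mem := Function.update s.mem a (Function.update (s.mem a) (i.val s) (e.val s))
          extent := Function.update s.extent a (max (s.extent a) (i.val s + 1)) }
  | seq {p q : Stmt R A} {s t u : MState R A} :
      Exec p s t → Exec q t u → Exec (.seq p q) s u
  | ite_true {c : Cond R A} {p q : Stmt R A} {s t : MState R A} :
      c.holds s → Exec p (s.charge (c.cost + 1) (c.peak s)) t → Exec (.ite c p q) s t
  | ite_false {c : Cond R A} {p q : Stmt R A} {s t : MState R A} :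
      ¬ c.holds s → Exec q (s.charge (c.cost + 1) (c.peak s)) t → Exec (.ite c p q) s t
  | loop_true {c : Cond R A} {p : Stmt R A} {s t u : MState R A} :
      c.holds s → Exec p (s.charge (c.cost + 1) (c.peak s)) t → Exec (.loop c p) t u →
        Exec (.loop c p) s u
  | loop_false {c : Cond R A} {p : Stmt R A} {s : MState R A} :
      ¬ c.holds s → Exec (.loop c p) s (s.charge (c.cost + 1) (c.peak s))
  | emit (e : Exp R A) (s : MState R A) :
      Exec (.emit e) s
        { s.charge (e.cost + 1) (e.peak s) with cur := s.cur ++ [e.val s] }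
  | finish (s : MState R A) :
      Exec .finish s
        { s.charge 1 0 with cur := [], out := s.out ++ [(s.cur, s.time + 1)] }

/-- The space used up to a state: the number of registers plus the total extent of all arrays. -/
def MState.space {R A : Type} [Fintype R] [Fintype A] (s : MState R A) : ℕ :=
  Fintype.card R + ∑ a, s.extent a

/-- An enumeration algorithm whose input is a pair of strings: it consists of a preprocessing
part and an enumeration part, and finds the two strings and their lengths in designated arrays
and registers. -/
structure EnumAlgorithm (R A : Type) : Type where
  /-- the arrays that hold the input strings -/
  inX : A
  inY : A
  /-- the registers that hold their lengths -/
  lenX : R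
  lenY : R
  /-- the preprocessing part -/
  pre : Stmt R A
  /-- the enumeration part -/
  main : Stmt R A

/-- The initial state on input `X`, `Y`: the elements of `X` are in the cells `1, ..., |X|` of the
first input array, likewise for `Y`, the lengths are in the designated registers, and everything
else is zero. -/
def EnumAlgorithm.init {R A : Type} [DecidableEq R] [DecidableEq A] (P : EnumAlgorithm R A)
    (X Y : List ℕ) : MState R A where
  reg := fun x => if x = P.lenX then X.length else if x = P.lenY then Y.length else 0
  mem := fun a k => if a = P.inX then (0 :: X).getD k 0 else
    if a = P.inY then (0 :: Y).getD k 0 else 0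
  extent := fun a => if a = P.inX then X.length + 1 else if a = P.inY then Y.length + 1 else 0
  time := 0
  word := 0
  cur := []
  out := []

/-- `P` is an `(fp, fs, fd)`-algorithm that solves the MCS enumeration problem: for strings
`X`, `Y` of length `O(n)` over the alphabet `{1, ..., σ}`, it performs an `O(fp n σ)`-time
preprocessing, uses `O(fs n σ)` space in total (on a machine whose words hold numbers of size
`O(n + σ)`), and then outputs the MCSs of `X` and `Y`, each exactly once, where the time before
the first output, between consecutive outputs, and from the last output to termination is
`O(fd n σ)`. The implied constants depend only on the constant in the length bound. -/
def EnumAlgorithm.SolvesMCSEnumeration {R A : Type} [DecidableEq R] [DecidableEq A] [Fintype R]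
    [Fintype A] (P : EnumAlgorithm R A) (fp fs fd : ℕ → ℕ → ℝ) : Prop :=
  ∀ K : ℕ, ∃ C : ℕ, ∀ n σ : ℕ, 2 ≤ n → ∀ X Y : List ℕ,
    X.length ≤ K * n → Y.length ≤ K * n → (∀ c ∈ X ++ Y, 1 ≤ c ∧ c ≤ σ) →
      ∃ s t : MState R A,
        Exec P.pre (P.init X Y) s ∧ s.cur = [] ∧ s.out = [] ∧ (s.time : ℝ) ≤ C * fp n σ ∧
        Exec P.main s t ∧
        (t.out.map Prod.fst).Nodup ∧
        (∀ Z : List ℕ, Z ∈ t.out.map Prod.fst ↔ IsMCS X Y Z) ∧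
        (s.time :: (t.out.map Prod.snd ++ [t.time])).IsChain
          (fun u v : ℕ => (v : ℝ) ≤ u + C * fd n σ) ∧
        (t.space : ℝ) ≤ C * fs n σ ∧
        t.word ≤ C * (n + σ)

/-! ### Algorithm Enum211 -/

namespace Enum211

/-- The two strings. -/
inductive Side : Type
  | x
  | y
  deriving DecidableEq

instance : Fintype Side := ⟨{.x, .y}, fun s => by cases s <;> simp⟩

/-- The other string. -/
def Side.other : Side → Side
  | .x => .y
  | .y => .x

/-- The registers of the algorithm. -/
inductive Reg : Type
  | rawLen (s : Side)
  | len (s : Side)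
  | m (s : Side)
  | sigma | size | width | blocks
  | i | j | k | r | c | p | q | iNext | jPrev
  | lo | hi | mid | rk | nx
  | lv | bs | pos | best | bl | br | ql | qr
  | np | nq | nz | top | nExt | last | f | found | w | sf
  deriving DecidableEq, Fintype

/-- The arrays of the algorithm. -/
inductive Arr : Type
  /-- the input strings -/
  | raw (s : Side)
  /-- the input strings `X`, `Y` in the normal form described at `normalize` -/
  | str (s : Side)
  /-- `dec[c]` is the input character that is represented by `c` -/
  | dec
  /-- `cnt s [c]` is the number of occurrences of `c` -/
  | cnt (s : Side)
  /-- `occ s [start s [c] + 1], ..., occ s [start s [c] + cnt s [c]]` are the indices at which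
  `c` occurs, in ascending order -/
  | start (s : Side)
  | occ (s : Side)
  /-- `rank s [h]` is the number of indices up to `h` with the same character as `h` -/
  | rank (s : Side)
  /-- the thresholds: for a character `c` and a character-wise diagonal coordinate `d`, the entry
  `start x [c] + start y [c] + d + cnt x [c]` of `th x` and of `th y` is the character-wise
  `i`- and `j`-coordinate, respectively, of the last suff-match of `c` on this diagonal -/
  | th (s : Side)
  /-- the range maximum query data structure of `th s` -/
  | mask (s : Side)
  | sparse (s : Side)
  | pow2
  | low
  | lg
  /-- the current row of suff-matches -/
  | suff
  /-- the current string `Z'` -/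
  | z
  /-- the coordinates of the matches `pref` and `safe` of all nonempty prefixes of `Z'` -/
  | pref (s : Side)
  | safe (s : Side)
  /-- a stack of characters: the sequences `alt` of all nonempty prefixes of `Z'`, where the one
  of the prefix of length `k` starts at `altStart[k]` -/
  | altStart
  | alt
  /-- the two ends of the sequence of extensible character candidates -/
  | up (s : Side)
  | down (s : Side)
  /-- the sequence `ext(Z')` -/
  | ext (s : Side)
  deriving DecidableEq, Fintype

/-- Expressions of the algorithm. -/
abbrev E : Type := Exp Reg Arr

/-- Tests of the algorithm. -/
abbrev B : Type := Cond Reg Arr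

/-- Statements of the algorithm. -/
abbrev S : Type := Stmt Reg Arr

instance : Coe Reg E := ⟨Exp.var⟩
instance (k : ℕ) : OfNat E k := ⟨Exp.lit k⟩
instance : Add E := ⟨Exp.add⟩
instance : Sub E := ⟨Exp.sub⟩
instance : Mul E := ⟨Exp.mul⟩
instance : Div E := ⟨Exp.div⟩

/-- Assignment. -/
abbrev put (x : Reg) (e : E) : S := .assign x e

/-- Array access. -/
abbrev rd (a : Arr) (e : E) : E := .get a e

/-- Array modification. -/
abbrev wr (a : Arr) (i e : E) : S := .store a i e

/-- Sequential composition. -/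
def block : List S → S
  | [] => .skip
  | [p] => p
  | p :: q :: l => .seq p (block (q :: l))

/-- Loop. -/
abbrev whl (c : B) (l : List S) : S := .loop c (block l)

/-- Conditional. -/
abbrev ifs (c : B) (l l' : List S) : S := .ite c (block l) (block l')

/-- For `x` from `e` up to `f`. -/
def forUp (x : Reg) (e f : E) (l : List S) : S :=
  block [put x e, whl (.le x f) [block l, put x (x + 1)]]

/-- For `x` from `e` down to `1`. -/
def forDown (x : Reg) (e : E) (l : List S) : S :=
  block [put x e, whl (.le 1 x) [block l, put x (x - 1)]]

open Reg Arr

/-! #### Preprocessing: normal form of the input -/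

/-- Replace the input strings by strings over `{1, ..., sigma}`, `sigma = |X| + |Y| + 2`: each
character is replaced by one plus the index of its first occurrence in the concatenation of the
input strings, and then the new character `1` is prepended and the new character `sigma` is
appended. -/
def normalize : S := block [
  put (len .x) (rawLen .x + 2),
  put (len .y) (rawLen .y + 2),
  put sigma (rawLen .x + rawLen .y + 2),
  forUp k 1 (rawLen .x) [wr dec (k + 1) (rd (raw .x) k)],
  forUp k 1 (rawLen .y) [wr dec (rawLen .x + k + 1) (rd (raw .y) k)],
  forUp k 1 (rawLen .x) [
    put c 2,
    whl (.ne (rd dec c) (rd (raw .x) k)) [put c (c + 1)],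
    wr (str .x) (k + 1) c],
  forUp k 1 (rawLen .y) [
    put c 2,
    whl (.ne (rd dec c) (rd (raw .y) k)) [put c (c + 1)],
    wr (str .y) (k + 1) c],
  wr (str .x) 1 1,
  wr (str .y) 1 1,
  wr (str .x) (len .x) sigma,
  wr (str .y) (len .y) sigma]

/-! #### Next-queries by binary search in the index lists -/

/-- For each character, prepare the ascending sequence of all indices at which it occurs. -/
def buildIndex (s : Side) : S := block [
  forUp k 1 (len s) [
    wr (cnt s) (rd (str s) k) (rd (cnt s) (rd (str s) k) + 1),
    wr (rank s) k (rd (cnt s) (rd (str s) k))],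
  forUp k 1 sigma [wr (start s) (k + 1) (rd (start s) k + rd (cnt s) k)],
  forUp k 1 (len s) [wr (occ s) (rd (start s) (rd (str s) k) + rd (rank s) k) k]]

/-- `rk` becomes the number of occurrences of `c` at indices up to `h`. -/
def countLE (s : Side) (c h : E) : S := block [
  put rk 0,
  put hi (rd (cnt s) c),
  whl (.lt rk hi) [
    put mid ((rk + hi + 1) / 2),
    ifs (.le (rd (occ s) (rd (start s) c + mid)) h) [put rk mid] [put hi (mid - 1)]]]

/-- `nx` becomes the least index greater than `h` at which `c` occurs, or the length plus one if
there is none. -/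
def nextQ (s : Side) (c h : E) : S := block [
  countLE s c h,
  ifs (.lt rk (rd (cnt s) c))
    [put nx (rd (occ s) (rd (start s) c + rk + 1))]
    [put nx (len s + 1)]]

/-! #### Range maximum queries with linear space and constant query time -/

/-- Tables shared by the range maximum query data structures: powers of two, the block width
(the number of binary digits of the length of the arrays), the positions of the lowest nonzero
binary digits, and binary logarithms. -/
def buildTables : S := block [
  put size (len .x + len .y),
  put width 0,
  wr pow2 0 1,
  whl (.le (rd pow2 width) size) [
    wr pow2 (width + 1) (rd pow2 width + rd pow2 width),
    put width (width + 1)],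
  put blocks (size / width + 1),
  forUp k 1 (rd pow2 width - 1) [
    ifs (.eq k (2 * (k / 2))) [wr low k (rd low (k / 2) + 1)] [wr low k 0]],
  forUp k 2 blocks [wr lg k (rd lg (k / 2) + 1)]]

/-- `pos` becomes the leftmost position of a maximum of `th s` between the positions `l` and `r`,
which belong to the same block. -/
def inBlock (s : Side) (l r : E) : S :=
  put pos (l + rd low (rd (mask s) r / rd pow2 (l - l / width * width)))

/-- Replace `best` by `e` if the latter is the position of a greater element of `th s`. -/
def improve (s : Side) (e : E) : S :=
  ifs (.lt (rd (th s) best) (rd (th s) e)) [put best e] []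

/-- Build the range maximum query data structure of `th s`: the binary digits of `mask s [k]`
indicate the positions `q` up to `k` in the block of `k` such that no element between `q` and `k`
exceeds the one at `q`; `sparse s [v * blocks + k]` is the leftmost position of a maximum among
the blocks `k, ..., k + 2 ^ v - 1`. -/
def buildRMQ (s : Side) : S := block [
  forUp k 0 (blocks * width - 1) [
    put bs (k / width * width),
    put q k,
    whl (.and (.lt bs q) (.lt (rd (th s) (q - 1)) (rd (th s) k))) [put q (q - 1)],
    ifs (.eq q bs)
      [wr (mask s) k (rd pow2 (k - bs))]
      [wr (mask s) k (rd (mask s) (q - 1) + rd pow2 (k - bs))]],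
  forUp k 0 (blocks - 1) [
    inBlock s (k * width) (k * width + width - 1),
    wr (sparse s) k pos],
  put lv 0,
  whl (.le (rd pow2 (lv + 1)) blocks) [
    forUp k 0 (blocks - rd pow2 (lv + 1)) [
      put best (rd (sparse s) (lv * blocks + k)),
      improve s (rd (sparse s) (lv * blocks + k + rd pow2 lv)),
      wr (sparse s) ((lv + 1) * blocks + k) best],
    put lv (lv + 1)]]

/-- `best` becomes the leftmost position of a maximum of `th s` between the positions `l` and
`r`. -/
def rmq (s : Side) (l r : E) : S := block [
  put ql l,
  put qr r,
  put bl (ql / width),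
  put br (qr / width),
  ifs (.eq bl br)
    [inBlock s ql qr, put best pos]
    [inBlock s ql (bl * width + width - 1),
      put best pos,
      ifs (.lt (bl + 1) br)
        [put lv (rd lg (br - bl - 1)),
          improve s (rd (sparse s) (lv * blocks + bl + 1)),
          improve s (rd (sparse s) (lv * blocks + br - rd pow2 lv))]
        [],
      inBlock s (br * width) qr,
      improve s pos]]

/-! #### Preprocessing: the thresholds -/

/-- Initialize the thresholds to those of diagonals without suff-matches. -/
def initTh : S :=
  forUp c 1 sigma [
    forUp k 1 (rd (cnt .x) c + rd (cnt .y) c - 1) [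
      wr (th .x) (rd (start .x) c + rd (start .y) c + k) (rd (cnt .x) c - k),
      wr (th .y) (rd (start .x) c + rd (start .y) c + k) (k - rd (cnt .x) c)]]

/-- Update the thresholds by the suff-match `(i, j)`. -/
def recordSuff : S := block [
  put c (rd (str .x) i),
  put p (rd (start .x) c + rd (start .y) c +
    (rd (rank .y) j + rd (cnt .x) c - rd (rank .x) i)),
  ifs (.lt (rd (th .x) p) (rd (rank .x) i)) [wr (th .x) p (rd (rank .x) i)] [],
  ifs (.lt (rd (th .y) p) (rd (rank .y) j)) [wr (th .y) p (rd (rank .y) j)] []]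

/-- Given that, for each `j`, `suff[j]` is the least `i' > i` such that `(i', j)` is a suff-match
(`|X| + 1` if there is none), turn `suff` into the analogous sequence for `i' ≥ i`. (No cell is
read after it has been modified, so that no copy of `suff` is needed.) -/
def updateSuff : S := block [
  put iNext (i + 1),
  whl (.and (.le iNext (len .x)) (.ne (rd (str .x) iNext) (rd (str .x) i)))
    [put iNext (iNext + 1)],
  put jPrev 0,
  forUp j 1 (len .y) [
    ifs (.and (.ne (rd suff j) (len .x + 1)) (.and (.le 1 jPrev) (.le (rd suff j) iNext)))
      [wr suff jPrev i] [],
    ifs (.eq (rd (str .y) j) (rd (str .x) i)) [put jPrev j] []]]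

/-- Enumerate all suff-matches, row by row, to determine the thresholds. -/
def buildTh : S := block [
  initTh,
  forUp j 1 (len .y - 1) [wr suff j (len .x + 1)],
  wr suff (len .y) (len .x),
  put i (len .x),
  put j (len .y),
  recordSuff,
  forDown i (len .x - 1) [
    updateSuff,
    forUp j 1 (len .y) [ifs (.eq (rd suff j) i) [recordSuff] []]]]

/-- The preprocessing. -/
def pre : S := block [
  normalize,
  buildIndex .x,
  buildIndex .y,
  buildTh,
  buildTables,
  buildRMQ .x,
  buildRMQ .y]

/-! #### Queries of `ext(Z')` -/

/-- `(up x [r], up y [r])`, for `r = 1, ..., np - 1`, become the matches `pref(Z' c)` for all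
`Z'`-extensible character candidates `c`, in ascending order of their `y`-coordinates, with
`(|X| + 1, j)` and `(i, |Y| + 1)`, where `(i, j) = pref(Z')`, as virtual first and last elements
at positions `0` and `np`. The sequence is constructed from both ends; that end is extended that
has the greater sum of coordinates, until both ends meet. -/
def candidates : S := block [
  put i (rd (pref .x) nz),
  put j (rd (pref .y) nz),
  put np 0,
  put nq 0,
  wr (up .x) 0 (len .x + 1),
  wr (up .y) 0 j,
  wr (down .x) 0 i,
  wr (down .y) 0 (len .y + 1),
  whl (.ne (rd (up .x) np) (rd (down .x) nq)) [
    ifs (.le (rd (down .x) nq + rd (down .y) nq) (rd (up .x) np + rd (up .y) np))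
      [put nx (rd (up .x) np),
        put p (rd (up .y) np),
        whl (.le (rd (up .x) np) nx) [
          put p (p + 1),
          ifs (.le p (len .y)) [nextQ .x (rd (str .y) p) i] [put nx i]],
        put np (np + 1),
        wr (up .x) np nx,
        wr (up .y) np p]
      [put nx (rd (down .y) nq),
        put p (rd (down .x) nq),
        whl (.le (rd (down .y) nq) nx) [
          put p (p + 1),
          ifs (.le p (len .x)) [nextQ .y (rd (str .x) p) j] [put nx j]],
        put nq (nq + 1),
        wr (down .x) nq p,
        wr (down .y) nq nx]],
  whl (.le 1 nq) [
    put nq (nq - 1),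
    put np (np + 1),
    wr (up .x) np (rd (down .x) nq),
    wr (up .y) np (rd (down .y) nq)]]

/-- The position in the threshold arrays of the diagonal of the match of `c` whose character-wise
coordinates are `f` on side `s` and `u` on the other side. -/
def diag (s : Side) (u : E) : E :=
  match s with
  | .x => rd (start .x) c + rd (start .y) c + (u + rd (cnt .x) c - f)
  | .y => rd (start .x) c + rd (start .y) c + (f + rd (cnt .x) c - u)

/-- `best` becomes the position of the greatest threshold among the diagonals of the matches of
`c` with character-wise coordinates `f` on side `s` and between `u` and `v` on the other side. -/
def rangeQuery (s : Side) (u v : E) : S :=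
  match s with
  | .x => rmq .x (diag .x u) (diag .x v)
  | .y => rmq .y (diag .y v) (diag .y u)

/-- For the candidate `c` with `pref(Z' c) = (m x, m y)`, search for the prominent `c`-witness
candidate that has the same coordinate as `pref(Z' c)` on side `s`: by a range maximum query
decide whether it exists (`found`), and if so, find by binary search its coordinate `w` on the
other side, the least one that is at most that of `safe(Z')` and belongs to a suff-match. -/
def searchWitness (s : Side) : S := block [
  put f (rd (rank s) (m s)),
  put lo (rd (rank s.other) (m s.other)),
  countLE s.other c (rd (safe s.other) nz),
  put hi rk,
  put found 0,
  ifs (.le lo hi)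
    [rangeQuery s lo hi,
      ifs (.le f (rd (th s) best))
        [put found 1,
          whl (.lt lo hi) [
            put mid ((lo + hi) / 2),
            rangeQuery s lo mid,
            ifs (.le f (rd (th s) best)) [put hi mid] [put lo (mid + 1)]],
          put w (rd (occ s.other) (rd (start s.other) c + lo))]
        []]
    []]

/-- The neighbour in the sequence of candidates that has a smaller coordinate on side `s`. -/
def neighbour (s : Side) : E :=
  match s with
  | .x => r + 1
  | .y => r - 1

/-- Append the match that `searchWitness s` has found to `ext(Z')` if it is a witness, that is, if
it does not exceed `safe(Z')` and no candidate precedes it in both coordinates. -/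
def addWitness (s : Side) : S :=
  ifs (.and (.eq found 1) (.and (.le (m s) (rd (safe s) nz))
      (.le w (rd (up s.other) (neighbour s)))))
    [put nExt (nExt + 1),
      wr (ext s) nExt (m s),
      wr (ext s.other) nExt w]
    []

/-- Obtain the sequence `ext(Z')` of all prominent witnesses of `Z'`-extensibility, for `Z'` of
length `nz`. (If `pref(Z' c)` itself is a witness, it is found on either side, but appended
once.) -/
def queryExt : S := block [
  candidates,
  put nExt 0,
  forUp r 1 (np - 1) [
    put (m .x) (rd (up .x) r),
    put (m .y) (rd (up .y) r),
    put c (rd (str .x) (m .x)),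
    searchWitness .x,
    addWitness .x,
    searchWitness .y,
    ifs (.ne w (m .x)) [addWitness .y] []]]

/-! #### Enumeration -/

/-- Push all distinct `Z'`-extensible characters, read off from `ext(Z')`, onto the stack `alt`.
(The at most two elements of `ext(Z')` with the same character are consecutive.) -/
def pushExtensible : S := block [
  queryExt,
  wr altStart (nz + 1) top,
  put last 0,
  forUp k 1 nExt [
    put c (rd (str .x) (rd (ext .x) k)),
    ifs (.ne c last)
      [wr alt top c,
        put top (top + 1),
        put last c]
      []]]

/-- Remove the least character from the part of `alt` that belongs to the prefix of length `nz`,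
and store it in `c`. -/
def takeLeast : S := block [
  put p (rd altStart nz),
  forUp k (rd altStart nz + 1) (top - 1) [
    ifs (.lt (rd alt k) (rd alt p)) [put p k] []],
  put c (rd alt p),
  put top (top - 1),
  wr alt p (rd alt top)]

/-- For `Z'` of length `nz`, let `c` be its last character, and determine the coordinate on side
`s` of `safe(Z')` from `safe` and `pref` of the prefix of length `nz - 1` and from `pref(Z')`. -/
def updateSafe (s : Side) : S := block [
  put sf (len s + 1),
  forUp k (rd (pref s.other) (nz - 1) + 1) (rd (pref s.other) nz - 1) [
    nextQ s (rd (str s.other) k) (rd (pref s) (nz - 1)),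
    ifs (.le nx (len s))
      [put p nx,
        nextQ s c p,
        ifs (.lt nx sf) [put sf nx] []]
      []],
  ifs (.le (rd (safe s) (nz - 1)) (len s))
    [nextQ s c (rd (safe s) (nz - 1)),
      ifs (.lt nx sf) [put sf nx] []]
    [],
  wr (safe s) nz sf]

/-- Let `c` be the last element of `Z'`, where `Z'` is of length `nz`, and determine `pref(Z')` and
`safe(Z')`. -/
def setLast : S := block [
  wr z nz c,
  nextQ .x c (rd (pref .x) (nz - 1)),
  wr (pref .x) nz nx,
  nextQ .y c (rd (pref .y) (nz - 1)),
  wr (pref .y) nz nx,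
  updateSafe .x,
  updateSafe .y]

/-- Output `Z'`, without its first and last characters and in terms of input characters. -/
def output : S := block [
  forUp k 2 (nz - 1) [.emit (rd dec (rd z k))],
  .finish]

/-- The enumeration: starting with the string `Z'` that consists of the character `1`, repeat the
following until `Z'` is empty. If the last character of `Z'` is not `sigma`, append the least
`Z'`-extensible character. Otherwise, output `Z'`, delete its last character as long as there is
no greater alternative to it, and replace the last character by the least greater alternative. -/
def main : S := block [
  put nz 1,
  put top 0,
  wr z 1 1,
  wr (pref .x) 1 1,
  wr (pref .y) 1 1,
  wr (safe .x) 1 (len .x + 1),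
  wr (safe .y) 1 (len .y + 1),
  wr altStart 1 0,
  whl (.ne nz 0) [
    ifs (.ne (rd z nz) sigma)
      [pushExtensible,
        put nz (nz + 1),
        takeLeast,
        setLast]
      [output,
        whl (.and (.ne nz 0) (.eq (rd altStart nz) top)) [put nz (nz - 1)],
        ifs (.ne nz 0) [takeLeast, setLast] []]]]

end Enum211

/-- Algorithm Enum211. -/
def enum211 : EnumAlgorithm Enum211.Reg Enum211.Arr where
  inX := .raw .x
  inY := .raw .y
  lenX := .rawLen .x
  lenY := .rawLen .y
  pre := Enum211.pre
  main := Enum211.main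

/-!
The program is verified with a weakest precondition calculus for total correctness, `wp`, which also
keeps track of time; `wp_sound` derives executions from it, and `wp_frame` provides for free that
everything a statement does not write to is unchanged. Numbers are bounded syntactically: registers
and cells contain numbers up to `V`, products in expressions are at most `V`, and since no
expression consists of more than 60 parts, no number exceeds `60 * V`.

The combinatorics is done for an input in normal form, `Inst`. The character `c` extends a prefix
`Z` of a maximal common subsequence (MCS) to another one if and only if it is the character of a
suff-match `v` with `pref(Z) ≺ v ≤ safe(Z)` (`isPrefix_concat_iff`). If `Z ++ c :: W` is an MCS,
then `suff(c :: W)` is such a suff-match. Conversely, given `v`, a longest string `W` such that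
`Z ++ c :: W` is a common subsequence and `suff(c :: W) ≤ v` makes `Z ++ c :: W` maximal: insertions
into `Z` are excluded by `v ≤ safe(Z)`, insertions after `Z` by `pref(Z) ≺ v`, and the others by the
choice of `W`. Moreover, `safe(Z ++ [c])` results from `safe(Z)` and the characters between
`pref(Z)` and `pref(Z ++ [c])` (`IsSafe.concat`).

Among the matches of a character on a diagonal, the suff-matches are an initial segment. So the last
suff-match of each diagonal, its *threshold*, tells whether a match is a suff-match (`Thr.sm_iff`).
In the order of the diagonals, the matches with a common coordinate are consecutive, and a range
maximum query on the thresholds decides whether there is a suff-match in a given range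
(`wp_rangeQuery`); with binary search, this finds the least one (`wp_searchWitness`) in logarithmic
time. The query structure takes linear space, since a sparse table is stored for the maxima of
blocks of logarithmic length only, and queries within blocks are answered by bit masks
(`wp_buildRMQ`, `wp_rmq`).

The matches `pref(Z ++ [c])` with `pref(Z) ≺ pref(Z ++ [c])` are the minimal matches greater than
`pref(Z)`: the *corners* of a staircase. The staircase is generated from both ends in turns
(`wp_candidates`), so that its two parts meet after a number of steps linear in the distance `d`, in
the sum of coordinates, between `pref(Z)` and the nearest corner. In particular, there are `O(d)`
corners, each of them takes logarithmic time, and whatever character `c` is appended, the sum `psum`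
of the coordinates of `pref` increases by at least `d`. Updating `safe` takes logarithmic time per
unit of this increase, too. Hence `psum`, which is at most the total length of the strings, is a
potential that pays for the time between two outputs, up to a logarithmic factor (`wp_push`,
`wp_advance`). It also bounds the space for the alternatives that are kept on the stack (`Level`).

Finally, the MCSs that are still to be output are, as a multiset, those that extend the current
string, and those that extend its prefixes by one of the alternatives on the stack (`Stack`,
`pending`). Each step of the main loop preserves this multiset or outputs one of its elements
(`exec_mainLoop`), so that each MCS is output exactly once. `nrm_mcs_iff` returns from the normal
form to the original strings.
-/

namespace Enum211
set_option linter.unusedSimpArgs false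

/-! ### A weakest precondition calculus -/

section

/-- The value of an expression, given the contents of registers and arrays. -/
def ev (r : Reg → ℕ) (m : Arr → ℕ → ℕ) : E → ℕ
  | .lit k => k
  | .var x => r x
  | .get a e => m a (ev r m e)
  | .add e f => ev r m e + ev r m f
  | .sub e f => ev r m e - ev r m f
  | .mul e f => ev r m e * ev r m f
  | .div e f => ev r m e / ev r m f

/-- The truth value of a test, given the contents of registers and arrays. -/
def evC (r : Reg → ℕ) (m : Arr → ℕ → ℕ) : B → Prop
  | .le e f => ev r m e ≤ ev r m f
  | .lt e f => ev r m e < ev r m f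
  | .eq e f => ev r m e = ev r m f
  | .ne e f => ev r m e ≠ ev r m f
  | .and b c => evC r m b ∧ evC r m c

/-- All literals are at most `2` and all products at most `V`. Then the numbers that occur in the
evaluation exceed `V` at most by a factor that depends only on the size of the expression, provided
that `V` bounds the contents of registers and arrays. -/
def safeE (V : ℕ) (r : Reg → ℕ) (m : Arr → ℕ → ℕ) : E → Prop
  | .lit k => k ≤ 2
  | .var _ => True
  | .get _ e => safeE V r m e
  | .add e f => safeE V r m e ∧ safeE V r m f
  | .sub e f => safeE V r m e ∧ safeE V r m f
  | .mul e f => safeE V r m e ∧ safeE V r m f ∧ ev r m e * ev r m f ≤ V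
  | .div e f => safeE V r m e ∧ safeE V r m f

/-- The analogue of `safeE` for tests. -/
def safeC (V : ℕ) (r : Reg → ℕ) (m : Arr → ℕ → ℕ) : B → Prop
  | .le e f => safeE V r m e ∧ safeE V r m f
  | .lt e f => safeE V r m e ∧ safeE V r m f
  | .eq e f => safeE V r m e ∧ safeE V r m f
  | .ne e f => safeE V r m e ∧ safeE V r m f
  | .and b c => safeC V r m b ∧ safeC V r m c

section simps
variable (V : ℕ) (r : Reg → ℕ) (m : Arr → ℕ → ℕ) (e f : E) (x : Reg) (a : Arr) (b c : B)

@[simp] lemma ev_two : ev r m 2 = 2 := rfl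
@[simp] lemma ev_zero : ev r m 0 = 0 := rfl
@[simp] lemma ev_one : ev r m 1 = 1 := rfl
@[simp] lemma ev_var : ev r m (.var x) = r x := rfl
@[simp] lemma ev_get : ev r m (.get a e) = m a (ev r m e) := rfl
@[simp] lemma ev_add : ev r m (e + f) = ev r m e + ev r m f := rfl
@[simp] lemma ev_sub : ev r m (e - f) = ev r m e - ev r m f := rfl
@[simp] lemma ev_mul : ev r m (e * f) = ev r m e * ev r m f := rfl
@[simp] lemma ev_div : ev r m (e / f) = ev r m e / ev r m f := rfl
@[simp] lemma evC_le : evC r m (.le e f) ↔ ev r m e ≤ ev r m f := Iff.rfl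
@[simp] lemma evC_lt : evC r m (.lt e f) ↔ ev r m e < ev r m f := Iff.rfl
@[simp] lemma evC_eq : evC r m (.eq e f) ↔ ev r m e = ev r m f := Iff.rfl
@[simp] lemma evC_ne : evC r m (.ne e f) ↔ ev r m e ≠ ev r m f := Iff.rfl
@[simp] lemma evC_and : evC r m (.and b c) ↔ evC r m b ∧ evC r m c := Iff.rfl
@[simp] lemma safeE_two : safeE V r m 2 ↔ True := by simp [show safeE V r m 2 ↔ 2 ≤ 2 from Iff.rfl]
@[simp] lemma safeE_zero : safeE V r m 0 ↔ True := by simp [show safeE V r m 0 ↔ 0 ≤ 2 from Iff.rfl]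
@[simp] lemma safeE_one : safeE V r m 1 ↔ True := by simp [show safeE V r m 1 ↔ 1 ≤ 2 from Iff.rfl]
@[simp] lemma safeE_var : safeE V r m (.var x) ↔ True := Iff.rfl
@[simp] lemma safeE_get : safeE V r m (.get a e) ↔ safeE V r m e := Iff.rfl
@[simp] lemma safeE_add : safeE V r m (e + f) ↔ safeE V r m e ∧ safeE V r m f := Iff.rfl
@[simp] lemma safeE_sub : safeE V r m (e - f) ↔ safeE V r m e ∧ safeE V r m f := Iff.rfl
@[simp] lemma safeE_mul :
    safeE V r m (e * f) ↔ safeE V r m e ∧ safeE V r m f ∧ ev r m e * ev r m f ≤ V := Iff.rfl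
@[simp] lemma safeE_div : safeE V r m (e / f) ↔ safeE V r m e ∧ safeE V r m f := Iff.rfl
@[simp] lemma safeC_le : safeC V r m (.le e f) ↔ safeE V r m e ∧ safeE V r m f := Iff.rfl
@[simp] lemma safeC_lt : safeC V r m (.lt e f) ↔ safeE V r m e ∧ safeE V r m f := Iff.rfl
@[simp] lemma safeC_eq : safeC V r m (.eq e f) ↔ safeE V r m e ∧ safeE V r m f := Iff.rfl
@[simp] lemma safeC_ne : safeC V r m (.ne e f) ↔ safeE V r m e ∧ safeE V r m f := Iff.rfl
@[simp] lemma safeC_and : safeC V r m (.and b c) ↔ safeC V r m b ∧ safeC V r m c := Iff.rfl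
@[simp] lemma cost_two : Exp.cost (2 : E) = 1 := rfl
@[simp] lemma cost_zero : Exp.cost (0 : E) = 1 := rfl
@[simp] lemma cost_one : Exp.cost (1 : E) = 1 := rfl
@[simp] lemma cost_var : Exp.cost (.var x : E) = 1 := rfl
@[simp] lemma cost_get : Exp.cost (.get a e) = e.cost + 1 := rfl
@[simp] lemma cost_add : Exp.cost (e + f) = e.cost + f.cost + 1 := rfl
@[simp] lemma cost_sub : Exp.cost (e - f) = e.cost + f.cost + 1 := rfl
@[simp] lemma cost_mul : Exp.cost (e * f) = e.cost + f.cost + 1 := rfl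
@[simp] lemma cost_div : Exp.cost (e / f) = e.cost + f.cost + 1 := rfl
@[simp] lemma costC_le : Cond.cost (.le e f) = e.cost + f.cost + 1 := rfl
@[simp] lemma costC_lt : Cond.cost (.lt e f) = e.cost + f.cost + 1 := rfl
@[simp] lemma costC_eq : Cond.cost (.eq e f) = e.cost + f.cost + 1 := rfl
@[simp] lemma costC_ne : Cond.cost (.ne e f) = e.cost + f.cost + 1 := rfl
@[simp] lemma costC_and : Cond.cost (.and b c) = b.cost + c.cost + 1 := rfl
end simps

/-- Postconditions: properties of registers, arrays and the time. -/
abbrev Post : Type := (Reg → ℕ) → (Arr → ℕ → ℕ) → ℕ → Prop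

/-- The weakest precondition of at most `n - 1` iterations of a loop with test `c`, where `W` is
the weakest precondition transformer of the body. -/
def loopN (V : ℕ) (c : B) (W : Post → Post) (Q : Post) : ℕ → Post
  | 0 => fun _ _ _ => False
  | n + 1 => fun r m t => safeC V r m c ∧
      (evC r m c → W (loopN V c W Q n) r m (t + c.cost + 1)) ∧
      (¬ evC r m c → Q r m (t + c.cost + 1))

/-- Weakest preconditions for total correctness of statements without output: `wp V M p Q r m t`
says that `p`, started at time `t` with registers `r` and arrays `m`, terminates such that `Q`
holds, and that it writes only numbers up to `V`, at indices below `M`. -/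
def wp (V M : ℕ) : S → Post → Post
  | .skip, Q => Q
  | .assign x e, Q => fun r m t => safeE V r m e ∧ ev r m e ≤ V ∧
      Q (Function.update r x (ev r m e)) m (t + e.cost + 1)
  | .store a i e, Q => fun r m t => safeE V r m i ∧ safeE V r m e ∧ ev r m i < M ∧ ev r m e ≤ V ∧
      Q r (Function.update m a (Function.update (m a) (ev r m i) (ev r m e)))
        (t + i.cost + e.cost + 1)
  | .seq p q, Q => wp V M p (wp V M q Q)
  | .ite c p q, Q => fun r m t => safeC V r m c ∧
      (evC r m c → wp V M p Q r m (t + c.cost + 1)) ∧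
      (¬ evC r m c → wp V M q Q r m (t + c.cost + 1))
  | .loop c p, Q => fun r m t => ∃ n, loopN V c (wp V M p) Q n r m t
  | .emit _, _ => fun _ _ _ => False
  | .finish, _ => fun _ _ _ => False

section
variable {V M : ℕ} {Q Q' : Post} {r : Reg → ℕ} {m : Arr → ℕ → ℕ} {t : ℕ}

@[simp] lemma wp_skip : wp V M .skip Q r m t ↔ Q r m t := Iff.rfl
@[simp] lemma wp_assign {x : Reg} {e : E} : wp V M (.assign x e) Q r m t ↔
    safeE V r m e ∧ ev r m e ≤ V ∧
      Q (Function.update r x (ev r m e)) m (t + e.cost + 1) := Iff.rfl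
@[simp] lemma wp_store {a : Arr} {i e : E} : wp V M (.store a i e) Q r m t ↔
    safeE V r m i ∧ safeE V r m e ∧ ev r m i < M ∧ ev r m e ≤ V ∧
      Q r (Function.update m a (Function.update (m a) (ev r m i) (ev r m e)))
        (t + i.cost + e.cost + 1) := Iff.rfl
@[simp] lemma wp_seq {p q : S} :
    wp V M (.seq p q) Q r m t ↔ wp V M p (fun r m t => wp V M q Q r m t) r m t := Iff.rfl
@[simp] lemma wp_ite {c : B} {p q : S} : wp V M (.ite c p q) Q r m t ↔ safeC V r m c ∧
      (evC r m c → wp V M p Q r m (t + c.cost + 1)) ∧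
      (¬ evC r m c → wp V M q Q r m (t + c.cost + 1)) := Iff.rfl
@[simp] lemma block_nil : block [] = .skip := rfl
@[simp] lemma block_single (p : S) : block [p] = p := rfl
@[simp] lemma block_cons (p q : S) (l : List S) :
    block (p :: q :: l) = .seq p (block (q :: l)) := rfl

lemma loopN_mono {c : B} {W : Post → Post}
    (hW : ∀ {Q Q' : Post}, (∀ r m t, Q r m t → Q' r m t) → ∀ r m t, W Q r m t → W Q' r m t)
    (h : ∀ r m t, Q r m t → Q' r m t) (n : ℕ) :
    ∀ r m t, loopN V c W Q n r m t → loopN V c W Q' n r m t := by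
  induction n with
  | zero => intro r m t h; exact h
  | succ n ih =>
    intro r m t H
    exact ⟨H.1, fun hc => hW ih _ _ _ (H.2.1 hc), fun hc => h _ _ _ (H.2.2 hc)⟩

lemma wp_mono (p : S) : ∀ {Q Q' : Post}, (∀ r m t, Q r m t → Q' r m t) →
    ∀ r m t, wp V M p Q r m t → wp V M p Q' r m t := by
  induction p with
  | skip => intro Q Q' h r m t H; exact h _ _ _ H
  | assign x e => intro Q Q' h r m t H; exact ⟨H.1, H.2.1, h _ _ _ H.2.2⟩
  | store a i e =>
    intro Q Q' h r m t H; exact ⟨H.1, H.2.1, H.2.2.1, H.2.2.2.1, h _ _ _ H.2.2.2.2⟩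
  | seq p q ihp ihq => intro Q Q' h r m t H; exact ihp (ihq h) _ _ _ H
  | ite c p q ihp ihq =>
    intro Q Q' h r m t H
    exact ⟨H.1, fun hc => ihp h _ _ _ (H.2.1 hc), fun hc => ihq h _ _ _ (H.2.2 hc)⟩
  | loop c p ih =>
    intro Q Q' h r m t ⟨n, H⟩
    exact ⟨n, loopN_mono ih h n _ _ _ H⟩
  | emit e => intro Q Q' h r m t H; exact H
  | finish => intro Q Q' h r m t H; exact H

/-- `p` may modify the register `x`. -/
def modR : S → Reg → Bool
  | .assign x _, y => decide (y = x)
  | .seq p q, y => modR p y || modR q y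
  | .ite _ p q, y => modR p y || modR q y
  | .loop _ p, y => modR p y
  | _, _ => false

/-- `p` may modify the array `a`. -/
def modA : S → Arr → Bool
  | .store a _ _, b => decide (b = a)
  | .seq p q, b => modA p b || modA q b
  | .ite _ p q, b => modA p b || modA q b
  | .loop _ p, b => modA p b
  | _, _ => false

/-- The numbers in all registers and arrays are at most `V`. -/
def Bd (V : ℕ) (r : Reg → ℕ) (m : Arr → ℕ → ℕ) : Prop :=
  (∀ x, r x ≤ V) ∧ ∀ a k, m a k ≤ V

/-- What `p` preserves for syntactic reasons: it changes only the registers and arrays to which it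
assigns, and keeps all numbers bounded by `V`. -/
structure Frame (V : ℕ) (p : S) (r : Reg → ℕ) (m : Arr → ℕ → ℕ) (r' : Reg → ℕ)
    (m' : Arr → ℕ → ℕ) : Prop where
  reg : ∀ x, modR p x = false → r' x = r x
  mem : ∀ a, modA p a = false → m' a = m a
  bd : Bd V r m → Bd V r' m'

lemma Frame.refl (p : S) (r : Reg → ℕ) (m : Arr → ℕ → ℕ) : Frame V p r m r m :=
  ⟨fun _ _ => rfl, fun _ _ => rfl, id⟩

/-- Frames are transitive for parts `p` and `q` of a statement `u`. -/
lemma Frame.trans {p q u : S} {r r' r'' : Reg → ℕ} {m m' m'' : Arr → ℕ → ℕ}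
    (h : Frame V p r m r' m') (h' : Frame V q r' m' r'' m'')
    (hr : ∀ x, modR u x = false → modR p x = false ∧ modR q x = false)
    (ha : ∀ x, modA u x = false → modA p x = false ∧ modA q x = false) :
    Frame V u r m r'' m'' :=
  ⟨fun x hx => (h'.reg x (hr x hx).2).trans (h.reg x (hr x hx).1),
    fun x hx => (h'.mem x (ha x hx).2).trans (h.mem x (ha x hx).1), fun H => h'.bd (h.bd H)⟩

/-- Frames come for free: a statement changes only what it may write to, and preserves the bound on the
contents of registers and arrays. -/
lemma wp_frame (p : S) : ∀ {Q : Post} {r m t}, wp V M p Q r m t →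
    wp V M p (fun r' m' t' => Q r' m' t' ∧ Frame V p r m r' m') r m t := by
  induction p with
  | skip => intro Q r m t H; exact ⟨H, Frame.refl _ _ _⟩
  | assign x e =>
    intro Q r m t H
    refine ⟨H.1, H.2.1, H.2.2, ⟨fun y hy => ?_, fun _ _ => rfl, fun hb => ⟨fun y => ?_, hb.2⟩⟩⟩
    · simp only [modR, decide_eq_false_iff_not] at hy
      simp [Function.update_apply, hy]
    · by_cases hy : y = x
      · simp [hy, H.2.1]
      · simp [Function.update_apply, hy, hb.1]
  | store a i e =>
    intro Q r m t H
    refine ⟨H.1, H.2.1, H.2.2.1, H.2.2.2.1, H.2.2.2.2,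
      ⟨fun _ _ => rfl, fun y hy => ?_, fun hb => ⟨hb.1, fun y k => ?_⟩⟩⟩
    · simp only [modA, decide_eq_false_iff_not] at hy
      simp [Function.update_apply, hy]
    · by_cases hy : y = a
      · subst hy
        by_cases hk : k = ev r m i
        · simp [hk, H.2.2.2.1]
        · simp [Function.update_apply, hk, hb.2]
      · simp [Function.update_apply, hy, hb.2]
  | seq p q ihp ihq =>
    intro Q r m t H
    refine wp_mono p (fun r' m' t' h => ?_) _ _ _ (ihp H)
    refine wp_mono q (fun r'' m'' t'' h' => ⟨h'.1, h.2.trans h'.2 ?_ ?_⟩) _ _ _ (ihq h.1) <;>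
    · intro x hx; simpa [modR, modA] using hx
  | ite c p q ihp ihq =>
    intro Q r m t H
    refine ⟨H.1, fun hc => wp_mono p (fun r' m' t' h => ⟨h.1, ?_⟩) _ _ _ (ihp (H.2.1 hc)),
      fun hc => wp_mono q (fun r' m' t' h => ⟨h.1, ?_⟩) _ _ _ (ihq (H.2.2 hc))⟩
    · refine (Frame.refl .skip r m).trans h.2 ?_ ?_ <;>
      · intro x hx; simp [modR, modA] at hx ⊢; exact hx.1
    · refine (Frame.refl .skip r m).trans h.2 ?_ ?_ <;>
      · intro x hx; simp [modR, modA] at hx ⊢; exact hx.2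
  | loop c p ih =>
    intro Q r m t ⟨n, H⟩
    refine ⟨n, ?_⟩
    suffices ∀ n r' m' t', Frame V (.loop c p) r m r' m' → loopN V c (wp V M p) Q n r' m' t' →
        loopN V c (wp V M p) (fun r' m' t' => Q r' m' t' ∧ Frame V (.loop c p) r m r' m') n
          r' m' t' from this n r m t (Frame.refl _ _ _) H
    intro n
    induction n with
    | zero => intro _ _ _ _ h; exact h
    | succ n ihn =>
      intro r' m' t' hF h
      refine ⟨h.1, fun hc => ?_, fun hc => ⟨h.2.2 hc, hF⟩⟩
      refine wp_mono p (fun r'' m'' t'' h' => ihn _ _ _ (hF.trans h'.2 ?_ ?_) h'.1) _ _ _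
        (ih (h.2.1 hc)) <;>
      · intro x hx; exact ⟨hx, hx⟩
  | emit e => intro Q r m t H; exact H
  | finish => intro Q r m t H; exact H

/-- The rule of consequence; the frame comes for free. -/
lemma wp_conseq {p : S} (h : wp V M p Q r m t)
    (H : ∀ r' m' t', Frame V p r m r' m' → Q r' m' t' → Q' r' m' t') : wp V M p Q' r m t :=
  wp_mono p (fun r' m' t' h' => H r' m' t' h'.2 h'.1) _ _ _ (wp_frame p h)

/-- The loop rule: `I` is an invariant and `μ` a variant. -/
lemma wp_loop {c : B} {p : S} (I : Post) (μ : (Reg → ℕ) → (Arr → ℕ → ℕ) → ℕ) (h0 : I r m t)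
    (hs : ∀ r' m' t', Frame V (.loop c p) r m r' m' → I r' m' t' → safeC V r' m' c)
    (hstep : ∀ r' m' t', Frame V (.loop c p) r m r' m' → I r' m' t' → evC r' m' c →
      wp V M p (fun r'' m'' t'' => I r'' m'' t'' ∧ μ r'' m'' < μ r' m') r' m' (t' + c.cost + 1))
    (hend : ∀ r' m' t', Frame V (.loop c p) r m r' m' → I r' m' t' → ¬ evC r' m' c →
      Q r' m' (t' + c.cost + 1)) :
    wp V M (.loop c p) Q r m t := by
  refine ⟨μ r m + 1, ?_⟩
  suffices ∀ n r' m' t', Frame V (.loop c p) r m r' m' → I r' m' t' → μ r' m' < n →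
      loopN V c (wp V M p) Q n r' m' t' from
    this _ r m t (Frame.refl _ _ _) h0 (Nat.lt_succ_self _)
  intro n
  induction n with
  | zero => intro _ _ _ _ _ h; omega
  | succ n ih =>
    intro r' m' t' hF hI hμ
    refine ⟨hs _ _ _ hF hI, fun hc => ?_, hend _ _ _ hF hI⟩
    refine wp_conseq (hstep _ _ _ hF hI hc) fun r'' m'' t'' hF' h => ih _ _ _ ?_ h.1 (by omega)
    exact hF.trans hF' (fun x hx => ⟨hx, hx⟩) (fun x hx => ⟨hx, hx⟩)

/-- The rule for counting loops. The invariant `I k` holds before the iteration for `k`. -/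
lemma wp_forUp {x : Reg} {e f : E} {l : List S} (I : ℕ → Post) (lo hi : ℕ)
    (hlo : ev r m e = lo) (hlV : lo ≤ V) (hle : lo ≤ hi + 1) (hhV : hi + 1 ≤ V)
    (hse : safeE V r m e) (hx : modR (block l) x = false)
    (hf : ∀ k r' m' t', Frame V (forUp x e f l) r m r' m' → I k r' m' t' →
      ev r' m' f = hi ∧ safeE V r' m' f)
    (h0 : I lo (Function.update r x lo) m (t + e.cost + 1))
    (hstep : ∀ k r' m' t', lo ≤ k → k ≤ hi → r' x = k → Frame V (forUp x e f l) r m r' m' →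
      I k r' m' t' → wp V M (block l)
        (fun r'' m'' t'' => I (k + 1) (Function.update r'' x (k + 1)) m'' (t'' + 4)) r' m'
        (t' + f.cost + 3))
    (hend : ∀ r' m' t', Frame V (forUp x e f l) r m r' m' → r' x = hi + 1 →
      I (hi + 1) r' m' t' → Q r' m' (t' + f.cost + 3)) :
    wp V M (forUp x e f l) Q r m t := by
  have key := @wp_loop V M Q (Function.update r x lo) m (t + e.cost + 1) (.le x f)
    (.seq (block l) (put x (x + 1)))
    (fun r' m' t' => lo ≤ r' x ∧ r' x ≤ hi + 1 ∧ I (r' x) r' m' t' ∧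
      Frame V (forUp x e f l) r m r' m') (fun r' _ => hi + 1 - r' x) ?_ ?_ ?_ ?_
  · refine ⟨hse, hlo ▸ hlV, ?_⟩
    rw [hlo]; exact key
  · refine ⟨by simp, by simpa using hle, by simpa using h0, ⟨fun y hy => ?_, fun _ _ => rfl, ?_⟩⟩
    · have : y ≠ x := by
        rintro rfl; simp [forUp, modR] at hy
      simp [Function.update_apply, this]
    · refine fun hb => ⟨fun y => ?_, hb.2⟩
      rw [Function.update_apply]; split_ifs
      · exact hlV
      · exact hb.1 _
  · rintro r' m' t' - ⟨-, -, hI, hF⟩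
    exact ⟨trivial, (hf _ _ _ _ hF hI).2⟩
  · rintro r' m' t' - ⟨h1, h2, hI, hF⟩ hc
    have hfv := (hf _ _ _ _ hF hI).1
    have hc' : r' x ≤ hi := by
      have : r' x ≤ ev r' m' f := hc
      omega
    have := wp_conseq (hstep _ r' m' t' h1 hc' rfl hF hI) (Q' := fun r'' m'' t'' =>
      I (r' x + 1) (Function.update r'' x (r' x + 1)) m'' (t'' + 4) ∧ r'' x = r' x ∧
      Frame V (forUp x e f l) r m r'' m'') ?_
    · have h3 : t' + (Cond.le (↑x : E) f).cost + 1 = t' + f.cost + 3 := by simp; omega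
      rw [h3]
      refine wp_mono (block l) ?_ _ _ _ this
      rintro r'' m'' t'' ⟨hI', hx', hF'⟩
      simp only [wp_assign, safeE_add, safeE_var, safeE_one, and_self, ev_add, ev_var, ev_one,
        cost_add, cost_var, cost_one, true_and, Function.update_self, hx']
      refine ⟨by omega, ⟨by omega, by omega, by simpa [add_assoc] using hI', ?_, hF'.mem, ?_⟩,
        by omega⟩
      · intro y hy
        have : y ≠ x := by
          rintro rfl; simp [forUp, modR] at hy
        rw [Function.update_of_ne this]
        exact hF'.reg y hy
      · refine fun hb => ⟨fun y => ?_, (hF'.bd hb).2⟩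
        rw [Function.update_apply]; split_ifs
        · omega
        · exact (hF'.bd hb).1 _
    · intro r'' m'' t'' hF' hI'
      refine ⟨hI', hF'.reg x hx, hF.trans hF' (fun y hy => ⟨hy, ?_⟩) (fun y hy => ⟨hy, ?_⟩)⟩
      · simp [forUp, modR] at hy; exact hy.2.1
      · simpa [forUp, modA] using hy
  · rintro r' m' t' - ⟨h1, h2, hI, hF⟩ hc
    have hfv := (hf _ _ _ _ hF hI).1
    have hc' : ¬ r' x ≤ ev r' m' f := hc
    have h3 : r' x = hi + 1 := by omega
    have h4 : t' + (Cond.le (↑x : E) f).cost + 1 = t' + f.cost + 3 := by simp; omega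
    rw [h4]
    exact hend _ _ _ hF h3 (h3 ▸ hI)

/-! ### Soundness of the calculus -/

/-- The greatest cost of an expression or test in a statement. -/
def maxCost : S → ℕ
  | .skip => 0
  | .assign _ e => e.cost
  | .store _ i e => max i.cost e.cost
  | .seq p q => max (maxCost p) (maxCost q)
  | .ite c p q => max c.cost (max (maxCost p) (maxCost q))
  | .loop c p => max c.cost (maxCost p)
  | .emit e => e.cost
  | .finish => 0

/-- The resource bounds of a state: numbers are at most `V`, the extents of arrays at most `M`,
and the largest number that occurred is at most `60 * V`. -/
structure Fits (V M : ℕ) (s : MState Reg Arr) : Prop where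
  bd : Bd V s.reg s.mem
  ext : ∀ a, s.extent a ≤ M
  word : s.word ≤ 60 * V

lemma val_eq_ev (s : MState Reg Arr) (e : E) : e.val s = ev s.reg s.mem e := by
  induction e <;> simp_all [Exp.val, ev]

lemma holds_iff_evC (s : MState Reg Arr) (c : B) : c.holds s ↔ evC s.reg s.mem c := by
  induction c <;> simp_all [Cond.holds, evC, val_eq_ev]

/-- The values of safe expressions of cost `k`, and of their parts, are at most `k * V`. -/
lemma peak_le (hV : 2 ≤ V) {s : MState Reg Arr} (hb : Bd V s.reg s.mem) (e : E)
    (hs : safeE V s.reg s.mem e) : e.val s ≤ e.cost * V ∧ e.peak s ≤ e.cost * V := by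
  have hm : ∀ k, V ≤ (k + 1) * V := fun k => Nat.le_mul_of_pos_left V (by omega)
  induction e with
  | lit k =>
    have : k ≤ 2 := hs
    simp only [Exp.val, Exp.cost, Exp.peak]; omega
  | var x => have := hb.1 x; simpa [Exp.val, Exp.cost, Exp.peak] using this
  | get a e ih =>
    have h := ih hs
    have := hb.2 a (e.val s)
    have := hm e.cost
    simp only [Exp.val, Exp.cost, Exp.peak]
    refine ⟨by omega, max_le ?_ (by omega)⟩
    exact h.2.trans (Nat.mul_le_mul_right _ (by omega))
  | add e f ihe ihf =>
    have h1 := ihe hs.1; have h2 := ihf hs.2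
    simp only [Exp.val, Exp.cost, Exp.peak, add_mul, one_mul]; omega
  | sub e f ihe ihf =>
    have h1 := ihe hs.1; have h2 := ihf hs.2
    simp only [Exp.val, Exp.cost, Exp.peak, add_mul, one_mul]; omega
  | mul e f ihe ihf =>
    have h1 := ihe hs.1; have h2 := ihf hs.2.1
    have h3 := hs.2.2
    simp only [← val_eq_ev] at h3
    simp only [Exp.val, Exp.cost, Exp.peak, add_mul, one_mul]; omega
  | div e f ihe ihf =>
    have h1 := ihe hs.1; have h2 := ihf hs.2
    have := Nat.div_le_self (e.val s) (f.val s)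
    simp only [Exp.val, Exp.cost, Exp.peak, add_mul, one_mul]; omega

lemma peakC_le (hV : 2 ≤ V) {s : MState Reg Arr} (hb : Bd V s.reg s.mem) (c : B)
    (hs : safeC V s.reg s.mem c) : c.peak s ≤ c.cost * V := by
  induction c with
  | and b c ihb ihc =>
    have h1 := ihb hs.1; have h2 := ihc hs.2
    simp only [Cond.cost, Cond.peak, add_mul, one_mul]; omega
  | _ e f =>
    have h1 := peak_le hV hb e hs.1; have h2 := peak_le hV hb f hs.2
    simp only [Cond.cost, Cond.peak, add_mul, one_mul]; omega

lemma Fits.charge (hV : 2 ≤ V) {s : MState Reg Arr} (h : Fits V M s) {c : B}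
    (hs : safeC V s.reg s.mem c) (hc : c.cost ≤ 60) (t : ℕ) : Fits V M (s.charge t (c.peak s)) :=
  ⟨h.bd, h.ext, max_le h.word ((peakC_le hV h.bd c hs).trans (Nat.mul_le_mul_right _ hc))⟩

/-- Soundness: the weakest precondition implies the existence of an execution. -/
theorem wp_sound (hV : 2 ≤ V) (p : S) (hp : maxCost p ≤ 60) : ∀ {Q : Post} {s : MState Reg Arr},
    Fits V M s → wp V M p Q s.reg s.mem s.time →
    ∃ t, Exec p s t ∧ Fits V M t ∧ t.cur = s.cur ∧ t.out = s.out ∧ Q t.reg t.mem t.time := by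
  induction p with
  | skip => intro Q s hs H; exact ⟨s, .skip s, hs, rfl, rfl, H⟩
  | assign x e =>
    intro Q s hs H
    refine ⟨_, .assign x e s, ⟨⟨fun y => ?_, hs.bd.2⟩, hs.ext, ?_⟩, rfl, rfl, ?_⟩
    · simp only [Function.update_apply]; split_ifs
      · rw [val_eq_ev]; exact H.2.1
      · exact hs.bd.1 y
    · exact max_le hs.word ((peak_le hV hs.bd e H.1).2.trans (Nat.mul_le_mul_right _ hp))
    · have := H.2.2
      simpa [val_eq_ev, MState.charge, add_assoc] using this
  | store a i e =>
    intro Q s hs H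
    have hp' : i.cost ≤ 60 ∧ e.cost ≤ 60 := by simpa [maxCost] using hp
    refine ⟨_, .store a i e s, ⟨⟨hs.bd.1, fun b k => ?_⟩, fun b => ?_, ?_⟩, rfl, rfl, ?_⟩
    · simp only [Function.update_apply]; split_ifs with h1
      · simp only [Function.update_apply]; split_ifs
        · rw [val_eq_ev]; exact H.2.2.2.1
        · exact hs.bd.2 _ _
      · exact hs.bd.2 _ _
    · simp only [Function.update_apply]; split_ifs with h1
      · have := H.2.2.1
        rw [val_eq_ev]
        exact max_le (hs.ext _) this
      · exact hs.ext b
    · exact max_le hs.word (max_le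
        ((peak_le hV hs.bd i H.1).2.trans (Nat.mul_le_mul_right _ hp'.1))
        ((peak_le hV hs.bd e H.2.1).2.trans (Nat.mul_le_mul_right _ hp'.2)))
    · have := H.2.2.2.2
      simpa [val_eq_ev, MState.charge, add_assoc] using this
  | seq p q ihp ihq =>
    intro Q s hs H
    have hp' : maxCost p ≤ 60 ∧ maxCost q ≤ 60 := by simpa [maxCost] using hp
    obtain ⟨u, hu, hu1, hu2, hu3, hu4⟩ := ihp hp'.1 hs H
    obtain ⟨v, hv, hv1, hv2, hv3, hv4⟩ := ihq hp'.2 hu1 hu4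
    exact ⟨v, .seq hu hv, hv1, hv2.trans hu2, hv3.trans hu3, hv4⟩
  | ite c p q ihp ihq =>
    intro Q s hs H
    have hp' : c.cost ≤ 60 ∧ maxCost p ≤ 60 ∧ maxCost q ≤ 60 := by simpa [maxCost] using hp
    have hs' := hs.charge hV H.1 hp'.1 (c.cost + 1)
    by_cases hc : c.holds s
    · obtain ⟨v, hv, hv1, hv2, hv3, hv4⟩ := ihp hp'.2.1 hs' (H.2.1 ((holds_iff_evC s c).1 hc))
      exact ⟨v, .ite_true hc hv, hv1, hv2, hv3, hv4⟩
    · obtain ⟨v, hv, hv1, hv2, hv3, hv4⟩ := ihq hp'.2.2 hs'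
        (H.2.2 fun h => hc ((holds_iff_evC s c).2 h))
      exact ⟨v, .ite_false hc hv, hv1, hv2, hv3, hv4⟩
  | loop c p ih =>
    intro Q s hs ⟨n, H⟩
    have hp' : c.cost ≤ 60 ∧ maxCost p ≤ 60 := by simpa [maxCost] using hp
    induction n generalizing s with
    | zero => exact H.elim
    | succ n ihn =>
      have hs' := hs.charge hV H.1 hp'.1 (c.cost + 1)
      by_cases hc : c.holds s
      · obtain ⟨u, hu, hu1, hu2, hu3, hu4⟩ := ih hp'.2 hs' (H.2.1 ((holds_iff_evC s c).1 hc))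
        obtain ⟨v, hv, hv1, hv2, hv3, hv4⟩ := ihn hu1 hu4
        exact ⟨v, .loop_true hc hu hv, hv1, hv2.trans hu2, hv3.trans hu3, hv4⟩
      · exact ⟨_, .loop_false hc, hs', rfl, rfl, H.2.2 fun h => hc ((holds_iff_evC s c).2 h)⟩
  | emit e => intro Q s hs H; exact H.elim
  | finish => intro Q s hs H; exact H.elim
end

end

/-! ### Prefix and suffix positions of common subsequences -/

section

/-- A pair of strings in normal form: `S s 1, ..., S s (n s)` are the characters of the string `s`.
Each of the least character `1` and the greatest character `σ` occurs exactly once, at the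
beginning and at the end, respectively. -/
structure Inst : Type where
  S : Side → ℕ → ℕ
  n : Side → ℕ
  σ : ℕ
  two_le : ∀ s, 2 ≤ n s
  two_le_σ : 2 ≤ σ
  first : ∀ s, S s 1 = 1
  last : ∀ s, S s (n s) = σ
  mid : ∀ s i, 1 < i → i < n s → 1 < S s i ∧ S s i < σ

@[simp] lemma Side.other_x : Side.other .x = .y := rfl
@[simp] lemma Side.other_y : Side.other .y = .x := rfl
@[simp] lemma Side.other_other (s : Side) : s.other.other = s := by cases s <;> rfl

lemma Side.forall {p : Side → Prop} : (∀ s, p s) ↔ p .x ∧ p .y :=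
  ⟨fun h => ⟨h _, h _⟩, fun h s => by cases s; exacts [h.1, h.2]⟩

lemma Side.forall_other {p : Side → Prop} (s : Side) (h : p s) (h' : p s.other) : ∀ t, p t := by
  cases s <;> (intro t; cases t <;> assumption)

namespace Inst
variable (I : Inst)

lemma S_pos {s : Side} {i : ℕ} (h1 : 1 ≤ i) (h2 : i ≤ I.n s) : 1 ≤ I.S s i ∧ I.S s i ≤ I.σ := by
  have := I.two_le_σ
  rcases h1.eq_or_lt with rfl | h1
  · rw [I.first]; omega
  rcases h2.eq_or_lt with rfl | h2
  · rw [I.last]; omega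
  have := I.mid s i h1 h2; omega

lemma eq_n_of_S {s : Side} {i : ℕ} (h1 : 1 ≤ i) (h2 : i ≤ I.n s) (h : I.S s i = I.σ) :
    i = I.n s := by
  by_contra h3
  have := I.two_le_σ
  rcases h1.eq_or_lt with rfl | h1
  · rw [I.first] at h; omega
  have := I.mid s i h1 (by omega); omega

open Classical in
/-- The least index greater than `h` at which `c` occurs in the string `s`; the length plus one if
there is none. -/
noncomputable def nxt (s : Side) (c h : ℕ) : ℕ :=
  if H : ∃ i, h < i ∧ i ≤ I.n s ∧ I.S s i = c then Nat.find H else I.n s + 1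

open Classical in
/-- The greatest index less than `g` at which `c` occurs in the string `s`; `0` if there is
none. -/
noncomputable def prv (s : Side) (c g : ℕ) : ℕ :=
  Nat.findGreatest (fun i => 1 ≤ i ∧ i < g ∧ I.S s i = c) (I.n s)

variable {I}
variable {s : Side} {c d g h i : ℕ} {A B Z : List ℕ}

lemma nxt_le_succ : I.nxt s c h ≤ I.n s + 1 := by
  unfold nxt; split_ifs with H
  · have := (Nat.find_spec H).2.1; omega
  · exact le_rfl

lemma nxt_spec (H : I.nxt s c h ≤ I.n s) : h < I.nxt s c h ∧ I.S s (I.nxt s c h) = c := by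
  unfold nxt at *; split_ifs at * with H'
  · exact ⟨(Nat.find_spec H').1, (Nat.find_spec H').2.2⟩
  · omega

lemma nxt_le (h1 : h < i) (h2 : i ≤ I.n s) (h3 : I.S s i = c) : I.nxt s c h ≤ i := by
  unfold nxt; split_ifs with H
  · exact Nat.find_min' H ⟨h1, h2, h3⟩
  · exact absurd ⟨i, h1, h2, h3⟩ H

lemma nxt_eq (h1 : h < i) (h2 : i ≤ I.n s) (h3 : I.S s i = c)
    (h4 : ∀ k, h < k → k < i → I.S s k ≠ c) : I.nxt s c h = i := by
  have h5 := nxt_le h1 h2 h3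
  have h6 := nxt_spec (h5.trans h2)
  by_contra h7
  exact h4 _ h6.1 (by omega) h6.2

lemma nxt_eq_succ (h4 : ∀ k, h < k → k ≤ I.n s → I.S s k ≠ c) : I.nxt s c h = I.n s + 1 := by
  by_contra h5
  have := @nxt_le_succ I s c h
  have h6 := nxt_spec (I := I) (s := s) (c := c) (h := h) (by omega)
  exact h4 _ h6.1 (by omega) h6.2

lemma lt_nxt (hh : h ≤ I.n s) : h < I.nxt s c h := by
  by_cases H : I.nxt s c h ≤ I.n s
  · exact (nxt_spec H).1
  · omega

lemma le_nxt (hh : h ≤ I.n s + 1) : h ≤ I.nxt s c h := by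
  by_cases H : I.nxt s c h ≤ I.n s
  · exact (nxt_spec H).1.le
  · omega

lemma nxt_mono (hg : g ≤ h) : I.nxt s c g ≤ I.nxt s c h := by
  by_cases H : I.nxt s c h ≤ I.n s
  · have := nxt_spec H
    exact nxt_le (by omega) H this.2
  · have := @nxt_le_succ I s c g; omega

lemma prv_le : I.prv s c g ≤ I.n s := by classical exact Nat.findGreatest_le _

lemma prv_spec (H : 1 ≤ I.prv s c g) : I.prv s c g < g ∧ I.S s (I.prv s c g) = c := by
  classical
  have := Nat.findGreatest_of_ne_zero (P := fun i => 1 ≤ i ∧ i < g ∧ I.S s i = c) (n := I.n s)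
    (m := I.prv s c g) (by unfold prv; congr) (by omega)
  exact this.2

lemma le_prv (h1 : 1 ≤ i) (h2 : i < g) (h3 : i ≤ I.n s) (h4 : I.S s i = c) : i ≤ I.prv s c g := by
  classical
  exact Nat.le_findGreatest (P := fun i => 1 ≤ i ∧ i < g ∧ I.S s i = c) h3 ⟨h1, h2, h4⟩

lemma prv_eq (h1 : 1 ≤ i) (h2 : i < g) (h3 : i ≤ I.n s) (h4 : I.S s i = c)
    (h5 : ∀ k, i < k → k < g → I.S s k ≠ c) : I.prv s c g = i := by
  have h6 := le_prv h1 h2 h3 h4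
  have h7 := prv_spec (h1.trans h6)
  by_contra h8
  exact h5 _ (by omega) h7.1 h7.2

/-- Next and previous occurrences form a Galois connection. -/
lemma nxt_lt_iff (hg : g ≤ I.n s + 1) : I.nxt s c h < g ↔ h < I.prv s c g := by
  constructor
  · intro H
    have := nxt_spec (I := I) (s := s) (c := c) (h := h) (by omega)
    have := le_prv (I := I) (by omega) H (by omega) this.2
    omega
  · intro H
    have := prv_spec (I := I) (s := s) (c := c) (g := g) (by omega)
    have := nxt_le H prv_le this.2
    omega

lemma prv_mono (hg : g ≤ h) : I.prv s c g ≤ I.prv s c h := by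
  by_cases H : 1 ≤ I.prv s c g
  · have := prv_spec H
    exact le_prv H (by omega) prv_le this.2
  · omega

variable (I) in
/-- The length of the shortest prefix of the string `s` that contains `Z`; the length of `s` plus
one if there is none. -/
noncomputable def pre (s : Side) (Z : List ℕ) : ℕ := Z.foldl (fun h c => I.nxt s c h) 0

variable (I) in
/-- The first index of the shortest suffix of the string `s` that contains `Z`; `0` if there is
none. -/
noncomputable def suf (s : Side) (Z : List ℕ) : ℕ :=
  Z.foldr (fun c g => I.prv s c g) (I.n s + 1)

variable (I) in
/-- `Z` is a common subsequence. -/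
def CS (Z : List ℕ) : Prop := ∀ s, I.pre s Z ≤ I.n s

variable (I) in
/-- `Z` is a maximal common subsequence. -/
def MCS (Z : List ℕ) : Prop := I.CS Z ∧ ∀ A B d, Z = A ++ B → ¬ I.CS (A ++ d :: B)

@[simp] lemma pre_nil : I.pre s [] = 0 := rfl
@[simp] lemma suf_nil : I.suf s [] = I.n s + 1 := rfl
@[simp] lemma suf_cons : I.suf s (c :: Z) = I.prv s c (I.suf s Z) := rfl

@[simp] lemma pre_concat : I.pre s (Z ++ [c]) = I.nxt s c (I.pre s Z) := by simp [pre]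

lemma suf_le_succ : I.suf s Z ≤ I.n s + 1 := by
  cases Z with
  | nil => exact le_rfl
  | cons c Z => exact prv_le.trans (by omega)

lemma pre_le_succ : I.pre s Z ≤ I.n s + 1 := by
  rcases Z.eq_nil_or_concat' with rfl | ⟨Z, c, rfl⟩
  · simp
  · rw [pre_concat]; exact nxt_le_succ

/-- Greedy matching from the left succeeds if and only if greedy matching from the right does. -/
lemma foldl_nxt_le_iff : ∀ (Z : List ℕ) (h : ℕ),
    Z.foldl (fun h c => I.nxt s c h) h ≤ I.n s ↔ h < I.suf s Z
  | [], h => by simp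
  | c :: Z, h => by
    rw [List.foldl_cons, foldl_nxt_le_iff Z, suf_cons, nxt_lt_iff suf_le_succ]

lemma pre_append_le_iff : I.pre s (A ++ B) ≤ I.n s ↔ I.pre s A < I.suf s B := by
  rw [pre, List.foldl_append, foldl_nxt_le_iff]; rfl

/-- A string is a common subsequence if and only if `pref` of its first part is less than `suff` of its
second part. -/
lemma cs_append_iff : I.CS (A ++ B) ↔ ∀ s, I.pre s A < I.suf s B :=
  forall_congr' fun _ => pre_append_le_iff

lemma foldl_nxt_mono : ∀ (Z : List ℕ) {g h : ℕ}, g ≤ h →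
    Z.foldl (fun h c => I.nxt s c h) g ≤ Z.foldl (fun h c => I.nxt s c h) h
  | [], _, _, hg => hg
  | _ :: Z, _, _, hg => foldl_nxt_mono Z (nxt_mono hg)

lemma pre_insert_le : I.pre s (A ++ B) ≤ I.pre s (A ++ d :: B) := by
  rw [pre, pre, List.foldl_append, List.foldl_append, List.foldl_cons]
  exact foldl_nxt_mono B (le_nxt pre_le_succ)

lemma pre_append_left_le : I.pre s A ≤ I.pre s (A ++ B) := by
  induction B using List.reverseRecOn with
  | nil => simp
  | append_singleton B c ih =>
    rw [← List.append_assoc, pre_concat]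
    exact ih.trans (le_nxt pre_le_succ)

lemma suf_append_mono : ∀ (A : List ℕ) {B B' : List ℕ}, I.suf s B ≤ I.suf s B' →
    I.suf s (A ++ B) ≤ I.suf s (A ++ B')
  | [], _, _, hB => hB
  | _ :: A, _, _, hB => prv_mono (suf_append_mono A hB)

lemma suf_cons_le : I.suf s (d :: B) ≤ I.suf s B := by
  by_cases h : 1 ≤ I.prv s d (I.suf s B)
  · exact (prv_spec h).1.le
  · simp only [suf_cons]; omega

lemma suf_insert_le : I.suf s (A ++ d :: B) ≤ I.suf s (A ++ B) := suf_append_mono A suf_cons_le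

lemma CS.of_append (h : I.CS (A ++ B)) : I.CS A := fun s => pre_append_left_le.trans (h s)

lemma S_pre (h : I.pre s (Z ++ [c]) ≤ I.n s) : I.S s (I.pre s (Z ++ [c])) = c := by
  rw [pre_concat] at *; exact (nxt_spec h).2

lemma pre_lt_concat (h : I.pre s Z ≤ I.n s) : I.pre s Z < I.pre s (Z ++ [c]) := by
  rw [pre_concat]; exact lt_nxt h

lemma length_le_pre : I.pre s Z ≤ I.n s → Z.length ≤ I.pre s Z := by
  induction Z using List.reverseRecOn with
  | nil => simp
  | append_singleton Z c ih =>
    intro h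
    have h1 := (pre_append_left_le (I := I) (s := s) (A := Z) (B := [c])).trans h
    have := pre_lt_concat (c := c) h1
    have := ih h1
    rw [List.length_append, List.length_singleton]; omega

variable (I) in
/-- The string `s` from index `h + 1` on, as a list. -/
def drop (s : Side) (h : ℕ) : List ℕ := (List.range' (h + 1) (I.n s - h)).map (I.S s)

/-- Greedy matching decides whether a string is a subsequence. -/
lemma foldl_nxt_le_iff_sublist : ∀ (k h : ℕ) (Z : List ℕ), I.n s - h = k → h ≤ I.n s →
    (Z.foldl (fun h c => I.nxt s c h) h ≤ I.n s ↔ Z.Sublist (I.drop s h)) := by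
  intro k
  induction k with
  | zero =>
    intro h Z hk hh
    have : I.drop s h = [] := by simp [drop, hk]
    rw [this, List.sublist_nil]
    cases Z with
    | nil => simpa using hh
    | cons c Z =>
      rw [foldl_nxt_le_iff]
      have := @prv_le I s c (I.suf s Z)
      simp; omega
  | succ k ih =>
    intro h Z hk hh
    have hd : I.drop s h = I.S s (h + 1) :: I.drop s (h + 1) := by
      rw [drop, drop, hk, show I.n s - (h + 1) = k by omega, List.range'_succ, List.map_cons]
    cases Z with
    | nil => simpa using hh
    | cons c Z =>
      rw [hd]
      by_cases hc : c = I.S s (h + 1)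
      · have : I.nxt s c h = h + 1 :=
          nxt_eq (by omega) (by omega) hc.symm fun k h1 h2 => by omega
        rw [List.foldl_cons, this, ih (h + 1) Z (by omega) (by omega), hc,
          List.cons_sublist_cons]
      · have : I.nxt s c h = I.nxt s c (h + 1) := by
          refine le_antisymm (nxt_mono (by omega)) ?_
          by_cases H : I.nxt s c h ≤ I.n s
          · have h1 := nxt_spec H
            refine nxt_le ?_ H h1.2
            by_contra h2
            have h3 : I.nxt s c h = h + 1 := by omega
            rw [h3] at h1; exact hc h1.2.symm
          · have := @nxt_le_succ I s c (h + 1); omega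
        have h2 := ih (h + 1) (c :: Z) (by omega) (by omega)
        rw [List.foldl_cons, this, ← List.foldl_cons (f := fun h c => I.nxt s c h), h2]
        constructor
        · exact fun h => h.cons _
        · intro h
          cases h with
          | cons _ h => exact h
          | cons_cons _ h => exact absurd rfl hc

lemma pre_le_iff_sublist : I.pre s Z ≤ I.n s ↔ Z.Sublist (I.drop s 0) :=
  foldl_nxt_le_iff_sublist _ 0 Z rfl (Nat.zero_le _)

variable (I) in
/-- There are only finitely many common subsequences. -/
lemma finite_mcs : {Z | I.MCS Z}.Finite := by
  refine Set.Finite.subset (List.finite_toSet (I.drop .x 0).sublists) fun Z hZ => ?_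
  exact List.mem_sublists.2 (pre_le_iff_sublist.1 (hZ.1 .x))

/-! ### Witnesses of extensibility -/

variable (I) in
/-- `v` is a match. -/
def Match (v : Side → ℕ) : Prop :=
  (∀ s, 1 ≤ v s ∧ v s ≤ I.n s) ∧ I.S .x (v .x) = I.S .y (v .y)

lemma Match.eq {v : Side → ℕ} (h : I.Match v) (s t : Side) : I.S s (v s) = I.S t (v t) := by
  have := h.2
  cases s <;> cases t <;> simp [this]

variable (I) in
/-- Suff-matches. Each of them arises from the pair of final positions by going to the previous
occurrences of a common character, repeatedly. -/
inductive SM : (Side → ℕ) → Prop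
  | base : SM I.n
  | step {u v : Side → ℕ} : SM v → I.Match u →
      (∀ s, u s < v s ∧ ∀ i, u s < i → i < v s → I.S s i ≠ I.S s (u s)) → SM u

lemma SM.match {v : Side → ℕ} (h : I.SM v) : I.Match v := by
  cases h with
  | base => exact ⟨fun s => ⟨(by have := I.two_le s; omega), le_rfl⟩, by rw [I.last, I.last]⟩
  | step _ h => exact h

/-- Suff-matches, defined recursively, are of the form `suff(W)`. -/
lemma SM.exists_suf {v : Side → ℕ} (h : I.SM v) :
    ∃ c W, (∀ s, I.S s (v s) = c) ∧ ∀ s, I.suf s (c :: W) = v s := by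
  induction h with
  | base =>
    refine ⟨I.σ, [], fun s => I.last s, fun s => ?_⟩
    have := I.two_le s
    exact prv_eq (by omega) (by simp) le_rfl (I.last s) fun k h1 h2 => by simp at h2; omega
  | @step u v hv hm hu ih =>
    obtain ⟨c, W, h1, h2⟩ := ih
    refine ⟨I.S .x (u .x), c :: W, fun s => hm.eq _ _, fun s => ?_⟩
    rw [suf_cons, h2]
    exact prv_eq (hm.1 s).1 (hu s).1 (hm.1 s).2 (hm.eq _ _)
      fun k h3 h4 h5 => (hu s).2 k h3 h4 (h5.trans (hm.eq _ _))

/-- `suff(W)` is a suff-match for each common subsequence `W` that ends with the last character. -/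
lemma SM.of_suf : ∀ {W : List ℕ}, (∀ s, 1 ≤ I.suf s (W ++ [I.σ])) →
    I.SM fun s => I.suf s (W ++ [I.σ])
  | [], _ => by
    convert SM.base with s
    have := I.two_le s
    exact prv_eq (by omega) (by simp) le_rfl (I.last s) fun k h1 h2 => by simp at h2; omega
  | c :: W, h => by
    have h1 : ∀ s, 1 ≤ I.suf s (W ++ [I.σ]) := fun s => (h s).trans suf_cons_le
    refine SM.step (SM.of_suf h1) ⟨fun s => ⟨h s, prv_le⟩, ?_⟩ fun s => ?_
    · exact (prv_spec (h .x)).2.trans (prv_spec (h .y)).2.symm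
    · have h2 := prv_spec (h s)
      refine ⟨h2.1, fun i h3 h4 h5 => ?_⟩
      have h6 := le_prv (by omega) h4 ?_ (h5.trans h2.2)
      · exact absurd h3 (by simpa using h6)
      · have := @suf_le_succ I s (W ++ [I.σ]); omega

variable (I) in
/-- There is a witness with character `c`: a suff-match `v` such that `P ≺ v ≤ F`. -/
def HasWit (P F : Side → ℕ) (c : ℕ) : Prop :=
  ∃ v, I.SM v ∧ (∀ s, I.S s (v s) = c) ∧ (∀ s, P s < v s ∧ v s ≤ F s) ∧
    ¬ ∃ w, I.Match w ∧ ∀ s, P s < w s ∧ w s < v s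

variable (I) in
/-- `P` is `pref(Z)`, and `F` can serve as `safe(Z)`: its coordinates are lower bounds for those of
`pref(Z*)`, where `Z*` is obtained from `Z` by inserting a character and the other coordinate is
the same as that of `pref(Z)`, and if they are not greater than the lengths, they are upper
bounds for such coordinates. -/
structure IsSafe (Z : List ℕ) (P F : Side → ℕ) : Prop where
  pre_eq : ∀ s, P s = I.pre s Z
  le_succ : ∀ s, F s ≤ I.n s + 1
  exists_le : ∀ s, F s ≤ I.n s → ∃ A B d, Z = A ++ B ∧ I.pre s (A ++ d :: B) ≤ F s ∧
    I.pre s.other (A ++ d :: B) ≤ P s.other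
  le_pre : ∀ s A B d, Z = A ++ B → I.pre s (A ++ d :: B) ≤ I.n s →
    I.pre s.other (A ++ d :: B) = P s.other → F s ≤ I.pre s (A ++ d :: B)

variable (I) in
/-- `Z` is a prefix of a maximal common subsequence. -/
def IsPrefix (Z : List ℕ) : Prop := ∃ W, I.MCS (Z ++ W)

/-- As both strings end with the greatest character, so does every maximal common subsequence. -/
lemma MCS.ends (h : I.MCS Z) : ∃ W, Z = W ++ [I.σ] := by
  rcases Z.eq_nil_or_concat' with rfl | ⟨W, c, rfl⟩
  · exfalso
    refine h.2 [] [] I.σ rfl fun s => ?_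
    exact nxt_le (by have := I.two_le s; omega) le_rfl (I.last s)
  · refine ⟨W, ?_⟩
    by_contra hc
    have hc' : c ≠ I.σ := fun h => hc (by rw [h])
    refine h.2 (W ++ [c]) [] I.σ (by simp) fun s => ?_
    rw [pre_concat]
    have h1 := h.1 s
    have h2 := S_pre h1
    refine nxt_le ?_ le_rfl (I.last s)
    refine lt_of_le_of_ne h1 fun h3 => hc' ?_
    rw [← h2, h3, I.last]

lemma pre_eq_n_of_last (h : I.CS (Z ++ [I.σ])) (s : Side) : I.pre s (Z ++ [I.σ]) = I.n s := by
  have h1 := S_pre (h s)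
  have h2 := h s
  refine I.eq_n_of_S ?_ h2 h1
  have := pre_lt_concat (I := I) (s := s) (Z := Z) (c := I.σ)
    (pre_append_left_le.trans h2)
  omega

lemma MCS.eq_of_prefix_last (h : I.MCS (Z ++ [I.σ] ++ B)) : B = [] := by
  cases B with
  | nil => rfl
  | cons c B =>
    exfalso
    have h1 := cs_append_iff.1 h.1 .x
    rw [pre_eq_n_of_last h.1.of_append, suf_cons] at h1
    have := @prv_le I .x c (I.suf .x B)
    omega

/-- As both strings start with the least character, so does every maximal common subsequence. -/
lemma MCS.starts (h : I.MCS Z) : ∃ W, Z = [1] ++ W := by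
  cases Z with
  | nil => obtain ⟨W, hW⟩ := h.ends; simp at hW
  | cons c W =>
    refine ⟨W, ?_⟩
    by_contra hc
    have hc' : c ≠ 1 := fun h => hc (by rw [h]; rfl)
    refine h.2 [] (c :: W) 1 rfl ?_
    have h0 : I.CS ([c] ++ W) := h.1
    show I.CS ([1] ++ c :: W)
    rw [cs_append_iff] at h0 ⊢
    intro s
    have h1 : I.pre s [1] ≤ 1 := nxt_le (by omega) (by have := I.two_le s; omega) (I.first s)
    have h2 : I.CS ([] ++ c :: W) := h.1
    have h3 := cs_append_iff.1 h2 s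
    simp only [pre_nil] at h3
    have h4 := prv_spec (I := I) (s := s) (c := c) (g := I.suf s W) h3
    rw [suf_cons] at *
    rcases Nat.lt_or_ge 1 (I.prv s c (I.suf s W)) with h5 | h5
    · omega
    · exfalso; apply hc'
      rw [← h4.2, show I.prv s c (I.suf s W) = 1 by omega, I.first]

/-- The criterion for extensibility by a character. -/
theorem isPrefix_concat_iff {P F : Side → ℕ} (hZ : I.IsPrefix Z) (hF : I.IsSafe Z P F) (c : ℕ) :
    I.IsPrefix (Z ++ [c]) ↔ I.HasWit P F c := by
  have hP := hF.pre_eq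
  constructor
  · rintro ⟨W, hW⟩
    have hW' : I.MCS (Z ++ c :: W) := by simpa using hW
    have hcs := cs_append_iff.1 hW'.1
    obtain ⟨U, hU⟩ : ∃ U, c :: W = U ++ [I.σ] := by
      obtain ⟨U, hU⟩ := hW'.ends
      rcases (c :: W).eq_nil_or_concat' with h | ⟨W', e, h⟩
      · simp at h
      · rw [h, ← List.append_assoc] at hU
        have := List.append_inj_right' hU (by simp)
        exact ⟨W', by rw [h, this]⟩
    have hpos : ∀ s, 1 ≤ I.suf s (c :: W) := fun s => (Nat.zero_le _).trans_lt (hcs s)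
    refine ⟨fun s => I.suf s (c :: W), ?_, fun s => (prv_spec (hpos s)).2, fun s => ⟨?_, ?_⟩, ?_⟩
    · rw [hU] at hpos ⊢; exact SM.of_suf hpos
    · rw [hP]; exact hcs s
    · by_contra hlt
      have hsuf := @prv_le I s c (I.suf s W)
      simp only [suf_cons, not_le] at hlt hsuf
      obtain ⟨A, B, d, h1, h2, h3⟩ := hF.exists_le s (by omega)
      refine hW'.2 A (B ++ c :: W) d (by rw [h1, List.append_assoc]) ?_
      have : I.CS ((A ++ d :: B) ++ c :: W) := by
        rw [cs_append_iff]
        refine Side.forall_other s ?_ ?_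
        · rw [suf_cons]; omega
        · have := hcs s.other
          rw [hP] at h3; omega
      simpa using this
    · rintro ⟨w, hm, hw⟩
      refine hW'.2 Z (c :: W) (I.S .x (w .x)) rfl ?_
      have : I.CS ((Z ++ [I.S .x (w .x)]) ++ c :: W) := by
        rw [cs_append_iff]
        intro s
        rw [pre_concat]
        refine (nxt_le ?_ (hm.1 s).2 (hm.eq _ _)).trans_lt (hw s).2
        rw [← hP]; exact (hw s).1
      simpa using this
  · rintro ⟨v, hv, hvc, hvb, hno⟩
    classical
    -- Among the strings `W` such that `Z c W` is a common subsequence and `suff(c W) ≤ v`, a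
    -- longest one makes `Z c W` maximal.
    let p : ℕ → Prop := fun k => ∃ W, W.length = k ∧ I.CS (Z ++ c :: W) ∧
      ∀ s, I.suf s (c :: W) ≤ v s
    have hex : ∃ k, p k := by
      obtain ⟨e, W, h1, h2⟩ := hv.exists_suf
      obtain rfl : e = c := (h1 .x).symm.trans (hvc .x)
      refine ⟨_, W, rfl, cs_append_iff.2 fun s => ?_, fun s => (h2 s).le⟩
      rw [h2, ← hP]; exact (hvb s).1
    have hbd : ∀ k, p k → k ≤ I.n .x := by
      rintro k ⟨W, rfl, h, -⟩
      have := (length_le_pre (h .x)).trans (h .x)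
      simp at this; omega
    obtain ⟨k, hk⟩ := hex
    have hmax := Nat.findGreatest_spec (hbd k hk) hk
    have hmax' : ∀ W, I.CS (Z ++ c :: W) → (∀ s, I.suf s (c :: W) ≤ v s) →
        W.length ≤ Nat.findGreatest p (I.n .x) := fun W h1 h2 =>
      Nat.le_findGreatest (hbd _ ⟨W, rfl, h1, h2⟩) ⟨W, rfl, h1, h2⟩
    obtain ⟨W, hWl, hW1, hW2⟩ := hmax
    rw [← hWl] at hmax'
    refine ⟨W, by simpa using hW1, fun A B d hAB hins => ?_⟩
    have hAB' : Z ++ c :: W = A ++ B := by simpa using hAB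
    rcases List.append_eq_append_iff.1 hAB' with ⟨R, hR1, hR2⟩ | ⟨R, hR1, hR2⟩
    · cases R with
      | nil =>
        simp only [List.append_nil, List.nil_append] at hR1 hR2
        subst hR1; subst hR2
        have h0 : I.CS ((A ++ [d]) ++ c :: W) := by simpa using hins
        rw [cs_append_iff] at h0
        have h1 := (cs_append_iff.2 h0).of_append
        refine hno ⟨fun s => I.pre s (A ++ [d]), ⟨fun s => ⟨?_, h1 s⟩, ?_⟩, fun s => ⟨?_, ?_⟩⟩
        · exact Nat.one_le_iff_ne_zero.2 (pre_lt_concat (c := d) (h1.of_append s)).ne_bot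
        · show I.S .x (I.pre .x (A ++ [d])) = I.S .y (I.pre .y (A ++ [d]))
          rw [S_pre (h1 .x), S_pre (h1 .y)]
        · rw [hP]; exact pre_lt_concat (h1.of_append s)
        · exact (h0 s).trans_le (hW2 s)
      | cons e R =>
        rw [List.cons_append, List.cons.injEq] at hR2
        obtain ⟨rfl, hR2⟩ := hR2
        subst hR1; subst hR2
        have h1 : I.CS (Z ++ c :: (R ++ d :: B)) := by simpa using hins
        have := hmax' _ h1 fun s => (suf_insert_le (A := c :: R)).trans (hW2 s)
        simp at this
    · subst hR1; subst hR2
      have h0 : I.CS ((A ++ d :: R) ++ c :: W) := by simpa using hins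
      have h1 := h0.of_append
      rw [cs_append_iff] at h0
      have hlt : ∀ s, I.pre s (A ++ d :: R) < v s := fun s => (h0 s).trans_le (hW2 s)
      have hge : ∀ s, P s ≤ I.pre s (A ++ d :: R) := fun s => by rw [hP]; exact pre_insert_le
      have hne : ∀ s, I.pre s (A ++ d :: R) ≠ P s := by
        intro s h2
        have h3 := hF.le_pre s.other A R d rfl (h1 _) (by simpa using h2)
        have := hlt s.other
        have := (hvb s.other).2
        omega
      obtain ⟨T, e, hT⟩ : ∃ T e, A ++ d :: R = T ++ [e] := by
        rcases (A ++ d :: R).eq_nil_or_concat' with h | ⟨T, e, h⟩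
        · simp at h
        · exact ⟨T, e, h⟩
      refine hno ⟨fun s => I.pre s (A ++ d :: R), ⟨fun s => ⟨?_, h1 s⟩, ?_⟩, fun s => ⟨?_, hlt s⟩⟩
      · exact Nat.one_le_iff_ne_zero.2 ((hge s).lt_of_ne (hne s).symm).ne_bot
      · show I.S .x (I.pre .x (A ++ d :: R)) = I.S .y (I.pre .y (A ++ d :: R))
        rw [hT] at h1 ⊢
        rw [S_pre (h1 .x), S_pre (h1 .y)]
      · exact (hge s).lt_of_ne (hne s).symm

variable (I) in
/-- The set of coordinates on side `s` from which `safe(Z c)` is determined, where `P` and `F` are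
`pref(Z)` and `safe(Z)`, and `P'` is `pref(Z c)`. -/
def SafeCand (P F P' : Side → ℕ) (c : ℕ) (s : Side) (v : ℕ) : Prop :=
  (∃ k, P s.other < k ∧ k < P' s.other ∧ I.nxt s (I.S s.other k) (P s) ≤ I.n s ∧
    v = I.nxt s c (I.nxt s (I.S s.other k) (P s))) ∨ (F s ≤ I.n s ∧ v = I.nxt s c (F s))

/-- The recurrence for `safe`. -/
theorem IsSafe.concat {P F P' F' : Side → ℕ} {c : ℕ} (hF : I.IsSafe Z P F)
    (hc : I.IsPrefix (Z ++ [c])) (hP' : ∀ s, P' s = I.pre s (Z ++ [c]))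
    (h1 : ∀ s, F' s = I.n s + 1 ∨ I.SafeCand P F P' c s (F' s))
    (h2 : ∀ s v, I.SafeCand P F P' c s v → F' s ≤ v)
    (h3 : ∀ s, F' s ≤ I.n s + 1) : I.IsSafe (Z ++ [c]) P' F' := by
  have hP := hF.pre_eq
  obtain ⟨W, hW⟩ := hc
  have hcs : I.CS (Z ++ [c]) := hW.1.of_append
  have hcs' : I.CS Z := hcs.of_append
  refine ⟨hP', h3, fun s hs => ?_, fun s A B d hAB hn ho => ?_⟩
  · rcases h1 s with h | ⟨k, hk1, hk2, hk3, hk4⟩ | ⟨hk1, hk2⟩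
    · omega
    · refine ⟨Z, [c], I.S s.other k, rfl, ?_, ?_⟩
      · rw [show Z ++ I.S s.other k :: [c] = (Z ++ [I.S s.other k]) ++ [c] by simp, pre_concat,
          pre_concat, hk4, hP]
      · have h4 : k < P' s.other := hk2
        rw [show Z ++ I.S s.other k :: [c] = (Z ++ [I.S s.other k]) ++ [c] by simp, pre_concat,
          pre_concat]
        rw [hP'] at h4 ⊢
        have h5 : I.nxt s.other (I.S s.other k) (I.pre s.other Z) ≤ k :=
          nxt_le (by rw [← hP]; exact hk1) (h4.le.trans (hcs _)) rfl
        exact nxt_le (h5.trans_lt h4) (hcs _) (S_pre (hcs _))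
    · obtain ⟨A, B, d, rfl, h4, h5⟩ := hF.exists_le s hk1
      refine ⟨A, B ++ [c], d, by simp, ?_, ?_⟩
      · rw [show A ++ d :: (B ++ [c]) = (A ++ d :: B) ++ [c] by simp, pre_concat, hk2]
        exact nxt_mono h4
      · rw [show A ++ d :: (B ++ [c]) = (A ++ d :: B) ++ [c] by simp, pre_concat, hP',
          pre_concat, ← hP]
        exact nxt_mono h5
  · rcases B.eq_nil_or_concat' with rfl | ⟨B, e, rfl⟩
    · exfalso
      rw [List.append_nil] at hAB
      subst hAB
      have := pre_lt_concat (c := d) (hcs s.other)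
      rw [hP'] at ho; omega
    · rw [← List.append_assoc] at hAB
      obtain ⟨rfl, hce⟩ := List.append_inj' hAB rfl
      obtain rfl : c = e := by simpa using hce
      have hsplit : A ++ d :: (B ++ [c]) = (A ++ d :: B) ++ [c] := by simp
      rw [hsplit] at hn ho ⊢
      set Z1 := A ++ d :: B with hZ1
      have hn1 : I.pre s Z1 ≤ I.n s := pre_append_left_le.trans hn
      have hko : P s.other ≤ I.pre s.other Z1 := by rw [hP]; exact pre_insert_le
      have hks : P s ≤ I.pre s Z1 := by rw [hP]; exact pre_insert_le
      have hko' : I.pre s.other Z1 < P' s.other := by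
        rw [← ho]
        refine pre_lt_concat (pre_append_left_le.trans (b := I.pre s.other (Z1 ++ [c])) ?_)
        rw [ho, hP']; exact hcs _
      rw [pre_concat]
      rcases hko.eq_or_lt with hk | hk
      · have h4 := hF.le_pre s A B d rfl hn1 hk.symm
        exact (h2 s _ (Or.inr ⟨h4.trans hn1, rfl⟩)).trans (nxt_mono h4)
      · -- The last character of `Z1` occurs strictly between `pref(Z)` and `pref(Z c)`.
        obtain ⟨T, e, hT⟩ : ∃ T e, Z1 = T ++ [e] := by
          rcases Z1.eq_nil_or_concat' with h | ⟨T, e, h⟩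
          · simp [hZ1] at h
          · exact ⟨T, e, h⟩
        have hon : I.pre s.other Z1 ≤ I.n s.other := hko'.le.trans (by rw [hP']; exact hcs _)
        have he : I.S s.other (I.pre s.other Z1) = e := by
          rw [hT] at hon ⊢; exact S_pre hon
        have he' : I.S s (I.pre s Z1) = e := by rw [hT] at hn1 ⊢; exact S_pre hn1
        rcases hks.eq_or_lt with hs | hs
        · exfalso
          refine hW.2 A (B ++ [c] ++ W) d (by simp) ?_
          have : I.CS ((Z1 ++ [c]) ++ W) := by
            rw [cs_append_iff]
            have h5 := cs_append_iff.1 hW.1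
            refine Side.forall_other s ?_ ?_
            · have := h5 s
              rwa [pre_concat, ← hP, hs, ← pre_concat] at this
            · have := h5 s.other
              rwa [← hP', ← ho] at this
          simpa [hZ1] using this
        · have h4 : I.nxt s e (P s) ≤ I.pre s Z1 := nxt_le hs hn1 he'
          refine (h2 s _ (Or.inl ⟨_, hk, hko', ?_, rfl⟩)).trans ?_
          · rw [he]; exact h4.trans hn1
          · rw [he]; exact nxt_mono h4

lemma pre_one : I.pre s [1] = 1 :=
  nxt_eq (by omega) (by have := I.two_le s; omega) (I.first s) fun k h1 h2 => by omega

variable (I) in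
/-- There is a maximal common subsequence, namely a longest common subsequence. -/
lemma isPrefix_one : I.IsPrefix [1] := by
  classical
  let p : ℕ → Prop := fun k => ∃ Z, Z.length = k ∧ I.CS Z
  have hbd : ∀ k, p k → k ≤ I.n .x := by
    rintro k ⟨W, rfl, h⟩
    exact (length_le_pre (h .x)).trans (h .x)
  have h0 : p 0 := ⟨[], rfl, fun s => Nat.zero_le _⟩
  obtain ⟨Z, hl, hZ⟩ := Nat.findGreatest_spec (Nat.zero_le (I.n .x)) h0
  have hM : I.MCS Z := by
    refine ⟨hZ, fun A B d h h' => ?_⟩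
    have := Nat.le_findGreatest (P := p) (hbd _ ⟨A ++ d :: B, rfl, h'⟩) ⟨A ++ d :: B, rfl, h'⟩
    rw [← hl, h] at this
    simp at this
  obtain ⟨W, rfl⟩ := hM.starts
  exact ⟨W, hM⟩

variable (I) in
/-- There are no insertions into the string `1` that share a coordinate of `pref` with it, since they
are longer. -/
lemma isSafe_one : I.IsSafe [1] (fun _ => 1) (fun s => I.n s + 1) := by
  refine ⟨fun s => pre_one.symm, fun s => le_rfl, fun s h => by omega, fun s A B d h h1 h2 => ?_⟩
  exfalso
  have h3 : I.pre s.other (A ++ d :: B) ≤ I.n s.other := by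
    rw [h2]; have := I.two_le s.other; omega
  have h4 := length_le_pre h3
  have h5 := congrArg List.length h
  simp at h4 h5
  omega

end Inst
end

/-! ### Index lists and binary search -/

section

namespace Inst
variable (I : Inst)

/-- The number of occurrences of `c` at indices up to `h`. -/
def rk (s : Side) (c : ℕ) : ℕ → ℕ
  | 0 => 0
  | h + 1 => rk s c h + if h + 1 ≤ I.n s ∧ I.S s (h + 1) = c then 1 else 0

/-- The number of occurrences of `c`. -/
def count (s : Side) (c : ℕ) : ℕ := I.rk s c (I.n s)

/-- The number of occurrences of characters less than `c`. -/
def before (s : Side) (c : ℕ) : ℕ := ∑ d ∈ Finset.range c, I.count s d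

variable {I} {s : Side} {c d g h i j k t : ℕ}

lemma rk_mono (hg : g ≤ h) : I.rk s c g ≤ I.rk s c h := by
  induction hg with
  | refl => exact le_rfl
  | step _ ih => exact ih.trans (by simp [rk])

lemma rk_eq_count (hh : I.n s ≤ h) : I.rk s c h = I.count s c := by
  induction h, hh using Nat.le_induction with
  | base => rfl
  | succ h hh ih => simp [rk, ih, show ¬ h + 1 ≤ I.n s by omega]

lemma rk_le_count : I.rk s c h ≤ I.count s c := by
  rcases le_total h (I.n s) with hh | hh
  · exact rk_mono hh
  · exact (rk_eq_count hh).le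

lemma rk_le : I.rk s c h ≤ h := by
  induction h with
  | zero => simp [rk]
  | succ h ih => simp only [rk]; split_ifs <;> omega

lemma count_le : I.count s c ≤ I.n s := rk_le

lemma rk_lt_rk (h1 : g < h) (h2 : h ≤ I.n s) (h3 : I.S s h = c) : I.rk s c g < I.rk s c h := by
  obtain ⟨h, rfl⟩ : ∃ k, h = k + 1 := ⟨h - 1, by omega⟩
  have := rk_mono (I := I) (s := s) (c := c) (show g ≤ h by omega)
  simp only [rk, h2, h3, and_self, if_true]; omega

lemma rk_pos (h1 : 1 ≤ h) (h2 : h ≤ I.n s) (h3 : I.S s h = c) : 1 ≤ I.rk s c h := by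
  have := rk_lt_rk (g := 0) h1 h2 h3; omega

lemma exists_rk_eq (h1 : 1 ≤ t) (h2 : t ≤ I.count s c) :
    ∃ k, 1 ≤ k ∧ k ≤ I.n s ∧ I.S s k = c ∧ I.rk s c k = t := by
  suffices ∀ h, t ≤ I.rk s c h → ∃ k, 1 ≤ k ∧ k ≤ I.n s ∧ I.S s k = c ∧ I.rk s c k = t from
    this _ h2
  intro h
  induction h with
  | zero => intro h; simp [rk] at h; omega
  | succ h ih =>
    intro hh
    by_cases h3 : t ≤ I.rk s c h
    · exact ih h3
    · by_cases h4 : h + 1 ≤ I.n s ∧ I.S s (h + 1) = c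
      · refine ⟨h + 1, by omega, h4.1, h4.2, ?_⟩
        simp only [rk, h4, and_self, if_true] at hh ⊢; omega
      · simp only [rk, h4, if_false] at hh; omega

lemma eq_of_rk_eq (h1 : i ≤ I.n s) (h2 : j ≤ I.n s) (h3 : I.S s i = c) (h4 : I.S s j = c)
    (h5 : I.rk s c i = I.rk s c j) : i = j := by
  by_contra h6
  rcases Nat.lt_or_gt_of_ne h6 with h7 | h7
  · have := rk_lt_rk h7 h2 h4; omega
  · have := rk_lt_rk h7 h1 h3; omega

lemma nxt_eq_of_rk (h1 : k ≤ I.n s) (h2 : I.S s k = c) (h3 : I.rk s c k = I.rk s c h + 1) :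
    I.nxt s c h = k := by
  refine nxt_eq ?_ h1 h2 fun l hl hl' hS => ?_
  · by_contra h4
    have := rk_mono (I := I) (s := s) (c := c) (show k ≤ h by omega); omega
  · have := rk_lt_rk hl (by omega) hS
    have := rk_lt_rk hl' h1 h2
    omega

lemma nxt_eq_of_count (h3 : I.count s c ≤ I.rk s c h) : I.nxt s c h = I.n s + 1 := by
  refine nxt_eq_succ fun l hl hl' hS => ?_
  have := rk_lt_rk hl hl' hS
  have := @rk_le_count I s c l
  omega

lemma before_succ : I.before s (c + 1) = I.before s c + I.count s c := Finset.sum_range_succ _ _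

lemma count_zero : I.count s 0 = 0 := by
  by_contra h
  obtain ⟨k, h1, h2, h3, -⟩ := exists_rk_eq (I := I) (s := s) (c := 0) (t := 1) le_rfl (by omega)
  have := I.S_pos h1 h2; omega

lemma before_one : I.before s 1 = 0 := by simp [before, count_zero]

lemma before_mono (hc : c ≤ d) : I.before s c ≤ I.before s d :=
  Finset.sum_le_sum_of_subset (by simpa using hc)

lemma before_le : I.before s c ≤ I.n s := by
  suffices ∀ h, ∑ d ∈ Finset.range c, I.rk s d h ≤ h from this _
  intro h
  induction h with
  | zero => simp [rk]
  | succ h ih =>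
    simp only [rk, Finset.sum_add_distrib]
    have : ∑ d ∈ Finset.range c, (if h + 1 ≤ I.n s ∧ I.S s (h + 1) = d then 1 else 0) ≤ 1 := by
      by_cases hh : h + 1 ≤ I.n s
      · simp only [hh, true_and, Finset.sum_ite_eq]; split_ifs <;> omega
      · simp [hh]
    omega

/-- Different indices have different positions in the occurrence lists. -/
lemma before_add_rk_inj {i j : ℕ} (hi1 : 1 ≤ i) (hi : i ≤ I.n s) (hj1 : 1 ≤ j) (hj : j ≤ I.n s)
    (h : I.before s (I.S s i) + I.rk s (I.S s i) i = I.before s (I.S s j) + I.rk s (I.S s j) j) :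
    i = j := by
  have h1 := rk_pos hi1 hi rfl
  have h2 := rk_pos hj1 hj rfl
  have h3 := @rk_le_count I s (I.S s i) i
  have h4 := @rk_le_count I s (I.S s j) j
  rcases lt_trichotomy (I.S s i) (I.S s j) with h5 | h5 | h5
  · have := before_mono (I := I) (s := s) (Nat.succ_le_of_lt h5)
    rw [Nat.succ_eq_add_one, before_succ] at this; omega
  · rw [h5] at h; exact eq_of_rk_eq hi hj h5 rfl (by omega)
  · have := before_mono (I := I) (s := s) (Nat.succ_le_of_lt h5)
    rw [Nat.succ_eq_add_one, before_succ] at this; omega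

variable (I) in
/-- The bounds `V` on numbers and `M` on indices are large enough for the instance. -/
structure Big (V M : ℕ) : Prop where
  σ_le : I.σ ≤ I.n .x + I.n .y
  le_M : 20 * (I.n .x + I.n .y) + 20 ≤ M
  le_V : M ≤ V

lemma Big.n_le {V M : ℕ} (h : I.Big V M) (s : Side) : 20 * I.n s + 20 ≤ M := by
  have := h.le_M; cases s <;> omega

variable (I) in
/-- The arrays that depend on one of the strings contain what they should. -/
structure Idx (s : Side) (r : Reg → ℕ) (m : Arr → ℕ → ℕ) : Prop where
  len : r (.len s) = I.n s
  str : ∀ k, 1 ≤ k → k ≤ I.n s → m (.str s) k = I.S s k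
  cnt : ∀ c, m (.cnt s) c = I.count s c
  rank : ∀ k, 1 ≤ k → k ≤ I.n s → m (.rank s) k = I.rk s (I.S s k) k
  start : ∀ c, 1 ≤ c → c ≤ I.σ → m (.start s) c = I.before s c
  occ : ∀ k, 1 ≤ k → k ≤ I.n s →
    m (.occ s) (I.before s (I.S s k) + I.rk s (I.S s k) k) = k

lemma Idx.congr {r r' : Reg → ℕ} {m m' : Arr → ℕ → ℕ} (h : I.Idx s r m)
    (hr : r' (.len s) = r (.len s))
    (hm : ∀ a, a = Arr.str s ∨ a = Arr.cnt s ∨ a = Arr.rank s ∨ a = Arr.start s ∨ a = Arr.occ s →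
      m' a = m a) : I.Idx s r' m' := by
  refine ⟨hr.trans h.len, ?_, ?_, ?_, ?_, ?_⟩
  · rw [hm _ (by simp)]; exact h.str
  · rw [hm _ (by simp)]; exact h.cnt
  · rw [hm _ (by simp)]; exact h.rank
  · rw [hm _ (by simp)]; exact h.start
  · rw [hm _ (by simp)]; exact h.occ

end Inst

variable {I : Inst} {V M L : ℕ} {Q : Post} {r : Reg → ℕ} {m : Arr → ℕ → ℕ} {t : ℕ} {s : Side}

/-- Binary search in an occurrence list: register `rk` receives the number of occurrences of `c` up to
index `h`. The hypotheses on the expressions `c` and `h` say that their values do not depend on the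
registers used by the search. -/
lemma wp_countLE (hB : I.Big V M) (hI : I.Idx s r m) {c h : E} {vc vh : ℕ}
    (hc : ∀ r', (∀ x, x ≠ .rk → x ≠ .hi → x ≠ .mid → r' x = r x) →
      ev r' m c = vc ∧ safeE V r' m c)
    (hh : ∀ r', (∀ x, x ≠ .rk → x ≠ .hi → x ≠ .mid → r' x = r x) →
      ev r' m h = vh ∧ safeE V r' m h)
    (hcc : c.cost ≤ 6) (hhc : h.cost ≤ 6) (h1 : 1 ≤ vc) (h2 : vc ≤ I.σ) (hL : I.n s < 2 ^ L)
    (H : ∀ r' t', (∀ x, x ≠ .rk → x ≠ .hi → x ≠ .mid → r' x = r x) →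
      r' .rk = I.rk s vc vh → t' ≤ t + 60 * (L + 1) → Q r' m t') :
    wp V M (countLE s c h) Q r m t := by
  have hV1 := hB.n_le s
  have hV2 := hB.le_V
  have hcl := @Inst.count_le I s vc
  have hcr := @Inst.rk_le_count I s vc vh
  obtain ⟨e1, e2⟩ := hc (Function.update r .rk 0) (by simp +contextual)
  simp only [countLE, whl, ifs, put, rd, block_cons, block_single, wp_seq, wp_assign, safeE_zero,
    ev_zero, zero_le, true_and, safeE_get, ev_get, e1, e2, hI.cnt]
  refine ⟨by omega, ?_⟩
  refine wp_loop (fun r' m' t' => m' = m ∧ (∀ x, x ≠ .rk → x ≠ .hi → x ≠ .mid → r' x = r x) ∧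
    r' .rk ≤ I.rk s vc vh ∧ I.rk s vc vh ≤ r' .hi ∧ r' .hi ≤ I.count s vc ∧
    ∃ j, r' .hi - r' .rk < 2 ^ j ∧ j ≤ L ∧ t' + 60 * j ≤ t + 60 * L + 12)
    (fun r' _ => r' .hi - r' .rk) ?_ ?_ ?_ ?_
  · refine ⟨rfl, ?_, by simp, by simpa using hcr, by simp, L, ?_, le_rfl, ?_⟩
    · intro x h1 h2 h3; simp [h1, h2]
    · simp; omega
    · simp; omega
  · simp
  · rintro r' m' t' - ⟨rfl, hr, ha, hb, hd, j, hj1, hj2, hj3⟩ hlt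
    simp only [evC_lt, ev_var] at hlt
    obtain ⟨j, rfl⟩ : ∃ k, j = k + 1 := ⟨j - 1, by
      rcases j with _ | j
      · simp at hj1; omega
      · rfl⟩
    set q := (r' .rk + r' .hi + 1) / 2 with hq
    have hq1 : r' .rk < q := by omega
    have hq2 : q ≤ r' .hi := by omega
    have hs1 : r' .hi - q < 2 ^ j := by rw [pow_succ] at hj1; omega
    have hs2 : q - 1 - r' .rk < 2 ^ j := by rw [pow_succ] at hj1; omega
    obtain ⟨k, hk1, hk2, hk3, hk4⟩ := Inst.exists_rk_eq (I := I) (s := s) (c := vc) (t := q)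
      (by omega) (by omega)
    have hocc := hI.occ k hk1 hk2
    rw [hk3, hk4] at hocc
    obtain ⟨e1, e2⟩ := hc (Function.update r' .mid q) (by
      intro x h1 h2 h3; simp [h3, hr x h1 h2 h3])
    obtain ⟨e3, e4⟩ := hh (Function.update r' .mid q) (by
      intro x h1 h2 h3; simp [h3, hr x h1 h2 h3])
    have hrk : (k ≤ vh) ↔ q ≤ I.rk s vc vh := by
      constructor
      · intro h; rw [← hk4]; exact Inst.rk_mono h
      · intro h; by_contra h'
        have := Inst.rk_lt_rk (show vh < k by omega) hk2 hk3; omega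
    simp only [wp_seq, wp_assign, safeE_div, safeE_add, safeE_var, safeE_one, safeE_two, and_self, true_and, ev_div, ev_add, ev_var, ev_one, ev_two, ← hq, wp_ite, safeC_le,
      safeE_get, e2, e4, evC_le, ev_get, e1, e3, hI.start vc h1 h2, Function.update_self, hocc,
      safeE_sub, ev_sub, cost_div, cost_add, cost_var, cost_one, cost_two, cost_sub, cost_get,
      costC_le, costC_lt, hrk]
    refine ⟨by omega, fun hle => ⟨by omega, ⟨?_, hle, ?_, ?_, j, ?_, by omega, by omega⟩, ?_⟩,
      fun hle => ⟨by omega, ⟨?_, ?_, by omega, by omega, j, ?_, by omega, by omega⟩, ?_⟩⟩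
    · intro x h1 h2 h3; simp [h1, h3, hr x h1 h2 h3]
    on_goal 5 => intro x h1 h2 h3; simp [h2, h3, hr x h1 h2 h3]
    all_goals simp; omega
  · rintro r' m' t' - ⟨rfl, hr, ha, hb, hd, j, hj1, hj2, hj3⟩ hlt
    simp only [evC_lt, ev_var] at hlt
    refine H _ _ hr (by omega) ?_
    simp; omega

/-- Register `nx` receives the next occurrence of `c` after index `h`. -/
lemma wp_nextQ (hB : I.Big V M) (hI : I.Idx s r m) {c h : E} {vc vh : ℕ}
    (hc : ∀ r', (∀ x, x ≠ .rk → x ≠ .hi → x ≠ .mid → r' x = r x) →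
      ev r' m c = vc ∧ safeE V r' m c)
    (hh : ∀ r', (∀ x, x ≠ .rk → x ≠ .hi → x ≠ .mid → r' x = r x) →
      ev r' m h = vh ∧ safeE V r' m h)
    (hcc : c.cost ≤ 6) (hhc : h.cost ≤ 6) (h1 : 1 ≤ vc) (h2 : vc ≤ I.σ) (hL : I.n s < 2 ^ L)
    (H : ∀ r' t', (∀ x, x ≠ .rk → x ≠ .hi → x ≠ .mid → x ≠ .nx → r' x = r x) →
      r' .nx = I.nxt s vc vh → t' ≤ t + 100 * (L + 1) → Q r' m t') :
    wp V M (nextQ s c h) Q r m t := by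
  have hV1 := hB.n_le s
  have hV2 := hB.le_V
  rw [nextQ, block_cons, block_single, wp_seq]
  refine wp_countLE hB hI hc hh hcc hhc h1 h2 hL fun r' t' hr hrk ht => ?_
  obtain ⟨e1, e2⟩ := hc r' hr
  simp only [ifs, rd, put, block_single, wp_ite, safeC_lt, safeE_var, safeE_get, e2, and_self,
    evC_lt, ev_var, ev_get, e1, hI.cnt, wp_assign, safeE_add, safeE_one, true_and, ev_add, ev_one,
    hI.start vc h1 h2, hrk, hr (.len s) (by simp) (by simp) (by simp), hI.len]
  refine ⟨fun hlt => ?_, fun hlt => ?_⟩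
  · obtain ⟨k, hk1, hk2, hk3, hk4⟩ := Inst.exists_rk_eq (I := I) (s := s) (c := vc)
      (t := I.rk s vc vh + 1) (by omega) (by omega)
    have hocc := hI.occ k hk1 hk2
    rw [hk3, hk4, ← add_assoc] at hocc
    rw [hocc]
    refine ⟨by omega, H _ _ ?_ ?_ ?_⟩
    · intro x h1 h2 h3 h4; simp [h4, hr x h1 h2 h3]
    · rw [Function.update_self, Inst.nxt_eq_of_rk hk2 hk3 hk4]
    · simp; omega
  · refine ⟨by omega, H _ _ ?_ ?_ ?_⟩
    · intro x h1 h2 h3 h4; simp [h4, hr x h1 h2 h3]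
    · rw [Function.update_self, Inst.nxt_eq_of_count (by omega)]
    · simp; omega

end

section

variable {I : Inst} {V M L : ℕ} {Q : Post} {r : Reg → ℕ} {m : Arr → ℕ → ℕ} {t : ℕ} {s : Side}

/-- The occurrence lists and ranks are built by counting sort. -/
lemma wp_buildIndex (hB : I.Big V M) (hlen : r (.len s) = I.n s) (hσ : r .sigma = I.σ)
    (hstr : ∀ k, 1 ≤ k → k ≤ I.n s → m (.str s) k = I.S s k)
    (hcnt : ∀ c, m (.cnt s) c = 0) (hstart : m (.start s) 1 = 0)
    (H : ∀ r' m' t', Frame V (buildIndex s) r m r' m' → I.Idx s r' m' →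
      t' ≤ t + 200 * (I.n .x + I.n .y + 1) → Q r' m' t') :
    wp V M (buildIndex s) Q r m t := by
  have hV1 := hB.n_le s
  have hV2 := hB.le_V
  have hV3 := hB.le_M
  have hV4 := hB.σ_le
  have hn2 := I.two_le s
  have hn : I.n s ≤ I.n .x + I.n .y := by cases s <;> omega
  refine wp_conseq (Q := fun r' m' t' => I.Idx s r' m' ∧ t' ≤ t + 200 * (I.n .x + I.n .y + 1)) ?_
    fun r' m' t' hF h => H r' m' t' hF h.1 h.2
  rw [buildIndex, block_cons, wp_seq]
  refine wp_forUp (fun k r' m' t' => (∀ c, m' (.cnt s) c = I.rk s c (k - 1)) ∧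
    (∀ i, 1 ≤ i → i < k → m' (.rank s) i = I.rk s (I.S s i) i) ∧ t' + 60 ≤ t + 60 * k + 2)
    1 (I.n s) rfl (by omega) (by omega) (by omega) (by simp) (by cases s <;> rfl) ?_ ?_ ?_ ?_
  · intro k r' m' t' hF _
    simp [hF.reg (.len s) (by rfl), hlen]
  · refine ⟨by simp [hcnt, Inst.rk], fun i h1 h2 => by omega, by simp⟩
  · rintro k r' m' t' hk1 hk2 hk hF ⟨hc, hr, ht⟩
    have hS : m' (.str s) k = I.S s k := by
      rw [hF.mem _ (by cases s <;> rfl), hstr k hk1 hk2]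
    have h1 : I.rk s (I.S s k) k = I.rk s (I.S s k) (k - 1) + 1 := by
      obtain ⟨j, rfl⟩ : ∃ j, k = j + 1 := ⟨k - 1, by omega⟩
      simp [Inst.rk, hk2]
    have h2 := @Inst.rk_le_count I s (I.S s k) k
    have h3 := @Inst.count_le I s (I.S s k)
    have h4 := I.S_pos hk1 hk2
    simp only [wr, rd, block_cons, block_single, wp_seq, wp_store, safeE_get, safeE_var, ev_get,
      ev_var, hk, hS, safeE_add, safeE_one, and_self, true_and, hc, ev_add, ev_one, ← h1,
      Function.update_apply, reduceCtorEq, if_false, if_true]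
    refine ⟨by omega, by omega, by omega, by omega, fun c => ?_, fun i hi1 hi2 => ?_, ?_⟩
    · by_cases hcS : c = I.S s k
      · simp [hcS]
      · obtain ⟨j, rfl⟩ : ∃ j, k = j + 1 := ⟨k - 1, by omega⟩
        simp [hcS, hc, Inst.rk, Ne.symm hcS]
    · by_cases hik : i = k
      · simp [hik]
      · simp [hik, hr i hi1 (by omega)]
    · simp; omega
  rintro r1 m1 t1 hF1 - ⟨hc, hr, ht⟩
  rw [block_cons, wp_seq]
  have hc' : ∀ c, m1 (.cnt s) c = I.count s c := fun c => by simpa [Inst.count] using hc c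
  refine wp_forUp (fun k r' m' t' => (∀ c, 1 ≤ c → c ≤ k → m' (.start s) c = I.before s c) ∧
    t' + 60 ≤ t1 + 60 * k + 10)
    1 I.σ rfl (by omega) (by omega) (by omega) (by simp) (by cases s <;> rfl) ?_ ?_ ?_ ?_
  · intro k r' m' t' hF _
    simp [hF.reg .sigma (by rfl), hF1.reg .sigma (by rfl), hσ]
  · refine ⟨fun c h1 h2 => ?_, by simp⟩
    obtain rfl : c = 1 := by omega
    rw [hF1.mem _ (by cases s <;> rfl), hstart, Inst.before_one]
  · rintro k r' m' t' hk1 hk2 hk hF ⟨hb, ht'⟩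
    have h1 : m' (.cnt s) k = I.count s k := by rw [hF.mem _ (by cases s <;> rfl), hc']
    have h2 := @Inst.before_succ I s k
    have h3 := @Inst.before_le I s (k + 1)
    simp only [wr, rd, block_cons, block_single, wp_seq, wp_store, safeE_get, safeE_var, ev_get,
      ev_var, hk, safeE_add, safeE_one, and_self, true_and, ev_add, ev_one, h1, hb k hk1 le_rfl,
      ← h2]
    refine ⟨by omega, by omega, fun c hc1 hc2 => ?_, ?_⟩
    · by_cases hck : c = k + 1
      · simp [hck]
      · simp [hck, hb c hc1 (by omega)]
    · simp; omega
  rintro r2 m2 t2 hF2 - ⟨hb, ht2⟩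
  rw [block_single]
  have hstr2 : ∀ k, 1 ≤ k → k ≤ I.n s → m2 (.str s) k = I.S s k := fun k h1 h2 => by
    rw [hF2.mem _ (by cases s <;> rfl), hF1.mem _ (by cases s <;> rfl), hstr k h1 h2]
  have hc2 : ∀ c, m2 (.cnt s) c = I.count s c := fun c => by
    rw [hF2.mem _ (by cases s <;> rfl), hc']
  have hr2 : ∀ i, 1 ≤ i → i ≤ I.n s → m2 (.rank s) i = I.rk s (I.S s i) i := fun i h1 h2 => by
    rw [hF2.mem _ (by cases s <;> rfl), hr i h1 (by omega)]
  have hl2 : r2 (.len s) = I.n s := by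
    rw [hF2.reg _ (by rfl), hF1.reg _ (by rfl), hlen]
  refine wp_forUp (fun k r' m' t' => (∀ i, 1 ≤ i → i < k →
    m' (.occ s) (I.before s (I.S s i) + I.rk s (I.S s i) i) = i) ∧ t' + 60 ≤ t2 + 60 * k + 10)
    1 (I.n s) rfl (by omega) (by omega) (by omega) (by simp) (by cases s <;> rfl) ?_ ?_ ?_ ?_
  · intro k r' m' t' hF _
    simp [hF.reg (.len s) (by rfl), hl2]
  · exact ⟨fun i h1 h2 => by omega, by simp⟩
  · rintro k r' m' t' hk1 hk2 hk hF ⟨ho, ht'⟩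
    have hS : m' (.str s) k = I.S s k := by rw [hF.mem _ (by cases s <;> rfl), hstr2 k hk1 hk2]
    have h4 := I.S_pos hk1 hk2
    have h5 : m' (.start s) (I.S s k) = I.before s (I.S s k) := by
      rw [hF.mem _ (by cases s <;> rfl), hb _ h4.1 (by omega)]
    have h6 : m' (.rank s) k = I.rk s (I.S s k) k := by
      rw [hF.mem _ (by cases s <;> rfl), hr2 k hk1 hk2]
    have h7 := @Inst.before_le I s (I.S s k)
    have h8 := @Inst.rk_le I s (I.S s k) k
    simp only [wr, rd, block_cons, block_single, wp_seq, wp_store, safeE_get, safeE_var, ev_get,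
      ev_var, hk, safeE_add, safeE_one, and_self, true_and, ev_add, ev_one, hS, h5, h6]
    refine ⟨by omega, by omega, fun i hi1 hi2 => ?_, ?_⟩
    · by_cases hik : i = k
      · simp [hik]
      · have : I.before s (I.S s i) + I.rk s (I.S s i) i ≠
            I.before s (I.S s k) + I.rk s (I.S s k) k := fun h =>
          hik (Inst.before_add_rk_inj hi1 (by omega) hk1 hk2 h)
        simp [this, ho i hi1 (by omega)]
    · simp; omega
  rintro r3 m3 t3 hF3 - ⟨ho, ht3⟩
  refine ⟨⟨?_, ?_, ?_, ?_, ?_, fun k h1 h2 => ho k h1 (by omega)⟩, ?_⟩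
  · rw [hF3.reg _ (by rfl), hl2]
  · rw [hF3.mem _ (by cases s <;> rfl)]; exact hstr2
  · rw [hF3.mem _ (by cases s <;> rfl)]; exact hc2
  · rw [hF3.mem _ (by cases s <;> rfl)]; exact hr2
  · rw [hF3.mem _ (by cases s <;> rfl)]; exact fun c h1 h2 => hb c h1 (by omega)
  · simp; omega

end

/-! ### Range maximum queries -/

section

/-- `p` is the position of a maximum of `A` between `l` and `r`. -/
def IsMaxAt (A : ℕ → ℕ) (l r p : ℕ) : Prop := l ≤ p ∧ p ≤ r ∧ ∀ i, l ≤ i → i ≤ r → A i ≤ A p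

/-- The registers `width` and `blocks` and the arrays `pow2`, `low`, `lg` contain what they should,
for arrays of length `N`. -/
structure Tables (N w B : ℕ) (r : Reg → ℕ) (m : Arr → ℕ → ℕ) : Prop where
  width : r .width = w
  blocks : r .blocks = B
  lt_pow : N < 2 ^ w
  pow_le : 2 ^ w ≤ 2 * N
  blocks_eq : B = N / w + 1
  pow2 : ∀ v, v ≤ w → m .pow2 v = 2 ^ v
  low : ∀ k, 1 ≤ k → k < 2 ^ w → k.testBit (m .low k) = true ∧
    ∀ j, j < m .low k → k.testBit j = false
  lg : ∀ k, 1 ≤ k → k ≤ B → 2 ^ m .lg k ≤ k ∧ k < 2 ^ (m .lg k + 1)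

/-- The set binary digits of `mask[k]` indicate the suffix maxima of `A` in the part up to `k` of the
block of `k`. -/
def IsMask (A : ℕ → ℕ) (w : ℕ) (mask : ℕ → ℕ) (k : ℕ) : Prop :=
  mask k < 2 ^ (k - k / w * w + 1) ∧ ∀ q, k / w * w ≤ q → q ≤ k →
    ((mask k).testBit (q - k / w * w) = true ↔ ∀ i, q < i → i ≤ k → A i ≤ A q)

/-- Level `v` of the sparse table of block maxima. -/
def IsSparse (A : ℕ → ℕ) (w B : ℕ) (sp : ℕ → ℕ) (v : ℕ) : Prop :=
  ∀ k, k + 2 ^ v ≤ B → IsMaxAt A (k * w) ((k + 2 ^ v) * w - 1) (sp (v * B + k))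

/-- The range maximum query structure of the array `th s`. -/
structure RMQ (w B : ℕ) (s : Side) (m : Arr → ℕ → ℕ) : Prop where
  mask : ∀ k, k < B * w → IsMask (m (.th s)) w (m (.mask s)) k
  sparse : ∀ v, 2 ^ v ≤ B → IsSparse (m (.th s)) w B (m (.sparse s)) v

section
variable {A : ℕ → ℕ} {w B N : ℕ} {mask : ℕ → ℕ} {k l p q : ℕ}

/-- The least marked index from `l` on is the one of the maximum. -/
lemma IsMask.isMaxAt (h : IsMask A w mask k) (hl : k / w * w ≤ l) (hlk : l ≤ k)
    (hp : (mask k / 2 ^ (l - k / w * w)).testBit p = true)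
    (hp' : ∀ j, j < p → (mask k / 2 ^ (l - k / w * w)).testBit j = false) :
    IsMaxAt A l k (l + p) := by
  simp only [Nat.testBit_div_two_pow] at hp hp'
  have h1 : l + p ≤ k := by
    by_contra h2
    have : mask k < 2 ^ (p + (l - k / w * w)) :=
      h.1.trans_le (Nat.pow_le_pow_right (by norm_num) (by omega))
    rw [Nat.testBit_lt_two_pow (by simpa [add_comm] using this)] at hp
    cases hp
  have h3 := (h.2 (l + p) (by omega) h1).1 (by
    rwa [show l + p - k / w * w = p + (l - k / w * w) by omega])
  refine ⟨by omega, h1, ?_⟩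
  -- The last position of a maximum is a suffix maximum.
  by_contra hcon
  push Not at hcon
  obtain ⟨i, hi1, hi2, hi3⟩ := hcon
  have hex : ∃ i, l ≤ i ∧ i ≤ k ∧ ∀ j, l ≤ j → j ≤ k → A j ≤ A i := by
    obtain ⟨i, hi, hm⟩ := Finset.exists_max_image (Finset.Icc l k) A ⟨l, by simp [hlk]⟩
    rw [Finset.mem_Icc] at hi
    exact ⟨i, hi.1, hi.2, fun j h1 h2 => hm j (by simp [h1, h2])⟩
  obtain ⟨i', hi'1, hi'2, hi'3⟩ := hex
  have h4 : A (l + p) < A i' := hi3.trans_le (hi'3 i hi1 hi2)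
  have h5 : i' < l + p := by
    by_contra h6
    rcases (not_lt.1 h6).eq_or_lt with h7 | h7
    · rw [h7] at h4; omega
    · have := h3 i' h7 hi'2; omega
  have h6 := (h.2 i' (by omega) hi'2).2 fun j _ hj => hi'3 j (by omega) hj
  have h7 := hp' (i' - l) (by omega)
  rw [show i' - l + (l - k / w * w) = i' - k / w * w by omega, h6] at h7
  cases h7

lemma IsMask.pos (h : IsMask A w mask k) (hl : k / w * w ≤ l) (hlk : l ≤ k) :
    1 ≤ mask k / 2 ^ (l - k / w * w) := by
  have h1 := (h.2 k (hl.trans hlk) le_rfl).2 fun i _ _ => by omega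
  have h2 := Nat.ge_two_pow_of_testBit h1
  refine (Nat.one_le_div_iff (by positivity)).2 ((Nat.pow_le_pow_right (by norm_num) ?_).trans h2)
  omega

/-- The recurrence for the masks: `q` is the least position such that all elements from `q` up to
`k` are smaller than that at `k`. -/
lemma IsMask.of_prev {bs : ℕ} (hbs : k / w * w = bs) (hq1 : bs ≤ q) (hq2 : q ≤ k)
    (hlt : ∀ i, q ≤ i → i < k → A i < A k) (hw : 0 < w)
    (h : (q = bs ∧ mask k = 2 ^ (k - bs)) ∨
      (bs < q ∧ A k ≤ A (q - 1) ∧ IsMask A w mask (q - 1) ∧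
        mask k = mask (q - 1) + 2 ^ (k - bs))) : IsMask A w mask k := by
  obtain ⟨x, hx, hx1, hx2⟩ : ∃ x, mask k = 2 ^ (k - bs) + x ∧ x < 2 ^ (q - bs) ∧
      ∀ i, bs ≤ i → i < k →
        (x.testBit (i - bs) = true ↔ ∀ j, i < j → j ≤ k → A j ≤ A i) := by
    rcases h with ⟨h1, h2⟩ | ⟨h1, h2, h3, h4⟩
    · refine ⟨0, by omega, by positivity, fun i hi1 hi2 => ?_⟩
      have := hlt i (by omega) hi2
      simp only [Nat.zero_testBit, Bool.false_eq_true, false_iff]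
      intro h; have := h k hi2 le_rfl; omega
    · have h5 : (q - 1) / w * w = bs := by
        rw [← hbs]; congr 1
        have h6 : k / w ≤ (q - 1) / w := by
          rw [Nat.le_div_iff_mul_le hw]; omega
        exact le_antisymm (Nat.div_le_div_right (by omega)) h6
      have h31 := h3.1
      have h32 := h3.2
      rw [h5] at h31 h32
      rw [show q - 1 - bs + 1 = q - bs by omega] at h31
      refine ⟨mask (q - 1), by omega, h31, fun i hi1 hi2 => ?_⟩
      by_cases hiq : i ≤ q - 1
      · rw [h32 i hi1 hiq]
        constructor
        · intro h j hj1 hj2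
          rcases hiq.eq_or_lt with h7 | h7
          · rw [h7]
            rcases hj2.eq_or_lt with h8 | h8
            · rw [h8]; exact h2
            · have := hlt j (by omega) h8; omega
          · rcases le_or_gt j (q - 1) with h8 | h8
            · exact h j hj1 h8
            · have h9 := h (q - 1) h7 le_rfl
              rcases hj2.eq_or_lt with h8 | h8
              · rw [h8]; omega
              · have := hlt j (by omega) h8; omega
        · exact fun h j hj1 hj2 => h j hj1 (by omega)
      · have h6 := hlt i (by omega) hi2
        have h7 : mask (q - 1) < 2 ^ (i - bs) :=
          h31.trans_le (Nat.pow_le_pow_right (by norm_num) (by omega))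
        rw [Nat.testBit_lt_two_pow h7]
        simp only [Bool.false_eq_true, false_iff]
        intro h; have := h k hi2 le_rfl; omega
  have hx3 : x < 2 ^ (k - bs) := hx1.trans_le (Nat.pow_le_pow_right (by norm_num) (by omega))
  refine ⟨?_, fun i hi1 hi2 => ?_⟩
  · rw [hbs, hx, pow_succ]; omega
  · rw [hbs] at hi1 ⊢
    rw [hx]
    rcases hi2.eq_or_lt with h1 | h1
    · subst h1
      rw [Nat.testBit_two_pow_add_eq, Nat.testBit_lt_two_pow hx3]
      simp only [Bool.not_false, true_iff]
      intro j h1 h2; omega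
    · rw [Nat.testBit_two_pow_add_gt (by omega), hx2 i hi1 h1]

end

variable {I : Inst} {V M L N w B : ℕ} {Q : Post} {r : Reg → ℕ} {m : Arr → ℕ → ℕ} {t : ℕ} {s : Side}

/-- Blocks have logarithmic width; the blocks cover `0, ..., N`, without much excess. -/
lemma Tables.bounds (h : Tables N w B r m) (hN : 4 ≤ N) :
    3 ≤ w ∧ w ≤ N ∧ N < B * w ∧ B * w ≤ 2 * N ∧ B ≤ N ∧ 1 ≤ B := by
  have h1 := h.lt_pow
  have h2 := h.pow_le
  have h3 : 3 ≤ w := by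
    by_contra h3
    have : 2 ^ w ≤ 2 ^ 2 := Nat.pow_le_pow_right (by norm_num) (by omega)
    omega
  have h4 : w ≤ N := by
    obtain ⟨v, rfl⟩ : ∃ v, w = v + 1 := ⟨w - 1, by omega⟩
    have := Nat.lt_two_pow_self (n := v)
    rw [pow_succ] at h2; omega
  have h5 := Nat.div_add_mod N w
  have h6 := Nat.mod_lt N (show 0 < w by omega)
  have h7 : N / w ≤ N / 3 := Nat.div_le_div_left h3 (by omega)
  have h8 : B * w = w * (N / w) + w := by rw [h.blocks_eq]; ring
  have h9 := h.blocks_eq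
  generalize N / w = d at *
  exact ⟨h3, h4, by omega, by omega, by omega, by omega⟩

lemma Tables.congr {r' : Reg → ℕ} {m' : Arr → ℕ → ℕ} (h : Tables N w B r m)
    (h1 : r' .width = r .width) (h2 : r' .blocks = r .blocks) (h3 : m' .pow2 = m .pow2)
    (h4 : m' .low = m .low) (h5 : m' .lg = m .lg) : Tables N w B r' m' :=
  ⟨h1.trans h.width, h2.trans h.blocks, h.lt_pow, h.pow_le, h.blocks_eq, h3 ▸ h.pow2,
    h4 ▸ h.low, h5 ▸ h.lg⟩

/-- A query inside a block takes constant time. -/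
lemma wp_inBlock (hT : Tables N w B r m) (hN : 4 ≤ N) (hV : 20 * N ≤ V) {l e : E} {vl ve : ℕ}
    (hl : ev r m l = vl) (he : ev r m e = ve) (sl : safeE V r m l) (se : safeE V r m e)
    (hlc : l.cost ≤ 8) (hec : e.cost ≤ 8) (h1 : vl ≤ ve) (h2 : ve / w * w ≤ vl) (h3 : ve < B * w)
    (hm : IsMask (m (.th s)) w (m (.mask s)) ve)
    (H : ∀ p t', IsMaxAt (m (.th s)) vl ve p → t' ≤ t + 60 →
      Q (Function.update r .pos p) m t') : wp V M (inBlock s l e) Q r m t := by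
  obtain ⟨hb1, hb2, hb3, hb4, hb5, hb6⟩ := hT.bounds hN
  have hw : 0 < w := by omega
  have h4 : vl / w = ve / w := by
    refine le_antisymm (Nat.div_le_div_right h1) ?_
    rw [Nat.le_div_iff_mul_le hw]; exact h2
  have h5 : ve - ve / w * w < w := by
    have := Nat.div_add_mod ve w
    have := Nat.mod_lt ve hw
    have h6 : w * (ve / w) = ve / w * w := mul_comm _ _
    omega
  have h6 := hm.pos h2 h1
  have h7 : m (.mask s) ve / 2 ^ (vl - ve / w * w) < 2 ^ w :=
    (Nat.div_le_self _ _).trans_lt (hm.1.trans_le (Nat.pow_le_pow_right (by norm_num) (by omega)))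
  have h8 := hT.low _ h6 h7
  have h9 := hm.isMaxAt h2 h1 h8.1 h8.2
  simp only [inBlock, put, rd, wp_assign, safeE_add, safeE_get, safeE_div, safeE_sub, safeE_mul,
    safeE_var, and_self, true_and, ev_add, ev_get, ev_div, ev_sub, ev_mul, ev_var, hl, he, sl, se,
    hT.width, h4, hT.pow2 (vl - ve / w * w) (by omega)]
  have := h9.2.1
  refine ⟨by omega, by omega, H _ _ h9 ?_⟩
  simp; omega

/-- The maximum of a range is that of the maxima of two ranges that cover it. -/
lemma wp_improve {e : E} {l u l' u' : ℕ} (hb : IsMaxAt (m (.th s)) l u (r .best))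
    (he : IsMaxAt (m (.th s)) l' u' (ev r m e)) (se : safeE V r m e) (hec : e.cost ≤ 12)
    (hV : u' ≤ V) (h1 : l ≤ l') (h2 : l' ≤ u + 1) (h3 : u ≤ u')
    (H : ∀ b t', IsMaxAt (m (.th s)) l u' b → t' ≤ t + 60 → Q (Function.update r .best b) m t') :
    wp V M (improve s e) Q r m t := by
  simp only [improve, ifs, put, rd, block_single, block_nil, wp_ite, safeC_lt, safeE_get, safeE_var,
    se, and_self, true_and, evC_lt, ev_get, ev_var, wp_assign, wp_skip]
  refine ⟨fun hlt => ⟨he.2.1.trans hV, H _ _ ⟨h1.trans he.1, he.2.1, fun i h4 h5 => ?_⟩ ?_⟩,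
    fun hlt => ?_⟩
  · rcases le_or_gt l' i with h6 | h6
    · exact he.2.2 i h6 h5
    · exact (hb.2.2 i h4 (by omega)).trans hlt.le
  · simp; omega
  · have := H (r .best) (t + ((Cond.lt (.get (.th s) (.var .best)) (.get (.th s) e)).cost) + 1)
      ⟨hb.1, hb.2.1.trans h3, fun i h4 h5 => ?_⟩ ?_
    · rwa [Function.update_eq_self] at this
    · rcases le_or_gt i u with h6 | h6
      · exact hb.2.2 i h4 h6
      · exact (he.2.2 i (by omega) h5).trans (not_lt.1 hlt)
    · simp; omega

/-- Range maximum queries take constant time. -/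
lemma wp_rmq (hT : Tables N w B r m) (hR : RMQ w B s m) (hN : 4 ≤ N) (hV : 20 * N ≤ V)
    {l e : E} {vl ve : ℕ}
    (hl : ev r m l = vl) (sl : safeE V r m l)
    (he : ∀ x, ev (Function.update r .ql x) m e = ve ∧ safeE V (Function.update r .ql x) m e)
    (hlc : l.cost ≤ 20) (hec : e.cost ≤ 20) (h1 : vl ≤ ve) (h3 : ve < B * w)
    (H : ∀ r' t', (∀ x, x ≠ .ql → x ≠ .qr → x ≠ .bl → x ≠ .br → x ≠ .pos → x ≠ .best → x ≠ .lv →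
      r' x = r x) → IsMaxAt (m (.th s)) vl ve (r' .best) → t' ≤ t + 500 → Q r' m t') :
    wp V M (rmq s l e) Q r m t := by
  obtain ⟨hb1, hb2, hb3, hb4, hb5, hb6⟩ := hT.bounds hN
  have hw : 0 < w := by omega
  have e1 := Nat.div_add_mod vl w
  have e2 := Nat.mod_lt vl hw
  have e3 := Nat.div_add_mod ve w
  have e4 := Nat.mod_lt ve hw
  rw [mul_comm] at e1 e3
  have hle : vl / w ≤ ve / w := Nat.div_le_div_right h1
  have nb := Nat.zero_le (vl / w)
  have nd := Nat.zero_le (ve / w)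
  set b := vl / w with hb
  set d := ve / w with hd
  have hdB : d + 1 ≤ B := by
    have : d < B := (Nat.div_lt_iff_lt_mul hw).2 h3
    omega
  simp only [rmq, ifs, put, rd, block_cons, block_single, wp_seq, wp_assign, sl, (he vl).2, hl,
    (he vl).1, true_and, safeE_div, safeE_var, and_self, ev_div, ev_var, Function.update_apply,
    reduceCtorEq, if_false, if_true, hT.width, ← hb, ← hd, wp_ite, safeC_eq, evC_eq]
  refine ⟨by omega, by omega, by omega, by omega, fun heq => ?_, fun hne => ?_⟩
  · refine wp_inBlock (hT.congr ?_ ?_ rfl rfl rfl) hN hV (vl := vl) (ve := ve) ?_ ?_ ?_ ?_ ?_ ?_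
      h1 ?_ h3 (hR.mask _ h3) fun p t' hp ht => ⟨?_, H _ _ ?_ ?_ ?_⟩
    any_goals simp
    · rw [← hd, ← heq]; omega
    · have := hp.2.1; omega
    · intro x h1 h2 h3 h4 h5 h6 h7; simp [*]
    · exact hp
    · simp at ht; omega
  have hlt : b + 1 ≤ d := by omega
  have hbw : (b + 1) * w ≤ d * w := Nat.mul_le_mul_right _ hlt
  have hdw : (d + 1) * w ≤ B * w := Nat.mul_le_mul_right _ hdB
  rw [add_mul, one_mul] at hbw hdw
  have hdiv1 : (b * w + w - 1) / w = b := by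
    rw [show b * w + w - 1 = w - 1 + b * w by omega, Nat.add_mul_div_right _ _ hw,
      Nat.div_eq_of_lt (by omega), zero_add]
  refine wp_inBlock (hT.congr ?_ ?_ rfl rfl rfl) hN hV (vl := vl) (ve := b * w + w - 1)
    ?_ ?_ ?_ ?_ ?_ ?_ (by omega) ?_ (by omega) (hR.mask _ (by omega)) fun p t1 hp ht => ?_
  any_goals simp [hT.width]
  · omega
  · rw [hdiv1]; omega
  clear hdiv1
  have hpV : p ≤ V := by have := hp.2.1; omega
  refine ⟨hpV, fun hlt2 => ⟨?_, ?_⟩, fun hlt2 => ?_⟩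
  · have hlg := hT.lg (d - b - 1) (by omega) (by omega)
    have := Nat.lt_two_pow_self (n := m .lg (d - b - 1)); omega
  · have hlg := hT.lg (d - b - 1) (by omega) (by omega)
    set v := m .lg (d - b - 1) with hv
    have hvw : v < w := by
      rw [← Nat.pow_lt_pow_iff_right (a := 2) (by norm_num)]
      have := hT.lt_pow; omega
    have hvB : v * B ≤ w * B := Nat.mul_le_mul_right _ hvw.le
    rw [mul_comm w] at hvB
    have hs := hR.sparse v (by omega)
    have hs1 := hs (b + 1) (by omega)
    have hs2 := hs (d - 2 ^ v) (by omega)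
    rw [show (b + 1) * w = b * w + w by ring] at hs1
    rw [show d - 2 ^ v + 2 ^ v = d by omega] at hs2
    have hc1 : (d - 2 ^ v) * w ≤ (b + 1 + 2 ^ v) * w := Nat.mul_le_mul_right _ (by
      rw [pow_succ] at hlg; omega)
    have hc2 : (b + 1 + 2 ^ v) * w ≤ d * w := Nat.mul_le_mul_right _ (by omega)
    have hc3 : (b + 1) * w ≤ (d - 2 ^ v) * w := Nat.mul_le_mul_right _ (by omega)
    have hc4 : (b + 2) * w ≤ (b + 1 + 2 ^ v) * w := Nat.mul_le_mul_right _ (by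
      have := Nat.one_le_two_pow (n := v); omega)
    have hc5 : (b + 1) * w = b * w + w := by ring
    have hc6 : (b + 2) * w = b * w + w + w := by ring
    have hdw' : d * w ≤ V := by omega
    refine wp_improve (l := vl) (u := b * w + w - 1) (l' := b * w + w)
      (u' := (b + 1 + 2 ^ v) * w - 1) ?_ ?_ ?_ ?_ ?_ ?_ ?_ ?_ fun p1 t2 hp1 ht2 => ?_
    · simpa using hp
    · simpa [hT.blocks, ← hv, add_assoc] using hs1
    · simp [hT.blocks, ← hv]; omega
    · simp
    · omega
    · omega
    · omega
    · omega
    refine wp_improve (l := vl) (u := (b + 1 + 2 ^ v) * w - 1) (l' := (d - 2 ^ v) * w)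
      (u' := d * w - 1) ?_ ?_ ?_ ?_ ?_ ?_ ?_ ?_ fun p2 t3 hp2 ht3 => ?_
    · simpa using hp1
    · have : v * B + d - 2 ^ v = v * B + (d - 2 ^ v) := by
        have : 2 ^ v ≤ d := by omega
        omega
      simpa [hT.blocks, ← hv, hT.pow2 v hvw.le, this] using hs2
    · simp [hT.blocks, ← hv]; omega
    · simp
    · omega
    · omega
    · omega
    · omega
    refine wp_inBlock (hT.congr ?_ ?_ rfl rfl rfl) hN hV (vl := d * w) (ve := ve)
      ?_ ?_ ?_ ?_ ?_ ?_ (by omega) ?_ (by omega) (hR.mask _ (by omega)) fun p3 t4 hp3 ht4 => ?_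
    any_goals simp [hT.width]
    · omega
    · rw [← hd]
    refine wp_improve (l := vl) (u := d * w - 1) (l' := d * w)
      (u' := ve) ?_ ?_ ?_ ?_ ?_ ?_ ?_ ?_ fun p4 t5 hp4 ht5 => ?_
    · simpa using hp2
    · simpa using hp3
    · simp
    · simp
    · omega
    · omega
    · omega
    · omega
    refine H _ _ ?_ ?_ ?_
    · intro x h1 h2 h3 h4 h5 h6 h7; simp [*]
    · simpa using hp4
    · simp at *; omega
  · have hbd : b + 1 = d := by omega
    have hbd' : d * w = b * w + w := by rw [← hbd]; ring
    refine wp_inBlock (hT.congr ?_ ?_ rfl rfl rfl) hN hV (vl := d * w) (ve := ve)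
      ?_ ?_ ?_ ?_ ?_ ?_ (by omega) ?_ (by omega) (hR.mask _ (by omega)) fun p3 t4 hp3 ht4 => ?_
    any_goals simp [hT.width]
    · omega
    · rw [← hd]
    refine wp_improve (l := vl) (u := b * w + w - 1) (l' := d * w)
      (u' := ve) ?_ ?_ ?_ ?_ ?_ ?_ ?_ ?_ fun p4 t5 hp4 ht5 => ?_
    · simpa using hp
    · simpa using hp3
    · simp
    · simp
    · omega
    · omega
    · omega
    · omega
    refine H _ _ ?_ ?_ ?_
    · intro x h1 h2 h3 h4 h5 h6 h7; simp [*]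
    · simpa using hp4
    · simp at *; omega

end

section

variable {I : Inst} {V M L N w B : ℕ} {Q : Post} {r : Reg → ℕ} {m : Arr → ℕ → ℕ} {t : ℕ} {s : Side}

/-- The tables of powers and logarithms used by the range maximum queries, and the block width, are
computed in linear time. -/
lemma wp_buildTables (hl : r (.len .x) + r (.len .y) = N) (hlg : m .lg 1 = 0) (hN : 4 ≤ N)
    (hM : 20 * N + 20 ≤ M) (hV : M ≤ V)
    (H : ∀ w B r' m' t', Frame V buildTables r m r' m' → Tables N w B r' m' →
      t' ≤ t + 400 * (N + 1) → Q r' m' t') : wp V M buildTables Q r m t := by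
  refine wp_conseq (Q := fun r' m' t' => ∃ w B, Tables N w B r' m' ∧ t' ≤ t + 400 * (N + 1)) ?_
    fun r' m' t' hF ⟨w, B, h⟩ => H w B r' m' t' hF h.1 h.2
  simp only [buildTables, put, wr, rd, ifs, block_cons, block_single, wp_seq, wp_assign, wp_store,
    safeE_add, safeE_var, safeE_zero, safeE_one, and_self, true_and, and_true, ev_add, ev_var, ev_zero, ev_one,
    hl, zero_le, Function.update_apply, reduceCtorEq, if_false, if_true, cost_add, cost_var,
    cost_zero, cost_one]
  refine ⟨by omega, by omega, by omega, ?_⟩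
  refine wp_loop (fun r' m' t' => r' .size = N ∧
    (∀ i, i ≤ r' .width → m' .pow2 i = 2 ^ i) ∧ (r' .width = 0 ∨ 2 ^ (r' .width - 1) ≤ N) ∧
      t' ≤ t + 40 * r' .width + 20)
    (fun r' _ => N + 1 - r' .width) ?_ ?_ ?_ ?_
  · refine ⟨by simp, fun i hi => ?_, by simp, by simp⟩
    simp at hi; simp [hi]
  · simp
  · rintro r' m' t' - ⟨h1, h2, h3, h4⟩ hc
    have hp := h2 _ le_rfl
    simp only [evC_le, ev_get, ev_var, hp, h1] at hc
    have h5 := Nat.lt_two_pow_self (n := r' .width)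
    simp only [wr, put, rd, block_cons, block_single, wp_seq, wp_store, wp_assign, safeE_add,
      safeE_var, safeE_get, safeE_one, and_self, true_and, and_true, ev_add, ev_var, ev_one, ev_get, hp, cost_add, cost_var, cost_one, cost_get,
      costC_le, Function.update_self]
    refine ⟨by omega, by omega, by omega, ⟨by simpa using h1, fun i hi => ?_, Or.inr (by simpa),
      by omega⟩, by omega⟩
    by_cases hi' : i = r' .width + 1
    · simp [hi', pow_succ, mul_two]
    · simp [hi', h2 i (by omega)]
  rintro r1 m1 t1 hF1 ⟨h1, h2, h3, h4⟩ hc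
  have hp := h2 _ le_rfl
  simp only [evC_le, ev_get, ev_var, hp, h1, not_le] at hc
  set w := r1 .width with hw
  have hw0 : w ≠ 0 := by rintro h; rw [h] at hc; simp at hc; omega
  replace h3 := h3.resolve_left hw0
  have hpw : 2 ^ w = 2 * 2 ^ (w - 1) := by rw [← pow_succ']; congr 1; omega
  have hwN : w - 1 < 2 ^ (w - 1) := Nat.lt_two_pow_self
  have hdiv := Nat.div_le_self N w
  have hdiv0 := Nat.zero_le (N / w)
  set B := N / w + 1 with hB
  simp only [safeE_div, safeE_var, and_self, true_and, ev_div, ev_var, h1, ← hw, ← hB, cost_div, cost_var, cost_get,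
    costC_le, cost_add, cost_one]
  refine ⟨by omega, ?_⟩
  refine wp_forUp (fun k r' m' t' => (∀ i, 1 ≤ i → i < k → i.testBit (m' .low i) = true ∧
    ∀ j, j < m' .low i → i.testBit j = false) ∧ t' ≤ t + 40 * N + 60 + 60 * k)
    1 (2 ^ w - 1) rfl (by omega) (by omega) (by omega) (by simp) rfl ?_ ?_ ?_ ?_
  · intro k r' m' t' hF _
    simp [hF.reg .width rfl, hF.mem .pow2 rfl, ← hw, hp]
  · exact ⟨fun i h1 h2 => by omega, by simp; omega⟩
  · rintro k r' m' t' hk1 hk2 hk hF ⟨hlow, ht⟩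
    have hkm := Nat.div_add_mod k 2
    simp only [wr, rd, block_single, wp_ite, wp_store, safeC_eq, safeE_mul, safeE_div, safeE_var,
      safeE_two, safeE_add, safeE_get, safeE_one, safeE_zero, and_self, true_and, and_true, evC_eq, ev_mul,
      ev_div, ev_var, ev_two, ev_add, ev_get, ev_one, ev_zero, hk, zero_le, cost_add, cost_get,
      cost_div, cost_mul, cost_var, cost_two, cost_one, cost_zero, costC_eq, cost_sub]
    have hlt : ∀ i, 1 ≤ i → i < k → m' .low i ≤ i := fun i h1 h2 => by
      have := Nat.ge_two_pow_of_testBit (hlow i h1 h2).1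
      have h5 := Nat.lt_two_pow_self (n := m' .low i)
      omega
    refine ⟨by omega, fun he => ⟨by omega, ?_, fun i hi1 hi2 => ?_, by omega⟩,
      fun ho => ⟨by omega, fun i hi1 hi2 => ?_, by omega⟩⟩
    · have := hlt (k / 2) (by omega) (by omega); omega
    · by_cases hik : i = k
      · subst hik
        have := hlow (i / 2) (by omega) (by omega)
        simp only [Function.update_self]
        rw [Nat.testBit_succ]
        refine ⟨this.1, fun j hj => ?_⟩
        cases j with
        | zero => rw [Nat.testBit_zero]; simp; omega
        | succ j => rw [Nat.testBit_succ]; exact this.2 j (by omega)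
      · simpa [hik] using hlow i hi1 (by omega)
    · by_cases hik : i = k
      · subst hik
        simp only [Function.update_self]
        refine ⟨by rw [Nat.testBit_zero]; simp; omega, fun j hj => by omega⟩
      · simpa [hik] using hlow i hi1 (by omega)
  rintro r2 m2 t2 hF2 - ⟨hlow, ht2⟩
  have hlg2 : m2 .lg 1 = 0 := by
    rw [hF2.mem .lg rfl, hF1.mem .lg rfl]; simp [hlg]
  refine wp_forUp (fun k r' m' t' => (∀ i, 1 ≤ i → i < k → 2 ^ m' .lg i ≤ i ∧
    i < 2 ^ (m' .lg i + 1)) ∧ t' ≤ t + 40 * N + 100 + 60 * 2 ^ w + 30 * k)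
    2 B rfl (by omega) (by omega) (by omega) (by simp) rfl ?_ ?_ ?_ ?_
  · intro k r' m' t' hF _
    simp [hF.reg .blocks rfl, hF2.reg .blocks rfl]
  · refine ⟨fun i h1 h2 => ?_, by simp; omega⟩
    obtain rfl : i = 1 := by omega
    rw [hlg2]; simp
  · rintro k r' m' t' hk1 hk2 hk hF ⟨hlow, ht⟩
    simp only [wr, rd, block_single, wp_store, safeE_div, safeE_var,
      safeE_two, safeE_add, safeE_get, safeE_one, and_self, true_and, and_true,
      ev_div, ev_var, ev_two, ev_add, ev_get, ev_one, hk, cost_add, cost_get,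
      cost_div, cost_var, cost_two, cost_one]
    have h6 := hlow (k / 2) (by omega) (by omega)
    have h5 := Nat.lt_two_pow_self (n := m' .lg (k / 2))
    refine ⟨by omega, by omega, fun i hi1 hi2 => ?_, by omega⟩
    by_cases hik : i = k
    · subst hik
      simp only [Function.update_self]
      rw [pow_succ 2 (m' .lg (i / 2) + 1), pow_succ] at *
      omega
    · simpa [hik] using hlow i hi1 (by omega)
  rintro r3 m3 t3 hF3 - ⟨hlg3, ht3⟩
  refine ⟨w, B, ⟨?_, ?_, hc, by omega, rfl, ?_, ?_, fun k hk1 hk2 => hlg3 k hk1 (by omega)⟩, ?_⟩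
  · rw [hF3.reg _ rfl, hF2.reg _ rfl]; simp [← hw]
  · rw [hF3.reg _ rfl, hF2.reg _ rfl]; simp
  · rw [hF3.mem _ rfl, hF2.mem _ rfl]; exact h2
  · rw [hF3.mem _ rfl]; exact fun k h1 h2 => hlow k h1 (by omega)
  · simp; omega

lemma IsMask.congr {A : ℕ → ℕ} {mask mask' : ℕ → ℕ} {k : ℕ} (h : IsMask A w mask k)
    (hk : mask' k = mask k) : IsMask A w mask' k := by
  unfold IsMask at *; rw [hk]; exact h

/-- The bit masks and the sparse table of block maxima are computed. -/
lemma wp_buildRMQ (hT : Tables N w B r m) (hN : 4 ≤ N)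
    (hM : 20 * N + 20 ≤ M) (hV : M ≤ V)
    (H : ∀ r' m' t', Frame V (buildRMQ s) r m r' m' → RMQ w B s m' →
      t' ≤ t + 1000 * (N + 1) ^ 2 → Q r' m' t') : wp V M (buildRMQ s) Q r m t := by
  obtain ⟨hb1, hb2, hb3, hb4, hb5, hb6⟩ := hT.bounds hN
  have hw : 0 < w := by omega
  have hpw := hT.pow_le
  refine wp_conseq (Q := fun r' m' t' => RMQ w B s m' ∧ t' ≤ t + 1000 * (N + 1) ^ 2) ?_
    fun r' m' t' hF h => H r' m' t' hF h.1 h.2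
  rw [buildRMQ, block_cons, wp_seq]
  set A := m (.th s) with hA
  refine wp_forUp (fun k r' m' t' => (∀ i, i < k → IsMask A w (m' (.mask s)) i) ∧
    t' ≤ t + 10 + k * (100 * (w + 1))) 0 (B * w - 1) rfl (by omega) (by omega) (by omega) (by simp)
    (by cases s <;> rfl) ?_ ?_ ?_ ?_
  · intro k r' m' t' hF _
    simp [hF.reg .width (by cases s <;> rfl), hF.reg .blocks (by cases s <;> rfl), hT.width,
      hT.blocks]
    omega
  · exact ⟨fun i hi => by omega, by simp⟩
  · rintro k r' m' t' - hk2 hk hF ⟨hmask, ht⟩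
    have hth : m' (.th s) = A := hF.mem _ (by cases s <;> rfl)
    have hwd : r' .width = w := by rw [hF.reg .width (by cases s <;> rfl), hT.width]
    have hpow : ∀ v ≤ w, m' .pow2 v = 2 ^ v := by
      rw [hF.mem .pow2 (by cases s <;> rfl)]; exact hT.pow2
    have hkm := Nat.div_add_mod k w
    have hkm' := Nat.mod_lt k hw
    rw [mul_comm] at hkm
    set bs := k / w * w with hbs
    simp only [put, wr, rd, ifs, whl, block_cons, block_single, wp_seq, wp_assign, safeE_mul,
      safeE_div, safeE_var, ev_mul, ev_div, ev_var, hk, hwd, ← hbs, true_and, and_true,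
      Function.update_apply, reduceCtorEq, if_false, if_true, cost_mul, cost_div, cost_var]
    refine ⟨by omega, by omega, by omega, ?_⟩
    refine wp_loop (fun r'' m'' t'' => bs ≤ r'' .q ∧ r'' .q ≤ k ∧ r'' .k = k ∧ r'' .bs = bs ∧
      m'' = m' ∧ (∀ i, r'' .q ≤ i → i < k → A i < A k) ∧
      t'' + 16 * (r'' .q - bs) ≤ t' + 20 + 16 * (k - bs)) (fun r'' _ => r'' .q) ?_ ?_ ?_ ?_
    · refine ⟨by simpa using (show bs ≤ k by omega), by simp, by simp [hk], by simp, rfl, fun i h1 h2 => ?_, ?_⟩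
      · simp at h1; omega
      · simp
    · simp
    · rintro r1 m1 t1 - ⟨h1, h2, h3, h4, rfl, h5, h6⟩ hc
      simp only [evC_and, evC_lt, ev_var, ev_get, ev_sub, ev_one, h3, h4, hth] at hc
      simp only [wp_assign, safeE_sub, safeE_var, safeE_one, and_self, true_and, and_true, ev_sub, ev_var,
        ev_one, Function.update_apply, reduceCtorEq, if_false, if_true, h3, h4, cost_sub, cost_var,
        cost_one, costC_and, costC_lt, cost_get]
      refine ⟨by omega, ⟨by omega, by omega, fun i hi1 hi2 => ?_, by omega⟩, by omega⟩
      by_cases hi : i = r1 .q - 1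
      · rw [hi]; exact hc.2
      · exact h5 i (by omega) hi2
    · rintro r1 m1 t1 - ⟨h1, h2, h3, h4, rfl, h5, h6⟩ hc
      have hstep : ∀ v, ((r1 .q = bs ∧ v = 2 ^ (k - bs)) ∨
          (bs < r1 .q ∧ A k ≤ A (r1 .q - 1) ∧
            v = m1 (.mask s) (r1 .q - 1) + 2 ^ (k - bs))) →
          IsMask A w (Function.update (m1 (.mask s)) k v) k := by
        intro v hv
        refine IsMask.of_prev hbs.symm h1 h2 h5 hw ?_
        rcases hv with ⟨h7, h8⟩ | ⟨h7, h8, h9⟩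
        · exact Or.inl ⟨h7, by simpa using h8⟩
        · refine Or.inr ⟨h7, h8, (hmask _ (by omega)).congr ?_, ?_⟩
          · rw [Function.update_of_ne (by omega)]
          · rw [Function.update_self, Function.update_of_ne (by omega), h9]
      have hval : ∀ v, IsMask A w (Function.update (m1 (.mask s)) k v) k → v ≤ V := by
        intro v hv
        have h8 := hv.1
        rw [Function.update_self] at h8
        have : 2 ^ (k - k / w * w + 1) ≤ 2 ^ w := Nat.pow_le_pow_right (by norm_num) (by omega)
        omega
      have hall : ∀ v, IsMask A w (Function.update (m1 (.mask s)) k v) k →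
          ∀ i, i < k + 1 → IsMask A w (Function.update (m1 (.mask s)) k v) i := by
        intro v hv i hi
        by_cases hik : i = k
        · rw [hik]; exact hv
        · exact (hmask i (by omega)).congr (by rw [Function.update_of_ne hik])
      simp only [evC_and, evC_lt, ev_var, ev_get, ev_sub, ev_one, h3, h4, hth, not_and, not_lt]
        at hc
      have hsucc := Nat.succ_mul k (100 * (w + 1))
      simp only [Nat.succ_eq_add_one] at hsucc
      simp only [wp_ite, wp_store, safeC_eq, safeE_var, safeE_get, safeE_sub, safeE_add, safeE_one,
        and_self, true_and, and_true, evC_eq, ev_var, ev_get, ev_sub, ev_add, ev_one, h3, h4,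
        hpow (k - bs) (by omega), Function.update_self, costC_eq, cost_var, cost_get, cost_sub,
        cost_one, costC_and, costC_lt, cost_add, cost_mul]
      refine ⟨fun h7 => ?_, fun h7 => ?_⟩
      · have := hstep (2 ^ (k - bs)) (Or.inl ⟨h7, rfl⟩)
        exact ⟨by omega, hval _ this, hall _ this, by omega⟩
      · have := hstep _ (Or.inr ⟨by omega, hc (by omega), rfl⟩)
        exact ⟨by omega, hval _ this, hall _ this, by omega⟩
  rintro r1 m1 t1 hF1 - ⟨hmask, ht1⟩
  rw [show B * w - 1 + 1 = B * w by omega] at hmask ht1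
  have hth1 : m1 (.th s) = A := hF1.mem _ (by cases s <;> rfl)
  have hT1 : Tables N w B r1 m1 := hT.congr (hF1.reg _ (by cases s <;> rfl))
    (hF1.reg _ (by cases s <;> rfl)) (hF1.mem _ (by cases s <;> rfl))
    (hF1.mem _ (by cases s <;> rfl)) (hF1.mem _ (by cases s <;> rfl))
  rw [block_cons, wp_seq]
  refine wp_forUp (fun k r' m' t' => (∀ i, i < k → IsMaxAt A (i * w) ((i + 1) * w - 1)
    (m' (.sparse s) i)) ∧ t' ≤ t1 + 20 + k * 100) 0 (B - 1) rfl (by omega) (by omega) (by omega)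
    (by simp) (by cases s <;> rfl) ?_ ?_ ?_ ?_
  · intro k r' m' t' hF _
    simp [hF.reg .blocks (by cases s <;> rfl), hT1.blocks]
  · exact ⟨fun i hi => by omega, by simp⟩
  · rintro k r' m' t' - hk2 hk hF ⟨hsp, ht⟩
    have hth : m' (.th s) = A := by rw [hF.mem _ (by cases s <;> rfl), hth1]
    have hT' : Tables N w B r' m' := hT1.congr (hF.reg _ (by cases s <;> rfl))
      (hF.reg _ (by cases s <;> rfl)) (hF.mem _ (by cases s <;> rfl))
      (hF.mem _ (by cases s <;> rfl)) (hF.mem _ (by cases s <;> rfl))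
    have hm' : m' (.mask s) = m1 (.mask s) := hF.mem _ (by cases s <;> rfl)
    have hkw : (k + 1) * w ≤ B * w := Nat.mul_le_mul_right _ (by omega)
    have hkw' : (k + 1) * w = k * w + w := by ring
    have hdiv : (k * w + w - 1) / w = k := by
      rw [show k * w + w - 1 = w - 1 + k * w by omega, Nat.add_mul_div_right _ _ hw,
        Nat.div_eq_of_lt (by omega), zero_add]
    rw [block_cons, block_single, wp_seq]
    refine wp_inBlock hT' hN (by omega) (vl := k * w) (ve := k * w + w - 1) ?_ ?_ ?_ ?_ ?_ ?_
      (by omega) (by rw [hdiv]) (by omega) ?_ fun p t'' hp ht' => ?_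
    · simp [hk, hT'.width]
    · simp [hk, hT'.width]
    · simp [hk, hT'.width]; omega
    · simp [hk, hT'.width]; omega
    · simp
    · simp
    · rw [hth, hm']; exact hmask _ (by omega)
    have hp2 := hp.2.1
    simp only [wr, wp_store, safeE_var, ev_var, true_and, and_true, Function.update_apply, reduceCtorEq,
      if_false, if_true, hk, cost_var]
    refine ⟨by omega, by omega, fun i hi => ?_, ?_⟩
    · by_cases hik : i = k
      · subst hik
        rw [hth] at hp
        simpa [hkw'] using hp
      · simpa [hik] using hsp i (by omega)
    · simp at ht' ⊢; omega
  rintro r2 m2 t2 hF2 - ⟨hsp, ht2⟩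
  rw [show B - 1 + 1 = B by omega] at hsp ht2
  have hth2 : m2 (.th s) = A := by rw [hF2.mem _ (by cases s <;> rfl), hth1]
  have hT2 : Tables N w B r2 m2 := hT1.congr (hF2.reg _ (by cases s <;> rfl))
    (hF2.reg _ (by cases s <;> rfl)) (hF2.mem _ (by cases s <;> rfl))
    (hF2.mem _ (by cases s <;> rfl)) (hF2.mem _ (by cases s <;> rfl))
  rw [block_cons, wp_seq]
  simp only [put, whl, wp_assign, safeE_zero, ev_zero, zero_le, true_and, and_true, block_single]
  have hvw : ∀ v, 2 ^ v ≤ B → v < w := fun v hv => by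
    rw [← Nat.pow_lt_pow_iff_right (a := 2) (by norm_num)]
    have := hT.lt_pow; omega
  refine wp_loop (fun r' m' t' => 2 ^ r' .lv ≤ B ∧
    (∀ u, u ≤ r' .lv → IsSparse A w B (m' (.sparse s)) u) ∧
    t' ≤ t2 + 10 + r' .lv * (200 * (B + 1))) (fun r' _ => B - r' .lv) ?_ ?_ ?_ ?_
  · refine ⟨by simpa using hb6, fun u hu k hk => ?_, by simp⟩
    simp at hu; subst hu
    simpa using hsp k (by simpa using hk)
  · simp
  · rintro r' m' t' hF ⟨h1, h2, h3⟩ hc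
    have hth : m' (.th s) = A := by rw [hF.mem _ (by cases s <;> rfl), hth2]
    have hbl : r' .blocks = B := by
      rw [hF.reg .blocks (by cases s <;> rfl)]; simpa using hT2.blocks
    have hpow : ∀ v ≤ w, m' .pow2 v = 2 ^ v := by
      rw [hF.mem .pow2 (by cases s <;> rfl)]; exact hT2.pow2
    set v := r' .lv with hv
    have hvw1 := hvw _ h1
    simp only [evC_le, ev_get, ev_add, ev_var, ev_one, ← hv, hpow (v + 1) (by omega), hbl] at hc
    have hvw2 := hvw _ hc
    have hvB : (v + 2) * B ≤ w * B := Nat.mul_le_mul_right _ hvw2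
    rw [mul_comm w] at hvB
    have e1 : (v + 2) * B = v * B + B + B := by ring
    have e2 : (v + 1) * B = v * B + B := by ring
    have hvlt := Nat.lt_two_pow_self (n := v)
    have hsucc := Nat.succ_mul v (200 * (B + 1))
    simp only [Nat.succ_eq_add_one] at hsucc
    have hpow2 : 2 ^ (v + 1) = 2 ^ v + 2 ^ v := by rw [pow_succ]; ring
    rw [block_cons, block_single, wp_seq]
    refine wp_forUp (fun k r'' m'' t'' => (∀ u, u ≤ v → IsSparse A w B (m'' (.sparse s)) u) ∧
      (∀ i, i < k → IsMaxAt A (i * w) ((i + 2 ^ (v + 1)) * w - 1)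
        (m'' (.sparse s) ((v + 1) * B + i))) ∧ t'' ≤ t' + 20 + k * 200) 0 (B - 2 ^ (v + 1)) rfl
      (by omega) (by omega) (by omega) (by simp) (by cases s <;> rfl) ?_ ?_ ?_ ?_
    · intro k r'' m'' t'' hF' _
      simp [hF'.reg .blocks (by cases s <;> rfl), hF'.reg .lv (by cases s <;> rfl), hbl, ← hv,
        hF'.mem .pow2 (by cases s <;> rfl), hpow (v + 1) (by omega)]
    · exact ⟨h2, fun i hi => by omega, by simp⟩
    · rintro k r'' m'' t'' - hk2 hk hF' ⟨hu, hi, ht''⟩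
      have hth' : m'' (.th s) = A := by rw [hF'.mem _ (by cases s <;> rfl), hth]
      have hbl' : r'' .blocks = B := by rw [hF'.reg .blocks (by cases s <;> rfl), hbl]
      have hlv' : r'' .lv = v := by rw [hF'.reg .lv (by cases s <;> rfl)]
      have hpow' : ∀ v ≤ w, m'' .pow2 v = 2 ^ v := by
        rw [hF'.mem .pow2 (by cases s <;> rfl)]; exact hpow
      have hs1 := hu v le_rfl k (by omega)
      have hs2 := hu v le_rfl (k + 2 ^ v) (by omega)
      have hk3 : (k + 2 ^ (v + 1)) * w ≤ B * w := Nat.mul_le_mul_right _ (by omega)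
      have hk4 : (k + 2 ^ v) * w ≤ (k + 2 ^ (v + 1)) * w := Nat.mul_le_mul_right _ (by omega)
      have hs11 := hs1.2.1
      simp only [put, wr, rd, block_cons, block_single, wp_seq, wp_assign, safeE_get, safeE_add,
        safeE_mul, safeE_var, and_self, true_and, and_true, ev_get, ev_add, ev_mul, ev_var, hk, hlv', hbl',
        cost_get, cost_add, cost_mul, cost_var]
      refine ⟨by omega, by omega, ?_⟩
      refine wp_improve (l := k * w) (u := (k + 2 ^ v) * w - 1) (l' := (k + 2 ^ v) * w)
        (u' := (k + 2 ^ (v + 1)) * w - 1) ?_ ?_ ?_ ?_ (by omega) ?_ (by omega) (by omega)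
        fun b t3 hb ht3 => ?_
      · simpa [hth'] using hs1
      · simpa [hth', hk, hlv', hbl', hpow' v (by omega), add_assoc, hpow2] using hs2
      · simp [hlv', hbl']; omega
      · simp
      · exact Nat.mul_le_mul_right _ (by omega)
      have hb2 := hb.2.1
      have hkw : k < 2 ^ (v + 1) * w + k * w := by
        have : k * 1 ≤ k * w := Nat.mul_le_mul_left _ hw
        have : 0 < 2 ^ (v + 1) * w := by positivity
        omega
      simp only [wp_store, safeE_add, safeE_mul, safeE_var, safeE_one, and_self, true_and, and_true, ev_add,
        ev_mul, ev_var, ev_one, Function.update_apply, reduceCtorEq, if_false, if_true, hk, hlv',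
        hbl', costC_le, cost_add, cost_mul, cost_var, cost_one, cost_sub, cost_get]
      refine ⟨by omega, by omega, by omega, fun u hu' i' hi' => ?_, fun i' hi' => ?_, ?_⟩
      · have : u * B ≤ v * B := Nat.mul_le_mul_right _ hu'
        have := Nat.one_le_two_pow (n := u)
        rw [Function.update_of_ne (by omega)]
        exact hu u hu' i' hi'
      · by_cases hik : i' = k
        · subst hik
          rw [if_pos rfl]
          rw [hth'] at hb; exact hb
        · rw [if_neg (by omega)]
          exact hi i' (by omega)
      · simp at ht3; omega
    · rintro r'' m'' t'' hF' - ⟨hu, hi, ht''⟩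
      have hlv' : r'' .lv = v := by rw [hF'.reg .lv (by cases s <;> rfl)]
      simp only [wp_assign, safeE_add, safeE_var, safeE_one, and_self, true_and, and_true, ev_add, ev_var,
        ev_one, hlv', Function.update_self, costC_le, cost_add, cost_mul, cost_var, cost_one,
        cost_sub, cost_get]  at ht'' ⊢
      refine ⟨by omega, ⟨hc, fun u hu' => ?_, by omega⟩, by omega⟩
      rcases hu'.eq_or_lt with rfl | hu'
      · exact fun k hk => hi k (by omega)
      · exact hu u (by omega)
  · rintro r' m' t' hF ⟨h1, h2, h3⟩ hc
    have hpow : ∀ v ≤ w, m' .pow2 v = 2 ^ v := by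
      rw [hF.mem .pow2 (by cases s <;> rfl)]; exact hT2.pow2
    have hbl : r' .blocks = B := by
      rw [hF.reg .blocks (by cases s <;> rfl)]; simpa using hT2.blocks
    have hvw1 := hvw _ h1
    simp only [evC_le, ev_get, ev_add, ev_var, ev_one, hpow (r' .lv + 1) (by omega), hbl, not_le]
      at hc
    refine ⟨⟨fun k hk => ?_, fun v hv => ?_⟩, ?_⟩
    · rw [hF.mem (.th s) (by cases s <;> rfl), hF.mem (.mask s) (by cases s <;> rfl), hth2,
        hF2.mem (.mask s) (by cases s <;> rfl)]
      exact hmask k hk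
    · rw [hF.mem (.th s) (by cases s <;> rfl), hth2]
      refine h2 v ?_
      have := (Nat.pow_lt_pow_iff_right (a := 2) (by norm_num)).1 (hv.trans_lt hc)
      omega
    · have e1 : r' .lv * (200 * (B + 1)) ≤ w * (200 * (B + 1)) := Nat.mul_le_mul_right _ hvw1.le
      have e2 : w * (200 * (B + 1)) = 200 * (B * w) + 200 * w := by ring
      have e3 : B * w * (100 * (w + 1)) ≤ 2 * N * (100 * (N + 1)) := Nat.mul_le_mul hb4 (by omega)
      have e4 : 2 * N * (100 * (N + 1)) = 200 * (N * N) + 200 * N := by ring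
      have e5 : 1000 * (N + 1) ^ 2 = 1000 * (N * N) + 2000 * N + 1000 := by ring
      simp at ht1 ht2 ⊢
      omega

end

/-! ### Thresholds -/

section

namespace Inst
variable (I : Inst)

/-- The number of matches of smaller characters that the positions of thresholds leave room for. -/
def base (c : ℕ) : ℕ := I.before .x c + I.before .y c

/-- The number of occurrences, up to index `i`, of the character at index `i`. -/
def rank (s : Side) (i : ℕ) : ℕ := I.rk s (I.S s i) i

/-- The position in the threshold arrays of the diagonal of the match `v`. -/
def dpos (v : Side → ℕ) : ℕ :=
  I.base (I.S .x (v .x)) +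
    (I.rank .y (v .y) + I.count .x (I.S .x (v .x)) - I.rank .x (v .x))

/-- The match `u` is on the same diagonal as the match `v`, and not before it. -/
def Above (v u : Side → ℕ) : Prop :=
  I.S .x (u .x) = I.S .x (v .x) ∧ ∃ k, ∀ s, I.rank s (u s) = I.rank s (v s) + k

/-- The thresholds reflect those suff-matches that satisfy `R`. -/
def Thr (R : (Side → ℕ) → Prop) (m : Arr → ℕ → ℕ) : Prop :=
  ∀ v, I.Match v → ∀ s, I.rank s (v s) ≤ m (.th s) (I.dpos v) ↔ ∃ u, I.SM u ∧ R u ∧ I.Above v u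

variable {I} {s : Side} {v u w : Side → ℕ} {c d i j k l : ℕ} {m : Arr → ℕ → ℕ}
  {R : (Side → ℕ) → Prop}

lemma base_succ : I.base (c + 1) = I.base c + (I.count .x c + I.count .y c) := by
  simp only [base, before_succ]; omega

lemma base_mono (h : c ≤ d) : I.base c ≤ I.base d := Nat.add_le_add (before_mono h) (before_mono h)

lemma base_le : I.base c ≤ I.n .x + I.n .y := Nat.add_le_add before_le before_le

/-- Diagonals of different characters have different positions in the threshold arrays. -/
lemma base_add_inj (h1 : 1 ≤ k) (h2 : k < I.count .x c + I.count .y c) (h3 : 1 ≤ l)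
    (h4 : l < I.count .x d + I.count .y d) (h : I.base c + k = I.base d + l) :
    c = d ∧ k = l := by
  rcases lt_trichotomy c d with h5 | h5 | h5
  · have := base_mono (I := I) (Nat.succ_le_of_lt h5)
    rw [Nat.succ_eq_add_one, base_succ] at this; omega
  · subst h5; exact ⟨rfl, by omega⟩
  · have := base_mono (I := I) (Nat.succ_le_of_lt h5)
    rw [Nat.succ_eq_add_one, base_succ] at this; omega

lemma Match.rank_pos (h : I.Match v) (s : Side) : 1 ≤ I.rank s (v s) :=
  rk_pos (h.1 s).1 (h.1 s).2 rfl

lemma Match.rank_le (h : I.Match v) (s t : Side) : I.rank s (v s) ≤ I.count s (I.S t (v t)) := by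
  rw [← h.eq s t]; exact rk_le_count

/-- Matches have the same position in the threshold arrays if and only if they are matches of the same
character on the same diagonal. -/
lemma Match.dpos_eq_iff (hv : I.Match v) (hu : I.Match u) : I.dpos u = I.dpos v ↔
    I.S .x (u .x) = I.S .x (v .x) ∧
      I.rank .y (u .y) + I.rank .x (v .x) = I.rank .y (v .y) + I.rank .x (u .x) := by
  have a1 := hv.rank_pos .x
  have a2 := hv.rank_pos .y
  have a3 := hv.rank_le .x .x
  have a4 := hv.rank_le .y .x
  have b1 := hu.rank_pos .x
  have b2 := hu.rank_pos .y
  have b3 := hu.rank_le .x .x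
  have b4 := hu.rank_le .y .x
  constructor
  · intro h
    have := base_add_inj (by omega) (by omega) (by omega) (by omega) h
    refine ⟨this.1, ?_⟩
    rw [this.1] at *; omega
  · rintro ⟨h1, h2⟩
    simp only [dpos]
    rw [h1] at *; omega

/-- Whether `v` precedes `u` on their diagonal can be read off from their ranks on either side. -/
lemma Match.above_iff (hv : I.Match v) (hu : I.Match u) (s : Side) :
    I.Above v u ↔ I.dpos u = I.dpos v ∧ I.rank s (v s) ≤ I.rank s (u s) := by
  rw [hv.dpos_eq_iff hu, Above]
  constructor
  · rintro ⟨h1, k, hk⟩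
    have h2 := hk .x; have h3 := hk .y; have h4 := hk s
    exact ⟨⟨h1, by omega⟩, by omega⟩
  · rintro ⟨⟨h1, h2⟩, h3⟩
    refine ⟨h1, I.rank s (u s) - I.rank s (v s), ?_⟩
    cases s <;> (intro t; cases t <;> omega)

lemma Match.dpos_lt (hv : I.Match v) : I.dpos v < I.n .x + I.n .y := by
  have a1 := hv.rank_pos .x
  have a2 := hv.rank_pos .y
  have a3 := hv.rank_le .x .x
  have a4 := hv.rank_le .y .x
  have := @base_succ I (I.S .x (v .x))
  have := @base_le I (I.S .x (v .x) + 1)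
  simp only [dpos]; omega

/-- On a diagonal, all matches before a suff-match are suff-matches. -/
lemma SM.of_above (hu : I.SM u) (hv : I.Match v) (h : I.Above v u) : I.SM v := by
  obtain ⟨hc, k, hk⟩ := h
  induction k generalizing u with
  | zero =>
    have : u = v := by
      funext s
      have h1 := hk s
      have h2 := hu.match
      have h3 : I.S s (u s) = I.S s (v s) := by rw [h2.eq s .x, hv.eq s .x, hc]
      rw [rank, rank, h3] at h1
      exact eq_of_rk_eq (h2.1 s).2 (hv.1 s).2 h3 rfl h1
    exact this ▸ hu
  | succ k ih =>
    have hm := hu.match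
    have : ∀ s, ∃ i, 1 ≤ i ∧ i ≤ I.n s ∧ I.S s i = I.S s (u s) ∧
        I.rk s (I.S s (u s)) i = I.rank s (v s) + k := fun s => by
      have := hv.rank_pos s
      have := hm.rank_le s s
      exact exists_rk_eq (by omega) (by have := hk s; omega)
    choose w hw1 hw2 hw3 hw4 using this
    have hwm : I.Match w := ⟨fun s => ⟨hw1 s, hw2 s⟩, by rw [hw3, hw3, hm.2]⟩
    have hwr : ∀ s, I.rank s (w s) = I.rank s (v s) + k := fun s => by rw [rank, hw3, hw4]
    refine ih (u := w) (SM.step hu hwm fun s => ⟨?_, fun i h1 h2 h3 => ?_⟩)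
      ((hw3 .x).trans hc) hwr
    · by_contra h1
      have h2 := rk_mono (I := I) (s := s) (c := I.S s (u s)) (not_lt.1 h1)
      have h3 := hk s
      rw [hw4] at h2
      simp only [rank] at h3 h2; omega
    · rw [hw3] at h3
      have h4 := rk_lt_rk h1 (h2.le.trans (hm.1 s).2) h3
      have h5 := rk_lt_rk h2 (hm.1 s).2 rfl
      have h6 := hk s
      rw [hw4] at h4
      simp only [rank] at h4 h5 h6; omega

/-- The thresholds decide which matches are suff-matches, because the matches that precede a suff-match
on its diagonal are suff-matches. -/
lemma Thr.sm_iff (h : I.Thr (fun _ => True) m) (hv : I.Match v) (s : Side) :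
    I.rank s (v s) ≤ m (.th s) (I.dpos v) ↔ I.SM v := by
  rw [h v hv s]
  exact ⟨fun ⟨u, h1, _, h2⟩ => h1.of_above hv h2, fun h => ⟨v, h, trivial, rfl, 0, fun _ => rfl⟩⟩

lemma Thr.congr {m' : Arr → ℕ → ℕ} {R' : (Side → ℕ) → Prop} (h : I.Thr R m)
    (hm : ∀ s, m' (.th s) = m (.th s)) (hR : ∀ u, I.SM u → (R' u ↔ R u)) : I.Thr R' m' := by
  intro v hv s
  rw [hm, h v hv s]
  exact exists_congr fun u => and_congr_right fun hu => and_congr_left fun _ => (hR u hu).symm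

/-- Recording a suff-match `w` updates the thresholds by maxima. -/
lemma Thr.record (h : I.Thr R m) {m' : Arr → ℕ → ℕ} (hw : I.SM w)
    (hm : ∀ s, m' (.th s) = Function.update (m (.th s)) (I.dpos w)
      (max (m (.th s) (I.dpos w)) (I.rank s (w s)))) : I.Thr (fun u => R u ∨ u = w) m' := by
  intro v hv s
  have hwm := hw.match
  rw [hm]
  have key : (∃ u, I.SM u ∧ (R u ∨ u = w) ∧ I.Above v u) ↔
      I.rank s (v s) ≤ m (.th s) (I.dpos v) ∨ I.Above v w := by
    rw [h v hv s]
    constructor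
    · rintro ⟨u, h1, h2 | rfl, h3⟩
      · exact Or.inl ⟨u, h1, h2, h3⟩
      · exact Or.inr h3
    · rintro (⟨u, h1, h2, h3⟩ | h3)
      · exact ⟨u, h1, Or.inl h2, h3⟩
      · exact ⟨w, hw, Or.inr rfl, h3⟩
  rw [key, hv.above_iff hwm s]
  by_cases hd : I.dpos v = I.dpos w
  · simp [hd]
  · simp [Function.update_apply, hd, Ne.symm hd]

/-- The pair `(i, j)`. -/
def pt (i j : ℕ) : Side → ℕ
  | .x => i
  | .y => j

@[simp] lemma pt_x : pt i j .x = i := rfl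
@[simp] lemma pt_y : pt i j .y = j := rfl
lemma pt_eta (v : Side → ℕ) : pt (v .x) (v .y) = v := by funext s; cases s <;> rfl

variable (I) in
/-- `a` is the least index `i' ≥ i` such that `(i', j)` is a suff-match; the length plus one if there
is none. -/
def Least (i j a : ℕ) : Prop :=
  i ≤ a ∧ a ≤ I.n .x + 1 ∧ (a ≤ I.n .x → I.SM (pt a j)) ∧ ∀ i', i ≤ i' → i' < a → ¬ I.SM (pt i' j)

lemma Least.of_succ {a : ℕ} (h : I.Least (i + 1) j a) (hn : ¬ I.SM (pt i j)) : I.Least i j a := by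
  refine ⟨by have := h.1; omega, h.2.1, h.2.2.1, fun i' h1 h2 => ?_⟩
  rcases h1.eq_or_lt with rfl | h1
  · exact hn
  · exact h.2.2.2 i' h1 h2

lemma Least.of_sm (hi : i ≤ I.n .x) (h : I.SM (pt i j)) : I.Least i j i :=
  ⟨le_rfl, by omega, fun _ => h, fun i' h1 h2 => by omega⟩

/-- The suff-matches of row `i` are determined by the next suff-matches, in each column, from row `i + 1`
on: `(i, j)` is a suff-match if and only if, for some column `k` up to the next occurrence of the
character in `Y`, the next suff-match in that column is not beyond the next occurrence of the
character in `X`. -/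
lemma sm_row_iff {old : ℕ → ℕ} (hi : 1 ≤ i) (hin : i < I.n .x) (hj : 1 ≤ j) (hjn : j ≤ I.n .y)
    (hS : I.S .y j = I.S .x i) (hold : ∀ k, 1 ≤ k → k ≤ I.n .y → I.Least (i + 1) k (old k)) :
    I.SM (pt i j) ↔ ∃ k, j < k ∧ k ≤ I.n .y ∧ (∀ l, j < l → l < k → I.S .y l ≠ I.S .x i) ∧
      old k ≠ I.n .x + 1 ∧ old k ≤ I.nxt .x (I.S .x i) i := by
  constructor
  · intro h
    generalize hp : pt i j = p at h
    cases h with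
    | base =>
      have := congrFun hp .x
      simp at this; omega
    | @step u v hv hm hu =>
      subst hp
      have h1 := hv.match
      have hx := hu .x
      have hy := hu .y
      simp only [pt_x, pt_y] at hx hy
      have ho := hold (v .y) (h1.1 .y).1 (h1.1 .y).2
      have h2 : old (v .y) ≤ v .x := by
        by_contra h3
        exact ho.2.2.2 (v .x) hx.1 (not_le.1 h3) (by rwa [pt_eta])
      have h3 := (h1.1 .x).2
      refine ⟨v .y, hy.1, (h1.1 .y).2, fun l hl1 hl2 => by rw [← hS]; exact hy.2 l hl1 hl2,
        by omega, h2.trans ?_⟩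
      by_contra h4
      have h5 := nxt_spec (I := I) (s := .x) (c := I.S .x i) (h := i) (by omega)
      exact hx.2 _ h5.1 (by omega) h5.2
  · rintro ⟨k, hk1, hk2, hk3, hk4, hk5⟩
    have ho := hold k (by omega) hk2
    have h1 := ho.2.1
    have h2 := ho.1
    refine SM.step (ho.2.2.1 (by omega)) ⟨Side.forall.2 ⟨⟨hi, hin.le⟩, hj, hjn⟩, hS.symm⟩
      (Side.forall.2 ⟨⟨h2, fun l hl1 hl2 hl3 => ?_⟩, hk1, fun l hl1 hl2 => ?_⟩)
    · simp only [pt_x] at hl1 hl2 hl3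
      have := nxt_le hl1 (by omega) hl3
      omega
    · simp only [pt_y]; rw [hS]; exact hk3 l hl1 hl2

end Inst

variable {I : Inst} {V M L N w B : ℕ} {Q : Post} {r : Reg → ℕ} {m : Arr → ℕ → ℕ} {t : ℕ} {s : Side}
  {R : (Side → ℕ) → Prop}

lemma Inst.Big.bound (hB : I.Big V M) : 20 * (I.n .x + I.n .y) + 20 ≤ V := hB.le_M.trans hB.le_V

open Inst in
/-- The suff-match in registers `i` and `j` is entered into the threshold arrays. -/
lemma wp_recordSuff (hB : I.Big V M) (hx : I.Idx .x r m) (hy : I.Idx .y r m) {u : Side → ℕ}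
    (hu : I.SM u) (hi : r .i = u .x) (hj : r .j = u .y) (hR : I.Thr R m)
    (H : ∀ r' m' t', Frame V recordSuff r m r' m' → I.Thr (fun v => R v ∨ v = u) m' →
      t' ≤ t + 100 → Q r' m' t') : wp V M recordSuff Q r m t := by
  refine wp_conseq (Q := fun r' m' t' => I.Thr (fun v => R v ∨ v = u) m' ∧ t' ≤ t + 100) ?_
    fun r' m' t' hF h => H r' m' t' hF h.1 h.2
  have hm := hu.match
  have hV := hB.bound
  have hM := hB.le_M
  have hσ := hB.σ_le
  have h1 := hm.1 .x
  have h2 := hm.1 .y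
  have h3 := I.S_pos h1.1 h1.2
  have h4 := hm.dpos_lt
  have h5 := @rk_le I .x (I.S .x (u .x)) (u .x)
  have h6 := @rk_le I .y (I.S .y (u .y)) (u .y)
  have hp : I.before .x (I.S .x (u .x)) + I.before .y (I.S .x (u .x)) +
    (I.rank .y (u .y) + I.count .x (I.S .x (u .x)) - I.rank .x (u .x)) = I.dpos u := rfl
  have r1 : I.rk .x (I.S .x (u .x)) (u .x) = I.rank .x (u .x) := rfl
  have r2 : I.rk .y (I.S .y (u .y)) (u .y) = I.rank .y (u .y) := rfl
  simp only [recordSuff, put, wr, rd, ifs, block_cons, block_single, block_nil, wp_seq, wp_assign,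
    wp_ite, wp_store, wp_skip, safeE_get, safeE_var, safeE_add, safeE_sub, and_self, true_and,
    and_true, ev_get, ev_var, ev_add, ev_sub, hi, hj, hx.str _ h1.1 h1.2, Function.update_apply,
    reduceCtorEq, if_false, if_true, hx.start _ h3.1 h3.2, hy.start _ h3.1 h3.2,
    hy.rank _ h2.1 h2.2, hx.cnt, hx.rank _ h1.1 h1.2, hp, r1, r2, safeC_lt, evC_lt, Arr.th.injEq,
    cost_get, cost_var, cost_add, cost_sub, costC_lt]
  refine ⟨by omega, by omega, fun hc1 => ⟨by omega, by omega, fun hc2 => ⟨by omega, by omega, ?_,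
    by omega⟩, fun hc2 => ⟨?_, by omega⟩⟩, fun hc1 => ⟨fun hc2 => ⟨by omega, by omega, ?_,
    by omega⟩, fun hc2 => ⟨?_, by omega⟩⟩⟩
  all_goals
    refine hR.record hu fun s => ?_
    funext k
    cases s <;> simp only [Function.update_apply, reduceCtorEq, Arr.th.injEq, if_true, if_false] <;>
      split_ifs with hk <;> first | rfl | (subst hk; omega)

open Inst in
/-- The threshold arrays are initialized for no suff-match at all, by the coordinates that precede the
first match of each diagonal. -/
lemma wp_initTh (hB : I.Big V M) (hx : I.Idx .x r m) (hy : I.Idx .y r m) (hσr : r .sigma = I.σ)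
    (H : ∀ r' m' t', Frame V initTh r m r' m' → I.Thr (fun _ => False) m' →
      t' ≤ t + 200 * (I.n .x + I.n .y + 1) → Q r' m' t') : wp V M initTh Q r m t := by
  refine wp_conseq (Q := fun r' m' t' => I.Thr (fun _ => False) m' ∧
    t' ≤ t + 200 * (I.n .x + I.n .y + 1)) ?_ fun r' m' t' hF h => H r' m' t' hF h.1 h.2
  have hV := hB.bound
  have hM := hB.le_M
  have hσ := hB.σ_le
  let P : ℕ → ℕ → (Arr → ℕ → ℕ) → Prop := fun c k m' =>
    m' (.th .x) (I.base c + k) = I.count .x c - k ∧ m' (.th .y) (I.base c + k) = k - I.count .x c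
  refine wp_forUp (fun c r' m' t' => (∀ d k, 1 ≤ d → d < c → 1 ≤ k →
    k < I.count .x d + I.count .y d → P d k m') ∧ t' ≤ t + 2 + 60 * c + 60 * I.base c)
    1 I.σ rfl (by omega) (by omega) (by omega) (by simp) rfl ?_ ?_ ?_ ?_
  · intro k r' m' t' hF _
    simp [hF.reg .sigma rfl, hσr]
  · refine ⟨fun d k h1 h2 => by omega, by simp; omega⟩
  · rintro c r' m' t' hc1 hc2 hc hF ⟨hP, ht⟩
    have hcx : m' (.cnt .x) c = I.count .x c := by rw [hF.mem _ rfl, hx.cnt]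
    have hcy : m' (.cnt .y) c = I.count .y c := by rw [hF.mem _ rfl, hy.cnt]
    have hsx : m' (.start .x) c = I.before .x c := by rw [hF.mem _ rfl, hx.start c hc1 hc2]
    have hsy : m' (.start .y) c = I.before .y c := by rw [hF.mem _ rfl, hy.start c hc1 hc2]
    have hb1 := @base_succ I c
    have hb2 := @base_le I (c + 1)
    rw [block_single]
    refine wp_forUp (fun k r'' m'' t'' => (∀ d k, 1 ≤ d → d < c → 1 ≤ k →
      k < I.count .x d + I.count .y d → P d k m'') ∧
      (∀ l, 1 ≤ l → l < k → l < I.count .x c + I.count .y c → P c l m'') ∧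
      t'' + 60 ≤ t + 2 + 60 * c + 60 * I.base c + 60 * k + 10)
      1 (I.count .x c + I.count .y c - 1) rfl (by omega) (by omega) (by omega) (by simp) rfl
        ?_ ?_ ?_ ?_
    · intro k r'' m'' t'' hF' _
      simp [hF'.reg .c rfl, hc, hF'.mem (.cnt .x) rfl, hF'.mem (.cnt .y) rfl, hcx, hcy]
    · exact ⟨hP, fun l h1 h2 => by omega, by simp; omega⟩
    · rintro k r'' m'' t'' hk1 hk2 hk hF' ⟨hP1, hP2, ht''⟩
      have hbk : I.before .x c + I.before .y c + k = I.base c + k := rfl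
      simp only [wr, rd, block_cons, block_single, wp_seq, wp_store, safeE_get, safeE_var,
        safeE_add, safeE_sub, and_self, true_and, and_true, ev_get, ev_var, ev_add, ev_sub,
        hF'.reg .c rfl, hc, hk, hF'.mem (.start .x) rfl, hF'.mem (.start .y) rfl,
        hF'.mem (.cnt .x) rfl, Function.update_apply, reduceCtorEq, Arr.start.injEq,
        Arr.cnt.injEq, if_false, hsx, hsy, hcx, hbk, cost_get, cost_var, cost_add, cost_sub, cost_one]
      have hset : ∀ d l, 1 ≤ l → l < I.count .x d + I.count .y d →
          ((d = c ∧ l = k) ∨ P d l m'') → P d l (Function.update (Function.update m'' (.th .x)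
            (Function.update (m'' (.th .x)) (I.base c + k) (I.count .x c - k))) (.th .y)
            (Function.update (m'' (.th .y)) (I.base c + k) (k - I.count .x c))) := by
        intro d l h1 h2 h3
        by_cases hdl : d = c ∧ l = k
        · obtain ⟨rfl, rfl⟩ := hdl
          simp [P]
        · have : I.base d + l ≠ I.base c + k := fun h =>
            hdl (base_add_inj h1 h2 hk1 (by omega) h)
          have := h3.resolve_left hdl
          simp [P, *]
      refine ⟨by omega, by omega, by omega, by omega,
        fun d l h1 h2 h3 h4 => hset d l h3 h4 (Or.inr (hP1 d l h1 h2 h3 h4)),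
        fun l h1 h2 h3 => hset c l h1 h3 ?_, by omega⟩
      by_cases hl : l = k
      · exact Or.inl ⟨rfl, hl⟩
      · exact Or.inr (hP2 l h1 (by omega) h3)
    · rintro r'' m'' t'' hF' - ⟨hP1, hP2, ht''⟩
      refine ⟨fun d k h1 h2 h3 h4 => ?_, ?_⟩
      · by_cases hd : d = c
        · subst hd; exact hP2 k h3 (by omega) h4
        · exact hP1 d k h1 (by omega) h3 h4
      · rw [hb1]
        simp only [cost_get, cost_var, cost_add, cost_sub, cost_one]
        omega
  · rintro r' m' t' hF - ⟨hP, ht⟩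
    refine ⟨fun v hv s => ?_, ?_⟩
    · have a0 := I.S_pos (hv.1 .x).1 (hv.1 .x).2
      have a1 := hv.rank_pos .x
      have a2 := hv.rank_pos .y
      have a3 := hv.rank_le .x .x
      have a4 := hv.rank_le .y .x
      have := hP (I.S .x (v .x))
        (I.rank .y (v .y) + I.count .x (I.S .x (v .x)) - I.rank .x (v .x))
        a0.1 (by omega) (by omega) (by omega)
      have h1 : m' (.th .x) (I.dpos v) = _ := this.1
      have h2 : m' (.th .y) (I.dpos v) = _ := this.2
      simp only [false_and, and_false, exists_false, iff_false, not_le]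
      cases s
      · rw [h1]; omega
      · rw [h2]; omega
    · have := @base_le I (I.σ + 1)
      simp; omega

end

section

namespace Inst
variable {I : Inst} {i j k a b : ℕ} {u : Side → ℕ}

lemma SM.lt_or_eq (h : I.SM u) : u = I.n ∨ ∀ s, u s < I.n s := by
  cases h with
  | base => exact Or.inl rfl
  | step hv _ h => exact Or.inr fun s => (h s).1.trans_le (hv.match.1 s).2

lemma sm_last_iff : I.SM (pt (I.n .x) j) ↔ j = I.n .y := by
  constructor
  · intro h
    rcases h.lt_or_eq with h | h
    · exact congrFun h .y
    · exact absurd (h .x) (lt_irrefl _)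
  · rintro rfl; rw [pt_eta]; exact SM.base

lemma Least.eq_iff (h : I.Least i j a) (hi : i ≤ I.n .x) : a = i ↔ I.SM (pt i j) := by
  constructor
  · rintro rfl; exact h.2.2.1 hi
  · intro h1
    by_contra h2
    exact h.2.2.2 i le_rfl (lt_of_le_of_ne h.1 (Ne.symm h2)) h1

/-- The step from row `i + 1` to row `i` in a column of the character of row `i`. The columns `k` less
than `b` are those up to the next occurrence of this character in `Y`. -/
lemma Least.of_row {old : ℕ → ℕ} (hi : 1 ≤ i) (hin : i < I.n .x) (hj : 1 ≤ j) (hjn : j ≤ I.n .y)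
    (hS : I.S .y j = I.S .x i) (hold : ∀ k, 1 ≤ k → k ≤ I.n .y → I.Least (i + 1) k (old k))
    (hb : ∀ k, j < k → k ≤ I.n .y → ((∀ l, j < l → l < k → I.S .y l ≠ I.S .x i) ↔ k < b))
    (ha : (a = i ∧ ∃ k, j < k ∧ k < b ∧ k ≤ I.n .y ∧ old k ≠ I.n .x + 1 ∧
        old k ≤ I.nxt .x (I.S .x i) i) ∨
      (a = old j ∧ ∀ k, j < k → k < b → k ≤ I.n .y → old k ≠ I.n .x + 1 →
        ¬ old k ≤ I.nxt .x (I.S .x i) i)) : I.Least i j a := by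
  have key := sm_row_iff hi hin hj hjn hS hold
  rcases ha with ⟨rfl, k, h1, h2, h3, h4⟩ | ⟨rfl, h⟩
  · exact Least.of_sm hin.le (key.2 ⟨k, h1, h3, (hb k h1 h3).2 h2, h4⟩)
  · refine (hold j hj hjn).of_succ fun h5 => ?_
    obtain ⟨k, h1, h3, h4, h6, h7⟩ := key.1 h5
    exact h k h1 ((hb k h1 h3).1 h4) h3 h6 h7

end Inst

variable {I : Inst} {V M L N w B : ℕ} {Q : Post} {r : Reg → ℕ} {m : Arr → ℕ → ℕ} {t : ℕ} {s : Side}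
  {i : ℕ}

open Inst in
/-- The array `suff`, which holds the next suff-match in each column, is updated from row `i + 1` to row
`i` in linear time. -/
lemma wp_updateSuff (hB : I.Big V M) (hx : I.Idx .x r m) (hy : I.Idx .y r m) (hi : 1 ≤ i)
    (hin : i < I.n .x) (hri : r .i = i)
    (hold : ∀ k, 1 ≤ k → k ≤ I.n .y → I.Least (i + 1) k (m .suff k))
    (H : ∀ r' m' t', Frame V updateSuff r m r' m' →
      (∀ k, 1 ≤ k → k ≤ I.n .y → I.Least i k (m' .suff k)) →
      t' ≤ t + 100 * (I.n .x + I.n .y + 1) → Q r' m' t') : wp V M updateSuff Q r m t := by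
  refine wp_conseq (Q := fun r' m' t' => (∀ k, 1 ≤ k → k ≤ I.n .y → I.Least i k (m' .suff k)) ∧
    t' ≤ t + 100 * (I.n .x + I.n .y + 1)) ?_ fun r' m' t' hF h => H r' m' t' hF h.1 h.2
  have hV := hB.bound
  have hM := hB.le_M
  have hSi : m (.str .x) i = I.S .x i := hx.str i hi hin.le
  have hnx := @Inst.nxt_le_succ I .x (I.S .x i) i
  have hlt : i < I.nxt .x (I.S .x i) i := lt_nxt (by omega)
  simp only [updateSuff, put, whl, block_cons, block_single, wp_seq, wp_assign, safeE_add,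
    safeE_var, safeE_one, and_self, true_and, ev_add, ev_var, ev_one, hri, cost_add, cost_var,
    cost_one]
  refine ⟨by omega, ?_⟩
  refine wp_loop (fun r' m' t' => (∀ x, x ≠ .iNext → r' x = r x) ∧ m' = m ∧ i < r' .iNext ∧
    r' .iNext ≤ I.nxt .x (I.S .x i) i ∧ t' ≤ t + 4 + 40 * (r' .iNext - i))
    (fun r' _ => I.n .x + 1 - r' .iNext) ?_ ?_ ?_ ?_
  · refine ⟨fun x hx => by simp [hx], rfl, by simp, by simp; omega, by simp⟩
  · intros; simp [rd]
  · rintro r' m' t' - ⟨hr, rfl, h1, h2, h3⟩ hc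
    simp only [evC_and, evC_le, evC_ne, rd, ev_get, ev_var, hr (.len .x) (by simp), hr .i (by simp),
      hri, hx.len, hSi] at hc
    rw [hx.str _ (by omega) hc.1] at hc
    simp only [wp_assign, safeE_add, safeE_var, safeE_one, and_self, true_and, ev_add, ev_var,
      ev_one, Function.update_self, cost_add, cost_var, cost_one, costC_and, costC_le, costC_ne, rd,
      cost_get]
    refine ⟨by omega, ⟨fun x hx => by simp [hx, hr x hx], by omega, ?_, by omega⟩, by omega⟩
    have : r' .iNext ≠ I.nxt .x (I.S .x i) i := fun h => by
      have := (nxt_spec (I := I) (s := .x) (c := I.S .x i) (h := i) (by omega)).2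
      exact hc.2 (h ▸ this)
    omega
  rintro r0 m0 t0 hF0 ⟨hr, rfl, h1, h2, h3⟩ hc
  have hiN : r0 .iNext = I.nxt .x (I.S .x i) i := by
    by_contra h4
    simp only [evC_and, evC_le, evC_ne, rd, ev_get, ev_var, hr (.len .x) (by simp), hr .i (by simp),
      hri, hx.len, hSi] at hc
    refine hc ⟨by omega, fun h5 => ?_⟩
    rw [hx.str _ (by omega) (by omega)] at h5
    have := nxt_le (I := I) h1 (by omega) h5
    omega
  clear hc h1 h2
  simp only [ev_zero, zero_le, true_and, safeE_zero, costC_and, costC_le, costC_ne, rd, cost_get,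
    cost_var, cost_zero]
  refine wp_forUp (fun j r' m' t' => ∃ p, r' .jPrev = p ∧ p < j ∧ (1 ≤ p → I.S .y p = I.S .x i) ∧
    (∀ l, p < l → l < j → I.S .y l ≠ I.S .x i) ∧
    (∀ k, j ≤ k → m' .suff k = m0 .suff k) ∧
    (∀ k, 1 ≤ k → k < j → k ≠ p → I.Least i k (m' .suff k)) ∧
    (1 ≤ p → (m' .suff p = i ∧ ∃ k, p < k ∧ k < j ∧ k ≤ I.n .y ∧ m0 .suff k ≠ I.n .x + 1 ∧
        m0 .suff k ≤ I.nxt .x (I.S .x i) i) ∨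
      (m' .suff p = m0 .suff p ∧ ∀ k, p < k → k < j → k ≤ I.n .y → m0 .suff k ≠ I.n .x + 1 →
        ¬ m0 .suff k ≤ I.nxt .x (I.S .x i) i)) ∧
    t' ≤ t + 60 + 40 * I.n .x + 80 * j) 1 (I.n .y) rfl (by omega) (by omega) (by omega) (by simp) rfl
    ?_ ?_ ?_ ?_
  · intro k r' m' t' hF _
    simp [hF.reg (.len .y) rfl, hr, hy.len]
  · refine ⟨0, by simp, by omega, by omega, fun l h1 h2 => by omega, fun _ _ => rfl,
      fun k h1 h2 => by omega, by omega, by simp; omega⟩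
  · rintro j r' m' t' hj1 hj2 hj hF ⟨p, hp, hpj, hSp, hl, hk, hL, hA, ht⟩
    have hij : m' (.str .x) i = I.S .x i := by rw [hF.mem _ rfl, hSi]
    have hyj : m' (.str .y) j = I.S .y j := by rw [hF.mem _ rfl, hy.str j hj1 hj2]
    have hlen : r' (.len .x) = I.n .x := by
      rw [hF.reg _ rfl]; simp [hr, hx.len]
    have hi' : r' .i = i := by rw [hF.reg _ rfl]; simp [hr, hri]
    have hiN' : r' .iNext = I.nxt .x (I.S .x i) i := by
      rw [hF.reg _ rfl, Function.update_of_ne (by simp), hiN]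
    simp only [put, wr, rd, ifs, block_cons, block_single, block_nil, wp_seq, wp_assign,
      wp_ite, wp_store, wp_skip, safeE_get, safeE_var, safeE_add, safeE_one, and_self, true_and,
      and_true, ev_get, ev_var, ev_add, ev_one, hi', hj, Function.update_apply,
      reduceCtorEq, if_false, if_true, safeC_and, safeC_ne, safeC_le, safeC_eq, evC_and, evC_ne,
      evC_le, evC_eq, hp, hlen, hiN', hij, hyj,
      cost_get, cost_var, cost_add, cost_one, costC_and, costC_le, costC_ne, costC_eq, hk j le_rfl]
    -- the state after the first conditional
    have step : ∀ a : ℕ → ℕ, (∀ k, k ≠ p → a k = m' .suff k) →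
        (1 ≤ p → (a p = i ∧ ∃ k, p < k ∧ k < j + 1 ∧ k ≤ I.n .y ∧ m0 .suff k ≠ I.n .x + 1 ∧
          m0 .suff k ≤ I.nxt .x (I.S .x i) i) ∨
        (a p = m0 .suff p ∧ ∀ k, p < k → k < j + 1 → k ≤ I.n .y → m0 .suff k ≠ I.n .x + 1 →
          ¬ m0 .suff k ≤ I.nxt .x (I.S .x i) i)) →
        (∀ k, j + 1 ≤ k → a k = m0 .suff k) ∧
        (I.S .y j = I.S .x i → ∀ k, 1 ≤ k → k < j + 1 → k ≠ j → I.Least i k (a k)) ∧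
        (I.S .y j ≠ I.S .x i → ∀ k, 1 ≤ k → k < j + 1 → k ≠ p → I.Least i k (a k)) ∧
        (I.S .y j = I.S .x i → a j = m0 .suff j) := by
      intro a ha hap
      refine ⟨fun k hk' => ?_, fun hS k h1 h2 h3 => ?_, fun hS k h1 h2 h3 => ?_, fun _ => ?_⟩
      · rw [ha k (by omega), hk k (by omega)]
      · by_cases hkp : k = p
        · subst hkp
          refine Least.of_row (b := j + 1) hi hin h1 (by omega) (hSp h1) hold
            (fun l h4 h5 => ⟨fun h6 => ?_, fun h6 l' h7 h8 => hl l' h7 (by omega)⟩) (hap h1)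
          by_contra h7
          exact h6 j (by omega) (by omega) hS
        · rw [ha k hkp]; exact hL k h1 (by omega) hkp
      · rw [ha k h3]
        by_cases hkj : k = j
        · subst hkj
          rw [hk k le_rfl]
          exact (hold k h1 hj2).of_succ fun h => hS (h.match.eq .y .x)
        · exact hL k h1 (by omega) h3
      · rw [ha j (by omega), hk j le_rfl]
    have hij : ∀ (hS : ¬ I.S .y j = I.S .x i) l, p < l → l < j + 1 → I.S .y l ≠ I.S .x i := by
      intro hS l h1 h2
      by_cases h : l = j
      · exact h ▸ hS
      · exact hl l h1 (by omega)
    refine ⟨fun ⟨hc1, hc2, hc3⟩ => ⟨by omega, by omega, ?_⟩, fun hc1 => ?_⟩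
    · have := step (Function.update (m' .suff) p i) (fun k hk => by simp [hk]) fun h =>
        Or.inl ⟨by simp, j, hpj, by omega, hj2, hc1, hc3⟩
      simp only [Function.update_apply] at this
      refine ⟨fun hS => ⟨by omega, j, rfl, by omega, fun _ => hS, fun l h1 h2 => by omega,
        this.1, this.2.1 hS, fun _ => Or.inr ⟨this.2.2.2 hS, fun k h1 h2 => by omega⟩, by omega⟩,
        fun hS => ⟨p, rfl, by omega, hSp, hij hS, this.1, this.2.2.1 hS,
          fun _ => Or.inl ⟨by simp, j, hpj, by omega, hj2, hc1, hc3⟩, by omega⟩⟩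
    · have hap : (1 ≤ p → (m' .suff p = i ∧ ∃ k, p < k ∧ k < j + 1 ∧ k ≤ I.n .y ∧
          m0 .suff k ≠ I.n .x + 1 ∧ m0 .suff k ≤ I.nxt .x (I.S .x i) i) ∨
        (m' .suff p = m0 .suff p ∧ ∀ k, p < k → k < j + 1 → k ≤ I.n .y → m0 .suff k ≠ I.n .x + 1 →
          ¬ m0 .suff k ≤ I.nxt .x (I.S .x i) i)) := by
        intro h1
        refine (hA h1).imp (fun ⟨h2, k, h3, h4, h5⟩ => ⟨h2, k, h3, by omega, h5⟩)
          fun ⟨h2, h3⟩ => ⟨h2, fun k h4 h5 h6 h7 h8 => ?_⟩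
        by_cases h : k = j
        · subst h; exact hc1 ⟨h7, h1, h8⟩
        · exact h3 k h4 (by omega) h6 h7 h8
      have := step (m' .suff) (fun k hk => rfl) hap
      refine ⟨fun hS => ⟨by omega, j, rfl, by omega, fun _ => hS, fun l h1 h2 => by omega,
        this.1, this.2.1 hS, fun _ => Or.inr ⟨this.2.2.2 hS, fun k h1 h2 => by omega⟩, by omega⟩,
        fun hS => ⟨p, rfl, by omega, hSp, hij hS, this.1, this.2.2.1 hS, hap, by omega⟩⟩
  · rintro r' m' t' hF - ⟨p, hp, hpj, hSp, hl, hk, hL, hA, ht⟩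
    refine ⟨fun k h1 h2 => ?_, by simp; omega⟩
    by_cases hkp : k = p
    · subst hkp
      exact Least.of_row (b := I.n .y + 1) hi hin h1 h2 (hSp h1) hold
        (fun l h4 h5 => ⟨fun _ => by omega, fun h6 l' h7 h8 => hl l' h7 (by omega)⟩) (hA h1)
    · exact hL k h1 (by omega) hkp

lemma Inst.Idx.frame {p : Enum211.S} {r' : Reg → ℕ} {m' : Arr → ℕ → ℕ} (h : I.Idx s r m)
    (hF : Frame V p r m r' m') (hp : (modR p (.len s) || modA p (.str s) || modA p (.cnt s) ||
      modA p (.rank s) || modA p (.start s) || modA p (.occ s)) = false) : I.Idx s r' m' := by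
  simp only [Bool.or_eq_false_iff] at hp
  refine h.congr (hF.reg _ hp.1.1.1.1.1) ?_
  rintro a (rfl | rfl | rfl | rfl | rfl)
  · exact hF.mem _ hp.1.1.1.1.2
  · exact hF.mem _ hp.1.1.1.2
  · exact hF.mem _ hp.1.1.2
  · exact hF.mem _ hp.1.2
  · exact hF.mem _ hp.2

open Inst in
/-- The thresholds are determined in quadratic time. -/
lemma wp_buildTh (hB : I.Big V M) (hx : I.Idx .x r m) (hy : I.Idx .y r m) (hσr : r .sigma = I.σ)
    (H : ∀ r' m' t', Frame V buildTh r m r' m' → I.Thr (fun _ => True) m' →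
      t' ≤ t + 1000 * (I.n .x + I.n .y + 1) ^ 2 → Q r' m' t') : wp V M buildTh Q r m t := by
  refine wp_conseq (Q := fun r' m' t' => I.Thr (fun _ => True) m' ∧
    t' ≤ t + 1000 * (I.n .x + I.n .y + 1) ^ 2) ?_ fun r' m' t' hF h => H r' m' t' hF h.1 h.2
  have hV := hB.bound
  have hM := hB.le_M
  have hn : ∀ s, 2 ≤ I.n s := I.two_le
  have hnx := hn .x
  have hny := hn .y
  generalize hK : I.n .x + I.n .y + 1 = K
  rw [buildTh, block_cons, wp_seq]
  refine wp_initTh hB hx hy hσr fun r1 m1 t1 hF1 hT1 ht1 => ?_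
  have hx1 := hx.frame hF1 rfl
  have hy1 := hy.frame hF1 rfl
  have hlx1 := hx1.len
  have hly1 := hy1.len
  rw [block_cons, wp_seq]
  refine wp_forUp (fun k r' m' t' => (∀ l, 1 ≤ l → l < k → m' .suff l = I.n .x + 1) ∧
    t' + 20 ≤ t + 300 * K + 20 * k) 1 (I.n .y - 1) rfl (by omega) (by omega) (by omega) (by simp) rfl
    ?_ ⟨fun l h1 h2 => by omega, by simp; omega⟩ ?_ ?_
  · intro k r' m' t' hF _
    simp [hF.reg (.len .y) rfl, hly1]
  · rintro j r' m' t' hj1 hj2 hj hF ⟨hP, ht⟩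
    have hlx' : r' (.len .x) = I.n .x := by rw [hF.reg _ rfl, hlx1]
    simp only [wr, block_single, wp_store, safeE_var, safeE_add, safeE_one, and_self, true_and,
      ev_var, ev_add, ev_one, hj, hlx', cost_var, cost_sub, cost_one, cost_add,
      Function.update_apply, if_true]
    refine ⟨by omega, by omega, fun l h1 h2 => ?_, by omega⟩
    split_ifs
    · rfl
    · exact hP l h1 (by omega)
  rintro r2 m2 t2 hF2 - ⟨hP2, ht2⟩
  have hx2 := hx1.frame hF2 rfl
  have hy2 := hy1.frame hF2 rfl
  have hT2 := hT1.congr (m' := m2) (R' := fun _ => False) (fun s => hF2.mem _ rfl) fun _ _ => Iff.rfl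
  have hlx2 := hx2.len
  have hly2 := hy2.len
  clear hF1 hF2 hx1 hy1 hT1 hlx1 hly1
  simp only [wr, put, block_cons, block_single, wp_seq, wp_store, wp_assign, safeE_var, true_and,
    ev_var, hlx2, hly2, Function.update_apply, reduceCtorEq, if_false, cost_var, cost_sub, cost_one]
  refine ⟨by omega, by omega, by omega, by omega, ?_⟩
  refine wp_recordSuff hB (u := I.n) (R := fun _ => False)
    (hx2.congr (by simp) (by simp)) (hy2.congr (by simp) (by simp)) SM.base (by simp) (by simp)
    (hT2.congr (fun s => by simp) fun _ _ => Iff.rfl) fun r3 m3 t3 hF3 hT3 ht3 => ?_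
  have hx3 := (hx2.congr (r' := r3) (m' := m3) (by rw [hF3.reg _ rfl]; simp)
    (by rintro a (rfl | rfl | rfl | rfl | rfl) <;> rw [hF3.mem _ rfl] <;> simp))
  have hy3 := (hy2.congr (r' := r3) (m' := m3) (by rw [hF3.reg _ rfl]; simp)
    (by rintro a (rfl | rfl | rfl | rfl | rfl) <;> rw [hF3.mem _ rfl] <;> simp))
  have hs3 : ∀ k, 1 ≤ k → k ≤ I.n .y → I.Least (I.n .x) k (m3 .suff k) := by
    intro k h1 h2
    rw [hF3.mem _ rfl, Function.update_self, Function.update_apply]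
    split_ifs with h
    · exact Least.of_sm le_rfl (sm_last_iff.2 h)
    · rw [hP2 k h1 (by omega)]
      refine ⟨by omega, le_rfl, by omega, fun i h3 h4 h5 => h ?_⟩
      have : i = I.n .x := by omega
      exact sm_last_iff.1 (this ▸ h5)
  replace hT3 : I.Thr (fun u => I.n .x - 1 < u .x) m3 := by
    refine hT3.congr (fun _ => rfl) fun u hu => ?_
    rcases hu.lt_or_eq with rfl | h
    · simp; omega
    · have := h .x
      simp only [false_or]
      exact ⟨fun _ => by omega, fun h => by rw [h] at this; omega⟩
  have ht3' : t3 ≤ t + 400 * K := by omega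
  clear hF3 hT2 hP2 ht2 ht3 hlx2 hly2 ht1 hx2 hy2
  have hlx3 := hx3.len
  simp only [forDown, block_cons, block_single, put, wp_seq, wp_assign, safeE_sub, safeE_var,
    safeE_one, and_self, true_and, ev_sub, ev_var, ev_one, hlx3, cost_sub, cost_var, cost_one]
  refine ⟨by omega, ?_⟩
  obtain ⟨W, hW⟩ : ∃ W, W = 400 * K := ⟨_, rfl⟩
  refine wp_loop (fun r' m' t' => r' .i ≤ I.n .x - 1 ∧
    (∀ k, 1 ≤ k → k ≤ I.n .y → I.Least (r' .i + 1) k (m' .suff k)) ∧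
    I.Thr (fun u => r' .i < u .x) m' ∧ I.Idx .x r' m' ∧ I.Idx .y r' m' ∧
    t' + W * r' .i ≤ t + 410 * K + W * I.n .x) (fun r' _ => r' .i) ?_ ?_ ?_ ?_
  · refine ⟨by simp, fun k h1 h2 => ?_, ?_, hx3.congr (by simp) (by simp),
      hy3.congr (by simp) (by simp), ?_⟩
    · simp only [Function.update_self]
      rw [show I.n .x - 1 + 1 = I.n .x by omega]
      exact hs3 k h1 h2
    · simpa using hT3
    · have : W * (I.n .x - 1) ≤ W * I.n .x := Nat.mul_le_mul_left _ (by omega)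
      simp only [Function.update_self]; omega
  · intros; simp
  · rintro r' m' t' - ⟨h1, h2, h3, hx', hy', h5⟩ hc
    simp only [evC_le, ev_one, ev_var] at hc
    generalize hi : r' .i = i at *
    simp only [costC_le, cost_one, cost_var]
    refine wp_updateSuff hB hx' hy' hc (by omega) hi h2 fun r4 m4 t4 hF4 h4 ht4 => ?_
    have hx4 := hx'.frame hF4 rfl
    have hy4 := hy'.frame hF4 rfl
    have hi4 : r4 .i = i := by rw [hF4.reg _ rfl, hi]
    have hT4 : I.Thr (fun u => i < u .x ∨ u .x = i ∧ u .y < 1) m4 :=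
      h3.congr (fun s => hF4.mem _ rfl) fun u hu => by have := (hu.match.1 .y).1; omega
    clear hF4 h3 h2 hx' hy'
    refine wp_forUp (fun j r' m' t' => I.Thr (fun u => i < u .x ∨ u .x = i ∧ u .y < j) m' ∧
      t' ≤ t4 + 10 + 130 * j) 1 (I.n .y) rfl (by omega) (by omega) (by omega) (by simp) rfl
      ?_ ⟨hT4, by simp⟩ ?_ ?_
    · intro k r' m' t' hF _
      simp [hF.reg (.len .y) rfl, hy4.len]
    · rintro j r' m' t' hj1 hj2 hj hF ⟨hT, ht⟩
      have hi' : r' .i = i := by rw [hF.reg _ rfl]; simp [hi4]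
      have hL := h4 j hj1 hj2
      rw [← hF.mem .suff rfl] at hL
      have hiff := hL.eq_iff (by omega)
      simp only [ifs, rd, block_single, block_nil, wp_ite, safeC_eq, safeE_get, safeE_var, and_self,
        true_and, evC_eq, ev_get, ev_var, hj, hi', wp_skip, cost_var, costC_eq, cost_get]
      refine ⟨fun h => ?_, fun h => ⟨hT.congr (fun _ => rfl) fun u hu => ?_, by omega⟩⟩
      · refine wp_recordSuff hB (u := pt i j) ((hx4.congr (by simp) (by simp)).frame hF rfl)
          ((hy4.congr (by simp) (by simp)).frame hF rfl) (hiff.1 h) hi' hj hT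
          fun r5 m5 t5 hF5 hT5 ht5 => ⟨hT5.congr (fun _ => rfl) fun u hu => ?_, by omega⟩
        constructor
        · rintro (h6 | ⟨h6, h7⟩)
          · exact Or.inl (Or.inl h6)
          · by_cases h8 : u .y = j
            · exact Or.inr (by rw [← pt_eta u, h6, h8])
            · exact Or.inl (Or.inr ⟨h6, by omega⟩)
        · rintro (h6 | rfl)
          · omega
          · exact Or.inr ⟨rfl, by simp⟩
      · constructor
        · rintro (h6 | ⟨h6, h7⟩)
          · exact Or.inl h6
          · refine Or.inr ⟨h6, lt_of_le_of_ne (by omega) fun h8 => h (hiff.2 ?_)⟩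
            rwa [← h6, ← h8, pt_eta]
        · omega
    · rintro r5 m5 t5 hF5 - ⟨hT5, ht5⟩
      have hi5 : r5 .i = i := by rw [hF5.reg _ rfl]; simp [hi4]
      obtain ⟨i, rfl⟩ : ∃ i', i = i' + 1 := ⟨i - 1, by omega⟩
      change wp V M (put .i (.var .i - 1)) _ _ _ _
      simp only [put, wp_assign, safeE_sub, safeE_var, safeE_one, and_self, true_and, ev_sub, ev_var,
        ev_one, hi5, Function.update_self, Nat.add_sub_cancel, cost_sub, cost_var, cost_one]
      rw [Nat.mul_succ] at h5
      refine ⟨by omega, ⟨by omega, fun k h1 h2 => ?_, hT5.congr (fun _ => rfl) fun u hu => ?_,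
        ?_, ?_, by omega⟩, by omega⟩
      · rw [hF5.mem _ rfl]; exact h4 k h1 h2
      · have := (hu.match.1 .y).2
        omega
      · exact ((hx4.congr (by simp) (by simp)).frame hF5 rfl).congr (by simp) (by simp)
      · exact ((hy4.congr (by simp) (by simp)).frame hF5 rfl).congr (by simp) (by simp)
  · rintro r' m' t' - ⟨h1, h2, h3, hx', hy', h5⟩ hc
    simp only [evC_le, ev_one, ev_var, not_le, Nat.lt_one_iff] at hc
    refine ⟨h3.congr (fun _ => rfl) fun u hu => ?_, ?_⟩
    · have := (hu.match.1 .x).1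
      simp; omega
    · rw [hc] at h5
      simp only [costC_le, cost_one, cost_var]
      subst hW
      nlinarith

end

/-! ### The staircase of extensible character candidates -/

section

/-- The pair with coordinate `a` on side `s` and coordinate `b` on the other side. -/
def sp (s : Side) (a b : ℕ) : Side → ℕ := fun t => if t = s then a else b

lemma Side.other_ne (s : Side) : s.other ≠ s := by cases s <;> decide

@[simp] lemma sp_self {s : Side} {a b : ℕ} : sp s a b s = a := if_pos rfl
@[simp] lemma sp_other {s : Side} {a b : ℕ} : sp s a b s.other = b := if_neg s.other_ne

@[simp] lemma sp_other' {s : Side} {a b : ℕ} : sp s.other a b s = b := if_neg s.other_ne.symm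

lemma sp_eta (s : Side) (v : Side → ℕ) : sp s (v s) (v s.other) = v :=
  funext (Side.forall_other s sp_self sp_other)

lemma pair_ext (s : Side) {u v : Side → ℕ} (h : u s = v s) (h' : u s.other = v s.other) : u = v :=
  funext (Side.forall_other s h h')

lemma pair_le (s : Side) {u v : Side → ℕ} (h : u s ≤ v s) (h' : u s.other ≤ v s.other) : u ≤ v :=
  Side.forall_other s h h'

namespace Inst
variable (I : Inst)

/-- The matches greater than `P` in both coordinates, and two virtual points that bound them. -/
def Pt (P v : Side → ℕ) : Prop :=
  (I.Match v ∧ ∀ s, P s < v s) ∨ ∃ s, v s = I.n s + 1 ∧ v s.other = P s.other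

/-- The minimal points. Except for the two virtual ones, these are the matches `pref(Z c)` for the
extensible character candidates `c`, where `P = pref(Z)`. -/
def Corner (P v : Side → ℕ) : Prop := Minimal (I.Pt P) v

/-- The least coordinate on side `s` of a point with coordinate `p` on the other side. -/
noncomputable def low (s : Side) (P : Side → ℕ) (p : ℕ) : ℕ :=
  if p ≤ I.n s.other then I.nxt s (I.S s.other p) (P s) else P s

variable {I} {s : Side} {P F u v w : Side → ℕ} {c p : ℕ}

lemma match_of (s : Side) (h1 : 1 ≤ v s ∧ v s ≤ I.n s) (h2 : 1 ≤ v s.other ∧ v s.other ≤ I.n s.other)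
    (h : I.S s (v s) = I.S s.other (v s.other)) : I.Match v :=
  ⟨Side.forall_other s h1 h2, by cases s; exacts [h, h.symm]⟩

/-- The corners form an antichain. -/
lemma Corner.eq_of_le (hu : I.Corner P u) (hv : I.Corner P v) (h : u ≤ v) : u = v :=
  le_antisymm h (hv.2 hu.1 h)

/-- Along the staircase, one coordinate increases as the other one decreases. -/
lemma Corner.lt_of_lt (hu : I.Corner P u) (hv : I.Corner P v) (h : u s < v s) :
    v s.other < u s.other := by
  by_contra h1
  have := hu.eq_of_le hv (pair_le s h.le (not_lt.1 h1))
  rw [this] at h; exact lt_irrefl _ h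

lemma Corner.eq_of_eq (hu : I.Corner P u) (hv : I.Corner P v) (h : u s = v s) : u = v := by
  rcases le_total (u s.other) (v s.other) with h1 | h1
  · exact hu.eq_of_le hv (pair_le s h.le h1)
  · exact (hv.eq_of_le hu (pair_le s h.ge h1)).symm

lemma Pt.bounds (hP : ∀ s, P s ≤ I.n s) (h : I.Pt P v) : ∀ s, P s ≤ v s ∧ v s ≤ I.n s + 1 := by
  rcases h with ⟨h1, h2⟩ | ⟨s, h1, h2⟩
  · exact fun s => ⟨(h2 s).le, by have := (h1.1 s).2; omega⟩
  · have h3 := hP s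
    have h4 := hP s.other
    exact Side.forall_other s (by omega) (by omega)

/-- Points on whose side `s` something is left are not virtual last ones. -/
lemma Pt.match (h : I.Pt P v) (h1 : P s < v s) (h2 : v s ≤ I.n s) :
    I.Match v ∧ ∀ s, P s < v s := by
  rcases h with h | ⟨s', h3, h4⟩
  · exact h
  · exfalso
    cases s <;> cases s' <;> simp only [Side.other_x, Side.other_y] at * <;> omega

/-- The two virtual points are the ends of the staircase. -/
lemma corner_virt (hP : ∀ s, P s ≤ I.n s) (s : Side) :
    I.Corner P (sp s (I.n s + 1) (P s.other)) := by
  refine ⟨Or.inr ⟨s, by simp, by simp⟩, fun w hw hle => ?_⟩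
  have h1 : w s.other ≤ P s.other := (hle s.other).trans_eq sp_other
  have h2 : w s ≤ I.n s + 1 := (hle s).trans_eq sp_self
  refine pair_le s ?_ (by rw [sp_other]; exact (hw.bounds hP s.other).1)
  rw [sp_self]
  rcases hw with ⟨-, h⟩ | ⟨s', h3, h4⟩
  · exact absurd (h s.other) (by omega)
  · have := hP s
    have := hP s.other
    cases s <;> cases s' <;> simp only [Side.other_x, Side.other_y] at * <;> omega

lemma Pt.exists_corner (h : I.Pt P v) : ∃ u, I.Corner P u ∧ u ≤ v := by
  obtain ⟨u, h1, h2⟩ := exists_minimal_le_of_wellFoundedLT (I.Pt P) v h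
  exact ⟨u, h2, h1⟩

lemma low_le_of_pt (h : I.Pt P v) (hP : ∀ s, P s ≤ I.n s) (h1 : P s.other < v s.other) :
    I.low s P (v s.other) ≤ v s := by
  unfold low
  split_ifs with h2
  · have := h.match h1 h2
    exact nxt_le (this.2 s) (this.1.1 s).2 (this.1.eq _ _)
  · exact (h.bounds hP s).1

/-- The successor of a corner is determined by the next lower point. -/
lemma Corner.next (hP : ∀ s, P s ≤ I.n s) (hu : I.Corner P u) (hp : u s.other < p)
    (hpn : p ≤ I.n s.other + 1) (hg : I.low s P p < u s)
    (hmin : ∀ q, u s.other < q → q < p → u s ≤ I.low s P q) :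
    I.Corner P (sp s (I.low s P p) p) ∧
      ∀ w, I.Corner P w → u s.other < w s.other → p ≤ w s.other := by
  have hPs := hP s
  have hPo := hP s.other
  have hub := hu.1.bounds hP
  have hus := hub s
  have huo := hub s.other
  constructor
  · refine ⟨?_, fun w hw hle => ?_⟩
    · unfold low at hg ⊢
      split_ifs at hg ⊢ with h
      · have h1 := nxt_spec (I := I) (s := s) (c := I.S s.other p) (h := P s) (by omega)
        refine Or.inl ⟨match_of s ?_ ?_ ?_, Side.forall_other s ?_ ?_⟩ <;>
          simp only [sp_self, sp_other]
        · omega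
        · omega
        · exact h1.2
        · exact h1.1
        · omega
      · exact Or.inr ⟨s.other, by simp; omega, by simp⟩
    · have h1 : w s ≤ I.low s P p := (hle s).trans_eq sp_self
      have h2 : w s.other ≤ p := (hle s.other).trans_eq sp_other
      have h3 : u s.other < w s.other := by
        by_contra h4
        have : u s ≤ w s := hu.2 hw (pair_le s (by omega) (by omega)) s
        omega
      have h4 := low_le_of_pt (s := s) hw hP (by omega)
      have h5 : w s.other = p := by
        by_contra h5
        have := hmin (w s.other) h3 (by omega)
        omega
      exact pair_le s (by rw [sp_self, ← h5]; exact h4) (by rw [sp_other, h5])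
  · intro w hw h
    by_contra h1
    have h2 := hmin _ h (by omega)
    have h3 := low_le_of_pt (s := s) hw.1 hP (by omega)
    have h4 := hu.eq_of_le hw (pair_le s (by omega) h.le)
    rw [h4] at h; omega

lemma low_last : I.low s P (I.n s.other + 1) = P s := if_neg (by omega)

/-! ### Witnesses and corners -/

variable (I) in
/-- A corner `v` has a witness with the same coordinate on side `s`, in the region given by `F`, and
by the coordinate `b` of its neighbour on the other side. -/
def Wit (F : Side → ℕ) (s : Side) (v : Side → ℕ) (b w : ℕ) : Prop :=
  I.SM (sp s (v s) w) ∧ v s.other ≤ w ∧ w ≤ F s.other ∧ v s ≤ F s ∧ w ≤ b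

/-- A corner is `pref(Z ++ [c])` for its character `c`, if `P = pref(Z)`. -/
lemma Corner.nxt_eq (hv : I.Corner P v) (hm : I.Match v) (hPv : ∀ s, P s < v s) (s : Side) :
    I.nxt s (I.S .x (v .x)) (P s) = v s := by
  have h1 : ∀ s, I.nxt s (I.S .x (v .x)) (P s) ≤ v s := fun s =>
    nxt_le (hPv s) (hm.1 s).2 (hm.eq _ _)
  have h2 : ∀ s, P s < I.nxt s (I.S .x (v .x)) (P s) ∧ _ := fun s =>
    nxt_spec ((h1 s).trans (hm.1 s).2)
  have h3 : I.Pt P (fun s => I.nxt s (I.S .x (v .x)) (P s)) :=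
    Or.inl ⟨⟨fun s => ⟨Nat.one_le_of_lt (h2 s).1, (h1 s).trans (hm.1 s).2⟩,
      (h2 .x).2.trans (h2 .y).2.symm⟩, fun s => (h2 s).1⟩
  exact le_antisymm (h1 s) (hv.2 h3 h1 s)

/-- The character of a witness is that of a corner. -/
lemma HasWit.corner (h : I.HasWit P F c) :
    I.Corner P (fun s => I.nxt s c (P s)) ∧ ∀ s, I.nxt s c (P s) ≤ I.n s := by
  obtain ⟨v, hv, hvc, hvb, hno⟩ := h
  have h1 : ∀ s, I.nxt s c (P s) ≤ v s := fun s => nxt_le (hvb s).1 (hv.match.1 s).2 (hvc s)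
  have hn : ∀ s, I.nxt s c (P s) ≤ I.n s := fun s => (h1 s).trans (hv.match.1 s).2
  have h2 : ∀ s, P s < I.nxt s c (P s) ∧ I.S s (I.nxt s c (P s)) = c := fun s => nxt_spec (hn s)
  refine ⟨⟨Or.inl ⟨⟨fun s => ⟨Nat.one_le_of_lt (h2 s).1, hn s⟩,
      (h2 .x).2.trans (h2 .y).2.symm⟩, fun s => (h2 s).1⟩, fun w hw hle => ?_⟩, hn⟩
  have hw' : I.Match w ∧ ∀ s, P s < w s := by
    rcases hw with hw | ⟨s, h3, h4⟩
    · exact hw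
    · have := hle s; have := hn s
      simp only at *; omega
  by_contra hlt
  have h5 : ∀ s, w s ≠ v s := fun s hs => hlt fun t => by
    refine nxt_le (hw'.2 t) (hw'.1.1 t).2 ?_
    rw [hw'.1.eq t s, hs, hvc]
  exact hno ⟨w, hw'.1, fun s => ⟨hw'.2 s, lt_of_le_of_ne ((hle s).trans (h1 s)) (h5 s)⟩⟩

/-- The criterion by which witnesses are recognized: `b s` is the coordinate, on the side other than
`s`, of that neighbour of the corner that has a smaller coordinate on side `s`. -/
lemma hasWit_iff (hv : I.Corner P v) (hm : I.Match v)
    (hPv : ∀ s, P s < v s) {b : Side → ℕ}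
    (hb : ∀ s, ∃ u, I.Corner P u ∧ b s = u s.other ∧ u s < v s ∧
      ∀ w, I.Corner P w → w s < v s → w s ≤ u s) :
    I.HasWit P F (I.S .x (v .x)) ↔ ∃ s w, I.Wit F s v (b s) w := by
  constructor
  · rintro ⟨z, hz, hzc, hzb, hno⟩
    have hle : ∀ s, v s ≤ z s := fun s => by
      rw [← hv.nxt_eq hm hPv s]
      exact nxt_le (hzb s).1 (hz.match.1 s).2 (hzc s)
    obtain ⟨s, hs⟩ : ∃ s, v s = z s := by
      by_contra h
      push Not at h
      exact hno ⟨v, hm, fun s => ⟨hPv s, lt_of_le_of_ne (hle s) (h s)⟩⟩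
    refine ⟨s, z s.other, by rw [hs, sp_eta]; exact hz, hle _, (hzb _).2, hs ▸ (hzb s).2, ?_⟩
    obtain ⟨u, hu, hbu, hus, -⟩ := hb s
    rw [hbu]
    by_contra hlt
    have h1 := (hz.match.1 s.other).2
    have h2 := hv.lt_of_lt hu (s := s.other)
    have h3 : P s.other < u s.other := (hPv s.other).trans (hu.lt_of_lt hv hus)
    have h4 := hu.1.match h3 (by omega)
    exact hno ⟨u, h4.1, Side.forall_other s ⟨h4.2 s, hs ▸ hus⟩ ⟨h3, by omega⟩⟩
  · rintro ⟨s, w, h1, h2, h3, h4, h5⟩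
    have hm' := h1.match
    have hS : ∀ t, I.S t (sp s (v s) w t) = I.S .x (v .x) := fun t => by
      rw [hm'.eq t s, sp_self, hm.eq]
    refine ⟨sp s (v s) w, h1, hS, Side.forall_other s ?_ ?_, ?_⟩
    · rw [sp_self]; exact ⟨hPv s, h4⟩
    · rw [sp_other]; exact ⟨(hPv _).trans_le h2, h3⟩
    · rintro ⟨z, hz, hzb⟩
      obtain ⟨u, hu, hle⟩ := Pt.exists_corner (I := I) (P := P) (Or.inl ⟨hz, fun s => (hzb s).1⟩)
      obtain ⟨u', hu', hbu, hus, hnext⟩ := hb s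
      have h6 : u s ≤ z s := hle s
      have h7 : u s.other ≤ z s.other := hle s.other
      have h8 := (hzb s).2
      have h9 := (hzb s.other).2
      rw [sp_self] at h8
      rw [sp_other] at h9
      have h10 := hnext u hu (h6.trans_lt h8)
      rcases h10.eq_or_lt with h11 | h11
      · rw [hu.eq_of_eq hu' h11] at h7
        omega
      · have := hu.lt_of_lt hu' h11
        omega

end Inst
end

section

variable {I : Inst} {V M L N w B : ℕ} {Q : Post} {r : Reg → ℕ} {m : Arr → ℕ → ℕ} {t : ℕ} {s : Side}
  {P F u v : Side → ℕ} {U D : Side → ℕ → ℕ} {a b k l : ℕ}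

/-! ### The data computed by the preprocessing -/

/-- The data on which the enumeration relies are in place, where `L` bounds the number of steps of
a binary search. -/
structure Env (I : Inst) (V M L w B : ℕ) (r : Reg → ℕ) (m : Arr → ℕ → ℕ) : Prop where
  big : I.Big V M
  lt_pow : ∀ s, I.n s < 2 ^ L
  idx : ∀ s, I.Idx s r m
  tab : Tables (I.n .x + I.n .y) w B r m
  rmq : ∀ s, RMQ w B s m
  thr : I.Thr (fun _ => True) m
  sigma : r .sigma = I.σ

/-- The registers that the enumeration only reads. -/
def envR : List Reg := [.len .x, .len .y, .sigma, .width, .blocks]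

/-- The arrays that the enumeration only reads. -/
def envA : List Arr := [.str .x, .str .y, .dec, .cnt .x, .cnt .y, .start .x, .start .y, .occ .x,
  .occ .y, .rank .x, .rank .y, .th .x, .th .y, .mask .x, .mask .y, .sparse .x, .sparse .y, .pow2,
  .low, .lg]

lemma Env.congr (h : Env I V M L w B r m) {r' : Reg → ℕ} {m' : Arr → ℕ → ℕ}
    (hr : ∀ x ∈ envR, r' x = r x) (hm : ∀ a ∈ envA, m' a = m a) : Env I V M L w B r' m' where
  big := h.big
  lt_pow := h.lt_pow
  idx s := (h.idx s).congr (hr _ (by cases s <;> simp [envR])) (by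
    rintro a (rfl | rfl | rfl | rfl | rfl) <;> exact hm _ (by cases s <;> simp [envA]))
  tab := h.tab.congr (hr _ (by simp [envR])) (hr _ (by simp [envR])) (hm _ (by simp [envA]))
    (hm _ (by simp [envA])) (hm _ (by simp [envA]))
  rmq s := by
    have h1 := hm (.th s) (by cases s <;> simp [envA])
    have h2 := hm (.mask s) (by cases s <;> simp [envA])
    have h3 := hm (.sparse s) (by cases s <;> simp [envA])
    exact ⟨by rw [h1, h2]; exact (h.rmq s).mask, by rw [h1, h3]; exact (h.rmq s).sparse⟩
  thr := h.thr.congr (fun s => hm _ (by cases s <;> simp [envA])) fun _ _ => Iff.rfl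
  sigma := (hr _ (by simp [envR])).trans h.sigma

lemma Env.frame {p : S} (h : Env I V M L w B r m) {r' : Reg → ℕ} {m' : Arr → ℕ → ℕ}
    (hF : Frame V p r m r' m') (hp : (envR.all (!modR p ·) && envA.all (!modA p ·)) = true) :
    Env I V M L w B r' m' := by
  simp only [Bool.and_eq_true, List.all_eq_true, Bool.not_eq_true'] at hp
  exact h.congr (fun x hx => hF.reg x (hp.1 x hx)) fun a ha => hF.mem a (hp.2 a ha)

/-! ### Generating the staircase from both ends -/

/-- The points `U · 0, ..., U · k` are the corners from the virtual one that is greatest on side `s`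
on. -/
structure Stair (I : Inst) (P : Side → ℕ) (s : Side) (k : ℕ) (U : Side → ℕ → ℕ) : Prop where
  corner : ∀ l, l ≤ k → I.Corner P (U · l)
  lt_succ : ∀ l, l < k → U s.other l < U s.other (l + 1)
  complete : ∀ v, I.Corner P v → v s.other ≤ U s.other k → ∃ l, l ≤ k ∧ ∀ t, v t = U t l
  zero : U s.other 0 = P s.other

lemma Stair.lt (h : Stair I P s k U) (h1 : a < b) (h2 : b ≤ k) : U s.other a < U s.other b := by
  induction b with
  | zero => omega
  | succ b ih =>
    have h3 := h.lt_succ b h2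
    rcases (Nat.lt_succ_iff.1 h1).eq_or_lt with rfl | h4
    · exact h3
    · exact (ih h4 (by omega)).trans h3

lemma Stair.gt (h : Stair I P s k U) (h1 : a < b) (h2 : b ≤ k) : U s b < U s a := by
  have := (h.corner a (by omega)).lt_of_lt (h.corner b h2) (h.lt h1 h2)
  simpa using this

lemma Stair.add_le (h : Stair I P s k U) (h1 : l ≤ k) : P s.other + l ≤ U s.other l := by
  induction l with
  | zero => rw [h.zero]; rfl
  | succ l ih => have := h.lt_succ l h1; have := ih (by omega); omega

lemma Stair.init (hP : ∀ s, P s ≤ I.n s) (h1 : U s 0 = I.n s + 1) (h2 : U s.other 0 = P s.other) :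
    Stair I P s 0 U := by
  have h3 : I.Corner P (U · 0) := by
    have := Inst.corner_virt (I := I) hP s
    rwa [← h1, ← h2, sp_eta s (U · 0)] at this
  refine ⟨fun l hl => by rwa [Nat.le_zero.1 hl], fun l hl => by omega, fun v hv hle =>
    ⟨0, le_rfl, fun t => ?_⟩, h2⟩
  have := (hv.1.bounds hP s.other).1
  exact congrFun (hv.eq_of_eq (s := s.other) h3 (by omega)) t

/-- A staircase is extended by the next corner. -/
lemma Stair.push (h : Stair I P s k U) {U' : Side → ℕ → ℕ} (hU : ∀ t l, l ≤ k → U' t l = U t l)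
    (hv : I.Corner P (U' · (k + 1))) (h1 : U s.other k < U' s.other (k + 1))
    (h2 : ∀ v, I.Corner P v → U s.other k < v s.other → U' s.other (k + 1) ≤ v s.other) :
    Stair I P s (k + 1) U' := by
  refine ⟨fun l hl => ?_, fun l hl => ?_, fun v hv' hle => ?_, ?_⟩
  · rcases hl.eq_or_lt with rfl | hl
    · exact hv
    · simpa only [hU _ l (by omega)] using h.corner l (by omega)
  · rcases (Nat.lt_succ_iff.1 hl).eq_or_lt with rfl | hl
    · rw [hU _ _ le_rfl]; exact h1
    · rw [hU _ _ (by omega), hU _ _ (by omega)]; exact h.lt_succ l hl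
  · by_cases h3 : v s.other ≤ U s.other k
    · obtain ⟨l, hl, hl'⟩ := h.complete v hv' h3
      exact ⟨l, by omega, fun t => by rw [hl', hU _ _ hl]⟩
    · exact ⟨k + 1, le_rfl, congrFun (hv'.eq_of_eq (s := s.other) hv
        (le_antisymm hle (h2 v hv' (by omega))))⟩
  · rw [hU _ _ (by omega), h.zero]

lemma Stair.pred (h : Stair I P s (k + 1) U) : Stair I P s k U := by
  refine ⟨fun l hl => h.corner l (by omega), fun l hl => h.lt_succ l (by omega),
    fun v hv hle => ?_, h.zero⟩
  have h1 := h.lt_succ k (by omega)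
  obtain ⟨l, hl, hl'⟩ := h.complete v hv (by omega)
  refine ⟨l, ?_, hl'⟩
  by_contra h2
  have h3 : l = k + 1 := by omega
  rw [hl', h3] at hle
  omega

/-- Where two staircases from opposite ends meet, the one continues with the elements of the
other in reverse order. -/
lemma Stair.succ_of_meet (hD : Stair I P s.other (l + 1) D)
    (h : ∀ t, U t k = D t (l + 1)) : U s.other k < D s.other l ∧
      ∀ v, I.Corner P v → U s.other k < v s.other → D s.other l ≤ v s.other := by
  have h1 := hD.gt (Nat.lt_succ_self l) le_rfl
  refine ⟨by rw [h]; exact h1, fun v hv hlt => ?_⟩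
  rw [h] at hlt
  have h2 := (hD.corner _ le_rfl).lt_of_lt hv hlt
  obtain ⟨l', hl, hl'⟩ := hD.complete v hv h2.le
  rw [hl'] at hlt ⊢
  rcases Nat.lt_trichotomy l' l with h3 | rfl | h3
  · exact (hD.gt h3 (by omega)).le
  · exact le_rfl
  · have : l' = l + 1 := by omega
    rw [this] at hlt; omega

/-- Finding the next corner. -/
lemma wp_scan (hE : Env I V M L w B r m) (hP : ∀ s, P s ≤ I.n s) (hu : I.Corner P u)
    (hus : P s < u s) {a : E} {b : Reg}
    (ha : ∀ r', (∀ x, x ≠ .p → x ≠ .nx → x ≠ .rk → x ≠ .hi → x ≠ .mid → r' x = r x) →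
      ev r' m a = u s ∧ safeE V r' m a) (hac : a.cost ≤ 3) (hb : r b = P s)
    (hbn : b ≠ .p ∧ b ≠ .nx ∧ b ≠ .rk ∧ b ≠ .hi ∧ b ≠ .mid)
    (hnx : r .nx = u s) (hp : r .p = u s.other)
    (H : ∀ r' t' v, (∀ x, x ≠ .p → x ≠ .nx → x ≠ .rk → x ≠ .hi → x ≠ .mid → r' x = r x) →
      I.Corner P v → r' .nx = v s → r' .p = v s.other → u s.other < v s.other →
      (∀ w, I.Corner P w → u s.other < w s.other → v s.other ≤ w s.other) →
      t' + 20 ≤ t + 200 * (L + 1) * (v s.other - u s.other) + 40 → Q r' m t') :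
    wp V M (whl (.le a Reg.nx) [put .p (Reg.p + 1), ifs (.le Reg.p (Reg.len s.other))
      [nextQ s (rd (.str s.other) Reg.p) b] [put .nx b]]) Q r m t := by
  have hV := hE.big.n_le s.other
  have hVs := hE.big.n_le s
  have hM := hE.big.le_V
  have hub := hu.1.bounds hP
  have hus2 := hub s
  have huo := hub s.other
  have hPs := hP s
  have hlast : I.low s P (I.n s.other + 1) = P s := Inst.low_last
  obtain ⟨K, hK⟩ : ∃ K, K = 200 * (L + 1) := ⟨_, rfl⟩
  rw [← hK] at H
  refine wp_loop (fun r' m' t' => m' = m ∧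
    (∀ x, x ≠ .p → x ≠ .nx → x ≠ .rk → x ≠ .hi → x ≠ .mid → r' x = r x) ∧ u s.other ≤ r' .p ∧
    r' .p ≤ I.n s.other + 1 ∧ (r' .p = u s.other → r' .nx = u s) ∧
    (r' .p ≠ u s.other → r' .nx = I.low s P (r' .p)) ∧
    (∀ q, u s.other < q → q < r' .p → u s ≤ I.low s P q) ∧
    t' ≤ t + K * (r' .p - u s.other)) (fun r' _ => I.n s.other + 1 - r' .p)
    ?_ ?_ ?_ ?_
  · refine ⟨rfl, fun _ _ _ _ _ _ => rfl, by omega, by omega, fun _ => hnx, fun h => absurd hp h,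
      fun q h1 h2 => by omega, by omega⟩
  · rintro r' m' t' - ⟨rfl, hr, -⟩
    exact ⟨(ha r' hr).2, trivial⟩
  · rintro r' m' t' - ⟨rfl, hr, h1, h2, h3, h4, h5, h6⟩ hc
    simp only [evC_le, (ha r' hr).1, ev_var] at hc
    have hlt : r' .p ≤ I.n s.other := by
      by_contra h
      have h7 : r' .p = I.n s.other + 1 := by omega
      by_cases h8 : r' .p = u s.other
      · have := (Inst.corner_virt hP s.other).lt_of_lt hu (s := s) (by simpa using hus)
        simp at this; omega
      · rw [h4 h8, h7, hlast] at hc; omega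
    have hmin : ∀ q, u s.other < q → q < r' .p + 1 → u s ≤ I.low s P q := fun q hq1 hq2 => by
      rcases (Nat.lt_succ_iff.1 hq2).eq_or_lt with rfl | hq2
      · rwa [h4 (by omega)] at hc
      · exact h5 q hq1 hq2
    have hrb : r' b = P s := by rw [hr b hbn.1 hbn.2.1 hbn.2.2.1 hbn.2.2.2.1 hbn.2.2.2.2, hb]
    have hlen : r' (.len s.other) = I.n s.other := by
      rw [hr _ (by simp) (by simp) (by simp) (by simp) (by simp), (hE.idx s.other).len]
    have hKt : K * (r' .p + 1 - u s.other) = K * (r' .p - u s.other) + K := by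
      rw [show r' .p + 1 - u s.other = r' .p - u s.other + 1 by omega, Nat.mul_succ]
    simp only [block_cons, block_single, wp_seq, put, ifs, wp_assign, safeE_add, safeE_var,
      safeE_one, and_self, true_and, ev_add, ev_var, ev_one, wp_ite, safeC_le, evC_le,
      Function.update_self, Function.update_of_ne (show Reg.len s.other ≠ .p by simp), hlen,
      Function.update_of_ne hbn.1, hrb, cost_add, cost_var, cost_one, costC_le]
    refine ⟨by omega, fun hc' => ?_, fun hc' => ⟨by omega, ?_⟩⟩
    · have hpos := I.S_pos (s := s.other) (i := r' .p + 1) (by omega) hc'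
      refine wp_nextQ hE.big ((hE.idx s).congr ?_ fun _ _ => rfl) (vc := I.S s.other (r' .p + 1))
        (vh := P s) (fun r'' h => ?_) (fun r'' h => ?_) (by simp) (by simp) hpos.1 hpos.2
        (hE.lt_pow s) fun r'' t'' hr'' hnx'' ht'' => ?_
      · rw [Function.update_of_ne (by simp)]
        exact hr _ (by simp) (by simp) (by simp) (by simp) (by simp)
      · simp only [rd, ev_get, ev_var, safeE_get, safeE_var, and_true, h .p (by simp) (by simp)
          (by simp), Function.update_self]
        exact (hE.idx s.other).str _ (by omega) hc'
      · simp only [ev_var, safeE_var, and_true]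
        rw [h b hbn.2.2.1 hbn.2.2.2.1 hbn.2.2.2.2, Function.update_of_ne hbn.1, hrb]
      · have hp'' : r'' .p = r' .p + 1 := by
          rw [hr'' _ (by simp) (by simp) (by simp) (by simp), Function.update_self]
        refine ⟨⟨rfl, fun x h1 h2 h3 h4 h5 => ?_, by omega, by omega, by omega, fun _ => ?_, ?_,
          ?_⟩, by omega⟩
        · rw [hr'' x h3 h4 h5 h2, Function.update_of_ne h1, hr x h1 h2 h3 h4 h5]
        · rw [hnx'', hp'']; unfold Inst.low; rw [if_pos hc']
        · rw [hp'']; exact hmin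
        · rw [hp'', hKt]; omega
    · have he : r' .p = I.n s.other := by omega
      refine ⟨⟨fun x h1 h2 h3 h4 h5 => ?_, ?_, ?_, ?_, fun _ => ?_, ?_, ?_⟩, ?_⟩
      · rw [Function.update_of_ne h2, Function.update_of_ne h1, hr x h1 h2 h3 h4 h5]
      · simp; omega
      · simp; omega
      · simp; omega
      · simp only [Function.update_self, ne_eq, reduceCtorEq, not_false_eq_true,
          Function.update_of_ne, he, hlast]
      · simpa using hmin
      · simp only [ne_eq, reduceCtorEq, not_false_eq_true, Function.update_of_ne,
          Function.update_self, hKt]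
        omega
      · simp; omega
  · rintro r' m' t' - ⟨rfl, hr, h1, h2, h3, h4, h5, h6⟩ hc
    simp only [evC_le, (ha r' hr).1, ev_var, not_le] at hc
    have hne : r' .p ≠ u s.other := fun h => by rw [h3 h] at hc; omega
    rw [h4 hne] at hc
    have key := hu.next hP (by omega) h2 hc h5
    refine H r' _ _ hr key.1 ?_ ?_ ?_ ?_ ?_
    · rw [sp_self, h4 hne]
    · rw [sp_other]
    · rw [sp_other]; omega
    · rw [sp_other]; exact key.2
    · rw [sp_other]; simp only [costC_le, cost_var]; omega

end

section

variable {I : Inst} {V M L N w B : ℕ} {Q : Post} {r : Reg → ℕ} {m : Arr → ℕ → ℕ} {t : ℕ} {s : Side}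
  {P F u v : Side → ℕ} {U D : Side → ℕ → ℕ} {a b k l : ℕ}

/-- All corners are generated. The sum of coordinates of the point where both ends meet is minimal,
so that the time is bounded in terms of any corner. -/
lemma wp_candidates (hE : Env I V M L w B r m) (hnz : r .nz = k) (hPm : ∀ s, m (.pref s) k = P s)
    (hP : ∀ s, 1 ≤ P s ∧ P s ≤ I.n s)
    (H : ∀ r' m' t' a d, Frame V candidates r m r' m' → r' .np = a →
      Stair I P .x a (fun s => m' (.up s)) → m' (.up .x) a = P .x → m' (.up .y) a = I.n .y + 1 →
      (∀ s, m' (.up s) 0 = sp .x (I.n .x + 1) (P .y) s) →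
      (∀ v, I.Corner P v → P .x + P .y + d ≤ v .x + v .y) → a ≤ d →
      t' ≤ t + 500 * (L + 1) * (d + 1) → Q r' m' t') : wp V M candidates Q r m t := by
  refine wp_conseq (Q := fun r' m' t' => ∃ a d, r' .np = a ∧
      Stair I P .x a (fun s => m' (.up s)) ∧ m' (.up .x) a = P .x ∧ m' (.up .y) a = I.n .y + 1 ∧
      (∀ s, m' (.up s) 0 = sp .x (I.n .x + 1) (P .y) s) ∧
      (∀ v, I.Corner P v → P .x + P .y + d ≤ v .x + v .y) ∧ a ≤ d ∧
      t' ≤ t + 500 * (L + 1) * (d + 1)) ?_ fun r' m' t' hF h => by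
    obtain ⟨a, d, h1, h2, h3, h4, h5, h6, h7, h8⟩ := h
    exact H r' m' t' a d hF h1 h2 h3 h4 h5 h6 h7 h8
  clear H
  have hM := hE.big.le_M
  have hMV := hE.big.le_V
  have hP' : ∀ s, P s ≤ I.n s := fun s => (hP s).2
  have hPx := hP .x
  have hPy := hP .y
  have hlx := (hE.idx .x).len
  have hly := (hE.idx .y).len
  obtain ⟨K, hK⟩ : ∃ K, K = 200 * (L + 1) := ⟨_, rfl⟩
  have hsum : ∀ v, I.Corner P v → (∀ s, P s ≤ v s ∧ v s ≤ I.n s + 1) := fun v hv =>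
    hv.1.bounds hP'
  simp only [candidates, put, wr, rd, block_cons, block_single, wp_seq, wp_assign, wp_store, safeE_get,
    safeE_var, safeE_zero, safeE_one, safeE_add, and_self, true_and, ev_get, ev_var, ev_zero, ev_one,
    ev_add, hnz, hPm, Function.update_apply, reduceCtorEq, if_false, if_true, cost_get, cost_var,
    cost_zero, cost_one, cost_add, hlx, hly, zero_le]
  refine ⟨by omega, by omega, by omega, by omega, by omega, by omega, by omega, by omega, by omega,
    by omega, ?_⟩
  refine wp_loop (fun r' m' t' => ∃ a b, r' .np = a ∧ r' .nq = b ∧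
    Stair I P .x a (fun s => m' (.up s)) ∧ Stair I P .y b (fun s => m' (.down s)) ∧
    (∀ s, m' (.up s) 0 = sp .x (I.n .x + 1) (P .y) s) ∧
    (∀ s, m' (.down s) 0 = sp .y (I.n .y + 1) (P .x) s) ∧
    m' (.up .y) a ≤ m' (.down .y) b ∧
    (∀ v, I.Corner P v → v .y < m' (.up .y) a ∨ v .x < m' (.down .x) b →
      m' (.up .x) a + m' (.up .y) a ≤ v .x + v .y ∨
      m' (.down .x) b + m' (.down .y) b ≤ v .x + v .y) ∧
    t' ≤ t + 100 + 2 * K * ((m' (.up .y) a - P .y) + (m' (.down .x) b - P .x)))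
    (fun r' m' => m' (.down .y) (r' .nq) - m' (.up .y) (r' .np)) ?_ ?_ ?_ ?_
  · refine ⟨0, 0, by simp, by simp, Stair.init hP' (by simp) (by simp),
      Stair.init hP' (by simp) (by simp), fun s => ?_, fun s => ?_, by simp; omega,
      fun v hv h => ?_, by simp⟩
    · cases s <;> simp [sp]
    · cases s <;> simp [sp]
    · have h1 := (hsum v hv .x).1
      have h2 := (hsum v hv .y).1
      simp at h
      omega
  · intros; simp [rd]
  · rintro r' m' t' hF ⟨a, b, ha, hb, hU, hD, hU0, hD0, hle, hpass, ht⟩ hc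
    simp only [evC_ne, rd, ev_get, ev_var, ha, hb] at hc
    have hE' : Env I V M L w B r' m' := (hE.congr (by simp [envR]) (by simp [envA])).frame hF rfl
    have hi : r' .i = P .x := by rw [hF.reg _ rfl]; simp
    have hj : r' .j = P .y := by rw [hF.reg _ rfl]; simp
    have hua := hU.corner a le_rfl
    have hdb := hD.corner b le_rfl
    have hxy : m' (.up .y) a < m' (.down .y) b := by
      refine lt_of_le_of_ne hle fun h => hc ?_
      exact congrFun (hua.eq_of_eq (s := .y) hdb h) .x
    have hdu : m' (.down .x) b < m' (.up .x) a := hua.lt_of_lt (s := .y) hdb hxy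
    have hub := hsum _ hua
    have hdbd := hsum _ hdb
    have hux := hub .x
    have huy := hub .y
    have hdx := hdbd .x
    have hdy := hdbd .y
    have hal : P .y + a ≤ m' (.up .y) a := hU.add_le le_rfl
    have hbl : P .x + b ≤ m' (.down .x) b := hD.add_le le_rfl
    clear hF
    simp only [rd, cost_get, cost_var, costC_ne, block_single, wp_ite, safeC_le, safeE_add, safeE_get,
      safeE_var, and_self, true_and, evC_le, ev_add, ev_get, ev_var, ha, hb, costC_le, cost_add, put,
      wr, block_cons, ifs, wp_seq, wp_assign, wp_store, Function.update_apply, reduceCtorEq, if_false]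
    refine ⟨fun hc' => ⟨by omega, by omega, ?_⟩, fun hc' => ⟨by omega, by omega, ?_⟩⟩
    · refine wp_scan (s := .x) (hE'.congr (by simp [envR]) fun _ _ => rfl) hP' hua
        (by omega) (fun r'' h => ?_) (by simp) ?_ (by simp) (by simp) ?_
        fun r'' t'' v hr'' hv hnx hp hlt hnext ht'' => ?_
      · have h1 := h .np (by simp) (by simp) (by simp) (by simp) (by simp)
        simp only [Function.update_apply, reduceCtorEq, if_false, ha] at h1
        simp [h1]
      · simpa using hi
      · simp [ha]
      · have hnp : r'' .np = a := by
          rw [hr'' _ (by simp) (by simp) (by simp) (by simp) (by simp)]; simpa using ha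
        have hnq : r'' .nq = b := by
          rw [hr'' _ (by simp) (by simp) (by simp) (by simp) (by simp)]; simpa using hb
        simp only [Side.other_x] at hlt hp hnext ht''
        have hvd : v .y ≤ m' (.down .y) b := hnext _ hdb hxy
        have hvx : v .x < m' (.up .x) a := hua.lt_of_lt (s := .y) hv hlt
        have hvb := hsum v hv
        have hvbx := hvb .x
        have hvby := hvb .y
        simp only [safeE_add, safeE_var, safeE_one, and_self, true_and, ev_add, ev_var, ev_one, hnp,
          hnq, hnx, hp, Function.update_self, Function.update_apply, reduceCtorEq, if_false, if_true,
          Arr.up.injEq]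
        refine ⟨by omega, by omega, by omega, by omega, by omega, ⟨a + 1, b, rfl, rfl, hU.push ?_ ?_ ?_ ?_, hD, ?_, hD0,
          by simpa using hvd, ?_, ?_⟩, by omega⟩
        · intro t l hl
          have hne : l ≠ a + 1 := by omega
          cases t <;> simp [hne]
        · exact (congrArg (I.Corner P) (pair_ext .x (by simp) (by simp))).mpr hv
        · simpa using hlt
        · simpa using hnext
        · intro s
          rw [← hU0]
          cases s <;> simp
        · intro w hw h
          simp only [if_true, eq_self_iff_true] at h ⊢
          rcases h with h | h
          · by_cases h1 : m' (.up .y) a < w .y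
            · exact absurd (hnext w hw h1) (by omega)
            · right
              by_cases h2 : w .y = m' (.up .y) a
              · have h3 : w = _ := hw.eq_of_eq (s := .y) hua h2
                rw [h3]; exact hc'
              · have := hpass w hw (Or.inl (by omega)); omega
          · have := hpass w hw (Or.inr h); omega
        · have h1 : 2 * K * ((v .y - P .y) + (m' (.down .x) b - P .x)) =
              2 * K * ((m' (.up .y) a - P .y) + (m' (.down .x) b - P .x)) +
              2 * (K * (v .y - m' (.up .y) a)) := by
            rw [show (v .y - P .y) + (m' (.down .x) b - P .x) =
              ((m' (.up .y) a - P .y) + (m' (.down .x) b - P .x)) + (v .y - m' (.up .y) a) by omega]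
            ring
          rw [← hK] at ht''
          have h2 : K * 1 ≤ K * (v .y - m' (.up .y) a) := Nat.mul_le_mul_left _ (by omega)
          simp only [if_true, eq_self_iff_true]
          rw [h1]
          simp only [cost_add, cost_var, cost_one]
          omega
    · refine wp_scan (s := .y) (hE'.congr (by simp [envR]) fun _ _ => rfl) hP' hdb
        (by omega) (fun r'' h => ?_) (by simp) ?_ (by simp) (by simp) ?_
        fun r'' t'' v hr'' hv hnx hp hlt hnext ht'' => ?_
      · have h1 := h .nq (by simp) (by simp) (by simp) (by simp) (by simp)
        simp only [Function.update_apply, reduceCtorEq, if_false, hb] at h1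
        simp [h1]
      · simpa using hj
      · simp [hb]
      · have hnp : r'' .np = a := by
          rw [hr'' _ (by simp) (by simp) (by simp) (by simp) (by simp)]; simpa using ha
        have hnq : r'' .nq = b := by
          rw [hr'' _ (by simp) (by simp) (by simp) (by simp) (by simp)]; simpa using hb
        simp only [Side.other_y] at hlt hp hnext ht''
        have hvd : v .x ≤ m' (.up .x) a := hnext _ hua hdu
        have hvy : v .y < m' (.down .y) b := hdb.lt_of_lt (s := .x) hv hlt
        have hvu : m' (.up .y) a ≤ v .y := by
          rcases hvd.eq_or_lt with h | h
          · have h1 : v = _ := hv.eq_of_eq (s := .x) hua h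
            rw [h1]
          · exact (hv.lt_of_lt (s := .x) hua h).le
        have hvb := hsum v hv
        have hvbx := hvb .x
        have hvby := hvb .y
        simp only [safeE_add, safeE_var, safeE_one, and_self, true_and, ev_add, ev_var, ev_one, hnp,
          hnq, hnx, hp, Function.update_self, Function.update_apply, reduceCtorEq, if_false, if_true,
          Arr.down.injEq]
        refine ⟨by omega, by omega, by omega, by omega, by omega, ⟨a, b + 1, rfl, rfl, hU, hD.push ?_ ?_ ?_ ?_, hU0, ?_,
          by simpa using hvu, ?_, ?_⟩, by omega⟩
        · intro t l hl
          have hne : l ≠ b + 1 := by omega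
          cases t <;> simp [hne]
        · exact (congrArg (I.Corner P) (pair_ext .x (by simp) (by simp))).mpr hv
        · simpa using hlt
        · simpa using hnext
        · intro s
          rw [← hD0]
          cases s <;> simp
        · intro w hw h
          simp only [if_true, eq_self_iff_true] at h ⊢
          rcases h with h | h
          · have := hpass w hw (Or.inl h); omega
          · by_cases h1 : m' (.down .x) b < w .x
            · exact absurd (hnext w hw h1) (by omega)
            · left
              by_cases h2 : w .x = m' (.down .x) b
              · have h3 : w = _ := hw.eq_of_eq (s := .x) hdb h2
                rw [h3]; simp only; omega
              · have := hpass w hw (Or.inr (by omega)); omega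
        · have h1 : 2 * K * ((m' (.up .y) a - P .y) + (v .x - P .x)) =
              2 * K * ((m' (.up .y) a - P .y) + (m' (.down .x) b - P .x)) +
              2 * (K * (v .x - m' (.down .x) b)) := by
            rw [show (m' (.up .y) a - P .y) + (v .x - P .x) =
              ((m' (.up .y) a - P .y) + (m' (.down .x) b - P .x)) + (v .x - m' (.down .x) b) by omega]
            ring
          rw [← hK] at ht''
          have h2 : K * 1 ≤ K * (v .x - m' (.down .x) b) := Nat.mul_le_mul_left _ (by omega)
          simp only [if_true, eq_self_iff_true]
          rw [h1]
          simp only [cost_add, cost_var, cost_one]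
          omega
  rintro r1 m1 t1 - ⟨a, b, ha, hb, hU, hD, hU0, hD0, hle, hpass, ht⟩ hc
  simp only [evC_ne, rd, ev_get, ev_var, ha, hb, not_not, ne_eq] at hc
  have hua := hU.corner a le_rfl
  have hdb := hD.corner b le_rfl
  have hmeet : (fun s => m1 (.up s) a) = (fun s => m1 (.down s) b) :=
    hua.eq_of_eq (s := .x) hdb hc
  have hub := hsum _ hua
  have hux := hub .x
  have huy := hub .y
  have hal : P .y + a ≤ m1 (.up .y) a := hU.add_le le_rfl
  have hbl : P .x + b ≤ m1 (.down .x) b := hD.add_le le_rfl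
  have hmx : m1 (.up .x) a = m1 (.down .x) b := hc
  have hmy : m1 (.up .y) a = m1 (.down .y) b := congrFun hmeet .y
  obtain ⟨d, hd⟩ : ∃ d, d = (m1 (.up .y) a - P .y) + (m1 (.down .x) b - P .x) := ⟨_, rfl⟩
  have hmin : ∀ v, I.Corner P v → P .x + P .y + d ≤ v .x + v .y := by
    intro v hv
    by_cases h : v .y < m1 (.up .y) a ∨ v .x < m1 (.down .x) b
    · have := hpass v hv h; omega
    · omega
  rw [← hd] at ht
  have hab : a + b ≤ d := by omega
  have hdn : d ≤ I.n .x + I.n .y + 2 := by omega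
  clear hpass hle hal hbl hc hmx hmy hd hux huy hub hua hdb
  simp only [costC_ne, rd, cost_get, cost_var]
  refine wp_loop (fun r' m' t' => ∃ a b, r' .np = a ∧ r' .nq = b ∧
    Stair I P .x a (fun s => m' (.up s)) ∧ Stair I P .y b (fun s => m' (.down s)) ∧
    (∀ s, m' (.up s) 0 = sp .x (I.n .x + 1) (P .y) s) ∧
    (∀ s, m' (.down s) 0 = sp .y (I.n .y + 1) (P .x) s) ∧
    (∀ s, m' (.up s) a = m' (.down s) b) ∧ a + b ≤ d ∧
    t' + 30 * b ≤ t + 110 + 2 * K * d + 30 * d)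
    (fun r' m' => r' .nq) ?_ ?_ ?_ ?_
  · exact ⟨a, b, ha, hb, hU, hD, hU0, hD0, fun s => congrFun hmeet s, hab, by omega⟩
  · intros; simp
  · rintro r' m' t' - ⟨a, b, ha, hb, hU, hD, hU0, hD0, hm, hab, ht⟩ hc
    simp only [evC_le, ev_one, ev_var, hb] at hc
    obtain ⟨b, rfl⟩ : ∃ b', b = b' + 1 := ⟨b - 1, by omega⟩
    have hs := Stair.succ_of_meet (s := .x) hD hm
    have hcor := hD.corner b (by omega)
    have hbd := hsum _ hcor
    have hbx := hbd .x
    have hby := hbd .y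
    simp only [Side.other_x] at hs hbx hby
    simp only [block_cons, block_single, wp_seq, put, wr, rd, wp_assign, wp_store, safeE_sub,
      safeE_add, safeE_var, safeE_one, safeE_get, and_self, true_and, ev_sub, ev_add, ev_var, ev_one,
      ev_get, ha, hb, Function.update_apply, reduceCtorEq, if_false, if_true, Nat.add_sub_cancel,
      cost_sub, cost_add, cost_var, cost_one, cost_get, costC_le, Arr.up.injEq]
    refine ⟨by omega, by omega, by omega, by omega, by omega, by omega, ⟨a + 1, b, rfl, rfl,
      hU.push ?_ ?_ ?_ ?_, hD.pred, ?_, hD0, ?_, by omega, by omega⟩, by omega⟩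
    · intro t l hl
      have hne : l ≠ a + 1 := by omega
      cases t <;> simp [hne]
    · exact (congrArg (I.Corner P) (pair_ext .x (by simp) (by simp))).mpr hcor
    · simpa using hs.1
    · simpa using hs.2
    · intro s
      rw [← hU0]
      cases s <;> simp
    · intro s; cases s <;> simp
  · rintro r' m' t' - ⟨a, b, ha, hb, hU, hD, hU0, hD0, hm, hab, ht⟩ hc
    simp only [evC_le, ev_one, ev_var, hb, not_le, Nat.lt_one_iff] at hc
    subst hc
    refine ⟨a, d, ha, hU, ?_, ?_, hU0, hmin, by omega, ?_⟩
    · rw [hm, hD0]; rfl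
    · rw [hm, hD0]; rfl
    · rw [show 500 * (L + 1) * (d + 1) = 2 * K * d + 100 * (L * d) + 100 * d + 500 * (L + 1) by
        rw [hK]; ring]
      simp only [costC_le, cost_one, cost_var]
      omega

end

section

variable {I : Inst} {V M L N w B : ℕ} {Q : Post} {r : Reg → ℕ} {m : Arr → ℕ → ℕ} {t : ℕ} {s : Side}
  {P F u v : Side → ℕ} {U D : Side → ℕ → ℕ} {a b k l : ℕ}

/-! ### Searching for witnesses -/

namespace Inst

/-- Occurrences on the other side provide all matches with the same coordinate on side `s`. -/
lemma exists_sp_match (hv : I.Match v) (s : Side) {k : ℕ} (h1 : 1 ≤ k)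
    (h2 : k ≤ I.count s.other (I.S .x (v .x))) :
    ∃ b, I.Match (sp s (v s) b) ∧ I.rank s.other b = k ∧ I.S s.other b = I.S .x (v .x) := by
  obtain ⟨b, h3, h4, h5, h6⟩ := exists_rk_eq h1 h2
  refine ⟨b, match_of s (by rw [sp_self]; exact hv.1 s) (by rw [sp_other]; exact ⟨h3, h4⟩) ?_, ?_, h5⟩
  · rw [sp_self, sp_other, h5, hv.eq]
  · rw [rank, h5, h6]

/-- The position, relative to that of the first match, in the order in which the second coordinate
varies. -/
def dnum (s : Side) (f cx u : ℕ) : ℕ :=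
  match s with
  | .x => u + cx - f
  | .y => f + cx - u

/-- The matches with a given coordinate on side `s` are consecutive in the threshold arrays, in the
order of the other coordinate, or in the opposite order. -/
lemma dpos_sp (h : I.Match (sp s a b)) : I.dpos (sp s a b) = I.base (I.S s a) +
    dnum s (I.rank s a) (I.count .x (I.S s a)) (I.rank s.other b) := by
  have := h.eq s .x
  rw [sp_self] at this
  rw [dpos, ← this]
  cases s
  · rfl
  · rfl

lemma SM.sp_char (hv : I.Match v) (h : I.SM (sp s (v s) b)) :
    I.S s.other b = I.S .x (v .x) ∧ 1 ≤ b ∧ b ≤ I.n s.other := by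
  have h1 := h.match
  have h2 := h1.eq s.other s
  have h3 := h1.1 s.other
  rw [sp_self, sp_other] at h2
  rw [sp_other] at h3
  exact ⟨h2.trans (hv.eq _ _), h3⟩

end Inst

open Inst in
/-- A range maximum query decides whether a range of matches with a common coordinate contains a
suff-match. -/
lemma wp_rangeQuery (hE : Env I V M L w B r m) (hv : I.Match v) (hc : r .c = I.S .x (v .x))
    (hf : r .f = I.rank s (v s)) {x y : Reg} (hx : x ≠ .ql) (hy : y ≠ .ql) (h1 : 1 ≤ r x)
    (h2 : r x ≤ r y) (h3 : r y ≤ I.count s.other (I.S .x (v .x)))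
    (H : ∀ r' t', (∀ x, x ≠ .ql → x ≠ .qr → x ≠ .bl → x ≠ .br → x ≠ .pos → x ≠ .best → x ≠ .lv →
      r' x = r x) →
      (I.rank s (v s) ≤ m (.th s) (r' .best) ↔ ∃ b, r x ≤ I.rank s.other b ∧
        I.rank s.other b ≤ r y ∧ I.SM (sp s (v s) b)) → t' ≤ t + 500 → Q r' m t') :
    wp V M (rangeQuery s x y) Q r m t := by
  have hM := hE.big.le_M
  have hMV := hE.big.le_V
  have hxi := hE.idx .x
  have hyi := hE.idx .y
  have hn : ∀ s, 2 ≤ I.n s := I.two_le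
  have hnx := hn .x
  have hny := hn .y
  have hvx := hv.1 .x
  have hpos := I.S_pos hvx.1 hvx.2
  have hcs : I.S s (v s) = I.S .x (v .x) := hv.eq _ _
  have hf1 := hv.rank_pos s
  have hf2 := hv.rank_le s .x
  have hlt : I.base (I.S .x (v .x)) + (I.count .x (I.S .x (v .x)) + I.count .y (I.S .x (v .x))) ≤
    I.n .x + I.n .y := by rw [← base_succ]; exact base_le
  have hBw : I.n .x + I.n .y < B * w := by
    have h1 := hE.tab.blocks_eq
    have h2 := Nat.div_add_mod (I.n .x + I.n .y) w
    have h3 := Nat.mod_lt (I.n .x + I.n .y) (y := w) (by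
      rcases Nat.eq_zero_or_pos w with h | h
      · have := hE.tab.lt_pow; subst h; omega
      · exact h)
    rw [h1, Nat.add_mul, Nat.mul_comm _ w]; omega
  have hd : ∀ (z : Reg) r', (∀ x, x ≠ .ql → r' x = r x) → z ≠ .ql →
      ev r' m (diag s z) = I.base (I.S .x (v .x)) +
        dnum s (I.rank s (v s)) (I.count .x (I.S .x (v .x))) (r z) ∧ safeE V r' m (diag s z) := by
    intro z r' hr' hz
    have hb : I.before .x (I.S .x (v .x)) + I.before .y (I.S .x (v .x)) = I.base (I.S .x (v .x)) :=
      rfl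
    cases s <;> simp [diag, rd, dnum, hr' .c, hr' .f, hr' z hz, hc, hf, hxi.start _ hpos.1 hpos.2,
      hyi.start _ hpos.1 hpos.2, hxi.cnt, hb]
  have hcost : ∀ z : Reg, (diag s z).cost ≤ 20 := by intro z; cases s <;> simp [diag, rd]
  -- any position in the queried range is that of a match
  have key : ∀ lo hi, (∀ q, lo ≤ q → q ≤ hi → ∃ k, r x ≤ k ∧ k ≤ r y ∧ q = I.base (I.S .x (v .x)) +
        dnum s (I.rank s (v s)) (I.count .x (I.S .x (v .x))) k) →
      (∀ k, r x ≤ k → k ≤ r y → lo ≤ I.base (I.S .x (v .x)) +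
        dnum s (I.rank s (v s)) (I.count .x (I.S .x (v .x))) k ∧ I.base (I.S .x (v .x)) +
        dnum s (I.rank s (v s)) (I.count .x (I.S .x (v .x))) k ≤ hi) →
      ∀ p, IsMaxAt (m (.th s)) lo hi p →
      (I.rank s (v s) ≤ m (.th s) p ↔ ∃ b, r x ≤ I.rank s.other b ∧
        I.rank s.other b ≤ r y ∧ I.SM (sp s (v s) b)) := by
    rintro lo hi hsur hin p ⟨hp1, hp2, hp3⟩
    have hsp : ∀ b, I.Match (sp s (v s) b) → (I.rank s (v s) ≤ m (.th s) (I.base (I.S .x (v .x)) +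
        dnum s (I.rank s (v s)) (I.count .x (I.S .x (v .x))) (I.rank s.other b)) ↔
        I.SM (sp s (v s) b)) := fun b hb => by
      have := hE.thr.sm_iff hb s
      rwa [dpos_sp hb, sp_self, hcs] at this
    constructor
    · intro h
      obtain ⟨k, hk1, hk2, rfl⟩ := hsur p hp1 hp2
      obtain ⟨b, hb1, hb2, -⟩ := exists_sp_match hv s (by omega) (hk2.trans h3)
      refine ⟨b, by omega, by omega, (hsp b hb1).1 ?_⟩
      rwa [hb2]
    · rintro ⟨b, hb1, hb2, hb3⟩
      have h4 := hin _ hb1 hb2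
      exact ((hsp b hb3.match).2 hb3).trans (hp3 _ h4.1 h4.2)
  have hcy := @count_le I .y (I.S .x (v .x))
  cases s
  · refine wp_rmq hE.tab (hE.rmq _) (by omega) (by omega) (hd x r (fun _ _ => rfl) hx).1
      (hd x r (fun _ _ => rfl) hx).2 (fun z => hd y _ (fun _ h => Function.update_of_ne h _ _) hy)
      (hcost _) (hcost _) ?_ ?_ fun r' t' hr' hmax ht' => H r' t' hr' (key _ _ ?_ ?_ _ hmax) ht'
    · simp only [dnum]; omega
    · simp only [dnum, Side.other_x] at *; omega
    · intro q hq1 hq2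
      simp only [dnum] at *
      exact ⟨q + I.rank .x (v .x) - I.base (I.S .x (v .x)) - I.count .x (I.S .x (v .x)), by omega,
        by omega, by omega⟩
    · intro k hk1 hk2
      simp only [dnum]; omega
  · refine wp_rmq hE.tab (hE.rmq _) (by omega) (by omega) (hd y r (fun _ _ => rfl) hy).1
      (hd y r (fun _ _ => rfl) hy).2 (fun z => hd x _ (fun _ h => Function.update_of_ne h _ _) hx)
      (hcost _) (hcost _) ?_ ?_ fun r' t' hr' hmax ht' => H r' t' hr' (key _ _ ?_ ?_ _ hmax) ht'
    · simp only [dnum]; omega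
    · simp only [dnum, Side.other_y] at *; omega
    · intro q hq1 hq2
      simp only [dnum, Side.other_y] at *
      exact ⟨I.base (I.S .x (v .x)) + I.rank .y (v .y) + I.count .x (I.S .x (v .x)) - q, by omega,
        by omega, by omega⟩
    · intro k hk1 hk2
      simp only [dnum]; omega

open Inst in
/-- The least suff-match with the same coordinate on side `s` is found, unless it exceeds the bound
given by `safe`. -/
lemma wp_searchWitness (hE : Env I V M L w B r m) (hv : I.Match v) (hvr : ∀ t, r (.m t) = v t)
    (hc : r .c = I.S .x (v .x)) (hF : m (.safe s.other) (r .nz) = F s.other)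
    (H : ∀ r' m' t', Frame V (searchWitness s) r m r' m' →
      (r' .found = 1 ∧ I.SM (sp s (v s) (r' .w)) ∧ v s.other ≤ r' .w ∧ r' .w ≤ F s.other ∧
        (∀ b, v s.other ≤ b → I.SM (sp s (v s) b) → r' .w ≤ b) ∨
      r' .found = 0 ∧ ∀ b, v s.other ≤ b → b ≤ F s.other → ¬ I.SM (sp s (v s) b)) →
      t' ≤ t + 800 * (L + 1) → Q r' m' t') : wp V M (searchWitness s) Q r m t := by
  refine wp_conseq (Q := fun r' _ t' => (r' .found = 1 ∧ I.SM (sp s (v s) (r' .w)) ∧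
      v s.other ≤ r' .w ∧ r' .w ≤ F s.other ∧ (∀ b, v s.other ≤ b → I.SM (sp s (v s) b) → r' .w ≤ b) ∨
      r' .found = 0 ∧ ∀ b, v s.other ≤ b → b ≤ F s.other → ¬ I.SM (sp s (v s) b)) ∧
      t' ≤ t + 800 * (L + 1)) ?_ fun r' m' t' hF h => H r' m' t' hF h.1 h.2
  clear H
  have hM := hE.big.le_M
  have hMV := hE.big.le_V
  have hns := hE.big.n_le s
  have hno := hE.big.n_le s.other
  have hvs := hv.1 s
  have hvo := hv.1 s.other
  have hi := hE.idx s
  have hio := hE.idx s.other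
  have hvx := hv.1 .x
  have hpos := I.S_pos hvx.1 hvx.2
  have hf2 := hv.rank_le s .x
  have hl1 := hv.rank_pos s.other
  have hl2 := hv.rank_le s.other .x
  have hc1 := @count_le I s (I.S .x (v .x))
  have hc2 := @count_le I s.other (I.S .x (v .x))
  have hbase := @before_le I s.other (I.S .x (v .x))
  have hcs : ∀ s, I.S s (v s) = I.S .x (v .x) := fun s => hv.eq _ _
  have hr1 : m (.rank s) (v s) = I.rank s (v s) := hi.rank _ hvs.1 hvs.2
  have hr2 : m (.rank s.other) (v s.other) = I.rank s.other (v s.other) := hio.rank _ hvo.1 hvo.2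
  have hrb : ∀ b, I.SM (sp s (v s) b) → (v s.other ≤ b ↔ I.rank s.other (v s.other) ≤ I.rank s.other b) ∧
      (b ≤ F s.other ↔ I.rank s.other b ≤ I.rk s.other (I.S .x (v .x)) (F s.other)) := by
    intro b hb
    obtain ⟨h1, h2, h3⟩ := hb.sp_char hv
    simp only [rank, h1, hcs]
    refine ⟨⟨fun h => rk_mono h, fun h => ?_⟩, ⟨fun h => rk_mono h, fun h => ?_⟩⟩
    · by_contra h4
      have := rk_lt_rk (not_le.1 h4) hvo.2 (hcs _)
      omega
    · by_contra h4
      have := rk_lt_rk (not_le.1 h4) h3 h1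
      omega
  have hk : I.rk s.other (I.S .x (v .x)) (F s.other) ≤ I.count s.other (I.S .x (v .x)) := rk_le_count
  have hLo := hE.lt_pow s.other
  simp only [searchWitness, put, rd, ifs, whl, block_cons, block_single, block_nil, wp_seq, wp_assign,
    safeE_get, safeE_var, true_and, ev_get, ev_var, hvr, hr1, hr2, Function.update_apply, reduceCtorEq,
    if_false, cost_get, cost_var]
  refine ⟨by omega, by omega, ?_⟩
  refine wp_countLE hE.big (hio.congr (by simp) fun _ _ => rfl) (vc := I.S .x (v .x))
    (vh := F s.other) (fun r' h => ?_) (fun r' h => ?_) (by simp) (by simp) hpos.1 hpos.2 hLo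
    fun r1 t1 hr1' hrk ht1 => ?_
  · simp [h .c, hc]
  · simp [h .nz, hF]
  have hlo1 : r1 .lo = I.rank s.other (v s.other) := by rw [hr1' _ (by simp) (by simp) (by simp)]; simp
  have hf1 : r1 .f = I.rank s (v s) := by rw [hr1' _ (by simp) (by simp) (by simp)]; simp
  have hcr1 : r1 .c = I.S .x (v .x) := by rw [hr1' _ (by simp) (by simp) (by simp)]; simp [hc]
  have hE1 : Env I V M L w B r1 m := hE.congr (fun x hx => by
    simp only [envR, List.mem_cons, List.not_mem_nil, or_false] at hx
    rw [hr1' x (by rintro rfl; simp at hx) (by rintro rfl; simp at hx) (by rintro rfl; simp at hx),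
      Function.update_of_ne (by rintro rfl; simp at hx), Function.update_of_ne (by rintro rfl; simp at hx)])
    fun _ _ => rfl
  clear hr1'
  simp only [safeE_zero, ev_zero, true_and, zero_le, wp_ite, safeC_le, safeE_var, and_self, evC_le,
    ev_var, Function.update_apply, reduceCtorEq, if_false, hlo1, hrk, cost_var, cost_zero, costC_le,
    if_true, wp_skip, and_true]
  refine ⟨by omega, fun hle => ?_, fun hle => ⟨Or.inr fun b h1 h2 h3 => ?_, by omega⟩⟩
  swap
  · have := hrb b h3; omega
  refine wp_rangeQuery (s := s) (hE1.congr (by simp [envR]) fun _ _ => rfl) hv (by simp [hcr1])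
    (by simp [hf1]) (by simp) (by simp) (by simp [hlo1]; omega) (by simp [hlo1]; omega) (by simp; omega)
    fun r2 t2 hr2' hiff ht2 => ?_
  have hlo2 : r2 .lo = I.rank s.other (v s.other) := by
    rw [hr2' _ (by simp) (by simp) (by simp) (by simp) (by simp) (by simp) (by simp)]; simp [hlo1]
  have hhi2 : r2 .hi = I.rk s.other (I.S .x (v .x)) (F s.other) := by
    rw [hr2' _ (by simp) (by simp) (by simp) (by simp) (by simp) (by simp) (by simp)]; simp
  have hf2' : r2 .f = I.rank s (v s) := by
    rw [hr2' _ (by simp) (by simp) (by simp) (by simp) (by simp) (by simp) (by simp)]; simp [hf1]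
  have hcr2 : r2 .c = I.S .x (v .x) := by
    rw [hr2' _ (by simp) (by simp) (by simp) (by simp) (by simp) (by simp) (by simp)]; simp [hcr1]
  have hfd2 : r2 .found = 0 := by
    rw [hr2' _ (by simp) (by simp) (by simp) (by simp) (by simp) (by simp) (by simp)]; simp
  have hE2 : Env I V M L w B r2 m := hE1.congr (fun x hx => by
    simp only [envR, List.mem_cons, List.not_mem_nil, or_false] at hx
    rw [hr2' x (by rintro rfl; simp at hx) (by rintro rfl; simp at hx) (by rintro rfl; simp at hx)
      (by rintro rfl; simp at hx) (by rintro rfl; simp at hx) (by rintro rfl; simp at hx)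
      (by rintro rfl; simp at hx),
      Function.update_of_ne (by rintro rfl; simp at hx), Function.update_of_ne (by rintro rfl; simp at hx)])
    fun _ _ => rfl
  simp only [Function.update_apply, reduceCtorEq, if_false, if_true, hlo1] at hiff
  clear hr2'
  simp only [wp_ite, wp_seq, wp_assign, safeC_le, safeE_var, and_self, safeE_get, evC_le, ev_get,
    ev_var, hf2', hiff, ev_one, safeE_one, true_and, cost_one, costC_le, wp_skip, block_nil]
  refine ⟨fun hex => ⟨by omega, ?_⟩, fun hex => ⟨Or.inr ⟨hfd2, fun b h1 h2 h3 => hex ?_⟩,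
    by simp only [cost_get, cost_var]; omega⟩⟩
  swap
  · have := hrb b h3
    exact ⟨b, by omega, by omega, h3⟩
  refine wp_loop (fun r' m' t' => m' = m ∧ r' .found = 1 ∧ r' .c = I.S .x (v .x) ∧
    r' .f = I.rank s (v s) ∧ Env I V M L w B r' m ∧
    I.rank s.other (v s.other) ≤ r' .lo ∧ r' .lo ≤ r' .hi ∧
    r' .hi ≤ I.rk s.other (I.S .x (v .x)) (F s.other) ∧
    (∃ b, r' .lo ≤ I.rank s.other b ∧ I.rank s.other b ≤ r' .hi ∧ I.SM (sp s (v s) b)) ∧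
    (∀ b, I.rank s.other (v s.other) ≤ I.rank s.other b → I.SM (sp s (v s) b) →
      r' .lo ≤ I.rank s.other b) ∧
    ∃ j, r' .hi - r' .lo < 2 ^ j ∧ t' + 600 * j ≤ t + 60 * (L + 1) + 570 + 600 * L)
    (fun r' _ => r' .hi - r' .lo) ?_ ?_ ?_ ?_
  · refine ⟨rfl, by simp, by simp [hcr2], by simp [hf2'], hE2.congr (by simp [envR]) fun _ _ => rfl,
      by simp [hlo2], by simp [hlo2, hhi2]; omega, by simp [hhi2], ?_, ?_, L, ?_, ?_⟩
    · simpa [hlo2, hhi2] using hex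
    · intro b h1 _
      simpa [hlo2] using h1
    · simp only [Function.update_apply, reduceCtorEq, if_false, hlo2, hhi2]; omega
    · simp only [cost_get, cost_var]; omega
  · intros; simp
  · rintro r' m' t' - ⟨rfl, h1, h2, h3, h4, h5, h6, h7, h8, h9, j, hj, ht⟩ hlt
    simp only [evC_lt, ev_var] at hlt
    obtain ⟨j, rfl⟩ : ∃ j', j = j' + 1 :=
      ⟨j - 1, by rcases j with _ | j; · { rw [pow_zero] at hj; omega }
                 · rfl⟩
    rw [pow_succ] at hj
    simp only [wp_seq, wp_assign, safeE_div, safeE_add, safeE_var, safeE_two, and_self, true_and, ev_div, ev_add, ev_var,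
      ev_two, cost_div, cost_add, cost_var, cost_two, costC_lt]
    refine ⟨by omega, ?_⟩
    have hmid1 : r' .lo ≤ (r' .lo + r' .hi) / 2 := by omega
    have hmid2 : (r' .lo + r' .hi) / 2 < r' .hi := by omega
    refine wp_rangeQuery (s := s) (h4.congr (by simp [envR]) fun _ _ => rfl) hv (by simp [h2])
      (by simp [h3]) (by simp) (by simp) (by simp; omega) (by simp; omega) (by simp; omega)
      fun r3 t3 hr3' hiff ht3 => ?_
    have hr3 : ∀ x, x ≠ .ql → x ≠ .qr → x ≠ .bl → x ≠ .br → x ≠ .pos → x ≠ .best → x ≠ .lv →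
        x ≠ .mid → r3 x = r' x := fun x a1 a2 a3 a4 a5 a6 a7 a8 => by
      rw [hr3' x a1 a2 a3 a4 a5 a6 a7, Function.update_of_ne a8]
    have hlo3 := hr3 .lo (by simp) (by simp) (by simp) (by simp) (by simp) (by simp) (by simp) (by simp)
    have hhi3 := hr3 .hi (by simp) (by simp) (by simp) (by simp) (by simp) (by simp) (by simp) (by simp)
    have hf3 := hr3 .f (by simp) (by simp) (by simp) (by simp) (by simp) (by simp) (by simp) (by simp)
    have hc3 := hr3 .c (by simp) (by simp) (by simp) (by simp) (by simp) (by simp) (by simp) (by simp)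
    have hfd3 := hr3 .found (by simp) (by simp) (by simp) (by simp) (by simp) (by simp) (by simp)
      (by simp)
    have hm3 : r3 .mid = (r' .lo + r' .hi) / 2 := by
      rw [hr3' _ (by simp) (by simp) (by simp) (by simp) (by simp) (by simp) (by simp)]; simp
    have hE3 : Env I V M L w B r3 m' := h4.congr (fun x hx => by
      simp only [envR, List.mem_cons, List.not_mem_nil, or_false] at hx
      exact hr3 x (by rintro rfl; simp at hx) (by rintro rfl; simp at hx) (by rintro rfl; simp at hx)
        (by rintro rfl; simp at hx) (by rintro rfl; simp at hx) (by rintro rfl; simp at hx)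
        (by rintro rfl; simp at hx) (by rintro rfl; simp at hx)) fun _ _ => rfl
    simp only [Function.update_apply, reduceCtorEq, if_false, if_true] at hiff
    simp only [wp_ite, wp_assign, safeC_le, safeE_var, safeE_get, and_self, evC_le, ev_var, ev_get, true_and, safeE_add,
      safeE_one, ev_add, ev_one, hf3, h3, hiff, hm3, Function.update_apply, reduceCtorEq, if_false,
      if_true, hfd3, hc3, h1, h2, hlo3, hhi3, cost_get, cost_var, cost_add, cost_one, costC_le]
    refine ⟨fun hb => ⟨by omega, ⟨hE3.congr (by simp [envR]) fun _ _ => rfl, h5, hmid1, by omega, hb,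
      h9, j, by omega, by omega⟩, by omega⟩, fun hb => ⟨by omega, ⟨hE3.congr (by simp [envR])
      fun _ _ => rfl, by omega, by omega, h7, ?_, ?_, j, by omega, by omega⟩, by omega⟩⟩
    · obtain ⟨b, hb1, hb2, hb3⟩ := h8
      refine ⟨b, ?_, hb2, hb3⟩
      by_contra h
      exact hb ⟨b, hb1, by omega, hb3⟩
    · intro b hb1 hb2
      by_contra h
      exact hb ⟨b, h9 b hb1 hb2, by omega, hb2⟩
  · rintro r' m' t' - ⟨rfl, h1, h2, h3, h4, h5, h6, h7, ⟨b, hb1, hb2, hb3⟩, h9, j, hj, ht⟩ hlt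
    simp only [evC_lt, ev_var, not_lt] at hlt
    have hbr : I.rank s.other b = r' .lo := by omega
    obtain ⟨hS, hb4, hb5⟩ := hb3.sp_char hv
    have hocc := hio.occ b hb4 hb5
    have hbrk : I.rk s.other (I.S .x (v .x)) b = r' .lo := by rw [← hbr, rank, hS]
    rw [hS, hbrk] at hocc
    simp only [wp_assign, safeE_add, safeE_var, safeE_get, and_self, true_and, ev_add, ev_var, ev_get, h2,
      hio.start _ hpos.1 hpos.2, hocc, h1, Function.update_apply, reduceCtorEq, if_false, if_true,
      cost_get, cost_var, cost_add, costC_lt]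
    have := hrb b hb3
    refine ⟨by omega, Or.inl ⟨hb3, by omega, by omega, fun b' hb1' hb2' => ?_⟩, by omega⟩
    have h10 := h9 b' ((hrb b' hb2').1.1 hb1') hb2'
    obtain ⟨hS', hb4', hb5'⟩ := hb2'.sp_char hv
    by_contra h11
    have h12 := rk_lt_rk (I := I) (not_le.1 h11) hb5 hS
    rw [rank, hS'] at h10
    omega

end

section

variable {I : Inst} {V M L N w B : ℕ} {Q : Post} {r : Reg → ℕ} {m : Arr → ℕ → ℕ} {t : ℕ} {s : Side}
  {P F u v : Side → ℕ} {U D : Side → ℕ → ℕ} {a b e k l q : ℕ}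

/-! ### The sequence of prominent witnesses -/

/-- A witness is added to the sequence unless it exceeds the bound given by `safe` or by the
neighbouring corner, whose index is `b`. -/
lemma wp_addWitness {nz : ℕ} (hnz : r .nz = nz) (hM : r .nExt + 1 < M) (hMV : M ≤ V)
    (h1 : r (.m s) ≤ V) (h2 : r .found = 1 → r .w ≤ V)
    (hb : ev r m (neighbour s) = b)
    (H : ∀ r' m' t', Frame V (addWitness s) r m r' m' →
      ((r .found = 1 ∧ r (.m s) ≤ m (.safe s) nz ∧ r .w ≤ m (.up s.other) b) ∧
        r' .nExt = r .nExt + 1 ∧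
        m' (.ext s) = Function.update (m (.ext s)) (r .nExt + 1) (r (.m s)) ∧
        m' (.ext s.other) = Function.update (m (.ext s.other)) (r .nExt + 1) (r .w) ∨
      ¬ (r .found = 1 ∧ r (.m s) ≤ m (.safe s) nz ∧ r .w ≤ m (.up s.other) b) ∧
        r' .nExt = r .nExt ∧ ∀ s, m' (.ext s) = m (.ext s)) →
      t' ≤ t + 50 → Q r' m' t') : wp V M (addWitness s) Q r m t := by
  refine wp_conseq (Q := fun r' m' t' =>
      ((r .found = 1 ∧ r (.m s) ≤ m (.safe s) nz ∧ r .w ≤ m (.up s.other) b) ∧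
        r' .nExt = r .nExt + 1 ∧
        m' (.ext s) = Function.update (m (.ext s)) (r .nExt + 1) (r (.m s)) ∧
        m' (.ext s.other) = Function.update (m (.ext s.other)) (r .nExt + 1) (r .w) ∨
      ¬ (r .found = 1 ∧ r (.m s) ≤ m (.safe s) nz ∧ r .w ≤ m (.up s.other) b) ∧
        r' .nExt = r .nExt ∧ ∀ s, m' (.ext s) = m (.ext s)) ∧ t' ≤ t + 50) ?_
    fun r' m' t' hF h => H r' m' t' hF h.1 h.2
  have hs : safeE V r m (neighbour s) := by cases s <;> simp [neighbour]
  have hcost : (neighbour s).cost = 3 := by cases s <;> rfl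
  have hso : s.other ≠ s := s.other_ne
  simp only [addWitness, put, wr, rd, ifs, block_cons, block_single, block_nil, wp_ite, wp_seq,
    wp_assign, wp_store, wp_skip, safeC_and, safeC_eq, safeC_le, safeE_var, safeE_get, safeE_one,
    safeE_add, hs, and_self, true_and, evC_and, evC_eq, evC_le, ev_var, ev_get, ev_one, ev_add, hnz,
    hb, Function.update_apply, reduceCtorEq, if_false, if_true, Arr.ext.injEq, hso, hso.symm,
    costC_and, costC_eq, costC_le, cost_var, cost_get, cost_one, cost_add, hcost]
  refine ⟨fun h => ⟨by omega, by omega, h1, by omega, h2 h.1, Or.inl ⟨h, trivial⟩, by omega⟩,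
    fun h => ⟨Or.inr ⟨h, fun _ => trivial⟩, by omega⟩⟩

/-- The first `e` elements of the sequence of witnesses, given by their `x`-coordinates `X`, have
characters `ch (ρ 1), ..., ch (ρ e)`, in this order. -/
structure ExtSeq (I : Inst) (ch : ℕ → ℕ) (l e : ℕ) (X ρ : ℕ → ℕ) : Prop where
  pos : ∀ k, 1 ≤ k → k ≤ e → 1 ≤ ρ k ∧ ρ k ≤ l
  mono : ∀ k, 1 ≤ k → k < e → ρ k ≤ ρ (k + 1)
  idx : ∀ k, 1 ≤ k → k ≤ e → 1 ≤ X k ∧ X k ≤ I.n .x ∧ I.S .x (X k) = ch (ρ k)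

/-- `l` is one of the first `e` elements of `ρ`. -/
def Occurs (ρ : ℕ → ℕ) (e l : ℕ) : Prop := ∃ k, 1 ≤ k ∧ k ≤ e ∧ ρ k = l

lemma ExtSeq.push {ch X ρ X' : ℕ → ℕ} (h : ExtSeq I ch l e X ρ) (hl : 1 ≤ l)
    (hX : ∀ k, 1 ≤ k → k ≤ e → X' k = X k) (h1 : 1 ≤ X' (e + 1)) (h2 : X' (e + 1) ≤ I.n .x)
    (h3 : I.S .x (X' (e + 1)) = ch l) :
    ∃ ρ', ExtSeq I ch l (e + 1) X' ρ' ∧ ∀ q, Occurs ρ' (e + 1) q ↔ Occurs ρ e q ∨ q = l := by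
  refine ⟨Function.update ρ (e + 1) l, ⟨fun k hk1 hk2 => ?_, fun k hk1 hk2 => ?_,
    fun k hk1 hk2 => ?_⟩, fun q => ⟨?_, ?_⟩⟩
  · rcases hk2.eq_or_lt with rfl | hk2
    · simp [hl]
    · rw [Function.update_of_ne (by omega)]; exact h.pos k hk1 (by omega)
  · rw [Function.update_of_ne (by omega)]
    rcases (Nat.lt_succ_iff.1 hk2).eq_or_lt with rfl | hk2
    · rw [Function.update_self]; exact (h.pos k hk1 le_rfl).2
    · rw [Function.update_of_ne (by omega)]; exact h.mono k hk1 hk2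
  · rcases hk2.eq_or_lt with rfl | hk2
    · rw [Function.update_self]; exact ⟨h1, h2, h3⟩
    · rw [Function.update_of_ne (by omega), hX k hk1 (by omega)]
      exact h.idx k hk1 (by omega)
  · rintro ⟨k, hk1, hk2, hk3⟩
    rcases hk2.eq_or_lt with rfl | hk2
    · rw [Function.update_self] at hk3; exact Or.inr hk3.symm
    · rw [Function.update_of_ne (by omega)] at hk3
      exact Or.inl ⟨k, hk1, by omega, hk3⟩
  · rintro (⟨k, hk1, hk2, hk3⟩ | rfl)
    · exact ⟨k, hk1, by omega, by rwa [Function.update_of_ne (by omega)]⟩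
    · exact ⟨e + 1, by omega, le_rfl, Function.update_self ..⟩

namespace Stair

/-- Complete staircases consist of all corners. -/
lemma exists_eq (h : Stair I P .x a U) (hP : ∀ s, P s ≤ I.n s) (hy : U .y a = I.n .y + 1)
    (hv : I.Corner P v) : ∃ l, l ≤ a ∧ ∀ t, v t = U t l :=
  h.complete v hv (by rw [Side.other_x, hy]; exact (hv.1.bounds hP .y).2)

lemma match_of (h : Stair I P .x a U) (h0 : U .x 0 = I.n .x + 1) (hx : U .x a = P .x) (h1 : 1 ≤ l)
    (h2 : l < a) : I.Match (U · l) ∧ ∀ s, P s < U s l := by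
  have h3 := h.gt h2 le_rfl
  have h4 := h.gt h1 h2.le
  exact (h.corner l h2.le).1.match (s := .x) (by omega) (by omega)

/-- Different corners have different characters. -/
lemma char_inj (h : Stair I P .x a U) (h0 : U .x 0 = I.n .x + 1) (hx : U .x a = P .x) (h1 : 1 ≤ l)
    (h2 : l < a) (h3 : 1 ≤ q) (h4 : q < a) (hc : I.S .x (U .x l) = I.S .x (U .x q)) : l = q := by
  have hl := h.match_of h0 hx h1 h2
  have hq := h.match_of h0 hx h3 h4
  have e1 := (h.corner l h2.le).nxt_eq hl.1 hl.2 .x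
  have e2 := (h.corner q h4.le).nxt_eq hq.1 hq.2 .x
  rw [hc, e2] at e1
  rcases lt_trichotomy l q with h5 | h5 | h5
  · have := h.gt h5 h4.le; omega
  · exact h5
  · have := h.gt h5 h2.le; omega

/-- Characters of witnesses are characters of corners. -/
lemma exists_char (h : Stair I P .x a U) (hP : ∀ s, P s ≤ I.n s) (h0 : U .x 0 = I.n .x + 1)
    (hy : U .y a = I.n .y + 1) {c : ℕ} (hc : I.HasWit P F c) :
    ∃ l, 1 ≤ l ∧ l < a ∧ c = I.S .x (U .x l) := by
  obtain ⟨h1, h2⟩ := hc.corner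
  obtain ⟨l, h3, h4⟩ := h.exists_eq hP hy h1
  have hx := h4 .x
  have hy' := h4 .y
  have h2x := h2 .x
  have h2y := h2 .y
  refine ⟨l, ?_, ?_, ?_⟩
  · by_contra h5
    have : l = 0 := by omega
    subst this; omega
  · by_contra h5
    have : l = a := by omega
    subst this; omega
  · rw [← hx]; exact (Inst.nxt_spec h2x).2.symm

open Inst in
lemma hasWit_iff (h : Stair I P .x a U) (hP : ∀ s, P s ≤ I.n s) (h0 : U .x 0 = I.n .x + 1)
    (hx : U .x a = P .x) (hy : U .y a = I.n .y + 1) (h1 : 1 ≤ l) (h2 : l < a) :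
    I.HasWit P F (I.S .x (U .x l)) ↔ (∃ b, I.Wit F .x (U · l) (U .y (l + 1)) b) ∨
      ∃ b, I.Wit F .y (U · l) (U .x (l - 1)) b := by
  have hl := h.match_of h0 hx h1 h2
  rw [Inst.hasWit_iff (h.corner l h2.le) hl.1 hl.2 (b := pt (U .y (l + 1)) (U .x (l - 1))) ?_]
  · constructor
    · rintro ⟨s, b, h⟩
      cases s
      · exact Or.inl ⟨b, h⟩
      · exact Or.inr ⟨b, h⟩
    · rintro (⟨b, h⟩ | ⟨b, h⟩)
      · exact ⟨.x, b, h⟩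
      · exact ⟨.y, b, h⟩
  · intro s
    cases s
    · refine ⟨_, h.corner (l + 1) h2, rfl, h.gt (Nat.lt_succ_self l) h2, fun w hw hlt => ?_⟩
      obtain ⟨q, hq, hq'⟩ := h.exists_eq hP hy hw
      rw [hq'] at hlt ⊢
      have h3 : l < q := by
        by_contra h3
        rcases (not_lt.1 h3).eq_or_lt with rfl | h3
        · exact lt_irrefl _ hlt
        · have := h.gt h3 h2.le; omega
      rcases Nat.eq_or_lt_of_le (Nat.succ_le_of_lt h3) with rfl | h3
      · exact le_rfl
      · exact (h.gt h3 hq).le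
    · refine ⟨_, h.corner (l - 1) (by omega), rfl, h.lt (by omega) h2.le, fun w hw hlt => ?_⟩
      obtain ⟨q, hq, hq'⟩ := h.exists_eq hP hy hw
      rw [hq'] at hlt ⊢
      have h3 : q < l := by
        by_contra h3
        rcases (not_lt.1 h3).eq_or_lt with rfl | h3
        · exact lt_irrefl _ hlt
        · have := h.lt h3 hq
          simp only [Side.other_x] at this; omega
      rcases Nat.eq_or_lt_of_le (Nat.le_sub_one_of_lt h3) with rfl | h3
      · exact le_rfl
      · exact (h.lt h3 (by omega)).le

end Stair

open Inst in
/-- The contribution of one corner to the sequence of witnesses. -/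
lemma wp_corner (hE : Env I V M L w B r m) {nz : ℕ} (hnz : r .nz = nz)
    (hF : ∀ s, m (.safe s) nz = F s) (hP : ∀ s, P s ≤ I.n s)
    (hst : Stair I P .x a (fun s => m (.up s))) (h0 : m (.up .x) 0 = I.n .x + 1)
    (hx : m (.up .x) a = P .x) (hy : m (.up .y) a = I.n .y + 1) (h1 : 1 ≤ l) (h2 : l < a)
    (hr : r .r = l) (he : r .nExt + 3 < M) {ρ : ℕ → ℕ}
    (hρ : ExtSeq I (fun l => I.S .x (m (.up .x) l)) (l - 1) (r .nExt) (m (.ext .x)) ρ)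
    (H : ∀ r' m' t', (∃ ρ', ExtSeq I (fun l => I.S .x (m (.up .x) l)) l (r' .nExt) (m' (.ext .x)) ρ' ∧
        (∀ q, q < l → (Occurs ρ' (r' .nExt) q ↔ Occurs ρ (r .nExt) q)) ∧
        (Occurs ρ' (r' .nExt) l ↔ I.HasWit P F (I.S .x (m (.up .x) l)))) →
      r' .nExt ≤ r .nExt + 2 → t' ≤ t + 2000 * (L + 1) → Q r' m' t') :
    wp V M (block [put (.m .x) (rd (.up .x) Reg.r), put (.m .y) (rd (.up .y) Reg.r),
      put .c (rd (.str .x) (Reg.m .x)), searchWitness .x, addWitness .x, searchWitness .y,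
      ifs (.ne Reg.w (Reg.m .x)) [addWitness .y] []]) Q r m t := by
  have hM := hE.big.le_M
  have hMV := hE.big.le_V
  have hm := hst.match_of h0 hx h1 h2
  have hmx : 1 ≤ m (.up .x) l ∧ m (.up .x) l ≤ I.n .x := hm.1.1 .x
  have hmy : 1 ≤ m (.up .y) l ∧ m (.up .y) l ≤ I.n .y := hm.1.1 .y
  have hSx : m (.str .x) (m (.up .x) l) = I.S .x (m (.up .x) l) := (hE.idx .x).str _ hmx.1 hmx.2
  have hch := I.S_pos hmx.1 hmx.2
  have hwit := hst.hasWit_iff (F := F) hP h0 hx hy h1 h2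
  have hσ := hE.big.σ_le
  simp only [put, rd, ifs, block_cons, block_single, block_nil, wp_seq, wp_assign, safeE_get,
    safeE_var, true_and, ev_get, ev_var, hr, Function.update_apply, reduceCtorEq, if_false, if_true,
    Reg.m.injEq, hSx, cost_get, cost_var]
  refine ⟨by omega, by omega, by omega, ?_⟩
  refine wp_searchWitness (s := .x) (v := fun s => m (.up s) l) (F := F)
    (hE.congr (by simp [envR]) fun _ _ => rfl) hm.1 (fun t => by cases t <;> simp) (by simp)
    (by simp [hnz, hF]) fun r1 m1 t1 hF1 hs1 ht1 => ?_
  have hn1 : r1 .nz = nz := by rw [hF1.reg _ rfl]; simp [hnz]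
  have hmx1 : r1 (.m .x) = m (.up .x) l := by rw [hF1.reg _ rfl]; simp
  have hmy1 : r1 (.m .y) = m (.up .y) l := by rw [hF1.reg _ rfl]; simp
  have hr1 : r1 .r = l := by rw [hF1.reg _ rfl]; simp [hr]
  have hc1 : r1 .c = I.S .x (m (.up .x) l) := by rw [hF1.reg _ rfl]; simp
  have he1 : r1 .nExt = r .nExt := by rw [hF1.reg _ rfl]; simp
  have hE1 : Env I V M L w B r1 m1 := (hE.congr (by simp [envR]) fun _ _ => rfl).frame hF1 rfl
  have hu1 : ∀ s, m1 (.up s) = m (.up s) := fun s => hF1.mem _ (by cases s <;> rfl)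
  have hsf1 : ∀ s, m1 (.safe s) = m (.safe s) := fun s => hF1.mem _ (by cases s <;> rfl)
  have hx1 : ∀ s, m1 (.ext s) = m (.ext s) := fun s => hF1.mem _ (by cases s <;> rfl)
  have hw1 : r1 .found = 1 → r1 .w ≤ I.n .y ∧ I.S .y (r1 .w) = I.S .x (m (.up .x) l) := by
    intro hf
    rcases hs1 with ⟨-, h, -⟩ | ⟨h, -⟩
    · exact ⟨(h.sp_char hm.1).2.2, (h.sp_char hm.1).1⟩
    · omega
  have hcond1 : (r1 .found = 1 ∧ r1 (.m .x) ≤ m1 (.safe .x) nz ∧ r1 .w ≤ m1 (.up .y) (l + 1)) ↔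
      ∃ b, I.Wit F .x (fun s => m (.up s) l) (m (.up .y) (l + 1)) b := by
    rw [hmx1, hsf1, hF, hu1]
    rcases hs1 with ⟨g1, g2, g3, g4, g5⟩ | ⟨g1, g2⟩
    · exact ⟨fun h => ⟨r1 .w, g2, g3, g4, h.2.1, h.2.2⟩, fun ⟨b, e1, e2, e3, e4, e5⟩ =>
        ⟨g1, e4, (g5 b e2 e1).trans e5⟩⟩
    · exact ⟨fun h => by omega, fun ⟨b, e1, e2, e3, e4, e5⟩ => absurd e1 (g2 b e2 e3)⟩
  clear hF1
  refine wp_addWitness (s := .x) hn1 (by omega) hMV (by omega) (fun h => by have := hw1 h; omega)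
    (b := l + 1) (by simp [neighbour, hr1]) fun r2 m2 t2 hF2 ha2 ht2 => ?_
  rw [show Side.x.other = .y from rfl] at ha2
  rw [hcond1] at ha2
  have hn2 : r2 .nz = nz := by rw [hF2.reg _ rfl, hn1]
  have hmx2 : r2 (.m .x) = m (.up .x) l := by rw [hF2.reg _ rfl, hmx1]
  have hmy2 : r2 (.m .y) = m (.up .y) l := by rw [hF2.reg _ rfl, hmy1]
  have hr2 : r2 .r = l := by rw [hF2.reg _ rfl, hr1]
  have hc2 : r2 .c = I.S .x (m (.up .x) l) := by rw [hF2.reg _ rfl, hc1]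
  have hE2 : Env I V M L w B r2 m2 := hE1.frame hF2 rfl
  have hu2 : ∀ s, m2 (.up s) = m (.up s) := fun s => by rw [hF2.mem _ (by cases s <;> rfl), hu1]
  have hsf2 : ∀ s, m2 (.safe s) = m (.safe s) := fun s => by
    rw [hF2.mem _ (by cases s <;> rfl), hsf1]
  clear hF2
  -- the sequence after the first search
  have hρ2 : ∃ ρ2, ExtSeq I (fun l => I.S .x (m (.up .x) l)) l (r2 .nExt) (m2 (.ext .x)) ρ2 ∧
      r2 .nExt ≤ r .nExt + 1 ∧ ∀ q, Occurs ρ2 (r2 .nExt) q ↔ Occurs ρ (r .nExt) q ∨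
        q = l ∧ ∃ b, I.Wit F .x (fun s => m (.up s) l) (m (.up .y) (l + 1)) b := by
    have hρ' : ExtSeq I (fun l => I.S .x (m (.up .x) l)) l (r .nExt) (m (.ext .x)) ρ :=
      ⟨fun k a b => by have := hρ.pos k a b; omega, hρ.mono, hρ.idx⟩
    rcases ha2 with ⟨g1, g2, g3, -⟩ | ⟨g1, g2, g3⟩
    · rw [he1] at g2 g3
      rw [g2, g3, hx1, hmx1]
      obtain ⟨ρ2, e1, e2⟩ := hρ'.push (X' := Function.update (m (.ext .x)) (r .nExt + 1)
        (m (.up .x) l)) h1 (fun k _ hk => Function.update_of_ne (by omega) _ _) (by simpa using hmx.1)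
        (by simpa using hmx.2) (by simp)
      exact ⟨ρ2, e1, by omega, fun q => by simp [e2, g1]⟩
    · rw [he1] at g2
      rw [g2, g3, hx1]
      exact ⟨ρ, hρ', by omega, fun q => by simp [g1]⟩
  obtain ⟨ρ2, hρ2, hle2, hocc2⟩ := hρ2
  clear ha2
  refine wp_searchWitness (s := .y) (v := fun s => m (.up s) l) (F := F) hE2 hm.1
    (fun t => by cases t <;> assumption) hc2 (by rw [hn2, hsf2, hF]) fun r3 m3 t3 hF3 hs3 ht3 => ?_
  have hn3 : r3 .nz = nz := by rw [hF3.reg _ rfl, hn2]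
  have hmx3 : r3 (.m .x) = m (.up .x) l := by rw [hF3.reg _ rfl, hmx2]
  have hmy3 : r3 (.m .y) = m (.up .y) l := by rw [hF3.reg _ rfl, hmy2]
  have hr3 : r3 .r = l := by rw [hF3.reg _ rfl, hr2]
  have he3 : r3 .nExt = r2 .nExt := by rw [hF3.reg _ rfl]
  have hu3 : ∀ s, m3 (.up s) = m (.up s) := fun s => by rw [hF3.mem _ (by cases s <;> rfl), hu2]
  have hsf3 : ∀ s, m3 (.safe s) = m (.safe s) := fun s => by
    rw [hF3.mem _ (by cases s <;> rfl), hsf2]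
  have hx3 : ∀ s, m3 (.ext s) = m2 (.ext s) := fun s => hF3.mem _ (by cases s <;> rfl)
  clear hF3
  have hw3 : r3 .found = 1 → (1 ≤ r3 .w ∧ r3 .w ≤ I.n .x) ∧
      I.S .x (r3 .w) = I.S .x (m (.up .x) l) := by
    intro hf
    rcases hs3 with ⟨-, h, -⟩ | ⟨h, -⟩
    · exact ⟨(h.sp_char hm.1).2, (h.sp_char hm.1).1⟩
    · omega
  have hcond3 : (r3 .found = 1 ∧ r3 (.m .y) ≤ m3 (.safe .y) nz ∧ r3 .w ≤ m3 (.up .x) (l - 1)) ↔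
      ∃ b, I.Wit F .y (fun s => m (.up s) l) (m (.up .x) (l - 1)) b := by
    rw [hmy3, hsf3, hF, hu3]
    rcases hs3 with ⟨g1, g2, g3, g4, g5⟩ | ⟨g1, g2⟩
    · exact ⟨fun h => ⟨r3 .w, g2, g3, g4, h.2.1, h.2.2⟩, fun ⟨b, e1, e2, e3, e4, e5⟩ =>
        ⟨g1, e4, (g5 b e2 e1).trans e5⟩⟩
    · exact ⟨fun h => by omega, fun ⟨b, e1, e2, e3, e4, e5⟩ => absurd e1 (g2 b e2 e3)⟩
  -- the second search finds the corner itself only if the first one does so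
  have hself : r3 .w = m (.up .x) l → (∃ b, I.Wit F .y (fun s => m (.up s) l) (m (.up .x) (l - 1)) b) →
      ∃ b, I.Wit F .x (fun s => m (.up s) l) (m (.up .y) (l + 1)) b := by
    rintro hw hb
    obtain ⟨g1, g2, -⟩ := hcond3.2 hb
    rw [hmy3, hsf3, hF] at g2
    rcases hs3 with ⟨-, g3, g4, g5, -⟩ | ⟨h, -⟩
    · refine ⟨m (.up .y) l, ?_, le_rfl, g2, ?_, (hst.lt (Nat.lt_succ_self l) h2).le⟩
      · rw [hw] at g3
        convert g3 using 1
        funext s; cases s <;> rfl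
      · rw [hw] at g5; exact g5
    · omega
  have hbase : ∀ q, q < l → (Occurs ρ2 (r2 .nExt) q ↔ Occurs ρ (r .nExt) q) := fun q hq => by
    rw [hocc2]; simp [hq.ne]
  have hl2 : Occurs ρ2 (r2 .nExt) l ↔
      ∃ b, I.Wit F .x (fun s => m (.up s) l) (m (.up .y) (l + 1)) b := by
    rw [hocc2]
    refine ⟨fun h => ?_, fun h => Or.inr ⟨rfl, h⟩⟩
    rcases h with ⟨k, e1, e2, e3⟩ | h
    · have := hρ.pos k e1 e2; omega
    · exact h.2
  have same : ∀ r' m' t', r' .nExt = r2 .nExt → (∀ s, m' (.ext s) = m2 (.ext s)) →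
      ((∃ b, I.Wit F .y (fun s => m (.up s) l) (m (.up .x) (l - 1)) b) →
        ∃ b, I.Wit F .x (fun s => m (.up s) l) (m (.up .y) (l + 1)) b) →
      t' ≤ t + 2000 * (L + 1) → Q r' m' t' := by
    intro r' m' t' e1 e2 e3 e4
    refine H _ _ _ ⟨ρ2, ?_, ?_, ?_⟩ (by omega) e4
    · rw [e1, e2]; exact hρ2
    · rw [e1]; exact hbase
    · rw [e1, hl2, hwit]
      exact ⟨Or.inl, fun h => h.elim id e3⟩
  simp only [wp_ite, safeC_ne, safeE_var, and_self, true_and, evC_ne, ev_var, hmx3, costC_ne,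
    cost_var, wp_skip]
  refine ⟨fun hne => ?_, fun heq => same _ _ _ he3 hx3 (hself (not_not.1 heq)) (by omega)⟩
  refine wp_addWitness (s := .y) hn3 (by omega) hMV (by omega) (fun h => by have := hw3 h; omega)
    (b := l - 1) (by simp [neighbour, hr3]) fun r4 m4 t4 _ ha4 ht4 => ?_
  rw [show Side.y.other = .x from rfl] at ha4
  rw [hcond3, he3] at ha4
  rcases ha4 with ⟨g1, g2, -, g3⟩ | ⟨g1, g2, g3⟩
  · have g4 := hw3 (hcond3.2 g1).1
    obtain ⟨ρ4, e1, e2⟩ := hρ2.push (X' := m4 (.ext .x)) h1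
      (fun k _ hk => by rw [g3, Function.update_of_ne (by omega), hx3])
      (by rw [g3, Function.update_self]; exact g4.1.1)
      (by rw [g3, Function.update_self]; exact g4.1.2) (by rw [g3, Function.update_self]; exact g4.2)
    refine H _ _ _ ⟨ρ4, by rw [g2]; exact e1, fun q hq => ?_, ?_⟩ (by omega) (by omega)
    · rw [g2, e2, hbase q hq]; simp [hq.ne]
    · rw [g2, e2, hwit]; simp [g1]
  · exact same _ _ _ g2 (fun s => by rw [g3, hx3]) (fun h => absurd h g1) (by omega)

/-- What is known about `ext(Z')`, for `pref(Z') = P` and `safe(Z') = F`: its `e` elements have, in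
this order, characters `ch (ρ 1), ..., ch (ρ e)`. Their number and the time are bounded in terms of
any extensible character. -/
structure ExtSpec (I : Inst) (P F : Side → ℕ) (e d : ℕ) (X ch ρ : ℕ → ℕ) : Prop where
  pos : ∀ k, 1 ≤ k → k ≤ e → 1 ≤ ρ k ∧ ρ k ≤ d
  mono : ∀ k, 1 ≤ k → k < e → ρ k ≤ ρ (k + 1)
  idx : ∀ k, 1 ≤ k → k ≤ e → 1 ≤ X k ∧ X k ≤ I.n .x ∧ I.S .x (X k) = ch (ρ k)
  inj : ∀ k l, 1 ≤ k → k ≤ e → 1 ≤ l → l ≤ e → ch (ρ k) = ch (ρ l) → ρ k = ρ l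
  hasWit : ∀ c, I.HasWit P F c ↔ ∃ k, 1 ≤ k ∧ k ≤ e ∧ c = ch (ρ k)
  le : e ≤ 2 * d
  min : ∀ c, I.HasWit P F c → P .x + P .y + d ≤ I.nxt .x c (P .x) + I.nxt .y c (P .y)
  le_n : d ≤ I.n .x + I.n .y

/-- The prominent witnesses are computed in logarithmic time per unit of the distance `d` to the nearest
corner. -/
lemma wp_queryExt (hE : Env I V M L w B r m) {nz : ℕ} (hnz : r .nz = nz)
    (hPm : ∀ s, m (.pref s) nz = P s) (hF : ∀ s, m (.safe s) nz = F s)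
    (hP : ∀ s, 1 ≤ P s ∧ P s ≤ I.n s)
    (H : ∀ r' m' t' d ch ρ, Frame V queryExt r m r' m' →
      ExtSpec I P F (r' .nExt) d (m' (.ext .x)) ch ρ → t' ≤ t + 3000 * (L + 1) * (d + 1) →
      Q r' m' t') : wp V M queryExt Q r m t := by
  refine wp_conseq (Q := fun r' m' t' => ∃ d ch ρ,
      ExtSpec I P F (r' .nExt) d (m' (.ext .x)) ch ρ ∧ t' ≤ t + 3000 * (L + 1) * (d + 1)) ?_
    fun r' m' t' hF h => by
      obtain ⟨d, ch, ρ, h1, h2⟩ := h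
      exact H r' m' t' d ch ρ hF h1 h2
  clear H
  have hM := hE.big.le_M
  have hMV := hE.big.le_V
  have hP' : ∀ s, P s ≤ I.n s := fun s => (hP s).2
  have hPx := hP .x
  have hPy := hP .y
  obtain ⟨K, hK⟩ : ∃ K, K = 2000 * (L + 1) := ⟨_, rfl⟩
  rw [queryExt, block_cons, wp_seq]
  refine wp_candidates hE hnz hPm hP fun r1 m1 t1 a d hF1 ha hst hx hy h0 hmin had ht1 => ?_
  have hE1 := hE.frame hF1 rfl
  have hn1 : r1 .nz = nz := by rw [hF1.reg _ rfl, hnz]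
  have hsf1 : ∀ s, m1 (.safe s) nz = F s := fun s => by rw [hF1.mem _ (by cases s <;> rfl), hF]
  have h0x : m1 (.up .x) 0 = I.n .x + 1 := by rw [h0]; rfl
  have ha1 : 1 ≤ a := by
    by_contra h
    have : a = 0 := by omega
    subst this; omega
  have hd : d ≤ I.n .x + I.n .y := by
    have := hmin _ (Inst.corner_virt hP' .x)
    simp [sp] at this
    omega
  clear hF1
  simp only [put, block_cons, block_single, wp_seq, wp_assign, safeE_zero, true_and, ev_zero, zero_le,
    cost_zero]
  refine wp_forUp (fun l r' m' t' => r' .nExt ≤ 2 * (l - 1) ∧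
    (∃ ρ, ExtSeq I (fun l => I.S .x (m1 (.up .x) l)) (l - 1) (r' .nExt) (m' (.ext .x)) ρ ∧
      ∀ q, 1 ≤ q → q < l →
        (Occurs ρ (r' .nExt) q ↔ I.HasWit P F (I.S .x (m1 (.up .x) q)))) ∧
    t' ≤ t1 + 20 + (K + 20) * (l - 1)) 1 (a - 1) rfl (by omega) (by omega) (by omega) (by simp) rfl
    ?_ ?_ ?_ ?_
  · intro k r' m' t' hF' _
    simp [hF'.reg .np rfl, ha]
  · refine ⟨by simp, ⟨fun _ => 0, ⟨fun k h1 h2 => ?_, fun k h1 h2 => ?_, fun k h1 h2 => ?_⟩,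
      fun q h1 h2 => by omega⟩, by simp⟩
    all_goals simp at h2; try omega
  · rintro l r' m' t' hl1 hl2 hl hF' ⟨he, ⟨ρ, hρ, hocc⟩, ht⟩
    have hu : ∀ s, m' (.up s) = m1 (.up s) := fun s => hF'.mem _ (by cases s <;> rfl)
    have hsf : ∀ s, m' (.safe s) = m1 (.safe s) := fun s => hF'.mem _ (by cases s <;> rfl)
    refine wp_corner (P := P) (F := F) (a := a) (l := l) (nz := nz)
      ((hE1.congr (by simp [envR]) fun _ _ => rfl).frame hF' rfl) (by rw [hF'.reg _ rfl]; simp [hn1])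
      (fun s => by rw [hsf, hsf1]) hP' (by simpa only [hu] using hst) (by rw [hu, h0x])
      (by rw [hu, hx]) (by rw [hu, hy]) hl1 (by omega) hl (by omega) (by simpa only [hu] using hρ)
      fun r2 m2 t2 h2 he2 ht2 => ?_
    simp only [hu] at h2
    obtain ⟨ρ2, e1, e2, e3⟩ := h2
    simp only [Function.update_apply, reduceCtorEq, if_false, Nat.add_sub_cancel]
    refine ⟨by omega, ⟨ρ2, e1, fun q hq1 hq2 => ?_⟩, ?_⟩
    · rcases (Nat.lt_succ_iff.1 hq2).eq_or_lt with rfl | hq2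
      · exact e3
      · rw [e2 q hq2, hocc q hq1 hq2]
    · obtain ⟨l, rfl⟩ : ∃ l', l = l' + 1 := ⟨l - 1, by omega⟩
      rw [Nat.mul_succ]
      simp only [Nat.add_sub_cancel] at ht
      simp only [cost_sub, cost_var, cost_one] at ht2
      omega
  · rintro r' m' t' hF' - ⟨he, ⟨ρ, hρ, hocc⟩, ht⟩
    have hw : ∀ q, 1 ≤ q → q < a → (Occurs ρ (r' .nExt) q ↔
        I.HasWit P F (I.S .x (m1 (.up .x) q))) := fun q h1 h2 => hocc q h1 (by omega)
    simp only [Nat.add_sub_cancel] at hρ ht he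
    refine ⟨d, fun l => I.S .x (m1 (.up .x) l), ρ, ⟨fun k h1 h2 => ?_, hρ.mono, hρ.idx, fun k l h1 h2 h3 h4 h5 => ?_,
      fun c => ⟨fun hc => ?_, ?_⟩, by omega, fun c hc => ?_, hd⟩, ?_⟩
    · have := hρ.pos k h1 h2; omega
    · have p1 := hρ.pos k h1 h2
      have p2 := hρ.pos l h3 h4
      exact hst.char_inj h0x hx p1.1 (by omega) p2.1 (by omega) h5
    · obtain ⟨l, h1, h2, rfl⟩ := hst.exists_char hP' h0x hy hc
      obtain ⟨k, h3, h4, rfl⟩ := (hw l h1 h2).2 hc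
      exact ⟨k, h3, h4, rfl⟩
    · rintro ⟨k, h1, h2, rfl⟩
      have := hρ.pos k h1 h2
      exact (hw _ this.1 (by omega)).1 ⟨k, h1, h2, rfl⟩
    · exact hmin _ hc.corner.1
    · have h1 : (K + 20) * (a - 1) ≤ (K + 20) * d := Nat.mul_le_mul_left _ (by omega)
      have h2 : 3000 * (L + 1) * (d + 1) = 500 * (L + 1) * (d + 1) + (K + 20) * d +
          500 * (L * d) + 480 * d + 2500 * (L + 1) := by rw [hK]; ring
      simp only [cost_sub, cost_var, cost_one]
      omega

end

section

variable {I : Inst} {V M L N w B : ℕ} {Q : Post} {r : Reg → ℕ} {m : Arr → ℕ → ℕ} {t : ℕ} {s : Side}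
  {P F u v : Side → ℕ} {U D : Side → ℕ → ℕ} {a b e k l q : ℕ}

/-! ### The stack of alternatives -/

/-- The cells of `A` from `st` on contain the list `R`. -/
def Seg (A : ℕ → ℕ) : ℕ → List ℕ → Prop
  | _, [] => True
  | st, c :: R => A st = c ∧ Seg A (st + 1) R

section Seg
variable {A A' : ℕ → ℕ} {st : ℕ} {R R' : List ℕ} {c : ℕ}

lemma seg_append : Seg A st (R ++ R') ↔ Seg A st R ∧ Seg A (st + R.length) R' := by
  induction R generalizing st with
  | nil => simp [Seg]
  | cons c R ih =>
    simp only [List.cons_append, Seg, ih, List.length_cons, and_assoc]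
    rw [show st + (R.length + 1) = st + 1 + R.length by omega]

lemma Seg.congr (h : Seg A st R) (hA : ∀ i, st ≤ i → i < st + R.length → A' i = A i) :
    Seg A' st R := by
  induction R generalizing st with
  | nil => trivial
  | cons c R ih =>
    simp only [List.length_cons] at hA
    exact ⟨(hA st le_rfl (by omega)).trans h.1, ih h.2 fun i h1 h2 => hA i (by omega) (by omega)⟩

lemma Seg.exists_split (h : Seg A st R) {p : ℕ} (h1 : st ≤ p) (h2 : p < st + R.length) :
    ∃ R₁ R₂, R = R₁ ++ A p :: R₂ ∧ p = st + R₁.length := by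
  induction R generalizing st with
  | nil => simp at h2; omega
  | cons c R ih =>
    rcases h1.eq_or_lt with rfl | h1
    · exact ⟨[], R, by simp [h.1], by simp⟩
    · simp only [List.length_cons] at h2
      obtain ⟨R₁, R₂, h3, h4⟩ := ih h.2 h1 (by omega)
      exact ⟨c :: R₁, R₂, by rw [h3]; rfl, by simp; omega⟩

/-- Deleting an element by moving the last element to its position. -/
lemma Seg.delete (h : Seg A st R) {p : ℕ} (h1 : st ≤ p) (h2 : p < st + R.length) :
    ∃ R', R.Perm (A p :: R') ∧ Seg (Function.update A p (A (st + R.length - 1))) st R' := by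
  obtain ⟨R₁, R₂, rfl, rfl⟩ := h.exists_split h1 h2
  rw [seg_append] at h
  have h3 : Seg (Function.update A (st + R₁.length)
      (A (st + (R₁ ++ A (st + R₁.length) :: R₂).length - 1))) st R₁ :=
    h.1.congr fun i _ hi => Function.update_of_ne (by omega) _ _
  rcases R₂.eq_nil_or_concat' with rfl | ⟨R₂, d, rfl⟩
  · exact ⟨R₁, (List.perm_append_singleton _ _), h3⟩
  · refine ⟨R₁ ++ d :: R₂, List.perm_middle.trans (List.Perm.cons _ (List.Perm.append_left _
      (List.perm_append_singleton _ _))), seg_append.2 ⟨h3, ?_, ?_⟩⟩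
    · have h4 := h.2.2
      rw [seg_append] at h4
      rw [Function.update_self, ← h4.2.1]
      congr 1
      simp; omega
    · have h4 := h.2.2
      rw [seg_append] at h4
      exact h4.1.congr fun i hi _ => Function.update_of_ne (by omega) _ _

end Seg

/-- The least alternative is taken off the topmost segment `R` of the stack. -/
lemma wp_takeLeast (hV : ∀ x, m .altStart x ≤ V) (hM : r .top ≤ M) (hMV : M + 1 ≤ V) {R : List ℕ}
    {st nz : ℕ} (hnz : r .nz = nz) (hst : m .altStart nz = st) (htop : r .top = st + R.length)
    (hR : R ≠ []) (hseg : Seg (m .alt) st R) (hb : ∀ k, m .alt k ≤ V)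
    (H : ∀ r' m' t' R', Frame V takeLeast r m r' m' → R.Perm (r' .c :: R') →
      r' .top = st + R'.length → Seg (m' .alt) st R' → (∀ k, k < st → m' .alt k = m .alt k) →
      t' ≤ t + 50 * (R.length + 1) → Q r' m' t') : wp V M takeLeast Q r m t := by
  refine wp_conseq (Q := fun r' m' t' => ∃ R', R.Perm (r' .c :: R') ∧ r' .top = st + R'.length ∧
      Seg (m' .alt) st R' ∧ (∀ k, k < st → m' .alt k = m .alt k) ∧ t' ≤ t + 50 * (R.length + 1)) ?_
    fun r' m' t' hF h => by
      obtain ⟨R', h1, h2, h3, h4, h5⟩ := h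
      exact H r' m' t' R' hF h1 h2 h3 h4 h5
  clear H
  have hlen : 1 ≤ R.length := List.length_pos_iff.2 hR
  simp only [takeLeast, put, wr, rd, block_cons, block_single, wp_seq, wp_assign, safeE_get, safeE_var,
    true_and, ev_get, ev_var, hnz, hst, cost_get, cost_var]
  refine ⟨by omega, ?_⟩
  refine wp_forUp (fun k r' m' t' => m' = m ∧ st ≤ r' .p ∧ r' .p < st + R.length ∧
    t' + 40 * (st + 1) ≤ t + 20 + 40 * k) (st + 1) (st + R.length - 1) (by simp [hnz, hst])
    (by omega) (by omega) (by omega) (by simp) rfl ?_ ?_ ?_ ?_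
  · intro k r' m' t' hF _
    simp [hF.reg .top rfl, htop]
  · refine ⟨rfl, by simp, by simp; omega, by simp⟩
  · rintro k r' m' t' hk1 hk2 hk hF ⟨rfl, h1, h2, ht⟩
    simp only [ifs, put, rd, block_single, block_nil, wp_ite, wp_assign, wp_skip, safeC_lt, safeE_get,
      safeE_var, and_self, true_and, evC_lt, ev_get, ev_var, hk, Function.update_apply, reduceCtorEq,
      if_false, if_true, cost_sub, cost_var, cost_one, cost_get, costC_lt]
    exact ⟨fun _ => ⟨by omega, by omega, by omega, by omega⟩, fun _ => ⟨h1, h2, by omega⟩⟩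
  · rintro r' m' t' hF - ⟨rfl, h1, h2, ht⟩
    have htop' : r' .top = st + R.length := by rw [hF.reg _ rfl]; simp [htop]
    obtain ⟨R', h3, h4⟩ := hseg.delete h1 h2
    have h5 := h3.length_eq
    simp only [List.length_cons] at h5
    simp only [wp_seq, wp_assign, wp_store, safeE_get, safeE_var, safeE_sub, safeE_one, and_self,
      true_and, ev_get, ev_var, ev_sub,
      ev_one, Function.update_apply, reduceCtorEq, if_false, if_true, htop', cost_sub, cost_var,
      cost_one, cost_get]
    refine ⟨hb _, by omega, by omega, hb _, R', h3, by omega, h4, fun k hk => if_neg (by omega),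
      by omega⟩

/-- The stack receives the extensible characters. -/
lemma wp_pushExtensible (hE : Env I V M L w B r m) {nz top : ℕ} (hnz : r .nz = nz)
    (hPm : ∀ s, m (.pref s) nz = P s) (hF : ∀ s, m (.safe s) nz = F s)
    (hP : ∀ s, 1 ≤ P s ∧ P s ≤ I.n s) (htop : r .top = top) (hnzM : nz + 1 < M)
    (htopM : top ≤ 2 * (I.n .x + I.n .y))
    (H : ∀ r' m' t' R d, Frame V pushExtensible r m r' m' →
      m' .altStart = Function.update (m .altStart) (nz + 1) top →
      (∀ k, k < top → m' .alt k = m .alt k) → Seg (m' .alt) top R → r' .top = top + R.length →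
      R.Nodup → (∀ c, c ∈ R ↔ I.HasWit P F c) → R.length ≤ d →
      (∀ c, I.HasWit P F c → P .x + P .y + d ≤ I.nxt .x c (P .x) + I.nxt .y c (P .y)) →
      t' ≤ t + 4000 * (L + 1) * (d + 1) → Q r' m' t') : wp V M pushExtensible Q r m t := by
  refine wp_conseq (Q := fun r' m' t' => ∃ R d,
      m' .altStart = Function.update (m .altStart) (nz + 1) top ∧
      (∀ k, k < top → m' .alt k = m .alt k) ∧ Seg (m' .alt) top R ∧ r' .top = top + R.length ∧
      R.Nodup ∧ (∀ c, c ∈ R ↔ I.HasWit P F c) ∧ R.length ≤ d ∧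
      (∀ c, I.HasWit P F c → P .x + P .y + d ≤ I.nxt .x c (P .x) + I.nxt .y c (P .y)) ∧
      t' ≤ t + 4000 * (L + 1) * (d + 1)) ?_ fun r' m' t' hF h => by
    obtain ⟨R, d, h1, h2, h3, h4, h5, h6, h7, h8, h9⟩ := h
    exact H r' m' t' R d hF h1 h2 h3 h4 h5 h6 h7 h8 h9
  clear H
  have hM := hE.big.le_M
  have hMV := hE.big.le_V
  have hσ := hE.big.σ_le
  rw [pushExtensible, block_cons, wp_seq]
  refine wp_queryExt hE hnz hPm hF hP fun r1 m1 t1 d ch ρ hF1 hX ht1 => ?_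
  have hE1 := hE.frame hF1 rfl
  have hn1 : r1 .nz = nz := by rw [hF1.reg _ rfl, hnz]
  have htop1 : r1 .top = top := by rw [hF1.reg _ rfl, htop]
  have hal1 : m1 .alt = m .alt := hF1.mem _ rfl
  have has1 : m1 .altStart = m .altStart := hF1.mem _ rfl
  have hdn := hX.le_n
  have hle := hX.le
  clear hF1
  simp only [put, wr, block_cons, block_single, wp_seq, wp_assign, wp_store, safeE_add, safeE_var,
    safeE_one, safeE_zero, and_self, true_and, ev_add, ev_var, ev_one, ev_zero, hn1, htop1, zero_le,
    cost_add, cost_var, cost_one, cost_zero]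
  refine ⟨by omega, by omega, ?_⟩
  refine wp_forUp (fun k r' m' t' => ∃ R : List ℕ,
    m' .altStart = Function.update (m .altStart) (nz + 1) top ∧
    (∀ i, i < top → m' .alt i = m .alt i) ∧ Seg (m' .alt) top R ∧ r' .top = top + R.length ∧
    R.Nodup ∧ (∀ c, c ∈ R ↔ ∃ j, 1 ≤ j ∧ j < k ∧ c = ch (ρ j)) ∧
    (k = 1 → r' .last = 0 ∧ R.length = 0) ∧
    (2 ≤ k → r' .last = ch (ρ (k - 1)) ∧ R.length ≤ ρ (k - 1)) ∧
    t' ≤ t1 + 20 + 60 * k) 1 (r1 .nExt) rfl (by omega) (by omega) (by omega) (by simp) rfl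
    ?_ ?_ ?_ ?_
  · intro k r' m' t' hF' _
    simp [hF'.reg .nExt rfl]
  · refine ⟨[], by simp [has1], fun i _ => by simp [hal1], trivial, by simp [htop1], List.nodup_nil,
      fun c => ⟨fun h => by simp at h, fun ⟨j, h1, h2, _⟩ => by omega⟩, fun _ => by simp,
      fun h => by omega, by simp⟩
  · rintro k r' m' t' hk1 hk2 hk hF' ⟨R, h1, h2, h3, h4, h5, h6, h7, h8, ht⟩
    have hx := hX.idx k hk1 hk2
    have hp := hX.pos k hk1 hk2
    have hpos := I.S_pos hx.1 hx.2.1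
    rw [hx.2.2] at hpos
    have hext : m' (.ext .x) k = m1 (.ext .x) k := by rw [hF'.mem _ rfl]; simp
    have hstr : m' (.str .x) (m1 (.ext .x) k) = ch (ρ k) := by
      rw [hF'.mem _ rfl]
      simp only [Function.update_apply, reduceCtorEq, if_false]
      rw [(hE1.idx .x).str _ hx.1 hx.2.1, hx.2.2]
    have hRd : R.length ≤ d := by
      rcases hk1.eq_or_lt with rfl | h
      · have := h7 rfl; omega
      · have := h8 h; have := hX.pos (k - 1) (by omega) (by omega); omega
    simp only [ifs, put, wr, rd, block_cons, block_single, block_nil, wp_ite, wp_seq, wp_assign,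
      wp_store, wp_skip, safeC_ne, safeE_get, safeE_add, safeE_var, safeE_one, and_self, true_and,
      evC_ne, ev_get, ev_add, ev_var, ev_one, hk, hext, hstr, Function.update_apply, reduceCtorEq,
      if_false, if_true, h4, cost_get, cost_var, cost_add, cost_one, costC_ne]
    refine ⟨by omega, fun hne => ⟨by omega, by omega, by omega, by omega, R ++ [ch (ρ k)], h1,
      fun i hi => ?_, ?_, by simp; omega, ?_, fun c => ?_, fun h => by omega, fun _ => ⟨rfl, ?_⟩,
      by omega⟩, fun heq => ⟨R, h1, h2, h3, rfl, h5, fun c => ?_, fun h => by omega,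
      fun _ => ⟨by simpa using (not_not.1 heq).symm, ?_⟩, by omega⟩⟩
    · rw [if_neg (by omega)]; exact h2 i hi
    · refine seg_append.2 ⟨h3.congr fun i _ hi => Function.update_of_ne (by omega) _ _,
        Function.update_self .., trivial⟩
    · refine List.Nodup.append h5 (List.nodup_singleton _) fun c hc1 hc2 => ?_
      rw [List.mem_singleton.1 hc2, h6] at hc1
      obtain ⟨j, hj1, hj2, hj3⟩ := hc1
      have hj4 := hX.inj k j hk1 hk2 hj1 (by omega) hj3
      have hmono : ∀ i, j ≤ i → i ≤ k → ρ j ≤ ρ i := fun i hi => by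
        induction i, hi using Nat.le_induction with
        | base => intro _; exact le_rfl
        | succ i hi ih => intro h; exact (ih (by omega)).trans (hX.mono i (by omega) (by omega))
      have h9 := hmono (k - 1) (by omega) (by omega)
      have h10 := hX.mono (k - 1) (by omega) (by omega)
      rw [Nat.sub_add_cancel hk1] at h10
      have h11 := (h8 (by omega)).1
      refine hne ?_
      rw [h11, show ρ k = ρ (k - 1) by omega]
    · rw [List.mem_append, List.mem_singleton, h6]
      constructor
      · rintro (⟨j, hj1, hj2, hj3⟩ | rfl)
        · exact ⟨j, hj1, by omega, hj3⟩
        · exact ⟨k, hk1, by omega, rfl⟩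
      · rintro ⟨j, hj1, hj2, rfl⟩
        rcases (Nat.lt_succ_iff.1 hj2).eq_or_lt with rfl | hj2
        · exact Or.inr rfl
        · exact Or.inl ⟨j, hj1, hj2, rfl⟩
    · simp only [List.length_append, List.length_singleton, Nat.add_sub_cancel]
      rcases hk1.eq_or_lt with rfl | h
      · have := h7 rfl; omega
      · have h9 := h8 h
        have h10 := hX.mono (k - 1) (by omega) (by omega)
        rw [Nat.sub_add_cancel hk1] at h10
        have : ρ (k - 1) ≠ ρ k := fun h11 => hne (by rw [h9.1, h11])
        omega
    · rw [h6]
      constructor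
      · rintro ⟨j, hj1, hj2, hj3⟩
        exact ⟨j, hj1, by omega, hj3⟩
      · rintro ⟨j, hj1, hj2, rfl⟩
        rcases (Nat.lt_succ_iff.1 hj2).eq_or_lt with rfl | hj2
        · rcases hk1.eq_or_lt with rfl | h
          · have := h7 rfl; omega
          · have h9 := (h8 h).1
            exact ⟨j - 1, by omega, by omega, by omega⟩
        · exact ⟨j, hj1, hj2, rfl⟩
    · simp only [Nat.add_sub_cancel]
      rcases hk1.eq_or_lt with rfl | h
      · have := h7 rfl; omega
      · have h9 := h8 h
        have h10 := hX.mono (k - 1) (by omega) (by omega)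
        rw [Nat.sub_add_cancel hk1] at h10
        omega
  · rintro r' m' t' hF' - ⟨R, h1, h2, h3, h4, h5, h6, h7, h8, ht⟩
    refine ⟨R, d, h1, h2, h3, h4, h5, fun c => ?_, ?_, hX.min, ?_⟩
    · rw [h6, hX.hasWit]
      exact exists_congr fun j => and_congr_right fun _ => and_congr_left fun _ => by omega
    · rcases Nat.eq_zero_or_pos (r1 .nExt) with h | h
      · have := h7 (by omega); omega
      · have := h8 (by omega); have := hX.pos (r1 .nExt) h le_rfl
        simp only [Nat.add_sub_cancel] at *; omega
    · have : 4000 * (L + 1) * (d + 1) = 3000 * (L + 1) * (d + 1) + 1000 * (L * d) + 1000 * d +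
        1000 * (L + 1) := by ring
      simp only [cost_var]
      omega

end

section

variable {I : Inst} {V M L N w B : ℕ} {Q : Post} {r : Reg → ℕ} {m : Arr → ℕ → ℕ} {t : ℕ} {s : Side}
  {P F u v : Side → ℕ} {U D : Side → ℕ → ℕ} {a b e k l q : ℕ}

/-! ### Maintaining `pref` and `safe` -/

/-- One coordinate of `safe` for the current string is computed, as the least of the candidates. -/
lemma wp_updateSafe (hE : Env I V M L w B r m) (hnz : r .nz = k + 1) {c : ℕ} (hc : r .c = c)
    (hc1 : 1 ≤ c) (hc2 : c ≤ I.σ) (hPs : m (.pref s) k = P s)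
    (hPo : m (.pref s.other) k = P s.other) {P' : Side → ℕ} (hP' : m (.pref s.other) (k + 1) = P' s.other)
    (hF : m (.safe s) k = F s) (hPn : ∀ s, P s < P' s ∧ P' s ≤ I.n s) (hkM : k + 1 < M)
    (H : ∀ r' m' t' f, Frame V (updateSafe s) r m r' m' →
      m' (.safe s) = Function.update (m (.safe s)) (k + 1) f → f ≤ I.n s + 1 →
      (f = I.n s + 1 ∨ I.SafeCand P F P' c s f) → (∀ v, I.SafeCand P F P' c s v → f ≤ v) →
      t' ≤ t + 500 * (L + 1) * (P' s.other - P s.other) → Q r' m' t') :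
    wp V M (updateSafe s) Q r m t := by
  refine wp_conseq (Q := fun r' m' t' => ∃ f,
      m' (.safe s) = Function.update (m (.safe s)) (k + 1) f ∧ f ≤ I.n s + 1 ∧
      (f = I.n s + 1 ∨ I.SafeCand P F P' c s f) ∧ (∀ v, I.SafeCand P F P' c s v → f ≤ v) ∧
      t' ≤ t + 500 * (L + 1) * (P' s.other - P s.other)) ?_ fun r' m' t' hF h => by
    obtain ⟨f, h1, h2, h3, h4, h5⟩ := h
    exact H r' m' t' f hF h1 h2 h3 h4 h5
  clear H
  have hMs := hE.big.n_le s
  have hMo := hE.big.n_le s.other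
  have hMV := hE.big.le_V
  have hls := (hE.idx s).len
  have hPno := hPn s.other
  have hPns := hPn s
  obtain ⟨K, hK⟩ : ∃ K, K = 200 * (L + 1) + 60 := ⟨_, rfl⟩
  simp only [updateSafe, put, block_cons, block_single, wp_seq, wp_assign, safeE_add, safeE_var,
    safeE_one, and_self, true_and, ev_add, ev_var, ev_one, hls, cost_add, cost_var, cost_one]
  refine ⟨by omega, ?_⟩
  refine wp_forUp (fun q r' m' t' => m' = m ∧ r' .sf ≤ I.n s + 1 ∧
    (r' .sf = I.n s + 1 ∨ I.SafeCand P F P' c s (r' .sf)) ∧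
    (∀ j, P s.other < j → j < q → I.nxt s (I.S s.other j) (P s) ≤ I.n s →
      r' .sf ≤ I.nxt s c (I.nxt s (I.S s.other j) (P s))) ∧
    t' ≤ t + 30 + K * (q - (P s.other + 1))) (P s.other + 1) (P' s.other - 1)
    (by simp [hnz, hPo]) (by omega) (by omega) (by omega) (by simp) (by cases s <;> rfl) ?_ ?_ ?_ ?_
  · intro j r' m' t' hF' _
    simp only [rd, ev_sub, ev_get, ev_var, ev_one, safeE_sub, safeE_get, safeE_var, safeE_one, and_self,
      and_true, hF'.reg .nz (by cases s <;> rfl), hF'.mem (.pref s.other) (by cases s <;> rfl),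
      Function.update_apply, reduceCtorEq, if_false, hnz, hP']
  · refine ⟨rfl, by simp, by simp, fun j h1 h2 => by omega, by simp⟩
  · rintro j r' m' t' hj1 hj2 hj hF' ⟨rfl, h1, h2, h3, ht⟩
    have hE' : Env I V M L w B r' m' := (hE.congr (by simp [envR]) fun _ _ => rfl).frame hF'
      (by cases s <;> rfl)
    have hnz' : r' .nz = k + 1 := by rw [hF'.reg _ (by cases s <;> rfl)]; simp [hnz]
    have hc' : r' .c = c := by rw [hF'.reg _ (by cases s <;> rfl)]; simp [hc]
    have hls' := (hE'.idx s).len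
    have hpos := I.S_pos (s := s.other) (i := j) (by omega) (by omega)
    clear hF'
    simp only [ifs, put, block_cons, block_single, block_nil, wp_seq]
    refine wp_nextQ hE'.big (hE'.idx s) (vc := I.S s.other j) (vh := P s) (fun r'' h => ?_)
      (fun r'' h => ?_) (by simp [rd]) (by simp [rd]) hpos.1 hpos.2 (hE'.lt_pow s)
      fun r1 t1 hr1 hnx1 ht1 => ?_
    · simp only [rd, ev_get, ev_var, safeE_get, safeE_var, and_true, h .k (by simp) (by simp)
        (by simp), hj]
      exact (hE'.idx s.other).str _ (by omega) (by omega)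
    · simp [rd, h .nz, hnz', hPs]
    have hls1 : r1 (.len s) = I.n s := by rw [hr1 _ (by simp) (by simp) (by simp) (by simp), hls']
    have hc1' : r1 .c = c := by rw [hr1 _ (by simp) (by simp) (by simp) (by simp), hc']
    have hk1' : r1 .k = j := by rw [hr1 _ (by simp) (by simp) (by simp) (by simp), hj]
    have hsf1 : r1 .sf = r' .sf := by rw [hr1 _ (by simp) (by simp) (by simp) (by simp)]
    have hKq : K * (j + 1 - (P s.other + 1)) = K * (j - (P s.other + 1)) + K := by
      rw [show j + 1 - (P s.other + 1) = j - (P s.other + 1) + 1 by omega, Nat.mul_succ]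
    have hlt : ∀ f, (f = r' .sf ∨ I.SafeCand P F P' c s f) → f ≤ r' .sf →
        (I.nxt s (I.S s.other j) (P s) ≤ I.n s →
          f ≤ I.nxt s c (I.nxt s (I.S s.other j) (P s))) →
        f ≤ I.n s + 1 ∧ (f = I.n s + 1 ∨ I.SafeCand P F P' c s f) ∧
        (∀ i, P s.other < i → i < j + 1 → I.nxt s (I.S s.other i) (P s) ≤ I.n s →
          f ≤ I.nxt s c (I.nxt s (I.S s.other i) (P s))) := by
      rintro f hf hle hfj
      refine ⟨by omega, ?_, fun i hi1 hi2 hi3 => ?_⟩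
      · rcases hf with rfl | hf
        · exact h2
        · exact Or.inr hf
      · rcases (Nat.lt_succ_iff.1 hi2).eq_or_lt with rfl | hi2
        · exact hfj hi3
        · exact hle.trans (h3 i hi1 hi2 hi3)
    simp only [wp_ite, wp_seq, wp_assign, wp_skip, safeC_le, safeE_var, and_self, true_and, evC_le,
      ev_var, hnx1, hls1, cost_var, costC_le, hsf1, hKq]
    simp only [rd, cost_sub, cost_get, cost_var, cost_one] at ht1
    have hskip := hlt (r' .sf) (Or.inl rfl) le_rfl
    refine ⟨fun hle => ⟨by omega, ?_⟩, fun hgt => ?_⟩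
    rotate_left
    · obtain ⟨g1, g2, g3⟩ := hskip fun h => absurd h hgt
      simp only [Function.update_apply, reduceCtorEq, if_false, hsf1]
      exact ⟨g1, g2, g3, by omega⟩
    refine wp_nextQ hE'.big ((hE'.idx s).congr (by simp [hls1, hls']) fun _ _ => rfl) (vc := c)
      (vh := I.nxt s (I.S s.other j) (P s)) (fun r'' h => ?_)
      (fun r'' h => ?_) (by simp [rd]) (by simp [rd]) hc1 hc2 (hE'.lt_pow s)
      fun r2 t2 hr2 hnx2 ht2 => ?_
    · simp [h .c, hc1']
    · simp [h .p]
    have hsf2 : r2 .sf = r' .sf := by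
      rw [hr2 _ (by simp) (by simp) (by simp) (by simp)]; simp [hsf1]
    have hk2' : r2 .k = j := by
      rw [hr2 _ (by simp) (by simp) (by simp) (by simp)]; simp [hk1']
    have hnle := @Inst.nxt_le_succ I s c (I.nxt s (I.S s.other j) (P s))
    simp only [safeC_lt, safeE_var, and_self, true_and, evC_lt, ev_var, hnx2, hsf2, costC_lt, cost_var,
      wp_ite, wp_assign, wp_skip, Function.update_apply, reduceCtorEq, if_false, if_true]
    refine ⟨fun h => ⟨by omega, ?_⟩, fun h => ?_⟩
    · obtain ⟨g1, g2, g3⟩ := hlt _ (Or.inr (Or.inl ⟨j, by omega, by omega, hle, rfl⟩)) h.le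
        fun _ => le_rfl
      exact ⟨g1, g2, g3, by omega⟩
    · obtain ⟨g1, g2, g3⟩ := hlt (r' .sf) (Or.inl rfl) le_rfl fun _ => not_lt.1 h
      exact ⟨g1, g2, g3, by omega⟩
  · rintro r' m' t' hF' - ⟨rfl, h1, h2, h3, ht⟩
    have hE' : Env I V M L w B r' m' := (hE.congr (by simp [envR]) fun _ _ => rfl).frame hF'
      (by cases s <;> rfl)
    have hnz' : r' .nz = k + 1 := by rw [hF'.reg _ (by cases s <;> rfl)]; simp [hnz]
    have hc' : r' .c = c := by rw [hF'.reg _ (by cases s <;> rfl)]; simp [hc]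
    have hls' := (hE'.idx s).len
    clear hF'
    have hKd : K * (P' s.other - 1 + 1 - (P s.other + 1)) + K = K * (P' s.other - P s.other) := by
      rw [← Nat.mul_succ]; congr 1; omega
    have h500 : 500 * (L + 1) * (P' s.other - P s.other) = K * (P' s.other - P s.other) +
        300 * (L * (P' s.other - P s.other)) + 240 * (P' s.other - P s.other) := by rw [hK]; ring
    have hL' : L * 1 ≤ L * (P' s.other - P s.other) := Nat.mul_le_mul_left _ (by omega)
    -- the candidate that stems from `safe` of the shorter prefix
    have fin : ∀ f, f ≤ I.n s + 1 → (f = I.n s + 1 ∨ I.SafeCand P F P' c s f) → f ≤ r' .sf →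
        (F s ≤ I.n s → f ≤ I.nxt s c (F s)) →
        f ≤ I.n s + 1 ∧ (f = I.n s + 1 ∨ I.SafeCand P F P' c s f) ∧
        (∀ v, I.SafeCand P F P' c s v → f ≤ v) := by
      refine fun f g1 g2 g3 g4 => ⟨g1, g2, ?_⟩
      rintro v (⟨j, e1, e2, e3, rfl⟩ | ⟨e1, rfl⟩)
      · exact g3.trans (h3 j e1 (by omega) e3)
      · exact g4 e1
    simp only [ifs, put, wr, rd, block_cons, block_single, block_nil, wp_seq, wp_ite, wp_assign,
      wp_store, wp_skip, safeC_le, safeE_get, safeE_sub, safeE_var, safeE_one, and_self, true_and,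
      evC_le, ev_get, ev_sub, ev_var, ev_one, hnz', Nat.add_sub_cancel, hF, hls', cost_get, cost_sub,
      cost_var, cost_one, costC_le, Function.update_self]
    refine ⟨fun hle => ?_, fun hgt => ⟨hkM, by omega, r' .sf, rfl, ?_⟩⟩
    · refine wp_nextQ hE'.big (hE'.idx s) (vc := c) (vh := F s) (fun r'' h => ?_)
        (fun r'' h => ?_) (by simp [rd]) (by simp [rd]) hc1 hc2 (hE'.lt_pow s)
        fun r1 t1 hr1 hnx1 ht1 => ?_
      · simp [h .c, hc']
      · simp [h .nz, hnz', hF]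
      have hsf1 : r1 .sf = r' .sf := by rw [hr1 _ (by simp) (by simp) (by simp) (by simp)]
      have hnz1 : r1 .nz = k + 1 := by rw [hr1 _ (by simp) (by simp) (by simp) (by simp), hnz']
      have hnle := @Inst.nxt_le_succ I s c (F s)
      simp only [safeC_lt, safeE_var, and_self, true_and, evC_lt, ev_var, hnx1, hsf1, costC_lt,
        cost_var, wp_ite, wp_assign, wp_skip, Function.update_apply, reduceCtorEq, if_false, if_true,
        hnz1]
      refine ⟨fun h => ⟨by omega, hkM, by omega, _, rfl, ?_⟩, fun h => ⟨hkM, by omega, r' .sf,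
        rfl, ?_⟩⟩
      · obtain ⟨g1, g2, g3⟩ := fin _ hnle (Or.inr (Or.inr ⟨hle, rfl⟩)) h.le fun _ => le_rfl
        exact ⟨g1, g2, g3, by omega⟩
      · obtain ⟨g1, g2, g3⟩ := fin _ h1 h2 le_rfl fun _ => not_lt.1 h
        exact ⟨g1, g2, g3, by omega⟩
    · obtain ⟨g1, g2, g3⟩ := fin _ h1 h2 le_rfl fun h => absurd h hgt
      exact ⟨g1, g2, g3, by omega⟩

/-- The data for the prefix of length `k + 1` are determined from those of the prefix of length
`k`. -/
lemma wp_setLast (hE : Env I V M L w B r m) (hnz : r .nz = k + 1) {c : ℕ} (hc : r .c = c)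
    (hc1 : 1 ≤ c) (hc2 : c ≤ I.σ) (hPm : ∀ s, m (.pref s) k = P s) (hF : ∀ s, m (.safe s) k = F s)
    (hP : ∀ s, P s ≤ I.n s) (hPn : ∀ s, I.nxt s c (P s) ≤ I.n s) (hkM : k + 1 < M)
    (H : ∀ r' m' (t' : ℕ) (F' : Side → ℕ), Frame V setLast r m r' m' → m' .z = Function.update (m .z) (k + 1) c →
      (∀ s, m' (.pref s) = Function.update (m (.pref s)) (k + 1) (I.nxt s c (P s))) →
      (∀ s, m' (.safe s) = Function.update (m (.safe s)) (k + 1) (F' s)) →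
      (∀ s, F' s ≤ I.n s + 1) →
      (∀ s, F' s = I.n s + 1 ∨ I.SafeCand P F (fun s => I.nxt s c (P s)) c s (F' s)) →
      (∀ s v, I.SafeCand P F (fun s => I.nxt s c (P s)) c s v → F' s ≤ v) →
      t' + 1000 * (L + 1) * (P .x + P .y) ≤
        t + 1000 * (L + 1) * (I.nxt .x c (P .x) + I.nxt .y c (P .y)) → Q r' m' t') :
    wp V M setLast Q r m t := by
  refine wp_conseq (Q := fun r' m' (t' : ℕ) => ∃ F' : Side → ℕ, m' .z = Function.update (m .z) (k + 1) c ∧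
      (∀ s, m' (.pref s) = Function.update (m (.pref s)) (k + 1) (I.nxt s c (P s))) ∧
      (∀ s, m' (.safe s) = Function.update (m (.safe s)) (k + 1) (F' s)) ∧
      (∀ s, F' s ≤ I.n s + 1) ∧
      (∀ s, F' s = I.n s + 1 ∨ I.SafeCand P F (fun s => I.nxt s c (P s)) c s (F' s)) ∧
      (∀ s v, I.SafeCand P F (fun s => I.nxt s c (P s)) c s v → F' s ≤ v) ∧
      t' + 1000 * (L + 1) * (P .x + P .y) ≤
        t + 1000 * (L + 1) * (I.nxt .x c (P .x) + I.nxt .y c (P .y))) ?_ fun r' m' t' hF h => by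
    obtain ⟨F', h1, h2, h3, h4, h5, h6, h7⟩ := h
    exact H r' m' t' F' hF h1 h2 h3 h4 h5 h6 h7
  clear H
  have hM := hE.big.le_M
  have hMV := hE.big.le_V
  have hσ := hE.big.σ_le
  have hPlt : ∀ s, P s < I.nxt s c (P s) ∧ I.nxt s c (P s) ≤ I.n s := fun s =>
    ⟨Inst.lt_nxt (hP s), hPn s⟩
  have hPx := hPlt .x
  have hPy := hPlt .y
  simp only [setLast, wr, block_cons, block_single, wp_seq, wp_store, safeE_var, true_and, ev_var, hnz,
    hc, cost_var]
  refine ⟨hkM, by omega, ?_⟩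
  refine wp_nextQ hE.big ((hE.idx .x).congr rfl (by simp)) (vc := c) (vh := P .x) (fun r'' h => ?_)
    (fun r'' h => ?_) (by simp [rd]) (by simp [rd]) hc1 hc2 (hE.lt_pow .x)
    fun r1 t1 hr1 hnx1 ht1 => ?_
  · simp [h .c, hc]
  · simp [rd, h .nz, hnz, hPm]
  have hnz1 : r1 .nz = k + 1 := by rw [hr1 _ (by simp) (by simp) (by simp) (by simp), hnz]
  have hc1' : r1 .c = c := by rw [hr1 _ (by simp) (by simp) (by simp) (by simp), hc]
  have hE1 : Env I V M L w B r1 m := hE.congr (fun x hx => by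
    simp only [envR, List.mem_cons, List.not_mem_nil, or_false] at hx
    exact hr1 x (by rintro rfl; simp at hx) (by rintro rfl; simp at hx) (by rintro rfl; simp at hx)
      (by rintro rfl; simp at hx)) fun _ _ => rfl
  clear hr1
  simp only [hnz1, hnx1]
  refine ⟨hkM, by omega, ?_⟩
  refine wp_nextQ hE.big ((hE1.idx .y).congr rfl (by simp)) (vc := c) (vh := P .y) (fun r'' h => ?_)
    (fun r'' h => ?_) (by simp [rd]) (by simp [rd]) hc1 hc2 (hE.lt_pow .y)
    fun r2 t2 hr2 hnx2 ht2 => ?_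
  · simp [h .c, hc1']
  · simp [rd, h .nz, hnz1, hPm]
  have hnz2 : r2 .nz = k + 1 := by rw [hr2 _ (by simp) (by simp) (by simp) (by simp), hnz1]
  have hc2' : r2 .c = c := by rw [hr2 _ (by simp) (by simp) (by simp) (by simp), hc1']
  have hE2 : Env I V M L w B r2 m := hE1.congr (fun x hx => by
    simp only [envR, List.mem_cons, List.not_mem_nil, or_false] at hx
    exact hr2 x (by rintro rfl; simp at hx) (by rintro rfl; simp at hx) (by rintro rfl; simp at hx)
      (by rintro rfl; simp at hx)) fun _ _ => rfl
  clear hr2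
  simp only [hnz2, hnx2]
  refine ⟨hkM, by omega, ?_⟩
  refine wp_updateSafe (s := .x) (P := P) (F := F) (P' := fun s => I.nxt s c (P s)) (k := k)
    (hE2.congr (fun _ _ => rfl) (by simp [envA])) hnz2 hc2' hc1 hc2 (by simp [hPm]) (by simp [hPm])
    (by simp) (by simp [hF]) hPlt hkM fun r3 m3 t3 fx hF3 hs3 gx1 gx2 gx3 ht3 => ?_
  have hnz3 : r3 .nz = k + 1 := by rw [hF3.reg _ rfl, hnz2]
  have hc3' : r3 .c = c := by rw [hF3.reg _ rfl, hc2']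
  have hE3 : Env I V M L w B r3 m3 := (hE2.congr (fun _ _ => rfl) (by simp [envA])).frame hF3 rfl
  have hz3 : m3 .z = Function.update (m .z) (k + 1) c := by rw [hF3.mem _ rfl]; simp
  have hp3 : ∀ s, m3 (.pref s) = Function.update (m (.pref s)) (k + 1) (I.nxt s c (P s)) := by
    intro s
    rw [hF3.mem _ (by cases s <;> rfl)]
    cases s <;> simp
  have hsx3 : m3 (.safe .x) = Function.update (m (.safe .x)) (k + 1) fx := by rw [hs3]; simp
  have hsy3 : m3 (.safe .y) = m (.safe .y) := by rw [hF3.mem _ rfl]; simp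
  clear hF3
  refine wp_updateSafe (s := .y) (P := P) (F := F) (P' := fun s => I.nxt s c (P s)) (k := k)
    hE3 hnz3 hc3' hc1 hc2 (by simp [hp3, hPm]) (by simp [hp3, hPm])
    (by simp [hp3]) (by simp [hsy3, hF]) hPlt hkM fun r4 m4 t4 fy hF4 hs4 gy1 gy2 gy3 ht4 => ?_
  refine ⟨fun s => match s with | .x => fx | .y => fy, by rw [hF4.mem _ rfl, hz3], fun s => by
    rw [hF4.mem _ (by cases s <;> rfl), hp3], ?_, ?_, ?_, ?_, ?_⟩
  · exact Side.forall.2 ⟨by rw [hF4.mem _ rfl, hsx3], by rw [hs4, hsy3]⟩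
  · exact Side.forall.2 ⟨gx1, gy1⟩
  · exact Side.forall.2 ⟨gx2, gy2⟩
  · exact Side.forall.2 ⟨gx3, gy3⟩
  · simp only [Side.other_x, Side.other_y, rd, cost_sub, cost_get, cost_var, cost_one] at *
    generalize hX : I.nxt .x c (P .x) = X at *
    generalize hY : I.nxt .y c (P .y) = Y at *
    obtain ⟨x, rfl⟩ : ∃ x, X = P .x + (x + 1) := ⟨X - P .x - 1, by omega⟩
    obtain ⟨y, rfl⟩ : ∃ y, Y = P .y + (y + 1) := ⟨Y - P .y - 1, by omega⟩
    simp only [Nat.add_sub_cancel_left] at ht3 ht4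
    have e1 : 1000 * (L + 1) * (P .x + (x + 1) + (P .y + (y + 1))) = 1000 * (L + 1) * (P .x + P .y) +
      500 * (L + 1) * (x + 1) + 500 * (L + 1) * (y + 1) + 500 * (L + 1) * x + 500 * (L + 1) * y +
      1000 * (L + 1) := by ring
    rw [e1]
    have := Nat.zero_le (500 * (L + 1) * x)
    have := Nat.zero_le (500 * (L + 1) * y)
    omega

end

/-! ### The normal form of the input -/

section

/-- The code of a character: the index of its first occurrence in the concatenation of the input
strings, shifted such that the first index is `2`. -/
def enc (X : Side → List ℕ) (c : ℕ) : ℕ := (X .x ++ X .y).idxOf c + 2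

section
variable {X : Side → List ℕ} {s : Side} {c d : ℕ} {Z U : List ℕ}

lemma mem_append_side (hc : c ∈ X s) : c ∈ X .x ++ X .y := by cases s <;> simp [hc]

lemma enc_lt (hc : c ∈ X .x ++ X .y) : enc X c < (X .x).length + (X .y).length + 2 := by
  have := List.idxOf_lt_length_iff.2 hc
  simp only [List.length_append] at this
  unfold enc; omega

lemma getD_enc (hc : c ∈ X .x ++ X .y) : (X .x ++ X .y).getD (enc X c - 2) 0 = c := by
  have := List.idxOf_lt_length_iff.2 hc
  rw [enc, Nat.add_sub_cancel, List.getD_eq_getElem _ _ this, List.getElem_idxOf]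

lemma enc_inj (hc : c ∈ X .x ++ X .y) (hd : d ∈ X .x ++ X .y) (h : enc X c = enc X d) : c = d := by
  rw [← getD_enc hc, ← getD_enc hd, h]

lemma enc_le_of_getD {k : ℕ} (hk : k < (X .x ++ X .y).length) (h : (X .x ++ X .y).getD k 0 = c) :
    enc X c ≤ k + 2 := by
  by_contra h1
  have h2 : k < (X .x ++ X .y).findIdx (· == c) := by unfold enc List.idxOf at h1; omega
  have := List.not_of_lt_findIdx h2
  rw [List.getD_eq_getElem _ _ hk] at h
  simp [h] at this

lemma map_enc_inj (hZ : ∀ c ∈ Z, c ∈ X .x ++ X .y) (hU : ∀ c ∈ U, c ∈ X .x ++ X .y)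
    (h : Z.map (enc X) = U.map (enc X)) : Z = U := by
  induction Z generalizing U with
  | nil => simpa using h.symm
  | cons c Z ih =>
    cases U with
    | nil => simp at h
    | cons d U =>
      simp only [List.map_cons, List.cons.injEq] at h
      rw [enc_inj (hZ c (by simp)) (hU d (by simp)) h.1,
        ih (fun c hc => hZ c (by simp [hc])) (fun c hc => hU c (by simp [hc])) h.2]

variable (X) in
/-- The normal form of the input. -/
def nrm : Inst where
  S s i := if i = 1 then 1 else if i = (X s).length + 2 then (X .x).length + (X .y).length + 2 else
    enc X ((X s).getD (i - 2) 0)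
  n s := (X s).length + 2
  σ := (X .x).length + (X .y).length + 2
  two_le s := by omega
  two_le_σ := by omega
  first s := rfl
  last s := by simp
  mid s i h1 h2 := by
    rw [if_neg (by omega), if_neg (by omega), List.getD_eq_getElem _ _ (by omega)]
    exact ⟨by unfold enc; omega, enc_lt (mem_append_side (List.getElem_mem _))⟩

/-- The strings in normal form. -/
lemma nrm_drop : (nrm X).drop s 0 = 1 :: ((X s).map (enc X) ++ [(nrm X).σ]) := by
  apply List.ext_getElem
  · simp [Inst.drop, nrm]
  · intro i h1 h2
    have h1' : i < (X s).length + 2 := by simpa [Inst.drop, nrm] using h1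
    simp only [Inst.drop, List.getElem_map, List.getElem_range']
    rcases i with _ | i
    · simp [nrm]
    · rw [List.getElem_cons_succ]
      rcases (show i ≤ (X s).length by omega).eq_or_lt with rfl | hi
      · simp [nrm, show 1 + ((X s).length + 1) = (X s).length + 2 by ring]
      · rw [List.getElem_append_left (by simpa using hi), List.getElem_map]
        simp only [nrm]
        rw [if_neg (by omega), if_neg (by omega), List.getD_eq_getElem _ _ (by omega)]
        congr 2; omega

/-- Only a common subsequence of the original strings, between the two additional characters, can
contain them. -/
lemma nrm_cs_iff : (nrm X).CS (1 :: (U ++ [(nrm X).σ])) ↔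
    ∃ Z, IsCommonSubseq (X .x) (X .y) Z ∧ U = Z.map (enc X) := by
  simp only [Inst.CS, Inst.pre_le_iff_sublist, nrm_drop, List.cons_sublist_cons,
    List.append_sublist_append_right, Side.forall, List.sublist_map_iff, IsCommonSubseq]
  constructor
  · rintro ⟨⟨Z, hZ, rfl⟩, Z', hZ', h⟩
    obtain rfl := map_enc_inj (fun c hc => List.mem_append_left _ (hZ.subset hc))
      (fun c hc => List.mem_append_right _ (hZ'.subset hc)) h
    exact ⟨Z, ⟨hZ, hZ'⟩, rfl⟩
  · rintro ⟨Z, ⟨h, h'⟩, rfl⟩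
    exact ⟨⟨Z, h, rfl⟩, Z, h', rfl⟩

lemma one_notMem : 1 ∉ (X s).map (enc X) ++ [(nrm X).σ] := by
  simp only [List.mem_append, List.mem_map, List.mem_singleton, not_or, not_exists, not_and]
  exact ⟨fun c _ => by unfold enc; omega, by simp [nrm]⟩

lemma sigma_notMem : (nrm X).σ ∉ (X s).map (enc X) := by
  simp only [List.mem_map, not_exists, not_and]
  intro c hc h
  have := enc_lt (mem_append_side hc)
  simp only [nrm] at h; omega

/-- The maximal common subsequences of the normal form are those of the input, encoded and
completed by the two additional characters. -/
theorem nrm_mcs_iff : (nrm X).MCS U ↔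
    ∃ Z, IsMCS (X .x) (X .y) Z ∧ U = 1 :: (Z.map (enc X) ++ [(nrm X).σ]) := by
  constructor
  · intro h
    obtain ⟨W, rfl⟩ := h.starts
    have hW : W ≠ [] := by
      rintro rfl
      obtain ⟨W, hW⟩ := h.ends
      obtain ⟨rfl, h1⟩ := List.append_inj' (show [] ++ [1] = W ++ [(nrm X).σ] by simpa using hW) rfl
      simp [nrm] at h1
    obtain ⟨V, c, rfl⟩ := W.eq_nil_or_concat'.resolve_left hW
    obtain ⟨W, hW'⟩ := h.ends
    obtain ⟨-, h1⟩ := List.append_inj' (show ([1] ++ V) ++ [c] = W ++ [(nrm X).σ] by simpa using hW')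
      rfl
    obtain rfl : c = (nrm X).σ := by simpa using h1
    obtain ⟨Z, hZ, rfl⟩ := nrm_cs_iff.1 h.1
    refine ⟨Z, ⟨hZ, fun Z₁ Z₂ c hc hcs => ?_⟩, rfl⟩
    subst hc
    refine h.2 (1 :: Z₁.map (enc X)) (Z₂.map (enc X) ++ [(nrm X).σ]) (enc X c) (by simp) ?_
    have := nrm_cs_iff.2 ⟨_, hcs, rfl⟩
    simpa using this
  · rintro ⟨Z, ⟨hZ, hmax⟩, rfl⟩
    refine ⟨nrm_cs_iff.2 ⟨Z, hZ, rfl⟩, fun A B d hAB hcs => ?_⟩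
    have hsub : (A ++ d :: B).Sublist (1 :: ((X .x).map (enc X) ++ [(nrm X).σ])) := by
      rw [← nrm_drop]; exact Inst.pre_le_iff_sublist.1 (hcs .x)
    rcases A with _ | ⟨a, A⟩
    · -- nothing can be inserted before the least character
      simp only [List.nil_append] at hAB hsub
      rw [← hAB] at hsub
      have : (1 :: (Z.map (enc X) ++ [(nrm X).σ])).Sublist ((X .x).map (enc X) ++ [(nrm X).σ]) := by
        cases hsub with
        | cons _ h => exact (List.sublist_cons_self _ _).trans h
        | cons_cons _ h => exact h
      exact one_notMem (this.subset (by simp))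
    simp only [List.cons_append, List.cons.injEq] at hAB
    obtain ⟨rfl, hAB⟩ := hAB
    rcases B.eq_nil_or_concat' with rfl | ⟨B, b, rfl⟩
    · -- nothing can be inserted after the greatest character
      simp only [List.append_nil] at hAB
      subst hAB
      rw [List.cons_append, List.cons_sublist_cons, List.append_assoc] at hsub
      have h1 := (List.sublist_append_right _ _).trans hsub
      obtain ⟨l₁, l₂, h2, h3, h4⟩ := List.sublist_append_iff.1 h1
      rcases l₁ with _ | ⟨a, l₁⟩
      · have := h4.length_le
        simp only [List.nil_append] at h2
        rw [← h2] at this; simp at this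
      · simp only [List.cons_append, List.nil_append, List.cons.injEq] at h2
        exact sigma_notMem (h3.subset (by simp [← h2.1]))
    · obtain ⟨h1, h2⟩ := List.append_inj'
        (show Z.map (enc X) ++ [(nrm X).σ] = (A ++ B) ++ [b] by simpa using hAB) rfl
      obtain rfl : (nrm X).σ = b := by simpa using h2
      obtain ⟨Z', hZ', h3⟩ := nrm_cs_iff.1 (show (nrm X).CS (1 :: ((A ++ d :: B) ++ [(nrm X).σ])) by
        simpa using hcs)
      obtain ⟨Z₁, Z₂, rfl, rfl, h4⟩ := List.map_eq_append_iff.1 h3.symm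
      obtain ⟨c, Z₂, rfl, rfl, rfl⟩ := List.map_eq_cons_iff.1 h4
      refine hmax Z₁ Z₂ c ?_ hZ'
      have hmem := fun e he => List.mem_append_left (X .y) (hZ'.1.subset (a := e) he)
      refine map_enc_inj (fun c hc => List.mem_append_left _ (hZ.1.subset hc)) (fun e he =>
        hmem e ?_) (by simpa using h1)
      simp only [List.mem_append, List.mem_cons] at he ⊢
      tauto
end

variable {X : Side → List ℕ} {V M N : ℕ} {Q : Post} {r : Reg → ℕ} {m : Arr → ℕ → ℕ} {t : ℕ}
  {s : Side}

/-- The encoding of one of the input strings. -/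
lemma wp_encode (hN : (X .x).length + (X .y).length = N) (hl : r (.rawLen s) = (X s).length)
    (hraw : ∀ k, 1 ≤ k → k ≤ (X s).length → m (.raw s) k = (X s).getD (k - 1) 0)
    (hdec : ∀ k, 2 ≤ k → k < N + 2 → m .dec k = (X .x ++ X .y).getD (k - 2) 0)
    (hM : N + 4 ≤ M) (hMV : M ≤ V) {p : S}
    (hp : p = forUp .k 1 (.var (.rawLen s)) [put .c 2,
      whl (.ne (rd .dec (.var .c)) (rd (.raw s) (.var .k))) [put .c (.var .c + 1)],
      wr (.str s) (.var .k + 1) (.var .c)])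
    (H : ∀ r' m' t', Frame V p r m r' m' →
      (∀ k, 1 ≤ k → k ≤ (X s).length → m' (.str s) (k + 1) = enc X ((X s).getD (k - 1) 0)) →
      t' ≤ t + 30 * (N + 1) ^ 2 → Q r' m' t') :
    wp V M p Q r m t := by
  subst hp
  have hs : (X s).length ≤ N := by cases s <;> omega
  refine wp_forUp (fun q r' m' t' =>
    (∀ k, 1 ≤ k → k < q → m' (.str s) (k + 1) = enc X ((X s).getD (k - 1) 0)) ∧
      t' ≤ t + 2 + (q - 1) * (20 * N + 25)) 1 (X s).length rfl (by omega) (by omega) (by omega)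
      (by simp) (by cases s <;> rfl) ?_ ?_ ?_ ?_
  · intro q r' m' t' hF _
    simp [hF.reg (.rawLen s) (by cases s <;> rfl), hl]
  · exact ⟨fun k h1 h2 => by omega, by simp⟩
  · rintro q r' m' t' hq1 hq2 hq hF ⟨hI, ht⟩
    have hrw : m' (.raw s) q = (X s).getD (q - 1) 0 := by
      rw [hF.mem _ (by cases s <;> rfl), hraw q hq1 hq2]
    have hdc : ∀ k, 2 ≤ k → k < N + 2 → m' .dec k = (X .x ++ X .y).getD (k - 2) 0 := by
      rw [hF.mem _ (by cases s <;> rfl)]; exact hdec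
    clear hF
    have hmem : (X s).getD (q - 1) 0 ∈ X .x ++ X .y := by
      rw [List.getD_eq_getElem _ _ (by omega)]
      exact mem_append_side (List.getElem_mem _)
    generalize hch : (X s).getD (q - 1) 0 = ch at *
    have henc := enc_lt hmem
    have henc2 : 2 ≤ enc X ch := by unfold enc; omega
    have hde : m' .dec (enc X ch) = ch := by
      rw [hdc _ henc2 (by omega), getD_enc hmem]
    simp only [put, wr, rd, block_cons, block_single, wp_seq, wp_assign, safeE_two, ev_two, true_and,
      cost_two]
    refine ⟨by omega, ?_⟩
    refine wp_loop (fun r'' m'' t'' => m'' = m' ∧ r'' .k = q ∧ 2 ≤ r'' .c ∧ r'' .c ≤ enc X ch ∧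
      t'' ≤ t' + 10 + 12 * (r'' .c - 2)) (fun r'' _ => enc X ch - r'' .c) ?_ ?_ ?_ ?_
    · simp [hq, henc2]
    · rintro r'' m'' t'' - -; simp
    · rintro r'' m'' t'' - ⟨rfl, hk, hc1, hc2, ht'⟩ hne
      simp only [evC_ne, ev_get, ev_var, hk, hrw] at hne
      have : r'' .c ≠ enc X ch := fun h => hne (by rw [h, hde])
      simp only [block_single, wp_assign, safeE_add, safeE_var, safeE_one, ev_add, ev_var, ev_one,
        cost_add, cost_var, cost_one, costC_ne, cost_get, Function.update_apply, reduceCtorEq, if_false,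
        if_true, hk, true_and, and_self]
      omega
    · rintro r'' m'' t'' - ⟨rfl, hk, hc1, hc2, ht'⟩ heq
      simp only [evC_ne, ev_get, ev_var, hk, hrw, not_not] at heq
      have hcv : r'' .c = enc X ch := by
        have hlt : r'' .c < N + 2 := by omega
        rw [hdc _ hc1 hlt] at heq
        have := enc_le_of_getD (by simp only [List.length_append]; omega) heq
        omega
      simp only [wp_store, safeE_add, safeE_var, safeE_one, ev_add, ev_var, ev_one, cost_add,
        cost_var, cost_one, costC_ne, cost_get, hk, hcv, true_and, and_self]
      refine ⟨by omega, by omega, fun k h1 h2 => ?_, ?_⟩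
      · simp only [Function.update_self, Function.update_apply, Nat.add_right_cancel_iff]
        split_ifs with hkq
        · rw [hkq, hch]
        · exact hI k h1 (by omega)
      · rw [show q + 1 - 1 = (q - 1) + 1 by omega, Nat.succ_mul]
        omega
  · rintro r' m' t' hF - ⟨hI, ht⟩
    refine H _ _ _ hF (fun k h1 h2 => hI k h1 (by omega)) ?_
    have h1 : (X s).length * (20 * N + 25) ≤ N * (20 * N + 25) := Nat.mul_le_mul_right _ hs
    have h2 : 30 * (N + 1) ^ 2 = N * (20 * N + 25) + 10 * (N * N) + 35 * N + 30 := by ring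
    simp at ht ⊢; omega

/-- The input is brought into normal form, and the original characters are kept in the array `dec`. -/
lemma wp_normalize (hN : (X .x).length + (X .y).length = N)
    (hl : ∀ s, r (.rawLen s) = (X s).length)
    (hraw : ∀ s k, 1 ≤ k → k ≤ (X s).length → m (.raw s) k = (X s).getD (k - 1) 0)
    (hM : N + 4 ≤ M) (hMV : M ≤ V) (hb : ∀ s k, m (.raw s) k ≤ V)
    (H : ∀ r' m' t', Frame V normalize r m r' m' → (∀ s, r' (.len s) = (nrm X).n s) →
      r' .sigma = (nrm X).σ →
      (∀ s k, 1 ≤ k → k ≤ (nrm X).n s → m' (.str s) k = (nrm X).S s k) →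
      (∀ c ∈ X .x ++ X .y, m' .dec (enc X c) = c) →
      t' ≤ t + 200 * (N + 1) ^ 2 → Q r' m' t') :
    wp V M normalize Q r m t := by
  refine wp_conseq (Q := fun r' m' t' => (∀ s, r' (.len s) = (nrm X).n s) ∧
      r' .sigma = (nrm X).σ ∧
      (∀ s k, 1 ≤ k → k ≤ (nrm X).n s → m' (.str s) k = (nrm X).S s k) ∧
      (∀ c ∈ X .x ++ X .y, m' .dec (enc X c) = c) ∧
      t' ≤ t + 200 * (N + 1) ^ 2) ?_ fun r' m' t' hF ⟨h1, h2, h3, h4, h5⟩ =>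
    H r' m' t' hF h1 h2 h3 h4 h5
  clear H
  have hlx := hl .x
  have hly := hl .y
  simp only [normalize, put, block_cons, block_single, wp_seq, wp_assign, safeE_add, safeE_var,
    safeE_two, and_self, true_and, ev_add, ev_var, ev_two, hlx, hly, cost_add, cost_var, cost_two,
    Function.update_apply, reduceCtorEq, if_false]
  refine ⟨by omega, by omega, by omega, ?_⟩
  refine wp_forUp (fun q r' m' t' => (∀ k, 2 ≤ k → k ≤ q → m' .dec k = (X .x).getD (k - 2) 0) ∧
      t' ≤ t + 20 + (q - 1) * 14) 1 (X .x).length rfl (by omega) (by omega) (by omega)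
      (by simp) rfl ?_ ⟨fun k h1 h2 => by omega, by simp⟩ ?_ ?_
  · intro q r' m' t' hF _
    simp [hF.reg (.rawLen .x) rfl, hlx]
  · rintro q r' m' t' hq1 hq2 hq hF ⟨hI, ht⟩
    have hrw := hF.mem (.raw .x) rfl
    simp only [wr, rd, block_single, wp_store, safeE_add, safeE_var, safeE_one, safeE_get, ev_add,
      ev_var, ev_one, ev_get, and_self, true_and, hq, hrw, hraw .x q hq1 hq2]
    refine ⟨by omega, by rw [← hraw .x q hq1 hq2]; exact hb _ _, fun k h1 h2 => ?_, ?_⟩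
    · simp only [Function.update_self, Function.update_apply]
      split_ifs with hkq
      · rw [hkq]; congr 1
      · exact hI k h1 (by omega)
    · simp only [cost_add, cost_var, cost_one, cost_get]; omega
  rintro r1 m1 t1 hF1 - ⟨hI1, ht1⟩
  have hrl1 : ∀ s, r1 (.rawLen s) = (X s).length := fun s => by
    rw [hF1.reg _ (by cases s <;> rfl)]; simp [hl]
  have hraw1 : ∀ s, m1 (.raw s) = m (.raw s) := fun s => hF1.mem _ (by cases s <;> rfl)
  have hlen1 : ∀ s, r1 (.len s) = (nrm X).n s := fun s => by
    rw [hF1.reg _ (by cases s <;> rfl)]; cases s <;> simp [nrm]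
  have hsig1 : r1 .sigma = (nrm X).σ := by rw [hF1.reg _ rfl]; simp [nrm]
  clear hF1
  refine wp_forUp (fun q r' m' t' => (∀ k, 2 ≤ k → k < (X .x).length + q + 1 →
        m' .dec k = (X .x ++ X .y).getD (k - 2) 0) ∧
      t' ≤ t1 + 20 + (q - 1) * 16) 1 (X .y).length rfl (by omega) (by omega) (by omega)
      (by simp) rfl ?_ ⟨fun k h1 h2 => ?_, by simp⟩ ?_ ?_
  · intro q r' m' t' hF _
    simp [hF.reg (.rawLen .y) rfl, hrl1]
  · rw [hI1 k h1 (by omega), List.getD_append _ _ _ _ (by omega)]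
  · rintro q r' m' t' hq1 hq2 hq hF ⟨hI, ht⟩
    have hrw : m' (.raw .y) q = (X .y).getD (q - 1) 0 := by
      rw [hF.mem _ rfl, hraw1, hraw .y q hq1 hq2]
    have hrx : r' (.rawLen .x) = (X .x).length := by rw [hF.reg _ rfl]; exact hrl1 .x
    simp only [wr, rd, block_single, wp_store, safeE_add, safeE_var, safeE_one, safeE_get, ev_add,
      ev_var, ev_one, ev_get, and_self, true_and, hq, hrw, hrx]
    refine ⟨by omega, by rw [← hraw .y q hq1 hq2]; exact hb _ _, fun k h1 h2 => ?_, ?_⟩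
    · simp only [Function.update_self, Function.update_apply]
      split_ifs with hkq
      · rw [hkq, List.getD_append_right _ _ _ _ (by omega)]; congr 1; omega
      · exact hI k h1 (by omega)
    · simp only [cost_add, cost_var, cost_one, cost_get]; omega
  rintro r2 m2 t2 hF2 - ⟨hI2, ht2⟩
  have hrl2 : ∀ s, r2 (.rawLen s) = (X s).length := fun s => by
    rw [hF2.reg _ (by cases s <;> rfl)]; exact hrl1 s
  have hraw2 : ∀ s k, 1 ≤ k → k ≤ (X s).length → m2 (.raw s) k = (X s).getD (k - 1) 0 := fun s => by
    rw [hF2.mem _ (by cases s <;> rfl), hraw1]; exact hraw s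
  have hlen2 : ∀ s, r2 (.len s) = (nrm X).n s := fun s => by
    rw [hF2.reg _ (by cases s <;> rfl)]; exact hlen1 s
  have hsig2 : r2 .sigma = (nrm X).σ := by rw [hF2.reg _ rfl]; exact hsig1
  clear hF2
  refine wp_encode (X := X) (s := .x) hN (hrl2 .x) (hraw2 .x) (fun k h1 h2 => hI2 k h1 (by omega)) hM hMV
    rfl fun r3 m3 t3 hF3 hs3 ht3 => ?_
  refine wp_encode (X := X) (s := .y) hN (by rw [hF3.reg _ rfl]; exact hrl2 .y)
    (by rw [hF3.mem _ rfl]; exact hraw2 .y)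
    (by rw [hF3.mem _ rfl]; exact fun k h1 h2 => hI2 k h1 (by omega)) hM hMV
    rfl fun r4 m4 t4 hF4 hs4 ht4 => ?_
  have hlen4 : ∀ s, r4 (.len s) = (nrm X).n s := fun s => by
    rw [hF4.reg _ (by cases s <;> rfl), hF3.reg _ (by cases s <;> rfl), hlen2]
  have hsig4 : r4 .sigma = (nrm X).σ := by rw [hF4.reg _ rfl, hF3.reg _ rfl, hsig2]
  have hdec4 : m4 .dec = m2 .dec := by rw [hF4.mem _ rfl, hF3.mem _ rfl]
  have hstr4 : ∀ s k, 1 ≤ k → k ≤ (X s).length →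
      m4 (.str s) (k + 1) = enc X ((X s).getD (k - 1) 0) := Side.forall.2
    ⟨by rw [hF4.mem _ rfl]; exact hs3, hs4⟩
  clear hF3 hF4
  simp only [wr, wp_store, safeE_var, safeE_one, ev_one, ev_var, true_and, hlen4, hsig4, and_self,
    cost_one, cost_var]
  have hnn : ∀ s, (nrm X).n s = (X s).length + 2 := fun s => rfl
  have hσ : (nrm X).σ = (X .x).length + (X .y).length + 2 := rfl
  refine ⟨by omega, by omega, by omega, by omega, by rw [hnn]; omega, by omega, by rw [hnn]; omega,
    by omega, fun _ => trivial, ?_, ?_, ?_⟩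
  · intro s k h1 h2
    rw [hnn] at h2
    simp only [nrm]
    split_ifs with hk1 hk2
    · cases s <;> simp [Function.update_apply, hk1, hnn]
    · cases s <;> simp [Function.update_apply, hk2, hnn, hσ]
    · have := hstr4 s (k - 1) (by omega) (by omega)
      rw [show k - 1 + 1 = k by omega, show k - 1 - 1 = k - 2 by omega] at this
      cases s <;> simpa [Function.update_apply, hk1, hk2, hnn] using this
  · intro c hc
    have h1 := enc_lt hc
    have h2 : 2 ≤ enc X c := by unfold enc; omega
    simp only [Function.update_apply, reduceCtorEq, if_false, hdec4]
    rw [hI2 _ h2 (by omega), getD_enc hc]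
  · have : 200 * (N + 1) ^ 2 = 60 * (N + 1) ^ 2 + 140 * (N * N) + 280 * N + 140 := by ring
    simp at ht1 ht2 ht3; omega

/-- The preprocessing of the input. -/
lemma wp_pre {L : ℕ} (hN : (X .x).length + (X .y).length + 4 = N)
    (hl : ∀ s, r (.rawLen s) = (X s).length)
    (hraw : ∀ s k, 1 ≤ k → k ≤ (X s).length → m (.raw s) k = (X s).getD (k - 1) 0)
    (hM : 20 * N + 20 ≤ M) (hMV : M ≤ V) (hb : ∀ s k, m (.raw s) k ≤ V) (hL : N ≤ 2 ^ L)
    (h0 : ∀ a, (∀ s, a ≠ .raw s) → m a = 0)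
    (H : ∀ w B r' m' t', Env (nrm X) V M L w B r' m' →
      (∀ c ∈ X .x ++ X .y, m' .dec (enc X c) = c) → t' ≤ t + 5000 * (N + 1) ^ 2 → Q r' m' t') :
    wp V M pre Q r m t := by
  have hn : (nrm X).n .x + (nrm X).n .y = N := by rw [← hN]; simp only [nrm]; ring
  have hB : (nrm X).Big V M := ⟨by rw [hn, ← hN]; simp only [nrm]; omega, by rw [hn]; exact hM, hMV⟩
  simp only [pre, block_cons, block_single, wp_seq]
  refine wp_normalize (X := X) rfl hl hraw (by omega) hMV hb fun r1 m1 t1 hF1 hlen hsig hstr hdec ht1 => ?_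
  refine wp_buildIndex (s := .x) hB (hlen .x) hsig (hstr .x)
    (fun c => by rw [hF1.mem _ rfl, h0 _ (by simp)]; rfl)
    (by rw [hF1.mem _ rfl, h0 _ (by simp)]; rfl) fun r2 m2 t2 hF2 hx2 ht2 => ?_
  refine wp_buildIndex (s := .y) hB (by rw [hF2.reg _ rfl]; exact hlen .y)
    (by rw [hF2.reg _ rfl]; exact hsig) (by rw [hF2.mem _ rfl]; exact hstr .y)
    (fun c => by rw [hF2.mem _ rfl, hF1.mem _ rfl, h0 _ (by simp)]; rfl)
    (by rw [hF2.mem _ rfl, hF1.mem _ rfl, h0 _ (by simp)]; rfl) fun r3 m3 t3 hF3 hy3 ht3 => ?_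
  have hx3 := hx2.frame hF3 rfl
  have hsig3 : r3 .sigma = (nrm X).σ := by rw [hF3.reg _ rfl, hF2.reg _ rfl, hsig]
  have hdec3 : m3 .dec = m1 .dec := by rw [hF3.mem _ rfl, hF2.mem _ rfl]
  have hlg3 : m3 .lg = 0 := by
    rw [hF3.mem _ rfl, hF2.mem _ rfl, hF1.mem _ rfl, h0 _ (by simp)]
  refine wp_buildTh hB hx3 hy3 hsig3 fun r4 m4 t4 hF4 hT4 ht4 => ?_
  have hx4 := hx3.frame hF4 rfl
  have hy4 := hy3.frame hF4 rfl
  refine wp_buildTables (N := N) (by rw [hx4.len, hy4.len, hn]) (by rw [hF4.mem _ rfl, hlg3]; rfl)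
    (by omega) hM hMV fun w B r5 m5 t5 hF5 hT5 ht5 => ?_
  have hx5 := hx4.frame hF5 rfl
  have hy5 := hy4.frame hF5 rfl
  refine wp_buildRMQ (s := .x) hT5 (by omega) hM hMV fun r6 m6 t6 hF6 hR6 ht6 => ?_
  have hT6 := hT5.congr (hF6.reg _ rfl) (hF6.reg _ rfl) (hF6.mem _ rfl) (hF6.mem _ rfl) (hF6.mem _ rfl)
  refine wp_buildRMQ (s := .y) hT6 (by omega) hM hMV fun r7 m7 t7 hF7 hR7 ht7 => ?_
  have hT7 := hT6.congr (hF7.reg _ rfl) (hF7.reg _ rfl) (hF7.mem _ rfl) (hF7.mem _ rfl) (hF7.mem _ rfl)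
  have hx7 := (hx5.frame hF6 rfl).frame hF7 rfl
  have hy7 := (hy5.frame hF6 rfl).frame hF7 rfl
  refine H w B _ _ _ ⟨hB, ?_, Side.forall.2 ⟨hx7, hy7⟩, by rw [hn]; exact hT7, Side.forall.2 ⟨?_, hR7⟩,
    ?_, ?_⟩ ?_ ?_
  · refine fun s => lt_of_lt_of_le ?_ hL
    have := (nrm X).two_le .x
    have := (nrm X).two_le .y
    cases s <;> omega
  · exact ⟨by rw [hF7.mem _ rfl, hF7.mem _ rfl]; exact hR6.mask,
      by rw [hF7.mem _ rfl, hF7.mem _ rfl]; exact hR6.sparse⟩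
  · refine hT4.congr (fun s => ?_) fun _ _ => Iff.rfl
    rw [hF7.mem _ (by cases s <;> rfl), hF6.mem _ (by cases s <;> rfl), hF5.mem _ (by cases s <;> rfl)]
  · rw [hF7.reg _ rfl, hF6.reg _ rfl, hF5.reg _ rfl, hF4.reg _ rfl, hsig3]
  · rw [hF7.mem _ rfl, hF6.mem _ rfl, hF5.mem _ rfl, hF4.mem _ rfl, hdec3]; exact hdec
  · rw [hn] at ht2 ht3 ht4
    have h1 : N + 1 ≤ (N + 1) ^ 2 := Nat.le_self_pow (by norm_num) _
    have h2 : ((X .x).length + (X .y).length + 1) ^ 2 ≤ (N + 1) ^ 2 :=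
      Nat.pow_le_pow_left (by omega) 2
    omega

end

section

variable {I : Inst} {V M L w B : ℕ} {Q : Post} {r : Reg → ℕ} {m : Arr → ℕ → ℕ} {t : ℕ}
  {Z R : List ℕ} {c top : ℕ} {T : Multiset (List ℕ)} {F : Side → ℕ} {D : ℕ → ℕ}

/-! ### The state of the enumeration -/

namespace Inst

open Classical in
variable (I) in
/-- The maximal common subsequences that extend `U`. -/
noncomputable def todo (U : List ℕ) : Multiset (List ℕ) :=
  (I.finite_mcs.toFinset.filter (U <+: ·)).val

lemma mem_todo {U W : List ℕ} : W ∈ I.todo U ↔ I.MCS W ∧ U <+: W := by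
  simp [todo]

lemma nodup_todo {U : List ℕ} : (I.todo U).Nodup := Finset.nodup _

lemma IsPrefix.pre_le (h : I.IsPrefix Z) (s : Side) : I.pre s Z ≤ I.n s := by
  obtain ⟨W, hW⟩ := h
  exact hW.1.of_append s

lemma IsPrefix.length_le (h : I.IsPrefix Z) : Z.length ≤ I.n .x :=
  (length_le_pre (h.pre_le .x)).trans (h.pre_le .x)

/-- The extensions of `Z` are classified by the character that follows `Z`. -/
lemma todo_eq_bind (hZ : ∀ W, Z ≠ W ++ [I.σ]) (hR : R.Nodup)
    (h : ∀ c, c ∈ R ↔ I.IsPrefix (Z ++ [c])) :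
    I.todo Z = (R : Multiset ℕ).bind fun c => I.todo (Z ++ [c]) := by
  refine (Multiset.Nodup.ext nodup_todo ?_).2 fun W => ?_
  · refine Multiset.nodup_bind.2 ⟨fun _ _ => nodup_todo, ?_⟩
    refine ⟨R, rfl, hR.pairwise_of_forall_ne fun c _ d _ hcd => ?_⟩
    refine Multiset.disjoint_left.2 fun h1 h2 => hcd ?_
    obtain ⟨A, hA⟩ := (mem_todo.1 h1).2
    obtain ⟨A', hA'⟩ := (mem_todo.1 h2).2
    rw [← hA', List.append_assoc, List.append_assoc] at hA
    simpa using congrArg List.head? (List.append_cancel_left hA)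
  · simp only [Multiset.mem_bind, Multiset.mem_coe, mem_todo, h]
    constructor
    · rintro ⟨hW, A, rfl⟩
      rcases A with _ | ⟨c, A⟩
      · obtain ⟨W, hW'⟩ := hW.ends
        exact absurd (by simpa using hW') (hZ W)
      · have h1 : Z ++ c :: A = Z ++ [c] ++ A := by simp
        exact ⟨c, ⟨A, h1 ▸ hW⟩, hW, A, h1.symm⟩
    · rintro ⟨c, -, hW, A, hA⟩
      exact ⟨hW, [c] ++ A, by rw [← hA, List.append_assoc]⟩

/-- A string that ends with the greatest character is not extended any more. -/
lemma todo_of_last (h : I.IsPrefix (Z ++ [I.σ])) : I.todo (Z ++ [I.σ]) = {Z ++ [I.σ]} := by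
  refine (Multiset.Nodup.ext nodup_todo (Multiset.nodup_singleton _)).2 fun W => ?_
  rw [mem_todo, Multiset.mem_singleton]
  constructor
  · rintro ⟨hW, A, rfl⟩
    rw [hW.eq_of_prefix_last, List.append_nil]
  · rintro rfl
    obtain ⟨A, hA⟩ := h
    have := hA.eq_of_prefix_last
    subst this
    exact ⟨by simpa using hA, List.prefix_rfl⟩

variable (I) in
/-- The sum of the coordinates of `pref`: the potential that pays for the time between two
outputs. -/
noncomputable def psum (Z : List ℕ) : ℕ := I.pre .x Z + I.pre .y Z

lemma IsPrefix.psum_le (h : I.IsPrefix Z) : I.psum Z ≤ I.n .x + I.n .y :=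
  add_le_add (h.pre_le .x) (h.pre_le .y)

lemma IsPrefix.of_concat (h : I.IsPrefix (Z ++ [c])) : I.IsPrefix Z := by
  obtain ⟨W, hW⟩ := h
  exact ⟨[c] ++ W, by rwa [← List.append_assoc]⟩

lemma IsPrefix.psum_lt (h : I.IsPrefix (Z ++ [c])) : I.psum Z < I.psum (Z ++ [c]) :=
  add_lt_add (pre_lt_concat (h.of_concat.pre_le .x)) (pre_lt_concat (h.of_concat.pre_le .y))

end Inst

variable (I) in
/-- What is stored for the prefix `Z ++ [c]` of the current string: its last character, the
coordinates of `pref` and `safe`, and the set `R` of the alternatives to `c` not yet considered.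
That the latter fits into space proportional to `psum`, above all that is stored for shorter
prefixes, is the reason why the stack of alternatives takes only linear space in total. -/
structure Level (m : Arr → ℕ → ℕ) (Z : List ℕ) (c : ℕ) (R : List ℕ) (top : ℕ)
    (F : Side → ℕ) : Prop where
  z : m .z (Z.length + 1) = c
  pref : ∀ s, m (.pref s) (Z.length + 1) = I.pre s (Z ++ [c])
  safe : ∀ s, m (.safe s) (Z.length + 1) = F s
  isSafe : I.IsSafe (Z ++ [c]) (fun s => I.pre s (Z ++ [c])) F
  altStart : m .altStart (Z.length + 1) = top
  seg : Seg (m .alt) top R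
  isPrefix : ∀ e ∈ c :: R, I.IsPrefix (Z ++ [e])
  le : ∀ e ∈ c :: R, top + R.length + 1 ≤ I.psum (Z ++ [e])
  nil : Z = [] → R = []

variable (I) in
/-- All that is stored for the current string `Z` and its prefixes. The stack of alternatives is of
height `top`, and `T` consists of the maximal common subsequences that extend the prefixes of `Z`
by alternative characters. -/
inductive Stack (m : Arr → ℕ → ℕ) : List ℕ → ℕ → Multiset (List ℕ) → Prop
  | nil : Stack m [] 0 0
  | concat {Z : List ℕ} {top : ℕ} {T : Multiset (List ℕ)} {c : ℕ} {R : List ℕ} {F : Side → ℕ}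
      (h : Stack m Z top T) (hl : Level I m Z c R top F) :
      Stack m (Z ++ [c]) (top + R.length) (T + (R : Multiset ℕ).bind fun e => I.todo (Z ++ [e]))

lemma Level.congr {m' : Arr → ℕ → ℕ} (h : Level I m Z c R top F)
    (hz : m' .z (Z.length + 1) = m .z (Z.length + 1))
    (hp : ∀ s, m' (.pref s) (Z.length + 1) = m (.pref s) (Z.length + 1))
    (hs : ∀ s, m' (.safe s) (Z.length + 1) = m (.safe s) (Z.length + 1))
    (ha : m' .altStart (Z.length + 1) = m .altStart (Z.length + 1))
    (halt : ∀ k, k < top + R.length → m' .alt k = m .alt k) : Level I m' Z c R top F where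
  z := hz.trans h.z
  pref s := (hp s).trans (h.pref s)
  safe s := (hs s).trans (h.safe s)
  isSafe := h.isSafe
  altStart := ha.trans h.altStart
  seg := h.seg.congr fun i _ hi => halt i hi
  isPrefix := h.isPrefix
  le := h.le
  nil := h.nil

lemma Stack.congr {m' : Arr → ℕ → ℕ} (h : Stack I m Z top T)
    (hz : ∀ k, k ≤ Z.length → m' .z k = m .z k)
    (hp : ∀ s k, k ≤ Z.length → m' (.pref s) k = m (.pref s) k)
    (hs : ∀ s k, k ≤ Z.length → m' (.safe s) k = m (.safe s) k)
    (ha : ∀ k, k ≤ Z.length → m' .altStart k = m .altStart k)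
    (halt : ∀ k, k < top → m' .alt k = m .alt k) : Stack I m' Z top T := by
  induction h with
  | nil => exact .nil
  | @concat Z top T c R F h hl ih =>
    have hle : ∀ {k}, k ≤ Z.length + 1 → k ≤ (Z ++ [c]).length := fun hk => by simpa using hk
    exact .concat (ih (fun k hk => hz k (hle (by omega))) (fun s k hk => hp s k (hle (by omega)))
      (fun s k hk => hs s k (hle (by omega))) (fun k hk => ha k (hle (by omega)))
      (fun k hk => halt k (by omega))) (hl.congr (hz _ (hle le_rfl)) (fun s => hp s _ (hle le_rfl))
      (fun s => hs s _ (hle le_rfl)) (ha _ (hle le_rfl)) halt)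

lemma Stack.top_le (h : Stack I m Z top T) : top ≤ I.psum Z := by
  cases h with
  | nil => simp
  | concat h hl => have := hl.le _ List.mem_cons_self; omega

lemma Stack.isPrefix (h : Stack I m Z top T) (hZ : Z ≠ []) : I.IsPrefix Z := by
  cases h with
  | nil => exact absurd rfl hZ
  | concat h hl => exact hl.isPrefix _ List.mem_cons_self

lemma Stack.length_le (h : Stack I m Z top T) : Z.length ≤ I.n .x := by
  by_cases hZ : Z = []
  · simp [hZ]
  · exact (h.isPrefix hZ).length_le

lemma Stack.z (h : Stack I m Z top T) : ∀ i, i < Z.length → m .z (i + 1) = Z.getD i 0 := by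
  induction h with
  | nil => simp
  | @concat Z top T c R F h hl ih =>
    intro i hi
    simp only [List.length_append, List.length_singleton] at hi
    rcases (show i ≤ Z.length by omega).eq_or_lt with rfl | hi
    · rw [hl.z, List.getD_append_right _ _ _ _ le_rfl]; simp
    · rw [ih i hi, List.getD_append _ _ _ _ hi]

variable (I) in
/-- The invariant of the enumeration: `Z` is the current string, and `T` consists of the maximal
common subsequences to be enumerated after those that extend `Z`. -/
structure Inv (V M L w B : ℕ) (D : ℕ → ℕ) (Z : List ℕ) (top : ℕ) (T : Multiset (List ℕ))
    (r : Reg → ℕ) (m : Arr → ℕ → ℕ) : Prop where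
  env : Env I V M L w B r m
  dec : m .dec = D
  bd : Bd V r m
  nz : r .nz = Z.length
  top_eq : r .top = top
  stack : Stack I m Z top T

/-! ### Steps of the enumeration -/

/-- The least of the alternatives `R` is appended to `Z`; the others are left on the stack. -/
lemma wp_advance {p : S} (hp : p = block [takeLeast, setLast]) (hE : Env I V M L w B r m)
    (hD : m .dec = D) (hb : Bd V r m) (hMV : M + 1 ≤ V) (hnz : r .nz = Z.length + 1) (hZ : Z ≠ [])
    (hst : Stack I m Z top T) (ha : m .altStart (Z.length + 1) = top)
    (htop : r .top = top + R.length) (hseg : Seg (m .alt) top R) (hR : R ≠ [])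
    (hRp : ∀ e ∈ R, I.IsPrefix (Z ++ [e])) (hRl : ∀ e ∈ R, top + R.length ≤ I.psum (Z ++ [e]))
    (H : ∀ r' m' t' c R', R.Perm (c :: R') →
      Inv I V M L w B D (Z ++ [c]) (top + R'.length)
        (T + (R' : Multiset ℕ).bind fun e => I.todo (Z ++ [e])) r' m' →
      t' + 1000 * (L + 1) * I.psum Z ≤
        t + 50 * (R.length + 1) + 1000 * (L + 1) * I.psum (Z ++ [c]) → Q r' m' t') :
    wp V M p Q r m t := by
  subst hp
  have hM := hE.big.le_M
  have hn := hE.big.n_le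
  obtain ⟨e, he⟩ := List.exists_mem_of_ne_nil R hR
  have htl := hRl e he
  have hpe := (hRp e he).psum_le
  have hlen := hst.length_le
  have hnx := hn .x
  have hPZ := hst.isPrefix hZ
  obtain ⟨F, hF, hsF, hpF⟩ : ∃ F, I.IsSafe Z (fun s => I.pre s Z) F ∧
      (∀ s, m (.safe s) Z.length = F s) ∧ ∀ s, m (.pref s) Z.length = I.pre s Z := by
    cases hst with
    | nil => exact absurd rfl hZ
    | concat h hl => exact ⟨_, hl.isSafe, by simpa using hl.safe, by simpa using hl.pref⟩
  rw [block_cons, block_single, wp_seq]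
  refine wp_takeLeast (fun k => hb.2 _ _) (by omega) hMV hnz ha htop hR hseg (fun k => hb.2 _ _)
    fun r1 m1 t1 R' hF1 hperm htop1 hseg1 halt1 ht1 => ?_
  generalize hc : r1 .c = c at hperm
  have hcp : I.IsPrefix (Z ++ [c]) := hRp c (hperm.mem_iff.2 (by simp))
  have hlenR : R.length = R'.length + 1 := by simpa using hperm.length_eq
  have hcv := Inst.S_pre (hcp.pre_le .x)
  have hpos := Inst.length_le_pre (hcp.pre_le .x)
  have hcS := I.S_pos (s := .x) (by simp only [List.length_append] at hpos; simp only [List.length_singleton] at hpos; omega) (hcp.pre_le .x)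
  rw [hcv] at hcS
  have hE1 := hE.frame hF1 rfl
  have hs1 : ∀ s, m1 (.safe s) = m (.safe s) := fun s => hF1.mem _ (by cases s <;> rfl)
  have hp1 : ∀ s, m1 (.pref s) = m (.pref s) := fun s => hF1.mem _ (by cases s <;> rfl)
  refine wp_setLast hE1 (by rw [hF1.reg _ rfl, hnz]) hc hcS.1 hcS.2 (fun s => by rw [hp1, hpF])
    (fun s => by rw [hs1, hsF]) (fun s => hPZ.pre_le s)
    (fun s => by rw [← Inst.pre_concat]; exact hcp.pre_le s) (by omega)
    fun r2 m2 t2 F' hF2 hz2 hp2 hs2 g1 g2 g3 ht2 => ?_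
  simp only [← Inst.pre_concat] at hp2 ht2 g2 g3
  have hz1 : m1 .z = m .z := hF1.mem _ rfl
  have ha1 : m1 .altStart = m .altStart := hF1.mem _ rfl
  have ha2 : m2 .altStart = m .altStart := by rw [hF2.mem _ rfl, ha1]
  have halt2 : m2 .alt = m1 .alt := hF2.mem _ rfl
  have hne : ∀ {k}, k ≤ Z.length → k ≠ Z.length + 1 := fun h => by omega
  refine H _ _ _ c R' hperm ⟨hE1.frame hF2 rfl, by rw [hF2.mem _ rfl, hF1.mem _ rfl, hD],
    hF2.bd (hF1.bd hb), by rw [hF2.reg _ rfl, hF1.reg _ rfl, hnz]; simp,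
    by rw [hF2.reg _ rfl, htop1], .concat (F := F') (hst.congr ?_ ?_ ?_ ?_ ?_) ⟨?_, ?_, ?_, ?_, ?_,
      ?_, ?_, ?_, ?_⟩⟩ ?_
  · intro k hk; rw [hz2, Function.update_of_ne (hne hk), hz1]
  · intro s k hk; rw [hp2, Function.update_of_ne (hne hk), hp1]
  · intro s k hk; rw [hs2, Function.update_of_ne (hne hk), hs1]
  · intro k hk; rw [ha2]
  · intro k hk; rw [halt2, halt1 k hk]
  · rw [hz2, Function.update_self]
  · intro s; rw [hp2, Function.update_self]
  · intro s; rw [hs2, Function.update_self]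
  · exact hF.concat hcp (fun _ => rfl) g2 g3 g1
  · rw [ha2, ha]
  · rw [halt2]; exact hseg1
  · exact fun e he => hRp e (hperm.mem_iff.2 he)
  · intro e he
    have := hRl e (hperm.mem_iff.2 he)
    omega
  · exact fun h => absurd h hZ
  · simp only [Inst.psum]; omega

/-- If the current string is not complete, the alternatives to extend it are computed and the least one
is appended. The increase of `psum` pays for the time. -/
lemma wp_push (hI : Inv I V M L w B D Z top T r m) (hMV : M + 1 ≤ V) (hZ : Z ≠ [])
    (hlast : ∀ W, Z ≠ W ++ [I.σ])
    (H : ∀ r' m' t' c top' T', Inv I V M L w B D (Z ++ [c]) top' T' r' m' →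
      I.todo Z + T = I.todo (Z ++ [c]) + T' → I.IsPrefix (Z ++ [c]) →
      t' + 10000 * (L + 1) * I.psum Z ≤ t + 10000 * (L + 1) * I.psum (Z ++ [c]) → Q r' m' t') :
    wp V M (block [pushExtensible, put .nz (.var .nz + 1), takeLeast, setLast]) Q r m t := by
  obtain ⟨hE, hD, hb, hnz, htop, hst⟩ := hI
  have hM := hE.big.le_M
  have hn := hE.big.n_le
  have hlen := hst.length_le
  have hnx := hn .x
  have hPZ := hst.isPrefix hZ
  have htl := hst.top_le
  have hpe := hPZ.psum_le
  obtain ⟨F, hF, hsF, hpF⟩ : ∃ F, I.IsSafe Z (fun s => I.pre s Z) F ∧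
      (∀ s, m (.safe s) Z.length = F s) ∧ ∀ s, m (.pref s) Z.length = I.pre s Z := by
    cases hst with
    | nil => exact absurd rfl hZ
    | concat h hl => exact ⟨_, hl.isSafe, by simpa using hl.safe, by simpa using hl.pref⟩
  rw [block_cons, wp_seq]
  refine wp_pushExtensible hE hnz hpF hsF (fun s => ⟨?_, hPZ.pre_le s⟩) htop (by omega) (by omega)
    fun r1 m1 t1 R d hF1 ha1 halt1 hseg1 htop1 hnd hmem hRd hd ht1 => ?_
  · have := Inst.length_le_pre (hPZ.pre_le s)
    have := List.length_pos_iff.2 hZ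
    omega
  have hmem' : ∀ c, c ∈ R ↔ I.IsPrefix (Z ++ [c]) := fun c => by
    rw [hmem, Inst.isPrefix_concat_iff hPZ hF]
  have hd' : ∀ c ∈ R, I.psum Z + d ≤ I.psum (Z ++ [c]) := fun c hc => by
    have := hd c ((hmem c).1 hc)
    simp only [Inst.psum, Inst.pre_concat]; omega
  have hR : R ≠ [] := by
    obtain ⟨W, hW⟩ := id hPZ
    rcases W with _ | ⟨c, W⟩
    · obtain ⟨W, hW'⟩ := hW.ends
      exact absurd (by simpa using hW') (hlast W)
    · exact List.ne_nil_of_mem ((hmem' c).2 ⟨W, by simpa using hW⟩)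
  rw [block_cons, wp_seq]
  simp only [wp_assign, safeE_add, safeE_var, safeE_one, and_self, true_and, ev_add, ev_var, ev_one,
    cost_add, cost_var, cost_one]
  have hnz1 : r1 .nz = Z.length := by rw [hF1.reg _ rfl, hnz]
  have hE1 := hE.frame hF1 rfl
  have hb1 := hF1.bd hb
  have hne : ∀ {k}, k ≤ Z.length → k ≠ Z.length + 1 := fun h => by omega
  refine ⟨by omega, wp_advance rfl (hE1.congr (by simp [envR]) fun _ _ => rfl)
    ((hF1.mem _ rfl).trans hD) ⟨fun x => ?_, hb1.2⟩ hMV (by simp [hnz1]) hZ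
    (hst.congr (fun k _ => by rw [hF1.mem _ rfl]) (fun s k _ => by rw [hF1.mem _ (by cases s <;> rfl)])
      (fun s k _ => by rw [hF1.mem _ (by cases s <;> rfl)])
      (fun k hk => by rw [ha1, Function.update_of_ne (hne hk)]) halt1) (by rw [ha1]; simp)
      (by simpa using htop1) hseg1 hR (fun e he => (hmem' e).1 he)
      (fun e he => by have := hd' e he; omega) fun r2 m2 t2 c R' hperm hI2 ht2 => ?_⟩
  · by_cases hx : x = .nz
    · simp [hx]; omega
    · simpa [Function.update_of_ne hx] using hb1.1 x
  · have hcR : c ∈ R := hperm.mem_iff.2 (by simp)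
    have hcp := (hmem' c).1 hcR
    refine H _ _ _ c _ _ hI2 ?_ hcp ?_
    · rw [Inst.todo_eq_bind hlast hnd hmem', Multiset.coe_eq_coe.2 hperm, ← Multiset.cons_coe,
        Multiset.cons_bind, add_assoc, add_comm T]
    · have h1 := hd' c hcR
      have h2 := hcp.psum_lt
      have hlenR : R.length = R'.length + 1 := by simpa using hperm.length_eq
      obtain ⟨e, he⟩ : ∃ e, I.psum (Z ++ [c]) = I.psum Z + (e + 1) :=
        ⟨I.psum (Z ++ [c]) - I.psum Z - 1, by omega⟩
      rw [he] at h1 ht2 ⊢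
      have hde : 4000 * (L + 1) * (d + 1) ≤ 4000 * (L + 1) * (e + 2) :=
        Nat.mul_le_mul_left _ (by omega)
      have e1 : 10000 * (L + 1) * (I.psum Z + (e + 1)) = 10000 * (L + 1) * I.psum Z +
        4000 * (L + 1) * (e + 2) + 1000 * (L + 1) * (e + 1) + 1000 * (L + 1) +
        5000 * (L * e) + 5000 * e := by ring
      have e2 : 1000 * (L + 1) * (I.psum Z + (e + 1)) = 1000 * (L + 1) * I.psum Z +
        1000 * (L + 1) * (e + 1) := by ring
      omega

/-- The maximal common subsequences still to be enumerated. -/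
noncomputable def pending (I : Inst) (Z : List ℕ) (T : Multiset (List ℕ)) : Multiset (List ℕ) :=
  (if Z = [] then 0 else I.todo Z) + T

/-- After an output, the next prefix to be extended is found. -/
lemma wp_backtrack (hI : Inv I V M L w B D Z top T r m) (hMV : M + 1 ≤ V)
    (H : ∀ r' m' t' Z' top' T', Inv I V M L w B D Z' top' T' r' m' → T = pending I Z' T' →
      t' ≤ t + 200 * (I.n .x + I.n .y) + 10000 * (L + 1) * I.psum Z' → Q r' m' t') :
    wp V M (block [whl (.and (.ne (.var .nz) 0) (.eq (rd .altStart (.var .nz)) (.var .top)))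
      [put .nz (.var .nz - 1)], ifs (.ne (.var .nz) 0) [takeLeast, setLast] []]) Q r m t := by
  have hlen := hI.stack.length_le
  rw [block_cons, wp_seq]
  refine wp_loop (fun r' m' t' => ∃ Z', Inv I V M L w B D Z' top T r' m' ∧
      t' + 20 * Z'.length ≤ t + 20 * Z.length) (fun r' _ => r' .nz) ⟨Z, hI, le_rfl⟩
      (by simp) ?_ ?_
  · rintro r' m' t' - ⟨Z', hI', ht'⟩ hc
    simp only [evC_and, evC_ne, evC_eq, ev_var, ev_get, ev_zero] at hc
    obtain ⟨hE, hD, hb, hnz, htop, hst⟩ := hI'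
    cases hst with
    | nil => exact absurd hnz hc.1
    | @concat Z' top' T' c R F h hl =>
      have hR : R = [] := by
        have h1 := hc.2
        rw [hnz, List.length_append, List.length_singleton, hl.altStart, htop] at h1
        exact List.length_eq_zero_iff.1 (by omega)
      subst hR
      simp only [List.length_append, List.length_singleton] at hnz ht'
      simp only [block_single, wp_assign, safeE_sub, safeE_var, safeE_one, and_self, true_and, ev_sub,
        ev_var, ev_one, hnz, Nat.add_sub_cancel]
      have hbz := hb.1 .nz
      refine ⟨by omega, ⟨Z', ⟨hE.congr (by simp [envR]) fun _ _ => rfl, hD, ⟨fun x => ?_, hb.2⟩,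
        by simp, by simpa using htop, by simpa using h⟩, ?_⟩, by simp⟩
      · by_cases hx : x = .nz
        · simp [hx]; omega
        · simpa [Function.update_of_ne hx] using hb.1 x
      · simp; omega
  · rintro r' m' t' - ⟨Z', hI', ht'⟩ hc
    simp only [evC_and, evC_ne, evC_eq, ev_var, ev_get, ev_zero] at hc
    simp only [ifs, block_single, wp_ite, safeC_ne, safeE_var, safeE_zero, and_self, true_and, evC_ne,
      ev_var, ev_zero, block_nil, wp_skip, not_not]
    refine ⟨fun hnz0 => ?_, fun hnz0 => ?_⟩
    · obtain ⟨hE, hD, hb, hnz, htop, hst⟩ := hI'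
      cases hst with
      | nil => exact absurd hnz hnz0
      | @concat Z' top' T' c R F h hl =>
        have hR : R ≠ [] := by
          rintro rfl
          refine hc ⟨hnz0, ?_⟩
          rw [hnz, List.length_append, List.length_singleton, hl.altStart, htop]; simp
        have hZ' : Z' ≠ [] := fun h => hR (hl.nil h)
        have hRp : ∀ e ∈ R, I.IsPrefix (Z' ++ [e]) := fun e he => hl.isPrefix e (by simp [he])
        have hRl : ∀ e ∈ R, top' + R.length ≤ I.psum (Z' ++ [e]) := fun e he => by
          have := hl.le e (by simp [he]); omega
        have hRn : R.length ≤ I.n .x + I.n .y := by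
          have := hl.le c (by simp)
          have := (hl.isPrefix c (by simp)).psum_le
          omega
        refine wp_advance rfl hE hD hb hMV (by simpa using hnz) hZ' h hl.altStart htop hl.seg hR hRp
          hRl fun r2 m2 t2 e R' hperm hI2 ht2 => H _ _ _ _ _ _ hI2 ?_ ?_
        · rw [pending, if_neg (by simp), Multiset.coe_eq_coe.2 hperm, ← Multiset.cons_coe,
            Multiset.cons_bind]
          abel
        · have hL : 10000 * (L + 1) * I.psum (Z' ++ [e]) = 1000 * (L + 1) * I.psum (Z' ++ [e]) +
            9000 * (L + 1) * I.psum (Z' ++ [e]) := by ring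
          have := I.two_le .x
          simp at ht2 ht'
          omega
    · obtain ⟨hE, hD, hb, hnz, htop, hst⟩ := id hI'
      have hZ' : Z' = [] := List.length_eq_zero_iff.1 (by omega)
      refine H _ _ _ _ _ _ hI' ?_ ?_
      · simp [pending, hZ']
      · have := I.two_le .x
        simp; omega

end

section

variable {I : Inst} {V M L w B : ℕ} {Z : List ℕ} {top : ℕ} {T : Multiset (List ℕ)} {D : ℕ → ℕ}
  {s : MState Reg Arr}

/-! ### The enumeration -/

/-- The string that is output for `Z`. -/
def decode (D : ℕ → ℕ) (Z : List ℕ) : List ℕ := (Z.drop 1).dropLast.map D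

/-- The characters from index `k` on, except the last one, are emitted. -/
lemma exec_outputLoop (hV : 2 ≤ V) (hz : ∀ i, i < Z.length → s.mem .z (i + 1) = Z.getD i 0)
    (hD : s.mem .dec = D) {l : ℕ} (hl : s.reg .k + l = Z.length) (hk : 2 ≤ s.reg .k)
    (hnz : s.reg .nz = Z.length) (hs : Fits V M s) (hVz : Z.length ≤ V) :
    ∃ t, Exec (whl (.le (.var .k) (.var .nz - 1)) [block [.emit (rd .dec (rd .z (.var .k)))],
        put .k (.var .k + 1)]) s t ∧ Fits V M t ∧
      t.cur = s.cur ++ ((Z.drop (s.reg .k - 1)).dropLast.map D) ∧ t.out = s.out ∧ t.mem = s.mem ∧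
      (∀ x, x ≠ .k → t.reg x = s.reg x) ∧ t.time ≤ s.time + 20 * (l + 1) := by
  induction l generalizing s with
  | zero =>
    refine ⟨_, .loop_false ?_, hs.charge hV ?_ ?_ _, ?_, rfl, rfl, fun _ _ => rfl, ?_⟩
    · simp only [holds_iff_evC, evC_le, ev_var, ev_sub, ev_one]; omega
    · simp
    · simp
    · have : (Z.drop (s.reg .k - 1)).dropLast = [] := by
        apply List.eq_nil_of_length_eq_zero
        simp only [List.length_dropLast, List.length_drop]; omega
      simp [this, MState.charge]
    · simp [MState.charge]
  | succ l ih =>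
    have hk1 : s.reg .k - 1 < Z.length := by omega
    set s1 := s.charge ((Cond.le (.var .k) (.var .nz - 1) : Enum211.B).cost + 1)
      ((Cond.le (.var .k) (.var .nz - 1) : Enum211.B).peak s) with hs1
    have hs1F : Fits V M s1 := hs.charge hV (by simp) (by simp) _
    set e : E := rd .dec (rd .z (.var .k)) with he
    set s2 : MState Reg Arr := { s1.charge (e.cost + 1) (e.peak s1) with
      cur := s1.cur ++ [e.val s1] } with hs2
    have hs2F : Fits V M s2 := ⟨hs.bd, hs.ext, max_le hs1F.word ((peak_le hV hs.bd e
      (by simp [he])).2.trans (Nat.mul_le_mul_right _ (by simp [he])))⟩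
    have hev : e.val s1 = D (Z.getD (s.reg .k - 1) 0) := by
      rw [val_eq_ev]
      simp only [he, ev_get, ev_var]
      change s.mem .dec (s.mem .z (s.reg .k)) = _
      rw [hD, ← hz _ hk1, show s.reg .k - 1 + 1 = s.reg .k by omega]
    obtain ⟨s3, h3, hs3F, hc3, ho3, hr3, hm3, ht3⟩ := wp_sound hV (put .k (.var .k + 1)) (by
      simp [maxCost]) (Q := fun r' m' t' => r' = Function.update s.reg .k (s.reg .k + 1) ∧ m' = s.mem ∧
        t' ≤ s2.time + 4) hs2F (by
        simp only [put, wp_assign, safeE_add, safeE_var, safeE_one, ev_add, ev_var, ev_one]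
        refine ⟨by simp, ?_, rfl, rfl, by simp⟩
        change s.reg .k + 1 ≤ V; omega)
    obtain ⟨t, ht, hF, hc, ho, hm, hr, htt⟩ := ih (s := s3) (by rw [hm3]; exact hz) (by rw [hm3, hD])
      (by rw [hr3]; simp; omega) (by rw [hr3]; simp; omega) (by rw [hr3]; simpa using hnz) hs3F
    refine ⟨t, .loop_true ?_ (.seq (.emit e s1) h3) ht, hF, ?_, by rw [ho, ho3]; rfl, by rw [hm, hm3],
      fun x hx => ?_, ?_⟩
    · simp only [holds_iff_evC, evC_le, ev_var, ev_sub, ev_one]; omega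
    · rw [hc, hc3, hr3]
      change (s.cur ++ [e.val s1]) ++ _ = _
      rw [hev, List.append_assoc]
      congr 1
      rw [List.drop_eq_getElem_cons hk1, List.getD_eq_getElem _ _ hk1, List.dropLast_cons_of_ne_nil]
      · simp only [Function.update_self, List.map_cons, List.singleton_append]
        rw [show s.reg .k + 1 - 1 = s.reg .k - 1 + 1 by omega]
      · intro h
        have := congrArg List.length h
        simp only [List.length_drop, List.length_nil] at this; omega
    · rw [hr x hx, hr3, Function.update_of_ne hx]
    · have : s2.time ≤ s.time + 10 := by simp [hs2, hs1, MState.charge, he]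
      omega

/-- The output of a string. -/
lemma exec_output (hV : 2 ≤ V) (hz : ∀ i, i < Z.length → s.mem .z (i + 1) = Z.getD i 0)
    (hD : s.mem .dec = D) (hZ : 2 ≤ Z.length) (hnz : s.reg .nz = Z.length) (hs : Fits V M s)
    (hVz : Z.length ≤ V) (hc : s.cur = []) :
    ∃ t, Exec output s t ∧ Fits V M t ∧ t.cur = [] ∧ t.out = s.out ++ [(decode D Z, t.time)] ∧
      t.mem = s.mem ∧ (∀ x, x ≠ .k → t.reg x = s.reg x) ∧ t.time ≤ s.time + 20 * Z.length := by
  obtain ⟨s1, h1, hF1, hc1, ho1, hr1, hm1, ht1⟩ := wp_sound hV (put .k 2) (by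
    simp [maxCost]) (Q := fun r' m' t' => r' = Function.update s.reg .k 2 ∧ m' = s.mem ∧
      t' ≤ s.time + 2) hs (by simp [hV])
  obtain ⟨t, ht, hF, hct, ho, hm, hr, htt⟩ := exec_outputLoop (s := s1) (l := Z.length - 2) hV
    (by rw [hm1]; exact hz) (by rw [hm1, hD]) (by rw [hr1]; simp; omega) (by rw [hr1]; simp)
    (by rw [hr1]; simpa using hnz) hF1 hVz
  refine ⟨_, .seq (.seq h1 ht) (.finish t), ⟨hF.bd, hF.ext, max_le hF.word (Nat.zero_le _)⟩, rfl, ?_,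
    hm.trans hm1, fun x hx => (hr x hx).trans (by rw [hr1, Function.update_of_ne hx]), ?_⟩
  · change t.out ++ [(t.cur, t.time + 1)] = s.out ++ [(decode D Z, t.time + 1)]
    rw [ho, ho1, hct, hc1, hc, hr1]
    simp [decode]
  · change t.time + 1 ≤ _
    omega

variable (I) in
/-- The bound on the delay. -/
def delay (L : ℕ) : ℕ := 20000 * (L + 1) * (I.n .x + I.n .y)

/-- The body of the main loop. -/
abbrev mainBody : List Enum211.S := [ifs (.ne (rd .z (.var .nz)) (.var .sigma))
  [pushExtensible, put .nz (.var .nz + 1), takeLeast, setLast]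
  [output, whl (.and (.ne (.var .nz) 0) (.eq (rd .altStart (.var .nz)) (.var .top)))
    [put .nz (.var .nz - 1)], ifs (.ne (.var .nz) 0) [takeLeast, setLast] []]]

open Inst in
/-- The main loop, where `τ` is the time of the last output. The induction is on the number of
strings still to be output and, between two outputs, on the potential. -/
lemma exec_mainLoop (hMV : M + 1 ≤ V) (k : ℕ) : ∀ {Z top T} {s : MState Reg Arr} {τ : ℕ},
    Fits V M s → Inv I V M L w B D Z top T s.reg s.mem → s.cur = [] →
    s.time ≤ τ + 300 * (I.n .x + I.n .y) + 10010 * (L + 1) * I.psum Z →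
    (pending I Z T).card * (I.n .x + I.n .y + 1) + (I.n .x + I.n .y - I.psum Z) < k →
    ∃ t O, Exec (whl (.ne (.var .nz) 0) mainBody) s t ∧ Fits V M t ∧ t.out = s.out ++ O ∧
      ((O.map Prod.fst : List (List ℕ)) : Multiset (List ℕ)) = (pending I Z T).map (decode D) ∧
      (τ :: (O.map Prod.snd ++ [t.time])).IsChain fun u v => v ≤ u + delay I L := by
  induction k with
  | zero => intro _ _ _ _ _ _ _ _ _ h; omega
  | succ k ih =>
    intro Z top T s τ hF hI hcur ht hk
    have hM := hI.env.big.le_M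
    have hV : 2 ≤ V := by omega
    have hnx := I.two_le .x
    have hny := I.two_le .y
    have hlen := hI.stack.length_le
    have hdel : delay I L = 10010 * (L + 1) * (I.n .x + I.n .y) + 9990 * (I.n .x + I.n .y) +
      9990 * (L * (I.n .x + I.n .y)) := by unfold delay; ring
    by_cases hZ : Z = []
    · subst hZ
      have hT : T = 0 := by
        have h := hI.stack
        generalize hZ : ([] : List ℕ) = Z at h
        cases h with
        | nil => rfl
        | concat => simp at hZ
      refine ⟨_, [], .loop_false ?_, hF.charge hV (by simp) (by simp) _, by simp [MState.charge],
        by simp [pending, hT], ?_⟩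
      · simp [holds_iff_evC, hI.nz]
      · simp only [List.map_nil, List.nil_append, List.isChain_cons_cons, List.isChain_singleton,
          and_true]
        simp [MState.charge, psum] at ht ⊢
        omega
    have hpZ := hI.stack.isPrefix hZ
    have hps := hpZ.psum_le
    set s1 := s.charge ((Cond.ne (.var .nz) 0 : Enum211.B).cost + 1)
      ((Cond.ne (.var .nz) 0 : Enum211.B).peak s) with hs1
    have hs1F : Fits V M s1 := hF.charge hV (by simp) (by simp) _
    set b : Enum211.B := .ne (rd .z (.var .nz)) (.var .sigma) with hb
    set s2 := s1.charge (b.cost + 1) (b.peak s1) with hs2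
    have hs2F : Fits V M s2 := hs1F.charge hV (by simp [hb]) (by simp [hb]) _
    have hs2t : s2.time ≤ s.time + 9 := by simp [hs2, hs1, MState.charge, hb]
    have hc1 : (Cond.ne (.var .nz) 0 : Enum211.B).holds s := by
      simp [holds_iff_evC, hI.nz, hZ]
    obtain ⟨W, c, rfl⟩ := Z.eq_nil_or_concat'.resolve_left hZ
    have hbv : b.holds s1 ↔ c ≠ I.σ := by
      have h1 := hI.stack.z W.length (by simp)
      have h2 : s1.reg .nz = W.length + 1 := by
        change s.reg .nz = _
        rw [hI.nz]; simp
      have h3 : s1.reg .sigma = I.σ := hI.env.sigma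
      rw [holds_iff_evC]
      simp only [hb, evC_ne, ev_get, ev_var, h2, h3]
      change s.mem .z (W.length + 1) ≠ _ ↔ _
      rw [h1, List.getD_append_right _ _ _ _ le_rfl]
      simp
    by_cases hc : c = I.σ
    · -- the string is complete
      subst hc
      have htodo := todo_of_last hpZ
      have hmcs : I.MCS (W ++ [I.σ]) :=
        (mem_todo.1 (htodo ▸ Multiset.mem_singleton_self _ : W ++ [I.σ] ∈ I.todo _)).1
      have hpend : pending I (W ++ [I.σ]) T = (W ++ [I.σ]) ::ₘ T := by
        rw [pending, if_neg hZ, htodo, Multiset.singleton_add]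
      obtain ⟨s3, h3, hF3, hc3, ho3, hm3, hr3, ht3⟩ := exec_output (s := s2) hV hI.stack.z hI.dec
        (by
          obtain ⟨A, hA⟩ := hmcs.starts
          rcases W with _ | ⟨a, W⟩
          · have := I.two_le_σ
            simp at hA; omega
          · simp) hI.nz hs2F (by omega) hcur
      have hI3 : Inv I V M L w B D (W ++ [I.σ]) top T s3.reg s3.mem :=
        ⟨hI.env.congr (fun x hx => hr3 x (by rintro rfl; simp [envR] at hx)) fun _ _ => by rw [hm3]; rfl,
          by rw [hm3]; exact hI.dec, hF3.bd, (hr3 _ (by simp)).trans hI.nz,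
          (hr3 _ (by simp)).trans hI.top_eq, by rw [hm3]; exact hI.stack⟩
      obtain ⟨s4, h4, hF4, hc4, ho4, Z', top', T', hI4, hT4, ht4⟩ := wp_sound hV _ (by decide)
        (Q := fun r' m' t' => ∃ Z' top' T', Inv I V M L w B D Z' top' T' r' m' ∧
          T = pending I Z' T' ∧
          t' ≤ s3.time + 200 * (I.n .x + I.n .y) + 10000 * (L + 1) * I.psum Z') hF3
        (wp_backtrack hI3 hMV fun r' m' t' Z' top' T' h1 h2 h3 => ⟨Z', top', T', h1, h2, h3⟩)
      have hk4 : (pending I Z' T').card * (I.n .x + I.n .y + 1) +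
          (I.n .x + I.n .y - I.psum Z') < k := by
        rw [hpend, hT4, Multiset.card_cons, Nat.succ_mul] at hk
        omega
      have hp4 : 10010 * (L + 1) * I.psum Z' = 10000 * (L + 1) * I.psum Z' +
        10 * (L + 1) * I.psum Z' := by ring
      obtain ⟨t, O, h5, hF5, ho5, hO, hch⟩ := ih (τ := s3.time) hF4 hI4 (hc4.trans hc3)
        (by omega) hk4
      refine ⟨t, (decode D (W ++ [I.σ]), s3.time) :: O, .loop_true hc1 (.ite_false (fun h => hbv.1 h rfl)
        (.seq h3 h4)) h5, hF5, ?_, ?_, ?_⟩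
      · rw [ho5, ho4, ho3, List.append_assoc]; rfl
      · rw [hpend, Multiset.map_cons, hT4, ← hO, List.map_cons, Multiset.cons_coe]
      · rw [List.map_cons, List.cons_append, List.isChain_cons_cons]
        refine ⟨?_, hch⟩
        have h6 : 10010 * (L + 1) * I.psum (W ++ [I.σ]) ≤ 10010 * (L + 1) * (I.n .x + I.n .y) :=
          Nat.mul_le_mul_left _ hps
        change s3.time ≤ τ + _
        omega
    · have hlast : ∀ A, W ++ [c] ≠ A ++ [I.σ] := fun A hA => by
        obtain ⟨-, h⟩ := List.append_inj' hA rfl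
        exact hc (by simpa using h)
      obtain ⟨s4, h4, hF4, hc4, ho4, d, top', T', hI4, hT4, hp4, ht4⟩ := wp_sound hV _ (by decide)
        (Q := fun r' m' t' => ∃ d top' T', Inv I V M L w B D ((W ++ [c]) ++ [d]) top' T' r' m' ∧
          I.todo (W ++ [c]) + T = I.todo ((W ++ [c]) ++ [d]) + T' ∧
          I.IsPrefix ((W ++ [c]) ++ [d]) ∧ t' + 10000 * (L + 1) * I.psum (W ++ [c]) ≤
            s2.time + 10000 * (L + 1) * I.psum ((W ++ [c]) ++ [d])) hs2F
        (wp_push hI hMV hZ hlast fun r' m' t' d top' T' h1 h2 h3 h4 => ⟨d, top', T', h1, h2, h3, h4⟩)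
      have hpend : pending I (W ++ [c]) T = pending I ((W ++ [c]) ++ [d]) T' := by
        rw [pending, pending, if_neg hZ, if_neg (by simp), hT4]
      have hlt := hp4.psum_lt
      have hle := hp4.psum_le
      rw [hpend] at hk ⊢
      obtain ⟨e, he⟩ : ∃ e, I.psum ((W ++ [c]) ++ [d]) = I.psum (W ++ [c]) + (e + 1) :=
        ⟨I.psum ((W ++ [c]) ++ [d]) - I.psum (W ++ [c]) - 1, by omega⟩
      have e1 : 10000 * (L + 1) * (I.psum (W ++ [c]) + (e + 1)) = 10000 * (L + 1) * I.psum (W ++ [c]) +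
        10000 * (L + 1) * (e + 1) := by ring
      have e2 : 10010 * (L + 1) * (I.psum (W ++ [c]) + (e + 1)) = 10010 * (L + 1) * I.psum (W ++ [c]) +
        10000 * (L + 1) * (e + 1) + 10 * (L * e + L + e) + 10 := by ring
      obtain ⟨t, O, h5, hF5, ho5, hO, hch⟩ := ih (τ := τ) hF4 hI4 (hc4.trans hcur)
        (by rw [he] at ht4 ⊢; omega) (by omega)
      refine ⟨t, O, .loop_true hc1 (.ite_true (hbv.2 hc) h4) h5, hF5, ?_, hO, hch⟩
      rw [ho5, ho4]; rfl

/-- A block can be executed in two parts. -/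
lemma Exec.block_append {l l' : List Enum211.S} (hl' : l' ≠ []) {s t u : MState Reg Arr} :
    Exec (block l) s t → Exec (block l') t u → Exec (block (l ++ l')) s u := by
  induction l generalizing s with
  | nil =>
    intro h h'
    cases h
    exact h'
  | cons p l ih =>
    intro h h'
    rcases l with _ | ⟨q, l⟩
    · obtain ⟨a, l', rfl⟩ := List.exists_cons_of_ne_nil hl'
      exact .seq h h'
    · cases h with
      | seq h1 h2 => exact .seq h1 (ih h2 h')

/-- The initialization of the enumeration. -/
abbrev mainInit : List Enum211.S := [put .nz 1, put .top 0, wr .z 1 1, wr (.pref .x) 1 1,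
  wr (.pref .y) 1 1, wr (.safe .x) 1 (.var (.len .x) + 1), wr (.safe .y) 1 (.var (.len .y) + 1),
  wr .altStart 1 0]

open Inst in
lemma wp_mainInit {r : Reg → ℕ} {m : Arr → ℕ → ℕ} {t : ℕ} (hE : Env I V M L w B r m)
    (hD : m .dec = D) (hb : Bd V r m) : wp V M (block mainInit)
      (fun r' m' t' => Inv I V M L w B D [1] 0 0 r' m' ∧ t' ≤ t + 100) r m t := by
  have hM := hE.big.le_M
  have hMV := hE.big.le_V
  have hn := hE.big.n_le
  have hnx := hn .x
  have hny := hn .y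
  refine wp_conseq (Q := fun r' m' t' => r' .nz = 1 ∧ r' .top = 0 ∧ m' .z 1 = 1 ∧
    (∀ s, m' (.pref s) 1 = 1) ∧ (∀ s, m' (.safe s) 1 = I.n s + 1) ∧ m' .altStart 1 = 0 ∧
    t' ≤ t + 100) ?_ ?_
  · simp only [block_cons, block_single, wp_seq, wp_assign, wp_store, put, wr, safeE_one, safeE_zero,
      safeE_add, safeE_var, ev_one, ev_zero, ev_add, ev_var, (hE.idx .x).len, (hE.idx .y).len,
      true_and, and_self, Side.forall, Function.update_apply, reduceCtorEq, if_false, if_true,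
      Arr.pref.injEq, Arr.safe.injEq, cost_one, cost_zero, cost_add, cost_var, Nat.zero_le]
    omega
  · rintro r' m' t' hF ⟨h1, h2, h3, h4, h5, h6, h7⟩
    refine ⟨⟨hE.frame hF rfl, (hF.mem _ rfl).trans hD, hF.bd hb, h1, h2, ?_⟩, h7⟩
    have h := isSafe_one I
    have := Stack.concat (I := I) (m := m') .nil (c := 1) (R := []) (F := fun s => I.n s + 1) ⟨h3,
      fun s => by rw [List.nil_append, pre_one]; exact h4 s, h5, ?_, h6, trivial, ?_, ?_, fun _ => rfl⟩
    · simpa using this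
    · have e : (fun s => I.pre s ([] ++ [1])) = fun _ => 1 := funext fun s => pre_one
      rw [e]; exact h
    · simpa using isPrefix_one I
    · simp [psum, pre_one]

open Inst in
/-- From the preprocessed data on, the program outputs every maximal common subsequence once, with
bounded delay. -/
lemma exec_main (hMV : M + 1 ≤ V) (hF : Fits V M s) (hE : Env I V M L w B s.reg s.mem)
    (hD : s.mem .dec = D) (hcur : s.cur = []) (hout : s.out = []) :
    ∃ t, Exec main s t ∧ Fits V M t ∧
      ((t.out.map Prod.fst : List (List ℕ)) : Multiset (List ℕ)) = (I.todo []).map (decode D) ∧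
      (s.time :: (t.out.map Prod.snd ++ [t.time])).IsChain fun u v => v ≤ u + delay I L := by
  have hM := hE.big.le_M
  have hn := I.two_le .x
  obtain ⟨s1, h1, hF1, hc1, ho1, hI, ht1⟩ := wp_sound (by omega) _ (by decide) hF
    (wp_mainInit hE hD hF.bd)
  obtain ⟨t, O, h2, hF2, ho2, hO, hch⟩ := exec_mainLoop (τ := s.time) hMV _ hF1 hI (hc1.trans hcur)
    (by simp only [psum, pre_one]; omega) (Nat.lt_succ_self _)
  refine ⟨t, Exec.block_append (l := mainInit) (l' := [_]) (by simp) h1 h2, hF2, ?_, ?_⟩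
  · rw [ho2, ho1, hout, List.nil_append, hO]
    congr 1
    rw [pending, if_neg (by simp), add_zero]
    refine (Multiset.Nodup.ext nodup_todo nodup_todo).2 fun W => ?_
    rw [mem_todo, mem_todo]
    refine and_congr_right fun hW => ⟨fun _ => List.nil_prefix, fun _ => ?_⟩
    obtain ⟨A, rfl⟩ := hW.starts
    exact List.prefix_append _ _
  · rw [ho2, ho1, hout, List.nil_append]; exact hch

end

/-! ### Correctness and complexity -/

/-- The pair of input strings. -/
def both (X Y : List ℕ) : Side → List ℕ
  | .x => X
  | .y => Y

open Inst in
/-- Correctness, and resource bounds in terms of the length `N` of both strings. -/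
theorem exec_enum211 {X Y : List ℕ} {N L σ : ℕ} (hN : X.length + Y.length + 4 = N) (hL : N ≤ 2 ^ L)
    (hσ : ∀ c ∈ X ++ Y, c ≤ σ) : ∃ s t : MState Reg Arr,
      Exec enum211.pre (enum211.init X Y) s ∧ s.cur = [] ∧ s.out = [] ∧ s.time ≤ 5000 * (N + 1) ^ 2 ∧
      Exec enum211.main s t ∧ (t.out.map Prod.fst).Nodup ∧
      (∀ Z, Z ∈ t.out.map Prod.fst ↔ IsMCS X Y Z) ∧
      (s.time :: (t.out.map Prod.snd ++ [t.time])).IsChain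
        (fun u v => v ≤ u + 20000 * (L + 1) * N) ∧
      (∀ a, t.extent a ≤ 20 * N + 20) ∧ t.word ≤ 60 * (20 * N + 21 + σ) := by
  obtain ⟨M, hM⟩ : ∃ M, M = 20 * N + 20 := ⟨_, rfl⟩
  obtain ⟨V, hV⟩ : ∃ V, V = 20 * N + 21 + σ := ⟨_, rfl⟩
  have hlt : ∀ {l : List ℕ} (k : ℕ), (∀ c ∈ l, c ≤ σ) → l.getD k 0 ≤ V := by
    intro l k hl
    by_cases hk : k < l.length
    · rw [List.getD_eq_getElem _ _ hk]
      have := hl _ (List.getElem_mem hk)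
      omega
    · rw [List.getD_eq_default _ _ (not_lt.1 hk)]; omega
  have hbX : ∀ k, (0 :: X).getD k 0 ≤ V := fun k => hlt k fun c hc => by
    rcases List.mem_cons.1 hc with rfl | hc
    exacts [Nat.zero_le _, hσ c (List.mem_append_left _ hc)]
  have hbY : ∀ k, (0 :: Y).getD k 0 ≤ V := fun k => hlt k fun c hc => by
    rcases List.mem_cons.1 hc with rfl | hc
    exacts [Nat.zero_le _, hσ c (List.mem_append_right _ hc)]
  have hmemx : (enum211.init X Y).mem (.raw .x) = fun k => (0 :: X).getD k 0 := by
    funext k; simp [EnumAlgorithm.init, enum211]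
  have hmemy : (enum211.init X Y).mem (.raw .y) = fun k => (0 :: Y).getD k 0 := by
    funext k; simp [EnumAlgorithm.init, enum211]
  have hmem0 : ∀ a, (∀ s, a ≠ .raw s) → (enum211.init X Y).mem a = 0 := fun a ha => by
    funext k; simp [EnumAlgorithm.init, enum211, ha]
  have hF : Fits V M (enum211.init X Y) := by
    refine ⟨⟨fun x => ?_, fun a k => ?_⟩, fun a => ?_, Nat.zero_le _⟩
    · simp only [EnumAlgorithm.init]; split_ifs <;> omega
    · by_cases ha : ∀ s, a ≠ .raw s
      · rw [hmem0 a ha]; exact Nat.zero_le _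
      · push Not at ha
        obtain ⟨s, rfl⟩ := ha
        cases s
        · rw [hmemx]; exact hbX k
        · rw [hmemy]; exact hbY k
    · simp only [EnumAlgorithm.init]; split_ifs <;> omega
  have hraw : ∀ s k, 1 ≤ k → k ≤ (both X Y s).length →
      (enum211.init X Y).mem (.raw s) k = (both X Y s).getD (k - 1) 0 := by
    intro s k h1 _
    obtain ⟨k, rfl⟩ : ∃ j, k = j + 1 := ⟨k - 1, by omega⟩
    cases s
    · rw [hmemx]; simp [both]
    · rw [hmemy]; simp [both]
  obtain ⟨s, h1, hF1, hc1, ho1, w, B, hE, hdec, ht1⟩ := wp_sound (by omega) pre (by decide) hF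
    (wp_pre (X := both X Y) (L := L) (N := N) hN (fun s => by cases s <;> rfl) hraw hM.ge (by omega)
      (fun s k => hF.bd.2 _ _) hL hmem0 (Q := fun r' m' t' => ∃ w B,
        Env (nrm (both X Y)) V M L w B r' m' ∧
        (∀ c ∈ X ++ Y, m' .dec (enc (both X Y) c) = c) ∧ t' ≤ 5000 * (N + 1) ^ 2)
      fun w B r' m' t' h1 h2 h3 => ⟨w, B, h1, h2, by simpa [EnumAlgorithm.init] using h3⟩)
  obtain ⟨t, h2, hF2, hout, hch⟩ := exec_main (by omega) hF1 hE rfl hc1 ho1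
  have hnN : (nrm (both X Y)).n .x + (nrm (both X Y)).n .y = N := by
    rw [← hN]; simp only [nrm, both]; ring
  have hdecode : ∀ Z, IsMCS X Y Z →
      decode (s.mem .dec) (1 :: (Z.map (enc (both X Y)) ++ [(nrm (both X Y)).σ])) = Z := by
    intro Z hZ
    simp only [decode, List.drop_succ_cons, List.drop_zero, List.dropLast_concat, List.map_map]
    conv_rhs => rw [← List.map_id Z]
    exact List.map_congr_left fun c hc => hdec c (List.mem_append_left _ (hZ.1.1.subset hc))
  have hmcs : ∀ W, W ∈ (nrm (both X Y)).todo [] ↔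
      ∃ Z, IsMCS X Y Z ∧ W = 1 :: (Z.map (enc (both X Y)) ++ [(nrm (both X Y)).σ]) := fun W => by
    rw [mem_todo, nrm_mcs_iff]
    simp [both]
  refine ⟨s, t, h1, hc1, ho1, ht1, h2, ?_, fun Z => ?_, ?_, fun a => (hF2.ext a).trans hM.le,
    hF2.word.trans (by rw [hV])⟩
  · rw [← Multiset.coe_nodup, hout]
    refine Multiset.Nodup.map_on ?_ nodup_todo
    intro W hW W' hW' h
    obtain ⟨Z, hZ, rfl⟩ := (hmcs W).1 hW
    obtain ⟨Z', hZ', rfl⟩ := (hmcs W').1 hW'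
    rw [hdecode Z hZ, hdecode Z' hZ'] at h
    rw [h]
  · rw [← Multiset.mem_coe, hout, Multiset.mem_map]
    constructor
    · rintro ⟨W, hW, rfl⟩
      obtain ⟨Z, hZ, rfl⟩ := (hmcs W).1 hW
      rwa [hdecode Z hZ]
    · exact fun hZ => ⟨_, (hmcs _).2 ⟨Z, hZ, rfl⟩, hdecode Z hZ⟩
  · rw [delay, hnN] at hch
    exact hch

/-- The logarithm of the length is at most proportional to `log n`. -/
lemma natLog_add_two_le {A n N : ℕ} (hn : 2 ≤ n) (hA : 1 ≤ A) (h1 : 1 ≤ N) (hN : N ≤ A * n) :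
    ((Nat.log 2 N + 2 : ℕ) : ℝ) ≤ (4 * A + 6) * Real.log n := by
  have hn' : (2 : ℝ) ≤ n := by exact_mod_cast hn
  have hA' : (1 : ℝ) ≤ A := by exact_mod_cast hA
  have h2 := Real.log_two_gt_d9
  have h3 : Real.log 2 ≤ Real.log n := Real.log_le_log (by norm_num) hn'
  have h4 : Real.log N ≤ A + Real.log n := by
    have h5 : Real.log N ≤ Real.log (A * n) :=
      Real.log_le_log (by exact_mod_cast h1) (by exact_mod_cast hN)
    rw [Real.log_mul (by positivity) (by positivity)] at h5
    have := Real.log_le_self (show (0 : ℝ) ≤ A by positivity)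
    linarith
  have h5 := Real.natLog_le_logb N 2
  have h6 : Real.logb 2 N ≤ 2 * Real.log N := by
    rw [Real.logb, div_le_iff₀ (by linarith)]
    have h7 : 0 ≤ Real.log N := Real.log_natCast_nonneg N
    nlinarith
  have h8 : (A : ℝ) * (1 / 2) ≤ A * Real.log n := mul_le_mul_of_nonneg_left (by linarith) (by positivity)
  push_cast at h5 ⊢
  nlinarith

end Enum211

theorem theorem4 :
    enum211.SolvesMCSEnumeration
      (fun n _ => (n : ℝ) ^ 2)
      (fun n _ => (n : ℝ))
      (fun n _ => (n : ℝ) * Real.log n) := by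
  intro K
  obtain ⟨A, hA⟩ : ∃ A, A = 2 * K + 2 := ⟨_, rfl⟩
  obtain ⟨p, hp⟩ : ∃ p, p = Fintype.card Enum211.Reg := ⟨_, rfl⟩
  obtain ⟨q, hq⟩ : ∃ q, q = Fintype.card Enum211.Arr := ⟨_, rfl⟩
  obtain ⟨C, hC⟩ : ∃ C, C = 5000 * (A + 1) ^ 2 + 20000 * A * (4 * A + 6) + p + q * (20 * A + 20) +
    60 * (20 * A + 21) := ⟨_, rfl⟩
  refine ⟨C, fun n σ hn X Y hX hY hXY => ?_⟩
  obtain ⟨N, hN⟩ : ∃ N, X.length + Y.length + 4 = N := ⟨_, rfl⟩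
  have hNA : N ≤ A * n := by
    rw [hA, add_mul, mul_assoc, two_mul]; omega
  obtain ⟨s, t, h1, h2, h3, h4, h5, h6, h7, h8, h9, h10⟩ := Enum211.exec_enum211 (σ := σ) hN
    (Nat.lt_pow_succ_log_self one_lt_two N).le fun c hc => (hXY c hc).2
  refine ⟨s, t, h1, h2, h3, ?_, h5, h6, h7, h8.imp fun u v huv => ?_, ?_, ?_⟩
  · have h11 : s.time ≤ C * n ^ 2 := by
      calc s.time ≤ 5000 * (N + 1) ^ 2 := h4
        _ ≤ 5000 * (A * n + n) ^ 2 := Nat.mul_le_mul_left _ (Nat.pow_le_pow_left (by omega) 2)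
        _ = 5000 * (A + 1) ^ 2 * n ^ 2 := by ring
        _ ≤ C * n ^ 2 := Nat.mul_le_mul_right _ (by omega)
    change (s.time : ℝ) ≤ C * (n : ℝ) ^ 2
    exact_mod_cast h11
  · have hlog := Enum211.natLog_add_two_le hn (by omega) (by omega) hNA
    have h0 : 0 ≤ Real.log n := Real.log_natCast_nonneg n
    have huv' : (v : ℝ) ≤ u + 20000 * ((Nat.log 2 N + 2 : ℕ) : ℝ) * N := by exact_mod_cast huv
    have hCA : (20000 * A * (4 * A + 6) : ℝ) ≤ C := by
      have : 20000 * A * (4 * A + 6) ≤ C := by omega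
      exact_mod_cast this
    have h46 : (0 : ℝ) ≤ 4 * A + 6 := by linarith [Nat.cast_nonneg (α := ℝ) A]
    have hNA' : (N : ℝ) ≤ A * n := by exact_mod_cast hNA
    calc (v : ℝ) ≤ u + 20000 * ((Nat.log 2 N + 2 : ℕ) : ℝ) * N := huv'
      _ ≤ u + 20000 * ((4 * A + 6) * Real.log n) * (A * n) :=
        add_le_add le_rfl (mul_le_mul (mul_le_mul_of_nonneg_left hlog (by norm_num)) hNA'
          (Nat.cast_nonneg _) (mul_nonneg (by norm_num) (mul_nonneg h46 h0)))
      _ = u + (20000 * A * (4 * A + 6)) * (n * Real.log n) := by ring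
      _ ≤ u + C * (n * Real.log n) :=
        add_le_add le_rfl (mul_le_mul_of_nonneg_right hCA (mul_nonneg (Nat.cast_nonneg _) h0))
  · have h11 : t.space ≤ C * n := by
      calc t.space ≤ p + q * (20 * N + 20) := by
            rw [MState.space, hp, hq]
            refine Nat.add_le_add_left ((Finset.sum_le_sum fun a _ => h9 a).trans ?_) _
            simp
        _ ≤ p * n + q * ((20 * A + 20) * n) := by
            refine Nat.add_le_add (Nat.le_mul_of_pos_right _ (by omega)) (Nat.mul_le_mul_left _ ?_)
            rw [add_mul, mul_assoc]; omega
        _ = (p + q * (20 * A + 20)) * n := by ring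
        _ ≤ C * n := Nat.mul_le_mul_right _ (by omega)
    change (t.space : ℝ) ≤ C * (n : ℝ)
    exact_mod_cast h11
  · calc t.word ≤ 60 * (20 * N + 21 + σ) := h10
      _ ≤ 60 * ((20 * A + 21) * n + (20 * A + 21) * σ) := by
          refine Nat.mul_le_mul_left _ (Nat.add_le_add ?_ (Nat.le_mul_of_pos_left _ (by omega)))
          rw [add_mul, mul_assoc]; omega
      _ = 60 * (20 * A + 21) * (n + σ) := by ring
      _ ≤ C * (n + σ) := Nat.mul_le_mul_right _ (by omega)
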